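/- Let $M\subset\mathbb R^n$ be an open Euclidean ball with coordinates $u=(u^1,\dots,u^n)$. For open $U\subset\mathbb R^n$ let $\mathcal A(U)$ be the ring of polynomials in the jet variables $u^{i,s}$ ($1\le i\le n$, $s\ge 1$) with coefficients in $C^\infty(U)$, graded by $\deg u^{i,s}=s$, $\deg f(u)=0$, with $\partial_x=\sum_{i,\,s\ge0}u^{i,s+1}\,\partial/\partial u^{i,s}$, where $u^{i,0}=u^i$. A local bivector on the extended formal loop space of $U$ is a series $$\{u^i(x),u^j(y)\}=\sum_{k\ge-1}\epsilon^k\sum_{s=0}^{k+1}A^{ij}_{k,s}\,\delta^{(k-s+1)}(x-y),\qquad A^{ij}_{k,s}\in\mathcal A(U),\ \deg A^{ij}_{k,s}=s,$$ antisymmetric under $(i,x)\leftrightarrow(j,y)$; it is a Poisson bracket if its Schouten–Nijenhuis bracket with itself vanishes. It is an $(n,0)$-bracket if, moreover, $h^{ij}(u)=A^{ij}_{-1,0}(u)$ is nondegenerate at every $u\in U$. A Miura transformation from $U$ to $V$ is a series $$\tilde u^i=\sum_{k\ge0}\epsilon^kF^i_k,\qquad F_k^i\in\mathcal A(U),\ \deg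 F^i_k=k,$$ whose leading term $F_0:U\to V$ is injective with $\det(\partial F_0^i/\partial u^j)\ne0$ everywhere. It carries a bracket $A$ on $U$ to a bracket $B$ on $V$ if the differential operators satisfy $B^{ij}=\sum_{k,l}L^{*\,i}_{\ \ k}\,A^{kl}L^j_{\ l}$, where the coefficients of $B$ are evaluated at $(\tilde u,\tilde u_x,\dots)$ and expanded in $\epsilon$, and $L^i_{\ k}=\sum_s(-\partial_x)^s\circ\frac{\partial\tilde u^i}{\partial u^{k,s}}$, $L^{*\,i}_{\ \ k}=\sum_s\frac{\partial\tilde u^i}{\partial u^{k,s}}\partial_x^s$. 1. Any two $(n,0)$ Poisson brackets on the extended formal loop space of $M$ are locally equivalent under Miura transformations: for any two such brackets $A,B$ and any points $p,q\in M$ there are a ball $B_r(p)\subset M$, $r>0$, and a Miura transformation from $B_r(p)$ to $M$ with $F_0(p)=q$ that carries $A|_{B_r(p)}$ to $B$. 2. If the leading coefficient $h^{ij}$ of an $(n,0)$ Poisson bracket $A$ is constant on $M$, then a Miura transformation defined on all of $M$ with $F_0=\mathrm{id}$ carries $A$ to the ultralocal bracket $\epsilon^{-1}h^{ij}\delta(x-y)$.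 3. Let $h^{ij}$ be a constant antisymmetric matrix with $\det h\ne0$ and $\varpi=h^{ij}\delta(x-y)$. Then the parts $\tilde H^1$ and $\tilde H^2$ of the Poisson cohomology of $\varpi$ on $M$ spanned by cocycles with $\epsilon$-powers $\ge0$ vanish: (a) if $a^i=\sum_{k\ge1}\epsilon^{k-1}a^i_k$ with $a^i_k\in\mathcal A(M)$, $\deg a_k^i=k$, and $\mathrm{Lie}_a\varpi=0$, then there are $f_k\in\mathcal A(M)$ of degree $k$ with $a^i_k=\sum_jh^{ij}\,\delta\bar f_k/\delta u^j(x)$ for all $k\ge1$, where $\bar f_k=\int f_k\,dx$; (b) if $\alpha$ is a local bivector on the extended formal loop space of $M$ without a term in $\epsilon^{-1}$ and $[\varpi,\alpha]=0$, then $\alpha=\mathrm{Lie}_a\varpi$ for some $a^i=\sum_{k\ge1}\epsilon^{k-1}a^i_k$ with $a^i_k\in\mathcal A(M)$, $\deg a^i_k=k$. -/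

import Mathlib

open TopologicalSpace
open scoped ContDiff

noncomputable section

namespace LoopSpace

/-- The target space of dimension `n`, with its linear coordinates `u¹, …, uⁿ`. -/
abbrev Coord (n : ℕ) : Type := EuclideanSpace ℝ (Fin n)

/-- The open ball of radius `r` around `p`. -/
def openBall {n : ℕ} (p : Coord n) (r : ℝ) : Opens (Coord n) :=
  ⟨Metric.ball p r, Metric.isOpen_ball⟩

/-! ### Smooth functions on an open set -/

/-- Extension by zero of a function on `U`; only its values on the open set `U` are used. -/
def zeroExt {n : ℕ} {U : Opens (Coord n)} (f : U → ℝ) : Coord n → ℝ :=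
  Function.extend Subtype.val f 0

theorem zeroExt_apply {n : ℕ} {U : Opens (Coord n)} (f : U → ℝ) (u : U) :
    zeroExt f u = f u :=
  Subtype.val_injective.extend_apply f 0 u

/-- A function on `U` that agrees on `U` with a function smooth on `U` is smooth. -/
theorem contDiffOn_zeroExt {n : ℕ} {U : Opens (Coord n)} {f : U → ℝ} {g : Coord n → ℝ}
    (hg : ContDiffOn ℝ ∞ g U) (h : ∀ u : U, f u = g u) : ContDiffOn ℝ ∞ (zeroExt f) U :=
  hg.congr fun x hx => by rw [← h ⟨x, hx⟩]; exact zeroExt_apply f ⟨x, hx⟩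

/-- The algebra `C^∞(U)` of smooth real functions on the open set `U`. -/
def Smooth {n : ℕ} (U : Opens (Coord n)) : Subalgebra ℝ (U → ℝ) where
  carrier := {f | ContDiffOn ℝ ∞ (zeroExt f) U}
  mul_mem' {f g} hf hg := contDiffOn_zeroExt (ContDiffOn.mul hf hg)
    fun u => by simp [zeroExt_apply]
  add_mem' {f g} hf hg := contDiffOn_zeroExt (ContDiffOn.add hf hg)
    fun u => by simp [zeroExt_apply]
  algebraMap_mem' r := contDiffOn_zeroExt (contDiffOn_const (c := r)) fun u => by simp

/-- The partial derivative `∂f/∂uⁱ` of a smooth function on `U`. -/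
def pd {n : ℕ} {U : Opens (Coord n)} (i : Fin n) (f : Smooth U) : Smooth U :=
  ⟨fun u => fderiv ℝ (zeroExt f.1) u (EuclideanSpace.single i 1),
    contDiffOn_zeroExt (g := fun x => fderiv ℝ (zeroExt f.1) x (EuclideanSpace.single i 1))
      ((ContDiffOn.fderiv_of_isOpen f.2 U.isOpen le_rfl).clm_apply contDiffOn_const)
      fun _ => rfl⟩

/-- The map `U → ℝⁿ` whose components are the smooth functions `φ i`. -/
def toMap {n : ℕ} {U : Opens (Coord n)} (φ : Fin n → Smooth U) (u : U) : Coord n :=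
  WithLp.toLp 2 fun i => (φ i).1 u

/-- The composition `c ∘ φ` of a smooth function on `V` with a smooth map `φ : U → V`. -/
def compSmooth {n : ℕ} {U V : Opens (Coord n)} (φ : Fin n → Smooth U)
    (hφ : ∀ u, toMap φ u ∈ V) (c : Smooth V) : Smooth U :=
  ⟨fun u => c.1 ⟨toMap φ u, hφ u⟩, by
    refine contDiffOn_zeroExt
      (g := fun x => zeroExt c.1 (WithLp.toLp 2 fun i => zeroExt (φ i).1 x)) ?_ ?_
    · refine ContDiffOn.comp (t := (V : Set (Coord n))) c.2 ?_ ?_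
      · rw [contDiffOn_euclidean]
        exact fun i => (φ i).2
      · intro x hx
        have h := hφ ⟨x, hx⟩
        simp only [toMap, ← zeroExt_apply] at h
        exact h
    · intro u
      simp only [zeroExt_apply]
      exact (zeroExt_apply c.1 ⟨toMap φ u, hφ u⟩).symm⟩

/-- Restriction of smooth functions to a smaller open set. -/
def restrictSmooth {n : ℕ} {U V : Opens (Coord n)} (h : U ≤ V) : Smooth V →+* Smooth U where
  toFun f := ⟨fun u => f.1 ⟨u, h u.2⟩,
    contDiffOn_zeroExt (ContDiffOn.mono f.2 h) fun u => (zeroExt_apply f.1 ⟨u, h u.2⟩).symm⟩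
  map_one' := rfl
  map_mul' _ _ := rfl
  map_zero' := rfl
  map_add' _ _ := rfl

/-! ### Differential polynomials -/

/-- The ring `𝒜(U)` of (translation invariant) differential polynomials: polynomials in the
jet variables `u^{i,s}`, `s ≥ 1`, with coefficients in `C^∞(U)`.
The variable `X (i, s)` stands for `u^{i,s+1}`. -/
abbrev DiffPoly {n : ℕ} (U : Opens (Coord n)) : Type :=
  MvPolynomial (Fin n × ℕ) (Smooth U)

/-- `f` is homogeneous of degree `d` for the grading `deg u^{i,s} = s`, `deg f(u) = 0`. -/
def HasDeg {n : ℕ} {U : Opens (Coord n)} (f : DiffPoly U) (d : ℕ) : Prop :=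
  MvPolynomial.IsWeightedHomogeneous (fun v : Fin n × ℕ => v.2 + 1) f d

/-- The partial derivative `∂/∂u^{i,s}`, `s ≥ 0`; for `s = 0` it acts on the coefficients. -/
def jetDeriv {n : ℕ} {U : Opens (Coord n)} (i : Fin n) : ℕ → DiffPoly U → DiffPoly U
  | 0, f => ∑ m ∈ f.support, MvPolynomial.monomial m (pd i (f.coeff m))
  | s + 1, f => MvPolynomial.pderiv (i, s) f

/-- The total derivative `∂ₓ f = ∑ u^{i,s+1} ∂f/∂u^{i,s}`. -/
def Dx {n : ℕ} {U : Opens (Coord n)} (f : DiffPoly U) : DiffPoly U :=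
  ∑ i, MvPolynomial.X (i, 0) * jetDeriv i 0 f +
    ∑ v ∈ f.vars, MvPolynomial.X (v.1, v.2 + 1) * jetDeriv v.1 (v.2 + 1) f

/-- The local functional `∫ f dx` is zero, that is, `f` is a total derivative. -/
def IntegralZero {n : ℕ} {U : Opens (Coord n)} (f : DiffPoly U) : Prop :=
  ∃ g : DiffPoly U, Dx g = f

/-- The variational derivative `δf̄/δuⁱ(x) = ∑ₛ (-∂ₓ)ˢ ∂f/∂u^{i,s}` of `f̄ = ∫ f dx` for `f`
homogeneous of degree `d` (then `f` does not contain `u^{i,s}` with `s > d`). -/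
def varDeriv {n : ℕ} {U : Opens (Coord n)} (d : ℕ) (f : DiffPoly U) (i : Fin n) : DiffPoly U :=
  ∑ s ∈ Finset.range (d + 1), (-1) ^ s * Dx^[s] (jetDeriv i s f)

/-! ### Local bivectors on the extended formal loop space -/

/-- Coefficients of a series of local bivector type
`{uⁱ(x), uʲ(y)} = ∑_{r,s ≥ 0} ε^{r+s-1} A r s i j δ^{(r)}(x-y)`. -/
abbrev BivectorData {n : ℕ} (U : Opens (Coord n)) : Type :=
  ℕ → ℕ → Fin n → Fin n → DiffPoly U

/-- The series `A` is a local bivector on the extended formal loop space of `U`: the coefficient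
`A r s` has degree `s`, and `A` is antisymmetric,
`A_rʲⁱ = ∑_{t ≥ r} (-1)^{t+1} (t choose r) ∂ₓ^{t-r} A_tⁱʲ` in each power of `ε`. -/
structure IsLocalBivector {n : ℕ} {U : Opens (Coord n)} (A : BivectorData U) : Prop where
  hasDeg : ∀ r s i j, HasDeg (A r s i j) s
  antisymm : ∀ r s i j, A r s j i = ∑ q ∈ Finset.HasAntidiagonal.antidiagonal s,
    (-1) ^ (r + q.1 + 1) * ((r + q.1).choose r : DiffPoly U) * Dx^[q.1] (A (r + q.1) q.2 i j)

/-- The coefficient of `ε^{D-2}` in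
`∑ ∫∫∫ φᵢ(x) ψⱼ(y) χₖ(z) ∂Aⁱʲ_{x,y}/∂u^{l,s}(x) ∂ₓˢ Bˡᵏ_{x,z} dx dy dz`,
as a density in the remaining variable `x`. -/
def schoutenTerm {n : ℕ} {U : Opens (Coord n)} (A B : BivectorData U)
    (φ ψ χ : Fin n → DiffPoly U) (D : ℕ) : DiffPoly U :=
  ∑ d ∈ Finset.HasAntidiagonal.antidiagonal D, ∑ a ∈ Finset.HasAntidiagonal.antidiagonal d.1, ∑ b ∈ Finset.HasAntidiagonal.antidiagonal d.2,
    ∑ i, ∑ j, ∑ k, ∑ l, ∑ s ∈ Finset.range (a.2 + 1),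
      φ i * jetDeriv l s (A a.1 a.2 i j) * Dx^[a.1] (ψ j) *
        Dx^[s] (B b.1 b.2 l k * Dx^[b.1] (χ k))

/-- A density for the coefficient of `ε^{D-2}` in the value of the Schouten–Nijenhuis bracket
`[A, B]` on the 1-forms `φ`, `ψ`, `χ`. -/
def schouten {n : ℕ} {U : Opens (Coord n)} (A B : BivectorData U)
    (φ ψ χ : Fin n → DiffPoly U) (D : ℕ) : DiffPoly U :=
  (schoutenTerm A B φ ψ χ D + schoutenTerm B A φ ψ χ D) +
  (schoutenTerm A B χ φ ψ D + schoutenTerm B A χ φ ψ D) +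
  (schoutenTerm A B ψ χ φ D + schoutenTerm B A ψ χ φ D)

/-- `[A, B] = 0` as a local trivector, i.e. as a trilinear map from 1-forms to local
functionals. -/
def SchoutenZero {n : ℕ} {U : Opens (Coord n)} (A B : BivectorData U) : Prop :=
  ∀ (φ ψ χ : Fin n → DiffPoly U) (D : ℕ), IntegralZero (schouten A B φ ψ χ D)

/-- A local Poisson bracket on the extended formal loop space of `U`. -/
structure IsPoisson {n : ℕ} {U : Opens (Coord n)} (A : BivectorData U) : Prop where
  bivector : IsLocalBivector A
  jacobi : SchoutenZero A A

/-- The coefficient `hⁱʲ(u)` of `ε⁻¹ δ(x-y)`. -/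
def hMatrix {n : ℕ} {U : Opens (Coord n)} (A : BivectorData U) (u : U) :
    Matrix (Fin n) (Fin n) ℝ :=
  Matrix.of fun i j => (MvPolynomial.constantCoeff (A 0 0 i j)).1 u

/-- The coefficient `gⁱʲ(u)` of `ε⁰ δ'(x-y)`. -/
def gMatrix {n : ℕ} {U : Opens (Coord n)} (A : BivectorData U) (u : U) :
    Matrix (Fin n) (Fin n) ℝ :=
  Matrix.of fun i j => (MvPolynomial.constantCoeff (A 1 0 i j)).1 u

/-- `(p, q)`-brackets: Poisson brackets such that `hⁱʲ(u)` has constant rank `p` and corank `q`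
and such that `gⁱʲ(u)` is nondegenerate on `Ker hⁱʲ(u)` for `u` in an open dense set. -/
structure IsPQBracket {n : ℕ} {U : Opens (Coord n)} (A : BivectorData U) (p q : ℕ) : Prop where
  poisson : IsPoisson A
  add_eq : p + q = n
  rank_eq : ∀ u, (hMatrix A u).rank = p
  nondeg : ∃ W : Set U, IsOpen W ∧ Dense W ∧ ∀ u ∈ W, ∀ ξ : Fin n → ℝ,
    (hMatrix A u).mulVec ξ = 0 →
    (∀ η : Fin n → ℝ, (hMatrix A u).mulVec η = 0 → ξ ⬝ᵥ (gMatrix A u).mulVec η = 0) → ξ = 0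

/-- The ultralocal bracket `ε⁻¹ hⁱʲ δ(x-y)` with constant `hⁱʲ`. -/
def ultralocal {n : ℕ} (U : Opens (Coord n)) (h : Matrix (Fin n) (Fin n) ℝ) : BivectorData U :=
  fun r s i j => if r = 0 ∧ s = 0 then MvPolynomial.C (algebraMap ℝ (Smooth U) (h i j)) else 0

/-- Restriction of a bivector to a smaller open set. -/
def restrictBivector {n : ℕ} {U V : Opens (Coord n)} (h : U ≤ V) (A : BivectorData V) :
    BivectorData U :=
  fun r s i j => MvPolynomial.map (restrictSmooth h) (A r s i j)

/-! ### Miura transformations and their action -/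

/-- The total derivative, coefficientwise on series in `ε`. -/
def DxSeries {n : ℕ} {U : Opens (Coord n)} (f : PowerSeries (DiffPoly U)) :
    PowerSeries (DiffPoly U) :=
  PowerSeries.mk fun d => Dx (PowerSeries.coeff d f)

/-- A Miura transformation `uⁱ ↦ ũⁱ = ∑ₖ εᵏ Fₖⁱ(u; uₓ, …, u^{(k)})`, `deg Fₖⁱ = k`, from `U`
to `V`: its leading term `F₀` is an injective map of `U` into `V` with
`det (∂F₀ⁱ/∂uʲ) ≠ 0` everywhere, that is, a diffeomorphism onto an open subset of `V`. -/
structure Miura {n : ℕ} (U V : Opens (Coord n)) where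
  F : ℕ → Fin n → DiffPoly U
  hasDeg : ∀ k i, HasDeg (F k i) k
  mapsTo : ∀ u, toMap (fun i => MvPolynomial.constantCoeff (F 0 i)) u ∈ V
  injective : Function.Injective (toMap fun i => MvPolynomial.constantCoeff (F 0 i))
  det_ne_zero : ∀ u,
    (Matrix.of fun i j => (pd j (MvPolynomial.constantCoeff (F 0 i))).1 u).det ≠ 0

namespace Miura

/-- The leading term `F₀ : U → V`. -/
def base {n : ℕ} {U V : Opens (Coord n)} (T : Miura U V) (u : U) : V :=
  ⟨toMap (fun i => MvPolynomial.constantCoeff (T.F 0 i)) u, T.mapsTo u⟩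

/-- The series `ũⁱ = ∑ₖ εᵏ Fₖⁱ`. -/
def series {n : ℕ} {U V : Opens (Coord n)} (T : Miura U V) (i : Fin n) :
    PowerSeries (DiffPoly U) :=
  PowerSeries.mk fun k => T.F k i

/-- The substitution `c(ũ)` in a smooth function `c` on `V`, as the Taylor expansion
`∑ₘ (1/m!) ∑_{i₁,…,iₘ} (∂_{i₁} ⋯ ∂_{iₘ} c)(F₀(u)) (ũ - F₀)^{i₁} ⋯ (ũ - F₀)^{iₘ}`;
as `ũ - F₀` is divisible by `ε`, only `m ≤ d` contributes to the coefficient of `ε^d`. -/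
def pullSmooth {n : ℕ} {U V : Opens (Coord n)} (T : Miura U V) (c : Smooth V) :
    PowerSeries (DiffPoly U) :=
  PowerSeries.mk fun d => ∑ m ∈ Finset.range (d + 1), ∑ ι : Fin m → Fin n,
    MvPolynomial.C ((m.factorial : ℝ)⁻¹ •
      compSmooth (fun i => MvPolynomial.constantCoeff (T.F 0 i)) T.mapsTo
        ((List.ofFn ι).foldr pd c)) *
      PowerSeries.coeff d (∏ a, (T.series (ι a) - PowerSeries.C (T.F 0 (ι a))))

/-- The substitution `g(ũ; ũₓ, ũₓₓ, …)` in a differential polynomial `g` on `V`,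
with `ũ^{i,s} = ∂ₓˢ ũⁱ`. -/
def pull {n : ℕ} {U V : Opens (Coord n)} (T : Miura U V) (g : DiffPoly V) :
    PowerSeries (DiffPoly U) :=
  ∑ m ∈ g.support, T.pullSmooth (g.coeff m) *
    m.prod fun v e => (DxSeries^[v.2 + 1] (T.series v.1)) ^ e

/-- The operator `L*ⁱₖ = ∑ₛ ∂ũⁱ/∂u^{k,s} ∂ₓˢ` (`Fdⁱ` does not contain `u^{k,s}` with `s > d`). -/
def Lstar {n : ℕ} {U V : Opens (Coord n)} (T : Miura U V) (i k : Fin n)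
    (f : PowerSeries (DiffPoly U)) : PowerSeries (DiffPoly U) :=
  PowerSeries.mk fun D => ∑ d ∈ Finset.HasAntidiagonal.antidiagonal D, ∑ s ∈ Finset.range (d.1 + 1),
    jetDeriv k s (T.F d.1 i) * Dx^[s] (PowerSeries.coeff d.2 f)

/-- The operator `Lⁱₖ = ∑ₛ (-∂ₓ)ˢ ∘ ∂ũⁱ/∂u^{k,s}`. -/
def L {n : ℕ} {U V : Opens (Coord n)} (T : Miura U V) (i k : Fin n)
    (f : PowerSeries (DiffPoly U)) : PowerSeries (DiffPoly U) :=
  PowerSeries.mk fun D => ∑ d ∈ Finset.HasAntidiagonal.antidiagonal D, ∑ s ∈ Finset.range (d.1 + 1),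
    (-1) ^ s * Dx^[s] (jetDeriv k s (T.F d.1 i) * PowerSeries.coeff d.2 f)

end Miura

/-- The differential operator `∑_{r,s} ε^{r+s} c r s ∂ₓʳ` on series in `ε`. -/
def diffOp {n : ℕ} {U : Opens (Coord n)} (c : ℕ → ℕ → PowerSeries (DiffPoly U))
    (f : PowerSeries (DiffPoly U)) : PowerSeries (DiffPoly U) :=
  PowerSeries.mk fun D => ∑ d ∈ Finset.HasAntidiagonal.antidiagonal D, ∑ a ∈ Finset.HasAntidiagonal.antidiagonal d.1,
    PowerSeries.coeff d.2 (c a.1 a.2 * DxSeries^[a.1] f)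

/-- The Miura transformation `T` carries the bracket `A` on `U` to (the restriction to the image
of `T` of) the bracket `B` on `V`: `Bⁱʲ = ∑ₖₗ L*ⁱₖ ∘ Aᵏˡ ∘ Lʲₗ` as differential operators, where
the coefficients of `B` are taken at `(ũ; ũₓ, …)`; both sides are multiplied by `ε`. -/
def Miura.Carries {n : ℕ} {U V : Opens (Coord n)} (T : Miura U V) (A : BivectorData U)
    (B : BivectorData V) : Prop :=
  ∀ (i j : Fin n) (f : PowerSeries (DiffPoly U)),
    diffOp (fun r s => T.pull (B r s i j)) f =
      ∑ k, ∑ l, T.Lstar i k (diffOp (fun r s => PowerSeries.C (A r s k l)) (T.L j l f))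

/-! ### Poisson cohomology in degrees one and two -/

/-- The coefficient of `ε^{D-2}` in `Lie_a A`, for the evolutionary vector field
`aⁱ = ∑ₖ ε^{k-1} aₖⁱ` with `deg aₖⁱ = k`, as a differential operator applied to `f`:
`∑ ∂ₓᵗaˡ ∂Aⁱʲ/∂u^{l,t} - ∑ ∂aⁱ/∂u^{l,t} ∂ₓᵗ ∘ Aˡʲ - ∑ Aⁱˡ ∘ (-∂ₓ)ᵗ ∘ ∂aʲ/∂u^{l,t}`. -/
def lieDeriv {n : ℕ} {U : Opens (Coord n)} (a : ℕ → Fin n → DiffPoly U) (A : BivectorData U)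
    (i j : Fin n) (f : DiffPoly U) (D : ℕ) : DiffPoly U :=
  ∑ d ∈ Finset.HasAntidiagonal.antidiagonal D, ∑ b ∈ Finset.HasAntidiagonal.antidiagonal d.2, ∑ l,
    (∑ t ∈ Finset.range (b.2 + 1),
        Dx^[t] (a d.1 l) * jetDeriv l t (A b.1 b.2 i j) * Dx^[b.1] f
      - ∑ t ∈ Finset.range (d.1 + 1),
        jetDeriv l t (a d.1 i) * Dx^[t] (A b.1 b.2 l j * Dx^[b.1] f)
      - ∑ t ∈ Finset.range (d.1 + 1),
        A b.1 b.2 i l * Dx^[b.1] ((-1) ^ t * Dx^[t] (jetDeriv l t (a d.1 j) * f)))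

/-- The coefficient of `ε^{D-1}` in the differential operator of `A`, applied to `f`. -/
def bivectorOp {n : ℕ} {U : Opens (Coord n)} (A : BivectorData U) (i j : Fin n)
    (f : DiffPoly U) (D : ℕ) : DiffPoly U :=
  ∑ b ∈ Finset.HasAntidiagonal.antidiagonal D, A b.1 b.2 i j * Dx^[b.1] f

/-- `H̃¹ = 0` for `ϖ = hⁱʲ δ(x-y)`: every vector field `aⁱ = ∑_{k ≥ 1} ε^{k-1} aₖⁱ` with
`Lie_a ϖ = 0` is Hamiltonian, `aⁱ = hⁱʲ δf̄/δuʲ(x)` up to the normalizing power of `ε`. -/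
def VanishingH1 {n : ℕ} (U : Opens (Coord n)) (h : Matrix (Fin n) (Fin n) ℝ) : Prop :=
  ∀ a : ℕ → Fin n → DiffPoly U, (∀ k i, HasDeg (a k i) k) → (∀ i, a 0 i = 0) →
    (∀ i j f D, lieDeriv a (ultralocal U h) i j f D = 0) →
    ∃ f : ℕ → DiffPoly U, (∀ k, HasDeg (f k) k) ∧ f 0 = 0 ∧
      ∀ k i, a k i = ∑ j, ultralocal U h 0 0 i j * varDeriv k (f k) j

/-- `H̃² = 0` for `ϖ = hⁱʲ δ(x-y)`: every local bivector `α` without a term in `ε⁻¹` and with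
`[ϖ, α] = 0` is `α = Lie_a ϖ` for some vector field `aⁱ = ∑_{k ≥ 1} ε^{k-1} aₖⁱ`. -/
def VanishingH2 {n : ℕ} (U : Opens (Coord n)) (h : Matrix (Fin n) (Fin n) ℝ) : Prop :=
  ∀ α : BivectorData U, IsLocalBivector α → (∀ i j, α 0 0 i j = 0) →
    SchoutenZero (ultralocal U h) α →
    ∃ a : ℕ → Fin n → DiffPoly U, (∀ k i, HasDeg (a k i) k) ∧ (∀ i, a 0 i = 0) ∧
      ∀ i j f D, lieDeriv a (ultralocal U h) i j f D = bivectorOp α i j f D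

end LoopSpace

end

/-! A local bivector, multiplied by `ε`, is a matrix differential operator: a power series in `ε`
with entries in `𝒜(U)[∂]` (`opOf`). Its constant term is multiplication by `h`, so for an
`(n,0)`-bracket the operator is invertible (`isUnit_opOf`), and one can work with the inverse `Ω`.
It is again skew and homogeneous (`GradedOp.inverse`), and the Jacobi identity for the bracket
becomes `dΩ = 0` (`closed_of_poisson`). Thus an `(n,0)`-bracket is a symplectic form on the loop
space, deforming in `ε` the finite-dimensional form `h⁻¹`.

On a ball with centre `c` closed functional forms are exact. The Euler field `e` has components `uⁱ
- cⁱ`, and on closed forms Cartan's formula reads `Lie_e ω = d(i_e ω)`. On a coefficient of a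
monomial with `m` jet variables, `Lie_e` is the radial derivative plus `m` plus the degree of the
form. This operator is inverted by the ray integral `∫₀¹ tᵏ g(c + t(u - c)) dt` (`radial_raySmooth`)
and has no kernel (`eq_zero_of_radial`). So a closed 2-form is `dΘ` with `Lie_e Θ = i_e Ω`
(`exact_of_closed`), a closed 1-form is a variational derivative (`potential_of_closed_one_form`),
and all gradings are preserved.

For constant `h` this gives the vanishing of cohomology. A field `a` with `Lie_a ϖ = 0` corresponds
to the closed 1-form `h⁻¹a`, hence `a = h δf̄/δu`. A cocycle `α` corresponds to the closed 2-form
`h⁻¹αh⁻¹ = dθ`, hence `α = Lie_a ϖ` with `a = -hθ`.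

For the equivalence of brackets `A` and `B` with potentials `Θ_A` and `Θ_B`, a Miura transformation
`ũ = φ + εz` carries `A` to `B` as soon as the pull-back of `Θ_B` and `Θ_A` have the same exterior
derivative (`act_conj`). If `φ` is symplectic for the leading forms, then the pull-back agrees with
`Θ_A` at `ε⁰` up to a closed form on `U`. Changing `z` by `εᴷy` changes the pull-back at order
`ε^{K+1}` by a variational derivative plus an invertible matrix of functions times `y`, the
contraction of the leading symplectic form with `y` (`pullForm_perturb`). The exact part is
irrelevant, so each `y` is found by linear algebra, with no differential equation to solve
(`exists_series`).

It remains to find `φ`. When `h` is constant both leading forms are `h⁻¹` and the identity works on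
the whole ball. In general Darboux's theorem supplies `φ` near the given points (`exists_darboux`):
a linear symplectic map matches the forms at the points, and Moser's flow corrects the rest. The
flow is obtained, smoothly in the initial value, from the inverse function theorem in the Banach
space of paths, where superposition operators are smooth (`contDiff_superpose`). -/

open TopologicalSpace
open scoped ContDiff

noncomputable section

namespace LoopSpace

set_option linter.unusedSectionVars false

/-! ### Calculus of smooth functions on an open set -/

section SmoothCalculus

variable {n : ℕ} {U V : Opens (Coord n)}

/-- The ring structure of the subalgebra `C^∞(U)`. -/
abbrev smoothCommRing (U : Opens (Coord n)) : CommRing (Smooth U) :=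
  @Subalgebra.toCommRing ℝ (U → ℝ) _ _ _ (Smooth U)

/-- The ring structure of `C^∞(U)`, whose semiring part is syntactically the one of a
subalgebra. -/
instance instCommRingSmooth : CommRing (Smooth U) :=
  { toRing :=
      { toSemiring := (Subalgebra.toCommSemiring (Smooth U)).toSemiring
        toNeg := (smoothCommRing U).toNeg
        toSub := (smoothCommRing U).toSub
        sub_eq_add_neg := (smoothCommRing U).sub_eq_add_neg
        zsmul := (smoothCommRing U).zsmul
        zsmul_zero' := (smoothCommRing U).zsmul_zero'
        zsmul_succ' := (smoothCommRing U).zsmul_succ'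
        zsmul_neg' := (smoothCommRing U).zsmul_neg'
        toIntCast := (smoothCommRing U).toIntCast
        intCast_ofNat := (smoothCommRing U).intCast_ofNat
        intCast_negSucc := (smoothCommRing U).intCast_negSucc
        neg_add_cancel := (smoothCommRing U).neg_add_cancel }
    mul_comm := (Subalgebra.toCommSemiring (Smooth U)).mul_comm }

theorem Smooth.ext {f g : Smooth U} (h : ∀ u, f.1 u = g.1 u) : f = g :=
  Subtype.ext (funext h)

theorem Smooth.contDiffAt (f : Smooth U) (u : U) : ContDiffAt ℝ ∞ (zeroExt f.1) u :=
  ContDiffOn.contDiffAt f.2 (U.isOpen.mem_nhds u.2)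

theorem Smooth.differentiableAt (f : Smooth U) (u : U) :
    DifferentiableAt ℝ (zeroExt f.1) u :=
  (Smooth.contDiffAt f u).differentiableAt (by simp)

/-- The restriction to `U` of a function that is smooth on `U`. -/
def Smooth.ofFun (g : Coord n → ℝ) (hg : ContDiffOn ℝ ∞ g U) : Smooth U :=
  ⟨fun u => g u, contDiffOn_zeroExt hg fun _ => rfl⟩

theorem zeroExt_eventuallyEq {f : U → ℝ} {g : Coord n → ℝ} (h : ∀ u : U, f u = g u) (u : U) :
    zeroExt f =ᶠ[nhds (u : Coord n)] g := by
  filter_upwards [U.isOpen.mem_nhds u.2] with x hx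
  rw [← h ⟨x, hx⟩]; exact zeroExt_apply f ⟨x, hx⟩

theorem pd_apply_eq {f : Smooth U} {g : Coord n → ℝ} (h : ∀ u : U, f.1 u = g u) (i : Fin n)
    (u : U) : (pd i f).1 u = fderiv ℝ g u (EuclideanSpace.single i 1) := by
  change fderiv ℝ (zeroExt f.1) u _ = _
  rw [(zeroExt_eventuallyEq h u).fderiv_eq]

theorem fderiv_zeroExt_apply (f : Smooth U) (u : U) (v : Coord n) :
    fderiv ℝ (zeroExt f.1) u v = ∑ i, v i * (pd i f).1 u := by
  have hv : v = ∑ i, v i • EuclideanSpace.single i (1 : ℝ) := by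
    ext j
    simp [Pi.single_apply]
  conv_lhs => rw [hv]
  simp [pd, map_sum]

/-- The partial derivative as a derivation of `C^∞(U)`. -/
def pdDer (i : Fin n) : Derivation ℝ (Smooth U) (Smooth U) where
  toFun := pd i
  map_add' f g := Smooth.ext fun u => by
    rw [pd_apply_eq (g := zeroExt f.1 + zeroExt g.1) (fun u => by simp [zeroExt_apply]),
      fderiv_add (Smooth.differentiableAt f u) (Smooth.differentiableAt g u)]
    rfl
  map_smul' r f := Smooth.ext fun u => by
    rw [pd_apply_eq (g := r • zeroExt f.1) (fun u => by simp [zeroExt_apply]),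
      fderiv_const_smul (Smooth.differentiableAt f u)]
    rfl
  map_one_eq_zero' := Smooth.ext fun u => by
    change (pd i 1).1 u = 0
    rw [pd_apply_eq (g := fun _ => 1) (fun u => rfl)]
    simp
  leibniz' f g := Smooth.ext fun u => by
    change (pd i (f * g)).1 u = (f • pd i g + g • pd i f).1 u
    rw [pd_apply_eq (g := zeroExt f.1 * zeroExt g.1) (fun u => by simp [zeroExt_apply]),
      fderiv_mul (Smooth.differentiableAt f u) (Smooth.differentiableAt g u)]
    simp [pd, zeroExt_apply]

@[simp] theorem pdDer_apply (i : Fin n) (f : Smooth U) : pdDer i f = pd i f := rfl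

theorem pd_add (i : Fin n) (f g : Smooth U) : pd i (f + g) = pd i f + pd i g :=
  map_add (pdDer i) f g

theorem pd_zero (i : Fin n) : pd i (0 : Smooth U) = 0 := map_zero (pdDer i)

theorem pd_mul (i : Fin n) (f g : Smooth U) : pd i (f * g) = f * pd i g + g * pd i f :=
  (pdDer i).leibniz f g

theorem pd_sum {ι : Type*} (i : Fin n) (s : Finset ι) (f : ι → Smooth U) :
    pd i (∑ a ∈ s, f a) = ∑ a ∈ s, pd i (f a) := map_sum (pdDer i) f s

theorem pd_algebraMap (i : Fin n) (r : ℝ) : pd i (algebraMap ℝ (Smooth U) r) = 0 :=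
  (pdDer i).map_algebraMap r

theorem pd_comm (i j : Fin n) (f : Smooth U) : pd i (pd j f) = pd j (pd i f) := by
  refine Smooth.ext fun u => ?_
  have key : ∀ i j : Fin n, (pd i (pd j f)).1 u =
      fderiv ℝ (fderiv ℝ (zeroExt f.1)) u (EuclideanSpace.single i 1)
        (EuclideanSpace.single j 1) := by
    intro i j
    rw [pd_apply_eq (g := fun x => fderiv ℝ (zeroExt f.1) x (EuclideanSpace.single j 1))
      (fun u => rfl)]
    have hd : DifferentiableAt ℝ (fderiv ℝ (zeroExt f.1)) u :=
      (ContDiffAt.fderiv_right (m := 1) (Smooth.contDiffAt f u) (by norm_cast)).differentiableAt (by simp)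
    rw [fderiv_clm_apply hd (differentiableAt_const _)]
    simp
  rw [key, key]
  exact ((Smooth.contDiffAt f u).isSymmSndFDerivAt
    (by rw [minSmoothness_of_isRCLikeNormedField]; exact WithTop.coe_le_coe.2 le_top)) _ _

/-- The coordinate function `uⁱ`. -/
def coordFn (i : Fin n) : Smooth U :=
  Smooth.ofFun (fun x => x i) (by fun_prop)

theorem pd_coordFn (i j : Fin n) : pd j (coordFn i : Smooth U) = if i = j then 1 else 0 := by
  refine Smooth.ext fun u => ?_
  rw [pd_apply_eq (g := fun x => EuclideanSpace.proj (𝕜 := ℝ) i x) (fun u => rfl),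
    ContinuousLinearMap.fderiv]
  split_ifs with h
  · subst h; simp
  · simp [h]

theorem Smooth.isUnit {f : Smooth U} (h : ∀ u, f.1 u ≠ 0) : IsUnit f := by
  refine IsUnit.of_mul_eq_one (Smooth.ofFun (U := U) (fun x => (zeroExt f.1 x)⁻¹) ?_) ?_
  · refine ContDiffOn.inv f.2 fun x hx => ?_
    have := zeroExt_apply f.1 ⟨x, hx⟩
    simp only at this
    rw [this]; exact h _
  · refine Smooth.ext fun u => ?_
    change f.1 u * (zeroExt f.1 u)⁻¹ = 1
    rw [zeroExt_apply, mul_inv_cancel₀ (h u)]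

theorem Smooth.isUnit_matrix {ι : Type*} [Fintype ι] [DecidableEq ι] {M : Matrix ι ι (Smooth U)}
    (h : ∀ u, (M.map fun f => f.1 u).det ≠ 0) : IsUnit M := by
  rw [Matrix.isUnit_iff_isUnit_det]
  refine Smooth.isUnit fun u => ?_
  have := h u
  let ev : Smooth U →+* ℝ := (Pi.evalRingHom (fun _ : U => ℝ) u).comp (Smooth U).val.toRingHom
  have h2 : (M.det).1 u = ev M.det := rfl
  rw [h2, RingHom.map_det]
  exact this

/-- Composition with a smooth map as a ring homomorphism. -/
def compSmoothHom (φ : Fin n → Smooth U) (hφ : ∀ u, toMap φ u ∈ V) : Smooth V →+* Smooth U where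
  toFun := compSmooth φ hφ
  map_one' := rfl
  map_mul' _ _ := rfl
  map_zero' := rfl
  map_add' _ _ := rfl

@[simp] theorem compSmoothHom_apply (φ : Fin n → Smooth U) (hφ : ∀ u, toMap φ u ∈ V)
    (c : Smooth V) : compSmoothHom φ hφ c = compSmooth φ hφ c := rfl

theorem pd_compSmooth (φ : Fin n → Smooth U) (hφ : ∀ u, toMap φ u ∈ V) (c : Smooth V)
    (k : Fin n) :
    pd k (compSmooth φ hφ c) = ∑ j, pd k (φ j) * compSmooth φ hφ (pd j c) := by
  refine Smooth.ext fun u => ?_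
  set ψ : Coord n → Coord n := fun x => WithLp.toLp 2 fun i => zeroExt (φ i).1 x with hψ
  have hψu : ∀ u : U, ψ u = toMap φ u := fun u => by simp [hψ, toMap, zeroExt_apply]
  rw [pd_apply_eq (g := zeroExt c.1 ∘ ψ) (fun u => by
    rw [Function.comp_apply, hψu]; exact (zeroExt_apply c.1 ⟨_, hφ u⟩).symm)]
  have hc : HasFDerivAt (zeroExt c.1) (fderiv ℝ (zeroExt c.1) (toMap φ u)) (ψ u) := by
    rw [hψu]; exact (Smooth.differentiableAt c ⟨_, hφ u⟩).hasFDerivAt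
  have hp : DifferentiableAt ℝ ψ u := by
    rw [differentiableAt_euclidean]
    exact fun i => Smooth.differentiableAt (φ i) u
  rw [(hc.comp _ hp.hasFDerivAt).fderiv, ContinuousLinearMap.comp_apply,
    fderiv_zeroExt_apply c ⟨_, hφ u⟩]
  have hval : (∑ j, pd k (φ j) * compSmooth φ hφ (pd j c)).1 u =
      ∑ j, (pd k (φ j)).1 u * (pd j c).1 ⟨_, hφ u⟩ := by
    simp [compSmooth]
  rw [hval]
  refine Finset.sum_congr rfl fun j _ => ?_
  congr 1
  have := (EuclideanSpace.proj (𝕜 := ℝ) j).hasFDerivAt.comp (u : Coord n) hp.hasFDerivAt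
  have h2 := this.fderiv
  have h3 : (⇑(EuclideanSpace.proj (𝕜 := ℝ) j) ∘ ψ) = zeroExt (φ j).1 := rfl
  rw [h3] at h2
  change _ = fderiv ℝ (zeroExt (φ j).1) u _
  rw [h2]; rfl

theorem pd_restrictSmooth (h : U ≤ V) (f : Smooth V) (i : Fin n) :
    pd i (restrictSmooth h f) = restrictSmooth h (pd i f) :=
  Smooth.ext fun u => pd_apply_eq (f := restrictSmooth h f)
    (fun u => (zeroExt_apply f.1 ⟨u, h u.2⟩).symm) i u

end SmoothCalculus

/-! ### Derivations of the ring of differential polynomials -/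

section Derivations

open MvPolynomial

/-- Derivations that agree on the variables occurring in `f` agree at `f`, so the possibly infinite
sum of the `Y v ∂/∂v` may be cut down to any finite set containing these variables. -/
theorem mkDerivation_eq_sum {R σ : Type*} [CommRing R] (Y : σ → MvPolynomial σ R)
    (f : MvPolynomial σ R) {s : Finset σ} (hs : f.vars ⊆ s) :
    mkDerivation R Y f = ∑ v ∈ s, Y v * pderiv v f := by
  classical
  let E : Derivation R (MvPolynomial σ R) (MvPolynomial σ R) := ∑ v ∈ s, Y v • pderiv v
  have hE : ∀ g, E g = ∑ v ∈ s, Y v * pderiv v g := by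
    intro g
    change Derivation.coeFnAddMonoidHom E g = _
    rw [map_sum, Finset.sum_apply]
    rfl
  rw [← hE]
  refine derivation_eq_of_forall_mem_vars fun v hv => ?_
  rw [mkDerivation_X, hE]
  simp [pderiv_X, Pi.single_apply, hs hv]

/-- An additive map satisfying the Leibniz rule. -/
def IsDer {A : Type*} [CommRing A] (d : A →+ A) : Prop :=
  ∀ f g, d (f * g) = f * d g + g * d f

theorem IsDer.map_one {A : Type*} [CommRing A] {d : A →+ A} (hd : IsDer d) : d 1 = 0 := by
  have := hd 1 1
  simp only [mul_one, one_mul] at this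
  exact left_eq_add.1 this

theorem IsDer.map_ite {A : Type*} [CommRing A] {d : A →+ A} (hd : IsDer d) (P : Prop)
    [Decidable P] : d (if P then 1 else 0) = 0 := by
  split_ifs
  · exact hd.map_one
  · exact map_zero d

theorem IsDer.map_natCast {A : Type*} [CommRing A] {d : A →+ A} (hd : IsDer d) (k : ℕ) :
    d k = 0 := by
  induction k with
  | zero => simp
  | succ k ih => rw [Nat.cast_succ, map_add, ih, hd.map_one, add_zero]

theorem iterate_map_sum' {A ι : Type*} [AddCommMonoid A] (d : A →+ A) (m : ℕ) (s : Finset ι)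
    (f : ι → A) : d^[m] (∑ a ∈ s, f a) = ∑ a ∈ s, d^[m] (f a) := by
  induction m with
  | zero => rfl
  | succ m ih => simp only [Function.iterate_succ_apply', ih, map_sum]

variable {n : ℕ} {U : Opens (Coord n)}

theorem coeff_jetDeriv_zero (i : Fin n) (f : DiffPoly U) (m : Fin n × ℕ →₀ ℕ) :
    coeff m (jetDeriv i 0 f) = pd i (coeff m f) := by
  classical
  simp only [jetDeriv, coeff_sum, coeff_monomial, Finset.sum_ite_eq']
  split_ifs with h
  · rfl
  · rw [notMem_support_iff.1 h, pd_zero]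

theorem jetDeriv_add (i : Fin n) (s : ℕ) (f g : DiffPoly U) :
    jetDeriv i s (f + g) = jetDeriv i s f + jetDeriv i s g := by
  cases s with
  | zero => ext m : 1; simp only [coeff_jetDeriv_zero, coeff_add, pd_add]
  | succ s => exact map_add _ _ _

theorem jetDeriv_mul (i : Fin n) (s : ℕ) (f g : DiffPoly U) :
    jetDeriv i s (f * g) = f * jetDeriv i s g + g * jetDeriv i s f := by
  cases s with
  | zero =>
    ext m : 1
    rw [coeff_jetDeriv_zero, mul_comm g, coeff_add, coeff_mul, coeff_mul, coeff_mul, pd_sum,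
      ← Finset.sum_add_distrib]
    refine Finset.sum_congr rfl fun x _ => ?_
    rw [coeff_jetDeriv_zero, coeff_jetDeriv_zero, pd_mul]
    ring
  | succ s => exact Derivation.leibniz _ _ _

/-- The partial derivative `∂/∂u^{i,s}` as an additive map. -/
def jetDer (i : Fin n) (s : ℕ) : DiffPoly U →+ DiffPoly U :=
  AddMonoidHom.mk' (jetDeriv i s) (jetDeriv_add i s)

@[simp] theorem jetDer_apply (i : Fin n) (s : ℕ) (f : DiffPoly U) :
    jetDer i s f = jetDeriv i s f := rfl

theorem isDer_jetDer (i : Fin n) (s : ℕ) : IsDer (jetDer (U := U) i s) := jetDeriv_mul i s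

theorem jetDeriv_zero_right (i : Fin n) (s : ℕ) : jetDeriv i s (0 : DiffPoly U) = 0 :=
  map_zero (jetDer i s)

theorem jetDeriv_sum {ι : Type*} (i : Fin n) (s : ℕ) (t : Finset ι) (f : ι → DiffPoly U) :
    jetDeriv i s (∑ a ∈ t, f a) = ∑ a ∈ t, jetDeriv i s (f a) := map_sum (jetDer i s) f t

theorem jetDeriv_zero_C (i : Fin n) (c : Smooth U) :
    jetDeriv i 0 (C c : DiffPoly U) = C (pd i c) := by
  classical
  ext m : 1
  rw [coeff_jetDeriv_zero, coeff_C, coeff_C]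
  split_ifs
  · rfl
  · exact pd_zero i

theorem jetDeriv_succ_C (i : Fin n) (s : ℕ) (c : Smooth U) :
    jetDeriv i (s + 1) (C c : DiffPoly U) = 0 := by
  simp [jetDeriv]

theorem jetDeriv_zero_X (i : Fin n) (v : Fin n × ℕ) :
    jetDeriv i 0 (X v : DiffPoly U) = 0 := by
  classical
  ext m : 1
  rw [coeff_jetDeriv_zero, coeff_X, coeff_zero]
  split_ifs
  · exact (pdDer i).map_one_eq_zero
  · exact pd_zero i

theorem jetDeriv_succ_X (i : Fin n) (s : ℕ) (v : Fin n × ℕ) :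
    jetDeriv i (s + 1) (X v : DiffPoly U) = if v = (i, s) then 1 else 0 := by
  classical
  simp [jetDeriv, pderiv_X, Pi.single_apply]

/-- The derivation with the value `Y i s` at `u^{i,s}`. -/
def derOf (Y : Fin n → ℕ → DiffPoly U) : DiffPoly U →+ DiffPoly U :=
  AddMonoidHom.mk' (fun f => ∑ i, Y i 0 * jetDeriv i 0 f +
    mkDerivation (Smooth U) (fun v : Fin n × ℕ => Y v.1 (v.2 + 1)) f) fun f g => by
      simp only [jetDeriv_add, mul_add, Finset.sum_add_distrib, map_add]
      abel

theorem derOf_apply (Y : Fin n → ℕ → DiffPoly U) (f : DiffPoly U) :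
    derOf Y f = ∑ i, Y i 0 * jetDeriv i 0 f +
      mkDerivation (Smooth U) (fun v : Fin n × ℕ => Y v.1 (v.2 + 1)) f := rfl

theorem isDer_derOf (Y : Fin n → ℕ → DiffPoly U) : IsDer (derOf Y) := by
  intro f g
  simp only [derOf_apply, jetDeriv_mul, Derivation.leibniz, smul_eq_mul, mul_add,
    Finset.sum_add_distrib, Finset.mul_sum]
  have : ∀ a b c : DiffPoly U, a * (b * c) = b * (a * c) := fun a b c => by ring
  simp only [this (Y _ _)]
  abel

theorem derOf_C (Y : Fin n → ℕ → DiffPoly U) (c : Smooth U) :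
    derOf Y (C c) = ∑ i, Y i 0 * C (pd i c) := by
  rw [derOf_apply, derivation_C, add_zero]
  simp only [jetDeriv_zero_C]

theorem derOf_X (Y : Fin n → ℕ → DiffPoly U) (v : Fin n × ℕ) :
    derOf Y (X v) = Y v.1 (v.2 + 1) := by
  simp [derOf_apply, jetDeriv_zero_X, mkDerivation_X]

/-- The derivations here are not linear over the coefficient ring, since they differentiate
functions of `u`. The values on coefficients must therefore be compared along with those on
variables. -/
theorem der_ext {σ R : Type*} [CommRing R] {d₁ d₂ : MvPolynomial σ R →+ MvPolynomial σ R}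
    (h₁ : IsDer d₁) (h₂ : IsDer d₂)
    (hC : ∀ c, d₁ (C c) = d₂ (C c)) (hX : ∀ v, d₁ (X v) = d₂ (X v)) (f : MvPolynomial σ R) :
    d₁ f = d₂ f := by
  induction f using MvPolynomial.induction_on with
  | C c => exact hC c
  | add f g hf hg => rw [map_add, map_add, hf, hg]
  | mul_X f v hf => rw [h₁, h₂, hf, hX]

/-- A commutator of derivations is a derivation, so a commutation relation needs checking only on
coefficients and variables. -/
theorem der_commutator_ext {σ R : Type*} [CommRing R]
    {d₁ d₂ d₃ : MvPolynomial σ R →+ MvPolynomial σ R}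
    (h₁ : IsDer d₁) (h₂ : IsDer d₂) (h₃ : IsDer d₃)
    (hC : ∀ c, d₁ (d₂ (C c)) = d₂ (d₁ (C c)) + d₃ (C c))
    (hX : ∀ v, d₁ (d₂ (X v)) = d₂ (d₁ (X v)) + d₃ (X v)) (f : MvPolynomial σ R) :
    d₁ (d₂ f) = d₂ (d₁ f) + d₃ f := by
  induction f using MvPolynomial.induction_on with
  | C c => exact hC c
  | add f g hf hg => simp only [map_add, hf, hg]; abel
  | mul_X f v hf =>
    simp only [h₁ _ _, h₂ _ _, h₃ _ _, map_add, hf, hX]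
    ring

theorem isDer_zero {A : Type*} [CommRing A] : IsDer (0 : A →+ A) := fun f g => by simp

theorem IsDer.add {A : Type*} [CommRing A] {d₁ d₂ : A →+ A} (h₁ : IsDer d₁)
    (h₂ : IsDer d₂) : IsDer (d₁ + d₂) := by
  intro f g
  simp only [AddMonoidHom.add_apply, h₁ _ _, h₂ _ _]
  ring

/-- A bound for the order of the jets that `f` depends on. -/
def jetBound (f : DiffPoly U) : ℕ := f.vars.sup (fun v => v.2) + 2

/-- The variable with stored index `t` is the jet of order `t + 1`, so the orders from `sup + 2` on
do not occur in `f`. -/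
theorem jetDeriv_eq_zero {f : DiffPoly U} {s : ℕ} (h : jetBound f ≤ s) (i : Fin n) :
    jetDeriv i s f = 0 := by
  obtain ⟨t, rfl⟩ : ∃ t, s = t + 1 := ⟨s - 1, by unfold jetBound at h; omega⟩
  refine pderiv_eq_zero_of_notMem_vars fun hv => ?_
  have : t ≤ f.vars.sup fun v => v.2 := Finset.le_sup (f := fun v : Fin n × ℕ => v.2) hv
  unfold jetBound at h
  omega

theorem derOf_eq_sum (Y : Fin n → ℕ → DiffPoly U) (f : DiffPoly U) {N : ℕ}
    (hN : ∀ i s, N ≤ s → jetDeriv i s f = 0) :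
    derOf Y f = ∑ i, ∑ s ∈ Finset.range N, Y i s * jetDeriv i s f := by
  have main : ∀ N, jetBound f ≤ N →
      derOf Y f = ∑ i, ∑ s ∈ Finset.range N, Y i s * jetDeriv i s f := by
    intro N hN
    obtain ⟨M, rfl⟩ : ∃ M, N = M + 1 := ⟨N - 1, by unfold jetBound at hN; omega⟩
    simp only [Finset.sum_range_succ']
    rw [Finset.sum_add_distrib, add_comm, derOf_apply]
    congr 1
    rw [mkDerivation_eq_sum (s := Finset.univ ×ˢ Finset.range M), Finset.sum_product]
    · rfl
    · intro v hv
      have : v.2 ≤ f.vars.sup fun v => v.2 := Finset.le_sup (f := fun v : Fin n × ℕ => v.2) hv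
      unfold jetBound at hN
      simp only [Finset.mem_product, Finset.mem_univ, Finset.mem_range, true_and]
      omega
  rw [main (max N (jetBound f)) (le_max_right _ _)]
  refine Finset.sum_congr rfl fun i _ => ?_
  symm
  refine Finset.sum_subset (fun s hs => ?_) fun s _ hs => ?_
  · simp only [Finset.mem_range] at hs ⊢; omega
  · rw [hN i s (by simpa using hs), mul_zero]

/-- The total derivative as a bundled additive map. -/
def dx : DiffPoly U →+ DiffPoly U := derOf fun i s => X (i, s)

theorem isDer_dx : IsDer (dx (U := U)) := isDer_derOf _

theorem Dx_eq_dx (f : DiffPoly U) : Dx f = dx f := by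
  rw [Dx, dx, derOf_apply, mkDerivation_eq_sum _ f (Finset.Subset.refl _)]
  rfl

theorem Dx_eq_coe_dx : (Dx : DiffPoly U → DiffPoly U) = ⇑(dx (U := U)) := funext Dx_eq_dx

/-- The evolutionary vector field with characteristic `Y`. -/
def evolField (Y : Fin n → DiffPoly U) : DiffPoly U →+ DiffPoly U :=
  derOf fun i s => dx^[s] (Y i)

theorem isDer_evolField (Y : Fin n → DiffPoly U) : IsDer (evolField Y) := isDer_derOf _

theorem evolField_C (Y : Fin n → DiffPoly U) (c : Smooth U) :
    evolField Y (C c) = ∑ i, Y i * C (pd i c) := derOf_C _ c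

theorem evolField_X (Y : Fin n → DiffPoly U) (v : Fin n × ℕ) :
    evolField Y (X v) = dx^[v.2 + 1] (Y v.1) := derOf_X _ v

theorem dx_C (c : Smooth U) : dx (C c : DiffPoly U) = ∑ i, X (i, 0) * C (pd i c) := derOf_C _ c

theorem dx_X (v : Fin n × ℕ) : dx (X v : DiffPoly U) = X (v.1, v.2 + 1) := derOf_X _ v

theorem iterate_dx_X (s : ℕ) (v : Fin n × ℕ) :
    dx^[s] (X v : DiffPoly U) = X (v.1, v.2 + s) := by
  induction s generalizing v with
  | zero => rfl
  | succ s ih => rw [Function.iterate_succ_apply, dx_X, ih, add_assoc, add_comm 1]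

/-- On jet variables this is the definition of the prolongation; on coefficients it is the symmetry
of second partial derivatives. -/
theorem evolField_dx (Y : Fin n → DiffPoly U) (f : DiffPoly U) :
    evolField Y (dx f) = dx (evolField Y f) := by
  refine (der_commutator_ext (isDer_evolField Y) isDer_dx isDer_zero (fun c => ?_) (fun v => ?_)
    f).trans (add_zero _)
  · rw [AddMonoidHom.zero_apply, add_zero, dx_C, evolField_C]
    simp only [map_sum, isDer_evolField Y _ _, isDer_dx _ _, evolField_X, evolField_C, dx_C, zero_add,
      Function.iterate_one]
    simp only [Finset.sum_add_distrib, Finset.mul_sum]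
    rw [Finset.sum_comm]
    refine congrArg₂ _ ?_ rfl
    refine Finset.sum_congr rfl fun i _ => Finset.sum_congr rfl fun j _ => ?_
    rw [pd_comm i j, mul_left_comm]
  · rw [AddMonoidHom.zero_apply, add_zero, dx_X, evolField_X, evolField_X]
    exact Function.iterate_succ_apply' _ _ _

theorem evolField_iterate_dx (Y : Fin n → DiffPoly U) (s : ℕ) (f : DiffPoly U) :
    evolField Y (dx^[s] f) = dx^[s] (evolField Y f) := by
  induction s with
  | zero => rfl
  | succ s ih => rw [Function.iterate_succ_apply', Function.iterate_succ_apply', evolField_dx, ih]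

theorem evolField_add (Y Z : Fin n → DiffPoly U) (f : DiffPoly U) :
    evolField (Y + Z) f = evolField Y f + evolField Z f := by
  refine der_ext (d₂ := evolField Y + evolField Z) (isDer_evolField _) ((isDer_evolField _).add (isDer_evolField _))
    (fun c => ?_) (fun v => ?_) f
  · simp only [AddMonoidHom.add_apply, evolField_C, Pi.add_apply, add_mul, Finset.sum_add_distrib]
  · simp only [AddMonoidHom.add_apply, evolField_X, Pi.add_apply, iterate_map_add]

/-- On jet variables both fields pass through `∂ₓˢ`; on coefficients the terms with second partial
derivatives cancel in the commutator. -/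
theorem evolField_bracket (Y Z : Fin n → DiffPoly U) (f : DiffPoly U) :
    evolField Y (evolField Z f) = evolField Z (evolField Y f) +
      evolField (fun i => evolField Y (Z i) - evolField Z (Y i)) f := by
  refine der_commutator_ext (isDer_evolField Y) (isDer_evolField Z) (isDer_evolField _)
    (fun c => ?_) (fun v => ?_) f
  · simp only [evolField_C, map_sum, isDer_evolField _ _ _, Finset.sum_add_distrib,
      Finset.mul_sum, sub_mul, Finset.sum_sub_distrib]
    rw [Finset.sum_comm]
    have e1 : ∀ x y : Fin n, Z y * (Y x * C (pd x (pd y c))) = Y x * (Z y * C (pd y (pd x c))) :=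
      fun x y => by rw [pd_comm x y, mul_left_comm]
    simp only [e1, mul_comm (C (pd _ c)) _]
    abel
  · simp only [evolField_X, evolField_iterate_dx, iterate_map_sub]
    abel

theorem evolField_eq_sum (Y : Fin n → DiffPoly U) (f : DiffPoly U) {N : ℕ}
    (hN : ∀ i s, N ≤ s → jetDeriv i s f = 0) :
    evolField Y f = ∑ i, ∑ s ∈ Finset.range N, dx^[s] (Y i) * jetDeriv i s f :=
  derOf_eq_sum _ f hN

end Derivations

/-! ### Differential rings and differential operators -/

/-- A commutative ring with a distinguished derivation. -/
class DRing (A : Type*) [CommRing A] where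
  d : A →+ A
  isDer_d : IsDer d

open DRing (d isDer_d)

section DiffOps

variable {A S : Type*} [CommRing A] [DRing A] [CommRing S] [DRing S]

/-- The space `A[∂]` of differential operators with coefficients in `A`. -/
def DOp (A : Type*) [CommRing A] [DRing A] : Type _ := ℕ →₀ A

namespace DOp

instance : AddCommGroup (DOp A) := inferInstanceAs (AddCommGroup (ℕ →₀ A))
instance : Module A (DOp A) := inferInstanceAs (Module A (ℕ →₀ A))

/-- The operator `a ∂ˢ`. -/
def mono (s : ℕ) : A →+ DOp A := Finsupp.singleAddHom s

/-- Extension of additive data from the operators `a ∂ˢ`. -/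
def lift {M : Type*} [AddCommMonoid M] (F : ℕ → A →+ M) : DOp A →+ M := Finsupp.liftAddHom F

@[simp] theorem lift_mono {M : Type*} [AddCommMonoid M] (F : ℕ → A →+ M) (s : ℕ) (a : A) :
    lift F (mono s a) = F s a :=
  Finsupp.liftAddHom_apply_single F s a

theorem induction {P : DOp A → Prop} (p : DOp A) (h0 : P 0)
    (hadd : ∀ p q, P p → P q → P (p + q)) (hm : ∀ s a, P (mono s a)) : P p :=
  Finsupp.induction_linear p h0 hadd hm

theorem hom_ext {M : Type*} [AddCommMonoid M] {F G : DOp A →+ M}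
    (h : ∀ s a, F (mono s a) = G (mono s a)) (p : DOp A) : F p = G p := by
  induction p using DOp.induction with
  | h0 => rw [map_zero, map_zero]
  | hadd p q hp hq => rw [map_add, map_add, hp, hq]
  | hm s a => exact h s a

theorem smul_mono (a b : A) (s : ℕ) : a • (mono s b : DOp A) = mono s (a * b) :=
  Finsupp.smul_single' a s b

/-- Left multiplication by `∂`. -/
def nabla : DOp A →+ DOp A := lift fun s => (mono s).comp d + mono (s + 1)

theorem nabla_mono (s : ℕ) (a : A) : nabla (mono s a) = mono s (d a) + mono (s + 1) a := by
  simp [nabla]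

theorem nabla_smul (a : A) (q : DOp A) : nabla (a • q) = d a • q + a • nabla q := by
  induction q using DOp.induction with
  | h0 => simp
  | hadd p q hp hq => simp only [smul_add, map_add, hp, hq]; abel
  | hm s b =>
    simp only [smul_mono, nabla_mono, isDer_d a b, map_add, smul_add, mul_comm b]
    abel

/-- The product of differential operators. -/
def mulHom : DOp A →+ DOp A →+ DOp A :=
  lift fun s => AddMonoidHom.mk' (fun a =>
    AddMonoidHom.mk' (fun q => a • nabla^[s] q) fun p q => by
      rw [iterate_map_add, smul_add]) fun a b => by
      ext q; simp [add_smul]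

instance : Mul (DOp A) := ⟨fun p q => mulHom p q⟩
instance : One (DOp A) := ⟨mono 0 1⟩

theorem one_def : (1 : DOp A) = mono 0 1 := rfl

theorem mono_mul (s : ℕ) (a : A) (q : DOp A) : mono s a * q = a • nabla^[s] q := by
  change mulHom _ _ = _
  simp [mulHom]

theorem add_mul' (p q r : DOp A) : (p + q) * r = p * r + q * r := by
  change mulHom _ _ = mulHom _ _ + mulHom _ _
  simp

theorem mul_add' (p q r : DOp A) : p * (q + r) = p * q + p * r := by
  change mulHom _ _ = mulHom _ _ + mulHom _ _
  simp

theorem zero_mul' (r : DOp A) : 0 * r = 0 := by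
  change mulHom _ _ = _
  simp

theorem mul_zero' (r : DOp A) : r * 0 = 0 := by
  change mulHom _ _ = _
  simp

theorem smul_mul' (a : A) (p q : DOp A) : (a • p) * q = a • (p * q) := by
  induction p using DOp.induction with
  | h0 => simp [zero_mul']
  | hadd p r hp hr => simp only [smul_add, add_mul', hp, hr]
  | hm s b => rw [smul_mono, mono_mul, mono_mul, mul_smul]

theorem nabla_mul (p q : DOp A) : nabla p * q = nabla (p * q) := by
  induction p using DOp.induction with
  | h0 => simp [zero_mul']
  | hadd p r hp hr => simp only [map_add, add_mul', hp, hr]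
  | hm s b =>
    rw [nabla_mono, add_mul', mono_mul, mono_mul, mono_mul, nabla_smul,
      Function.iterate_succ_apply']

theorem iterate_nabla_mul (s : ℕ) (p q : DOp A) : nabla^[s] p * q = nabla^[s] (p * q) := by
  induction s with
  | zero => rfl
  | succ s ih => rw [Function.iterate_succ_apply', Function.iterate_succ_apply', nabla_mul, ih]

theorem iterate_nabla_mono (s : ℕ) : nabla^[s] (mono 0 1 : DOp A) = mono s 1 := by
  induction s with
  | zero => rfl
  | succ s ih =>
    rw [Function.iterate_succ_apply', ih, nabla_mono, isDer_d.map_one, map_zero, zero_add]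

/-- Associativity reduces to a left factor `a ∂ˢ`, where it holds because left multiplication by `∂`
commutes with right multiplication (`nabla_mul`). -/
instance : Ring (DOp A) :=
  { (inferInstance : AddCommGroup (DOp A)), (inferInstance : Mul (DOp A)),
    (inferInstance : One (DOp A)) with
    left_distrib := mul_add'
    right_distrib := add_mul'
    zero_mul := zero_mul'
    mul_zero := mul_zero'
    mul_assoc := fun p q r => by
      induction p using DOp.induction with
      | h0 => simp only [zero_mul']
      | hadd p p' hp hp' => simp only [add_mul', hp, hp']
      | hm s b => rw [mono_mul, mono_mul, smul_mul', iterate_nabla_mul]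
    one_mul := fun p => by
      rw [one_def, mono_mul, one_smul]; rfl
    mul_one := fun p => by
      induction p using DOp.induction with
      | h0 => simp only [zero_mul']
      | hadd p p' hp hp' => simp only [add_mul', hp, hp']
      | hm s b => rw [one_def, mono_mul, iterate_nabla_mono, smul_mono, mul_one] }

/-- Multiplication operators. -/
def const : A →+* DOp A :=
  { mono 0 with
    map_one' := rfl
    map_mul' := fun a b => by
      change mono 0 (a * b) = mono 0 a * mono 0 b
      rw [mono_mul, Function.iterate_zero_apply, smul_mono] }

/-- The action on `S` of the operator obtained by applying `π` to the coefficients. -/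
def ev (π : A →+* S) : DOp A →+ S →+ S :=
  lift fun s => AddMonoidHom.mk' (fun a =>
    AddMonoidHom.mk' (fun f => π a * d^[s] f) fun f g => by
      rw [iterate_map_add, mul_add]) fun a b => by
      ext f; simp [add_mul]

theorem ev_mono (π : A →+* S) (s : ℕ) (a : A) (f : S) : ev π (mono s a) f = π a * d^[s] f := by
  simp [ev]

theorem ev_smul (π : A →+* S) (a : A) (p : DOp A) (f : S) : ev π (a • p) f = π a * ev π p f := by
  induction p using DOp.induction with
  | h0 => simp
  | hadd p q hp hq => simp only [smul_add, map_add, AddMonoidHom.add_apply, hp, hq, mul_add]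
  | hm s b => rw [smul_mono, ev_mono, ev_mono, map_mul, mul_assoc]

theorem ev_nabla {π : A →+* S} (hπ : ∀ a, π (d a) = d (π a)) (p : DOp A) (f : S) :
    ev π (nabla p) f = d (ev π p f) := by
  induction p using DOp.induction with
  | h0 => simp
  | hadd p q hp hq => simp only [map_add, AddMonoidHom.add_apply, hp, hq]
  | hm s b =>
    rw [nabla_mono, map_add, AddMonoidHom.add_apply, ev_mono, ev_mono, ev_mono, isDer_d _ _, hπ,
      Function.iterate_succ_apply']
    ring

theorem ev_iterate_nabla {π : A →+* S} (hπ : ∀ a, π (d a) = d (π a)) (s : ℕ) (p : DOp A)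
    (f : S) : ev π (nabla^[s] p) f = d^[s] (ev π p f) := by
  induction s with
  | zero => rfl
  | succ s ih => rw [Function.iterate_succ_apply', Function.iterate_succ_apply', ev_nabla hπ, ih]

/-- Since `π` commutes with the derivations, transporting coefficients respects composition. The
later instances of `π` are the constants of the series ring, the substitution of a Miura series and
the restriction to a smaller set. -/
theorem ev_mul {π : A →+* S} (hπ : ∀ a, π (d a) = d (π a)) (p q : DOp A) (f : S) :
    ev π (p * q) f = ev π p (ev π q f) := by
  induction p using DOp.induction with
  | h0 => simp
  | hadd p r hp hr => simp only [map_add, AddMonoidHom.add_apply, hp, hr, add_mul]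
  | hm s b => rw [mono_mul, ev_smul, ev_iterate_nabla hπ, ev_mono]

theorem ev_one (π : A →+* S) (f : S) : ev π 1 f = f := by
  rw [one_def, ev_mono]; simp

/-- The formal adjoint. -/
def adj : DOp A →+ DOp A :=
  lift fun s => AddMonoidHom.mk' (fun a => (-1 : ℤ) ^ s • nabla^[s] (mono 0 a)) fun a b => by
    rw [map_add, iterate_map_add, smul_add]

theorem ev_adj_mono {π : A →+* S} (hπ : ∀ a, π (d a) = d (π a)) (s : ℕ) (a : A) (f : S) :
    ev π (adj (mono s a)) f = (-1) ^ s * d^[s] (π a * f) := by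
  simp only [adj, lift_mono, AddMonoidHom.mk'_apply, map_zsmul, AddMonoidHom.zsmul_apply]
  rw [ev_iterate_nabla hπ, ev_mono, Function.iterate_zero_apply, zsmul_eq_mul]
  simp

end DOp

/-! ### Functionals -/

/-- The space of functionals: elements of the ring up to total derivatives. -/
abbrev Fctl (S : Type*) [CommRing S] [DRing S] : Type _ := S ⧸ (d : S →+ S).range

/-- The functional with a given density. -/
def integ : S →+ Fctl S := QuotientAddGroup.mk' _

theorem integ_eq_zero_iff {f : S} : integ f = 0 ↔ ∃ g, d g = f :=
  (QuotientAddGroup.eq_zero_iff f).trans AddMonoidHom.mem_range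

theorem integ_d (f : S) : integ (d f) = 0 := integ_eq_zero_iff.2 ⟨f, rfl⟩

theorem integ_parts (f g : S) : integ (d f * g) = -integ (f * d g) := by
  have := integ_d (f * g)
  rw [isDer_d, map_add] at this
  rw [mul_comm, eq_neg_iff_add_eq_zero, add_comm, this]

theorem integ_parts_iterate (s : ℕ) (f g : S) :
    integ (d^[s] f * g) = integ (f * ((-1) ^ s * d^[s] g)) := by
  induction s generalizing f with
  | zero => simp
  | succ s ih =>
    have h : d ((-1 : S) ^ s * d^[s] g) = (-1) ^ s * d^[s + 1] g := by
      have h1 : d ((-1 : S) ^ s) = 0 := by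
        rcases neg_one_pow_eq_or S s with h | h <;> simp [h, isDer_d.map_one]
      rw [isDer_d, h1, Function.iterate_succ_apply']; ring
    rw [Function.iterate_succ_apply, ih, integ_parts, h, ← map_neg]
    congr 1
    ring

/-- Repeated integration by parts, which identifies `adj` as the adjoint for the integral pairing.
-/
theorem integ_ev {π : A →+* S} (hπ : ∀ a, π (d a) = d (π a)) (p : DOp A) (f g : S) :
    integ (f * DOp.ev π p g) = integ (DOp.ev π (DOp.adj p) f * g) := by
  induction p using DOp.induction with
  | h0 => simp
  | hadd p q hp hq =>
    simp only [map_add, AddMonoidHom.add_apply, mul_add, add_mul, hp, hq]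
  | hm s a =>
    rw [DOp.ev_adj_mono hπ, DOp.ev_mono, mul_left_comm, ← mul_assoc, mul_comm (_ * f),
      integ_parts_iterate, mul_comm]

end DiffOps

/-! ### Series -/

section Series

open Finset.HasAntidiagonal (antidiagonal)

theorem sum_antidiagonal_assoc {M : Type*} [AddCommMonoid M] (D : ℕ) (f : ℕ → ℕ → ℕ → M) :
    ∑ q ∈ antidiagonal D, ∑ r ∈ antidiagonal q.1, f r.1 r.2 q.2 =
      ∑ q ∈ antidiagonal D, ∑ r ∈ antidiagonal q.2, f q.1 r.1 r.2 := by
  rw [Finset.sum_sigma', Finset.sum_sigma']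
  refine Finset.sum_nbij' (fun ⟨⟨_, j⟩, ⟨k, l⟩⟩ => ⟨(k, l + j), (l, j)⟩)
    (fun ⟨⟨i, _⟩, ⟨k, l⟩⟩ => ⟨(i + k, l), (i, k)⟩) ?_ ?_ ?_ ?_ ?_ <;>
  simp +contextual [← add_assoc]
  all_goals
    rintro ⟨⟨i, j⟩, ⟨k, l⟩⟩ h1 h2
    change i + j = D at h1
    change k + l = j at h2
    change i + k + l = D
    omega

theorem sum_antidiagonal_swap {M : Type*} [AddCommMonoid M] (D : ℕ) (f : ℕ → ℕ → M) :
    ∑ q ∈ antidiagonal D, f q.1 q.2 = ∑ q ∈ antidiagonal D, f q.2 q.1 :=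
  (Finset.sum_equiv (Equiv.prodComm ℕ ℕ) (by simp [add_comm]) (by simp))

variable {A S : Type*} [CommRing A] [DRing A] [CommRing S] [DRing S]

instance : DRing (PowerSeries A) where
  d := AddMonoidHom.mk' (fun f => PowerSeries.mk fun k => d (PowerSeries.coeff k f)) fun f g => by
    ext k; simp
  isDer_d := by
    intro f g
    refine PowerSeries.ext (R := A) fun k => ?_
    simp only [AddMonoidHom.mk'_apply, PowerSeries.coeff_mk, PowerSeries.coeff_mul, map_add,
      map_sum, isDer_d _ _, Finset.sum_add_distrib]
    congr 1
    exact sum_antidiagonal_swap k fun a b => PowerSeries.coeff b g * d (PowerSeries.coeff a f)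

theorem coeff_d (k : ℕ) (f : PowerSeries A) :
    PowerSeries.coeff k (d f) = d (PowerSeries.coeff k f) := by
  change PowerSeries.coeff k (PowerSeries.mk fun k => d (PowerSeries.coeff k f)) = _
  simp

theorem coeff_iterate_d (s k : ℕ) (f : PowerSeries A) :
    PowerSeries.coeff k (d^[s] f) = d^[s] (PowerSeries.coeff k f) := by
  induction s with
  | zero => rfl
  | succ s ih => rw [Function.iterate_succ_apply', Function.iterate_succ_apply', coeff_d, ih]

theorem d_C (a : A) : d (PowerSeries.C a) = PowerSeries.C (d a) := by
  ext k
  rw [coeff_d, PowerSeries.coeff_C, PowerSeries.coeff_C]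
  split_ifs <;> simp

theorem d_X_mul (f : PowerSeries A) : d (PowerSeries.X * f) = PowerSeries.X * d f := by
  ext k
  cases k with
  | zero => simp [coeff_d]
  | succ k => simp [coeff_d, PowerSeries.coeff_succ_X_mul]

theorem integ_series_eq_zero_iff {f : PowerSeries A} :
    integ f = 0 ↔ ∀ k, integ (PowerSeries.coeff k f) = 0 := by
  simp only [integ_eq_zero_iff]
  constructor
  · rintro ⟨g, rfl⟩ k
    exact ⟨_, (coeff_d k g).symm⟩
  · intro h
    choose g hg using h
    exact ⟨PowerSeries.mk g, by ext k; rw [coeff_d, PowerSeries.coeff_mk, hg]⟩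

/-- The sum `∑ₐ εᵃ xₐ`. -/
def epsSum (x : ℕ → PowerSeries A) : PowerSeries A :=
  PowerSeries.mk fun D => ∑ q ∈ antidiagonal D, PowerSeries.coeff q.2 (x q.1)

theorem coeff_epsSum (D : ℕ) (x : ℕ → PowerSeries A) :
    PowerSeries.coeff D (epsSum x) = ∑ q ∈ antidiagonal D, PowerSeries.coeff q.2 (x q.1) :=
  PowerSeries.coeff_mk _ _

theorem epsSum_add (x y : ℕ → PowerSeries A) :
    epsSum (fun a => x a + y a) = epsSum x + epsSum y := by
  ext D; simp [coeff_epsSum, Finset.sum_add_distrib]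

theorem epsSum_sub (x y : ℕ → PowerSeries A) :
    epsSum (fun a => x a - y a) = epsSum x - epsSum y := by
  ext D; simp [coeff_epsSum, Finset.sum_sub_distrib]

theorem epsSum_sum {ι : Type*} (s : Finset ι) (x : ι → ℕ → PowerSeries A) :
    epsSum (fun a => ∑ i ∈ s, x i a) = ∑ i ∈ s, epsSum (x i) := by
  ext D
  simp only [coeff_epsSum, map_sum]
  rw [Finset.sum_comm]

theorem d_epsSum (x : ℕ → PowerSeries A) : d (epsSum x) = epsSum fun a => d (x a) := by
  ext D; simp [coeff_d, coeff_epsSum]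

theorem iterate_d_epsSum (s : ℕ) (x : ℕ → PowerSeries A) :
    d^[s] (epsSum x) = epsSum fun a => d^[s] (x a) := by
  induction s with
  | zero => rfl
  | succ s ih => simp only [Function.iterate_succ_apply', ih, d_epsSum]

theorem mul_epsSum (c : PowerSeries A) (x : ℕ → PowerSeries A) :
    c * epsSum x = epsSum fun a => c * x a := by
  ext D
  simp only [coeff_epsSum, PowerSeries.coeff_mul, Finset.mul_sum]
  rw [← sum_antidiagonal_assoc D fun a b e =>
    PowerSeries.coeff a c * PowerSeries.coeff e (x b),
    ← sum_antidiagonal_assoc D fun a b e => PowerSeries.coeff b c * PowerSeries.coeff e (x a)]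
  refine Finset.sum_congr rfl fun q _ => ?_
  exact sum_antidiagonal_swap q.1 fun a b =>
    PowerSeries.coeff a c * PowerSeries.coeff q.2 (x b)

theorem epsSum_epsSum (x : ℕ → ℕ → PowerSeries A) :
    epsSum (fun a => epsSum (x a)) = epsSum fun D => ∑ r ∈ antidiagonal D, x r.1 r.2 := by
  ext D
  simp only [coeff_epsSum, map_sum]
  exact (sum_antidiagonal_assoc D fun a b e => PowerSeries.coeff e (x a b)).symm

theorem epsSum_single (f : PowerSeries A) :
    epsSum (fun a => if a = 0 then f else 0) = f := by
  ext D
  rw [coeff_epsSum, Finset.sum_eq_single (0, D)]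
  · simp
  · rintro ⟨a, b⟩ h hne
    rw [if_neg, map_zero]
    rintro rfl
    simp only [Finset.HasAntidiagonal.mem_antidiagonal, zero_add] at h
    exact hne (by rw [h])
  · simp

theorem X_mul_epsSum (x : ℕ → PowerSeries A) (y : PowerSeries A) :
    epsSum (fun a => Nat.casesOn a y x) = y + PowerSeries.X * epsSum x := by
  ext D
  cases D with
  | zero => simp [coeff_epsSum]
  | succ D =>
    rw [coeff_epsSum, Finset.Nat.antidiagonal_succ, map_add, PowerSeries.coeff_succ_X_mul,
      coeff_epsSum]
    simp

theorem integ_epsSum {x y : ℕ → PowerSeries A} (h : ∀ a, integ (x a) = integ (y a)) :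
    integ (epsSum x) = integ (epsSum y) := by
  rw [← sub_eq_zero, ← map_sub, ← epsSum_sub]
  have h' : ∀ a, ∃ g, d g = x a - y a := fun a => integ_eq_zero_iff.1 (by
    rw [map_sub, h, sub_self])
  choose g hg using h'
  exact integ_eq_zero_iff.2 ⟨epsSum g, by rw [d_epsSum]; simp only [hg]⟩

/-- Additive maps compatible with multiplication by `ε`. -/
structure EpsLin (A : Type*) [CommRing A] {M N : Type*} [AddCommGroup M] [Module (PowerSeries A) M] [AddCommGroup N]
    [Module (PowerSeries A) N] (Φ : M → N) : Prop where
  map_add : ∀ x y, Φ (x + y) = Φ x + Φ y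
  map_X : ∀ x, Φ ((PowerSeries.X : PowerSeries A) • x) = (PowerSeries.X : PowerSeries A) • Φ x

theorem exists_eq_C_add_X_smul {ι : Type*} (v : ι → PowerSeries A) :
    ∃ w : ι → PowerSeries A,
      v = (fun i => PowerSeries.C (PowerSeries.coeff 0 (v i))) + (PowerSeries.X : PowerSeries A) • w := by
  refine ⟨fun i => PowerSeries.mk fun k => PowerSeries.coeff (k + 1) (v i), funext fun i => ?_⟩
  have := PowerSeries.eq_X_mul_shift_add_const (v i)
  conv_lhs => rw [this]
  simp [add_comm]

/-- Compatibility with `ε` replaces linearity and continuity: after peeling off the constant term of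
`v`, the rest is `ε` times another vector, so the coefficient of `εᵏ` is reached in finitely many
steps. -/
theorem EpsLin.ext {ι : Type*} {Φ Ψ : (ι → PowerSeries A) → PowerSeries A} (h₁ : EpsLin A Φ)
    (h₂ : EpsLin A Ψ) (h : ∀ a : ι → A, Φ (fun i => PowerSeries.C (a i)) =
      Ψ (fun i => PowerSeries.C (a i))) (v : ι → PowerSeries A) : Φ v = Ψ v := by
  ext k
  induction k generalizing v with
  | zero =>
    obtain ⟨w, hw⟩ := exists_eq_C_add_X_smul v
    rw [hw, h₁.map_add, h₂.map_add, h₁.map_X, h₂.map_X, h]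
    simp
  | succ k ih =>
    obtain ⟨w, hw⟩ := exists_eq_C_add_X_smul v
    rw [hw, h₁.map_add, h₂.map_add, h₁.map_X, h₂.map_X, h]
    simp only [_root_.map_add, smul_eq_mul, PowerSeries.coeff_succ_X_mul, ih]

theorem EpsLin.ext₁ {Φ Ψ : PowerSeries A → PowerSeries A} (h₁ : EpsLin A Φ)
    (h₂ : EpsLin A Ψ) (h : ∀ a : A, Φ (PowerSeries.C a) = Ψ (PowerSeries.C a))
    (f : PowerSeries A) : Φ f = Ψ f :=
  EpsLin.ext (ι := Unit) (Φ := fun v => Φ (v ())) (Ψ := fun v => Ψ (v ()))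
    ⟨fun _ _ => h₁.map_add _ _, fun _ => h₁.map_X _⟩
    ⟨fun _ _ => h₂.map_add _ _, fun _ => h₂.map_X _⟩ (fun a => h (a ())) fun _ => f

end Series

/-! ### Evolutionary vector fields and matrix differential operators on series -/

/-- A differential ring with jet derivations and evolutionary vector fields. -/
class JetRing (n : outParam ℕ) (A : Type*) [CommRing A] extends DRing A where
  jd : Fin n → ℕ → A →+ A
  isDer_jd : ∀ i s, IsDer (jd i s)
  bound : A → ℕ
  jd_eq_zero : ∀ {f : A} {s : ℕ}, bound f ≤ s → ∀ i, jd i s f = 0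
  evol : (Fin n → A) → A →+ A
  isDer_evol : ∀ Y, IsDer (evol Y)
  evol_d : ∀ Y f, evol Y (d f) = d (evol Y f)
  evol_add : ∀ Y Z f, evol (Y + Z) f = evol Y f + evol Z f
  evol_bracket : ∀ Y Z f, evol Y (evol Z f) =
    evol Z (evol Y f) + evol (fun i => evol Y (Z i) - evol Z (Y i)) f
  evol_eq_sum : ∀ Y f (N : ℕ), (∀ i s, N ≤ s → jd i s f = 0) →
    evol Y f = ∑ i, ∑ s ∈ Finset.range N, d^[s] (Y i) * jd i s f
  eq_zero_of_integ : ∀ f : A, (∀ φ, integ (φ * f) = 0) → f = 0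
  eq_zero_of_ev : ∀ (_ : Fin n) (p : DOp A), (∀ f, DOp.ev (RingHom.id A) p f = 0) → p = 0

section Calculus

open PowerSeries (coeff C X)
open Finset.HasAntidiagonal (antidiagonal)

variable {n : ℕ} {A B : Type*} [CommRing A] [JetRing n A] [CommRing B] [JetRing n B]

namespace JetRing

theorem evol_zero_left (f : A) : evol (0 : Fin n → A) f = 0 := by
  have := evol_add (0 : Fin n → A) 0 f
  rw [add_zero] at this
  exact left_eq_add.1 this

/-- The evolutionary vector field whose characteristic is a series. -/
def evolS (Y : Fin n → PowerSeries A) : PowerSeries A →+ PowerSeries A :=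
  AddMonoidHom.mk' (fun f => PowerSeries.mk fun D => ∑ q ∈ antidiagonal D,
    evol (fun i => coeff q.1 (Y i)) (coeff q.2 f)) fun f g => by
      ext D; simp [Finset.sum_add_distrib]

theorem coeff_evolS (Y : Fin n → PowerSeries A) (f : PowerSeries A) (D : ℕ) :
    coeff D (evolS Y f) = ∑ q ∈ antidiagonal D,
      evol (fun i => coeff q.1 (Y i)) (coeff q.2 f) := by
  change coeff D (PowerSeries.mk fun D => ∑ q ∈ antidiagonal D,
    evol (fun i => coeff q.1 (Y i)) (coeff q.2 f)) = _
  rw [PowerSeries.coeff_mk]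

theorem evolS_add (Y Z : Fin n → PowerSeries A) (f : PowerSeries A) :
    evolS (Y + Z) f = evolS Y f + evolS Z f := by
  ext D
  simp only [coeff_evolS, map_add, ← Finset.sum_add_distrib]
  exact Finset.sum_congr rfl fun q _ => by rw [← evol_add]; simp only [Pi.add_apply, map_add]; rfl

theorem evolS_X (Y : Fin n → PowerSeries A) (f : PowerSeries A) :
    evolS Y (X * f) = X * evolS Y f := by
  ext D
  cases D with
  | zero => simp [coeff_evolS]
  | succ D =>
    rw [PowerSeries.coeff_succ_X_mul, coeff_evolS, Finset.Nat.antidiagonal_succ', coeff_evolS]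
    simp [PowerSeries.coeff_succ_X_mul]

theorem evolS_X_left (Y : Fin n → PowerSeries A) (f : PowerSeries A) :
    evolS ((X : PowerSeries A) • Y) f = X * evolS Y f := by
  have h0 : evol (fun _ : Fin n => (0 : A)) = 0 := AddMonoidHom.ext evol_zero_left
  ext D
  cases D with
  | zero => simp [coeff_evolS, h0]
  | succ D =>
    rw [PowerSeries.coeff_succ_X_mul, coeff_evolS, Finset.Nat.antidiagonal_succ, coeff_evolS]
    simp [PowerSeries.coeff_succ_X_mul, h0]

theorem evolS_C (Y : Fin n → A) (f : A) :
    evolS (fun i => C (Y i)) (C f) = C (evol Y f) := by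
  ext D
  rw [coeff_evolS, Finset.sum_eq_single (0, D)]
  · simp only [PowerSeries.coeff_C, if_true]
    split_ifs
    · rfl
    · exact map_zero _
  · rintro ⟨a, b⟩ h hne
    have ha : a ≠ 0 := by
      rintro rfl
      simp only [Finset.HasAntidiagonal.mem_antidiagonal, zero_add] at h
      exact hne (by rw [h])
    simp only [PowerSeries.coeff_C, if_neg ha]
    exact evol_zero_left _
  · simp

/-- Both sides are additive and compatible with `ε` in each of `Y`, `f` and `g`, so the Leibniz rule
for constant series suffices. -/
theorem evolS_mul (Y : Fin n → PowerSeries A) : IsDer (evolS Y) := by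
  intro f g
  refine EpsLin.ext (A := A) (Φ := fun Y => evolS Y (f * g))
    (Ψ := fun Y => f * evolS Y g + g * evolS Y f)
    ⟨fun Y Z => evolS_add _ _ _, fun Y => evolS_X_left _ _⟩
    ⟨fun Y Z => by simp only [evolS_add]; ring,
      fun Y => by simp only [evolS_X_left, smul_eq_mul]; ring⟩ (fun y => ?_) Y
  refine EpsLin.ext₁ (A := A) (Φ := fun f => evolS (fun i => C (y i)) (f * g))
    (Ψ := fun f => f * evolS (fun i => C (y i)) g + g * evolS (fun i => C (y i)) f)
    ⟨fun f f' => by simp only [add_mul, map_add],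
      fun f => by simp only [smul_eq_mul, mul_assoc, evolS_X]⟩
    ⟨fun f f' => by simp only [map_add]; ring,
      fun f => by simp only [smul_eq_mul, evolS_X]; ring⟩ (fun a => ?_) f
  refine EpsLin.ext₁ (A := A) (Φ := fun g => evolS (fun i => C (y i)) (C a * g))
    (Ψ := fun g => C a * evolS (fun i => C (y i)) g + g * evolS (fun i => C (y i)) (C a))
    ⟨fun f f' => by simp only [mul_add, map_add],
      fun f => by simp only [smul_eq_mul, mul_left_comm _ X, evolS_X]⟩
    ⟨fun f f' => by simp only [map_add]; ring,
      fun f => by simp only [smul_eq_mul, evolS_X]; ring⟩ (fun b => ?_) g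
  rw [← map_mul, evolS_C, evolS_C, evolS_C, isDer_evol, map_add, map_mul, map_mul]

theorem evolS_d (Y : Fin n → PowerSeries A) (f : PowerSeries A) :
    evolS Y (d f) = d (evolS Y f) := by
  ext D
  rw [coeff_evolS, coeff_d, coeff_evolS, map_sum]
  exact Finset.sum_congr rfl fun q _ => by rw [coeff_d, evol_d]

/-- A series vector field acting on a vector of series. -/
def prV (Y Z : Fin n → PowerSeries A) : Fin n → PowerSeries A := fun i => evolS Y (Z i)

theorem prV_apply (Y Z : Fin n → PowerSeries A) (i : Fin n) : prV Y Z i = evolS Y (Z i) := rfl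

theorem prV_add (Y Z W : Fin n → PowerSeries A) : prV Y (Z + W) = prV Y Z + prV Y W :=
  funext fun _ => map_add _ _ _

theorem prV_add_left (Y Z W : Fin n → PowerSeries A) : prV (Y + Z) W = prV Y W + prV Z W :=
  funext fun _ => evolS_add _ _ _

theorem prV_sub (Y Z W : Fin n → PowerSeries A) : prV Y (Z - W) = prV Y Z - prV Y W :=
  funext fun _ => map_sub _ _ _

theorem evolS_sub (Y Z : Fin n → PowerSeries A) (f : PowerSeries A) :
    evolS (Y - Z) f = evolS Y f - evolS Z f := by
  rw [eq_sub_iff_add_eq, ← evolS_add, sub_add_cancel]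

theorem prV_sub_left (Y Z W : Fin n → PowerSeries A) : prV (Y - Z) W = prV Y W - prV Z W :=
  funext fun _ => evolS_sub _ _ _

/-- As for the Leibniz rule, every argument is reduced to constant series, where `evol_bracket`
applies. -/
theorem evolS_bracket (Y Z : Fin n → PowerSeries A) (f : PowerSeries A) :
    evolS Y (evolS Z f) = evolS Z (evolS Y f) + evolS (prV Y Z - prV Z Y) f := by
  refine EpsLin.ext (A := A) (Φ := fun Y => evolS Y (evolS Z f))
    (Ψ := fun Y => evolS Z (evolS Y f) + evolS (prV Y Z - prV Z Y) f)
    ⟨fun Y Z => evolS_add _ _ _, fun Y => evolS_X_left _ _⟩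
    ⟨fun Y Y' => ?_, fun Y => ?_⟩ (fun y => ?_) Y
  · simp only [evolS_add, prV_add, prV_add_left, map_add, evolS_sub]; ring
  · have h1 : prV (((X : PowerSeries A)) • Y) Z = (X : PowerSeries A) • prV Y Z :=
      funext fun _ => evolS_X_left _ _
    have h2 : prV Z ((X : PowerSeries A) • Y) = (X : PowerSeries A) • prV Z Y :=
      funext fun _ => evolS_X _ _
    simp only [h1, h2, evolS_X_left, evolS_sub, evolS_X, smul_eq_mul]; ring
  refine EpsLin.ext (A := A) (Φ := fun Z => evolS (fun i => C (y i)) (evolS Z f))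
    (Ψ := fun Z => evolS Z (evolS (fun i => C (y i)) f) +
      evolS (prV (fun i => C (y i)) Z - prV Z (fun i => C (y i))) f)
    ⟨fun Y Z => by simp only [evolS_add, map_add],
      fun Y => by simp only [evolS_X_left, evolS_X, smul_eq_mul]⟩
    ⟨fun Y Y' => ?_, fun Z => ?_⟩ (fun z => ?_) Z
  · simp only [evolS_add, prV_add, prV_add_left, evolS_sub]; ring
  · have h1 : prV (((X : PowerSeries A)) • Z) (fun i => C (y i)) =
        (X : PowerSeries A) • prV Z (fun i => C (y i)) :=
      funext fun _ => evolS_X_left _ _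
    have h2 : prV (fun i => C (y i)) ((X : PowerSeries A) • Z) =
        (X : PowerSeries A) • prV (fun i => C (y i)) Z :=
      funext fun _ => evolS_X _ _
    simp only [h1, h2, evolS_X_left, evolS_sub, smul_eq_mul]; ring
  refine EpsLin.ext₁ (A := A)
    (Φ := fun f => evolS (fun i => C (y i)) (evolS (fun i => C (z i)) f))
    (Ψ := fun f => evolS (fun i => C (z i)) (evolS (fun i => C (y i)) f) +
      evolS (prV (fun i => C (y i)) (fun i => C (z i)) -
        prV (fun i => C (z i)) (fun i => C (y i))) f)
    ⟨fun f g => by simp only [map_add], fun f => by simp only [evolS_X, smul_eq_mul]⟩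
    ⟨fun f g => by simp only [map_add]; ring,
      fun f => by simp only [evolS_X, smul_eq_mul]; ring⟩ (fun a => ?_) f
  have h : prV (fun i => C (y i)) (fun i => C (z i)) - prV (fun i => C (z i)) (fun i => C (y i)) =
      fun i => C (evol y (z i) - evol z (y i)) := by
    funext i
    simp only [Pi.sub_apply, prV_apply, evolS_C, map_sub]
  simp only [h, evolS_C]
  rw [evol_bracket, map_add]

/-- Evolutionary fields commute with `∂ₓ`, hence act on functionals. This allows identities between
pairings to be differentiated along a field. -/
theorem integ_evolS {f g : PowerSeries A} (h : integ f = integ g) (Y : Fin n → PowerSeries A) :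
    integ (evolS Y f) = integ (evolS Y g) := by
  rw [← sub_eq_zero, ← map_sub] at h ⊢
  obtain ⟨k, hk⟩ := integ_eq_zero_iff.1 h
  rw [← map_sub, ← hk, evolS_d, integ_d]

/-- The pairing of a 1-form with a vector field. -/
def pair (φ ψ : Fin n → PowerSeries A) : Fctl (PowerSeries A) := integ (∑ i, φ i * ψ i)

theorem pair_comm (φ ψ : Fin n → PowerSeries A) : pair φ ψ = pair ψ φ := by
  simp only [pair, mul_comm]

theorem pair_add (φ ψ χ : Fin n → PowerSeries A) : pair φ (ψ + χ) = pair φ ψ + pair φ χ := by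
  simp only [pair, Pi.add_apply, mul_add, Finset.sum_add_distrib, map_add]

theorem pair_sub (φ ψ χ : Fin n → PowerSeries A) : pair φ (ψ - χ) = pair φ ψ - pair φ χ := by
  simp only [pair, Pi.sub_apply, mul_sub, Finset.sum_sub_distrib, map_sub]

theorem add_pair (φ ψ χ : Fin n → PowerSeries A) : pair (φ + ψ) χ = pair φ χ + pair ψ χ := by
  rw [pair_comm, pair_add, pair_comm χ, pair_comm χ]

theorem sub_pair (φ ψ χ : Fin n → PowerSeries A) : pair (φ - ψ) χ = pair φ χ - pair ψ χ := by
  rw [pair_comm, pair_sub, pair_comm χ, pair_comm χ]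

theorem pair_neg (φ ψ : Fin n → PowerSeries A) : pair φ (-ψ) = -pair φ ψ := by
  simp only [pair, Pi.neg_apply, mul_neg, Finset.sum_neg_distrib, map_neg]

theorem neg_pair (φ ψ : Fin n → PowerSeries A) : pair (-φ) ψ = -pair φ ψ := by
  rw [pair_comm, pair_neg, pair_comm]

theorem eq_zero_of_pair {θ : Fin n → PowerSeries A} (h : ∀ Y, pair θ Y = 0) : θ = 0 := by
  classical
  refine funext fun i => PowerSeries.ext fun k => ?_
  refine eq_zero_of_integ _ fun φ => ?_
  have h1 := h (Pi.single i (C φ))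
  simp only [pair, Pi.single_apply, mul_ite, mul_zero, Finset.sum_ite_eq', Finset.mem_univ,
    if_true] at h1
  have := integ_series_eq_zero_iff.1 h1 k
  rwa [PowerSeries.coeff_mul_C, mul_comm] at this

theorem eq_of_pair {θ η : Fin n → PowerSeries A} (h : ∀ Y, pair θ Y = pair η Y) : θ = η := by
  rw [← sub_eq_zero]
  exact eq_zero_of_pair fun Y => by rw [sub_pair, h, sub_self]

/-- Matrix differential operators depending on `ε`. -/
abbrev MOp (n : ℕ) (A : Type*) [CommRing A] [DRing A] : Type _ :=
  PowerSeries (Matrix (Fin n) (Fin n) (DOp A))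

/-- The action on vectors of series of a matrix operator with coefficients transported by `π`. -/
def act (π : A →+* PowerSeries B) (M : MOp n A) (f : Fin n → PowerSeries B) :
    Fin n → PowerSeries B :=
  fun i => epsSum fun a => ∑ j, DOp.ev π (coeff a M i j) (f j)

theorem act_apply (π : A →+* PowerSeries B) (M : MOp n A) (f : Fin n → PowerSeries B)
    (i : Fin n) : act π M f i = epsSum fun a => ∑ j, DOp.ev π (coeff a M i j) (f j) := rfl

theorem act_add (π : A →+* PowerSeries B) (M : MOp n A) (f g : Fin n → PowerSeries B) :
    act π M (f + g) = act π M f + act π M g := by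
  funext i
  simp only [act_apply, Pi.add_apply, map_add, Finset.sum_add_distrib, epsSum_add]

theorem act_zero (π : A →+* PowerSeries B) (M : MOp n A) : act π M 0 = 0 := by
  have := act_add π M 0 0
  rw [add_zero] at this
  exact left_eq_add.1 this

theorem act_sub (π : A →+* PowerSeries B) (M : MOp n A) (f g : Fin n → PowerSeries B) :
    act π M (f - g) = act π M f - act π M g := by
  rw [eq_sub_iff_add_eq, ← act_add, sub_add_cancel]

theorem add_act (π : A →+* PowerSeries B) (M N : MOp n A) (f : Fin n → PowerSeries B) :
    act π (M + N) f = act π M f + act π N f := by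
  funext i
  simp only [act_apply, Pi.add_apply, map_add, Matrix.add_apply, AddMonoidHom.add_apply,
    Finset.sum_add_distrib, epsSum_add]

theorem sub_act (π : A →+* PowerSeries B) (M N : MOp n A) (f : Fin n → PowerSeries B) :
    act π (M - N) f = act π M f - act π N f := by
  rw [eq_sub_iff_add_eq, ← add_act, sub_add_cancel]

theorem ev_epsSum (π : A →+* PowerSeries B) (p : DOp A) (x : ℕ → PowerSeries B) :
    DOp.ev π p (epsSum x) = epsSum fun a => DOp.ev π p (x a) := by
  induction p using DOp.induction with
  | h0 => ext; simp [coeff_epsSum]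
  | hadd p q hp hq => simp only [map_add, AddMonoidHom.add_apply, hp, hq, epsSum_add]
  | hm s a => simp only [DOp.ev_mono, iterate_d_epsSum, mul_epsSum]

theorem mul_act {π : A →+* PowerSeries B} (hπ : ∀ a, π (d a) = d (π a)) (M N : MOp n A)
    (f : Fin n → PowerSeries B) : act π (M * N) f = act π M (act π N f) := by
  funext i
  simp only [act_apply, ev_epsSum, ← epsSum_sum, epsSum_epsSum]
  congr 1
  funext D
  simp only [PowerSeries.coeff_mul, Matrix.sum_apply, Matrix.mul_apply, map_sum,
    AddMonoidHom.finsetSum_apply, DOp.ev_mul hπ]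
  rw [Finset.sum_comm]
  refine Finset.sum_congr rfl fun r _ => ?_
  rw [Finset.sum_comm]

theorem one_act (π : A →+* PowerSeries B) (f : Fin n → PowerSeries B) : act π 1 f = f := by
  funext i
  rw [act_apply]
  refine Eq.trans (congrArg epsSum ?_) (epsSum_single (f i))
  funext a
  rw [PowerSeries.coeff_one]
  split_ifs
  · rw [Finset.sum_eq_single i]
    · rw [Matrix.one_apply_eq, DOp.ev_one]
    · intro j _ hj; rw [Matrix.one_apply_ne hj.symm]; simp
    · simp
  · simp

/-- The adjoint matrix operator. -/
def adjM (M : MOp n A) : MOp n A :=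
  PowerSeries.mk fun a => Matrix.of fun i j => DOp.adj (coeff a M j i)

theorem pair_act {π : A →+* PowerSeries B} (hπ : ∀ a, π (d a) = d (π a)) (M : MOp n A)
    (f g : Fin n → PowerSeries B) : pair f (act π M g) = pair (act π (adjM M) f) g := by
  simp only [pair, act_apply, adjM, PowerSeries.coeff_mk, Matrix.of_apply, mul_epsSum,
    mul_comm (epsSum _), ← epsSum_sum]
  refine integ_epsSum fun a => ?_
  simp only [Finset.mul_sum, map_sum]
  rw [Finset.sum_comm]
  refine Finset.sum_congr rfl fun i _ => Finset.sum_congr rfl fun j _ => ?_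
  rw [integ_ev hπ, mul_comm]

theorem C_d (a : A) : (C : A →+* PowerSeries A) (d a) = d (C a) := (d_C a).symm

/-- The symbol of the Fréchet derivative of an element with respect to `uᵏ`. -/
def frSym (f : A) (k : Fin n) : DOp A := ∑ s ∈ Finset.range (bound f), DOp.mono s (jd k s f)

/-- The Fréchet derivative of a vector of series. -/
def fr (T : Fin n → PowerSeries A) : MOp n A :=
  PowerSeries.mk fun a => Matrix.of fun i k => frSym (coeff a (T i)) k

theorem ev_frSym {S : Type*} [CommRing S] [DRing S] (π : A →+* S) (f : A) (k : Fin n) (y : S) {N : ℕ}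
    (hN : ∀ i s, N ≤ s → jd (n := n) i s f = 0) :
    DOp.ev π (frSym f k) y = ∑ s ∈ Finset.range N, π (jd k s f) * d^[s] y := by
  have main : ∀ N M, (∀ s, N ≤ s → jd k s f = 0) → N ≤ M →
      ∑ s ∈ Finset.range N, π (jd k s f) * d^[s] y =
      ∑ s ∈ Finset.range M, π (jd k s f) * d^[s] y := by
    intro N M hN hM
    refine Finset.sum_subset (fun s hs => ?_) fun s _ hs => ?_
    · simp only [Finset.mem_range] at hs ⊢; omega
    · rw [hN s (by simpa using hs), map_zero, zero_mul]
  simp only [frSym, map_sum, AddMonoidHom.finsetSum_apply, DOp.ev_mono]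
  rw [main N _ (hN k) (le_max_left N (bound f)),
    main (bound f) _ (fun s hs => jd_eq_zero hs k) (le_max_right N (bound f))]

theorem frSym_eq (f : A) (k : Fin n) {N : ℕ} (hN : ∀ i s, N ≤ s → jd i s f = 0) :
    frSym f k = ∑ s ∈ Finset.range N, DOp.mono s (jd k s f) := by
  have main : ∀ N M, (∀ s, N ≤ s → jd k s f = 0) → N ≤ M →
      ∑ s ∈ Finset.range N, DOp.mono s (jd k s f) =
      ∑ s ∈ Finset.range M, DOp.mono s (jd k s f) := by
    intro N M hN hM
    refine Finset.sum_subset (fun s hs => ?_) fun s _ hs => ?_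
    · simp only [Finset.mem_range] at hs ⊢; omega
    · rw [hN s (by simpa using hs), map_zero]
  rw [frSym, main N _ (hN k) (le_max_left N (bound f)),
    main (bound f) _ (fun s hs => jd_eq_zero hs k) (le_max_right N (bound f))]

theorem frSym_add (f g : A) (k : Fin n) : frSym (f + g) k = frSym f k + frSym g k := by
  rw [frSym_eq f k (N := max (bound f) (bound g)), frSym_eq g k (N := max (bound f) (bound g)),
    frSym_eq (f + g) k (N := max (bound f) (bound g)), ← Finset.sum_add_distrib]
  · simp only [map_add]
  · intro i s hs
    rw [map_add, jd_eq_zero ((le_max_left _ _).trans hs), jd_eq_zero ((le_max_right _ _).trans hs),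
      add_zero]
  · exact fun i s hs => jd_eq_zero ((le_max_right _ _).trans hs) i
  · exact fun i s hs => jd_eq_zero ((le_max_left _ _).trans hs) i

theorem ev_id_frSym (Y : Fin n → A) (f : A) :
    ∑ k, DOp.ev (RingHom.id A) (frSym f k) (Y k) = evol Y f := by
  rw [evol_eq_sum Y f (bound f) fun i s hs => jd_eq_zero hs i]
  refine Finset.sum_congr rfl fun k _ => ?_
  rw [ev_frSym _ f k (Y k) fun i s hs => jd_eq_zero hs i]
  simp only [RingHom.id_apply, mul_comm]

theorem coeff_ev_C (p : DOp A) (f : PowerSeries A) (D : ℕ) :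
    coeff D (DOp.ev (C : A →+* PowerSeries A) p f) = DOp.ev (RingHom.id A) p (coeff D f) := by
  induction p using DOp.induction with
  | h0 => simp
  | hadd p q hp hq => simp only [map_add, AddMonoidHom.add_apply, hp, hq]
  | hm s a =>
    rw [DOp.ev_mono, DOp.ev_mono, PowerSeries.coeff_C_mul, coeff_iterate_d, RingHom.id_apply]

theorem coeff_act_C (M : MOp n A) (f : Fin n → PowerSeries A) (i : Fin n) (D : ℕ) :
    coeff D (act C M f i) = ∑ q ∈ antidiagonal D, ∑ j,
      DOp.ev (RingHom.id A) (coeff q.1 M i j) (coeff q.2 (f j)) := by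
  simp only [act_apply, coeff_epsSum, map_sum, coeff_ev_C]

/-- This passage between the Fréchet derivative as an operator and differentiation along a field
lets computations with adjoints be done by pairing. -/
theorem act_fr (T Y : Fin n → PowerSeries A) : act C (fr T) Y = prV Y T := by
  funext i
  ext D
  rw [coeff_act_C, prV_apply, coeff_evolS,
    sum_antidiagonal_swap D fun a b => evol (fun i => coeff a (Y i)) (coeff b (T i))]
  refine Finset.sum_congr rfl fun q _ => ?_
  simp only [fr, PowerSeries.coeff_mk, Matrix.of_apply]
  exact ev_id_frSym (fun j => coeff q.2 (Y j)) _

/-- The exterior derivative of a 1-form, as a matrix differential operator. -/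
def dM (θ : Fin n → PowerSeries A) : MOp n A := fr θ - adjM (fr θ)

/-- The value of the exterior derivative of a 1-form on two vector fields. -/
def dForm (θ Y Z : Fin n → PowerSeries A) : Fctl (PowerSeries A) :=
  pair (prV Y θ) Z - pair (prV Z θ) Y

theorem pair_act_dM (θ Y Z : Fin n → PowerSeries A) :
    pair (act C (dM θ) Y) Z = dForm θ Y Z := by
  rw [dM, sub_act, sub_pair, act_fr, ← pair_act C_d, act_fr, pair_comm Y]
  rfl

theorem dForm_add (θ η Y Z : Fin n → PowerSeries A) :
    dForm (θ + η) Y Z = dForm θ Y Z + dForm η Y Z := by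
  simp only [dForm, prV_add, add_pair]; abel

theorem integ_sum_evolS_mul (Y φ ψ : Fin n → PowerSeries A) :
    integ (evolS Y (∑ i, φ i * ψ i)) = pair (prV Y φ) ψ + pair φ (prV Y ψ) := by
  simp only [pair, map_sum, evolS_mul Y _ _, Finset.sum_add_distrib, map_add, prV_apply]
  rw [add_comm]
  simp only [mul_comm]

/-- The exterior derivative of the pull-back of a 1-form `w` along the map `T`. -/
theorem dForm_pullback {T w γ : Fin n → PowerSeries A} (hγ : γ = act C (adjM (fr T)) w)
    (Y Z : Fin n → PowerSeries A) :
    dForm γ Y Z = pair (prV Y w) (prV Z T) - pair (prV Z w) (prV Y T) := by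
  have h1 : ∀ Z, pair γ Z = pair w (prV Z T) := fun Z => by
    rw [hγ, ← pair_act C_d, act_fr]
  -- Differentiate `h1 Z` along `Y`; the term in which the derivative falls on `Z` is an instance of
  -- `h1`.
  have h2 : ∀ Y Z, pair (prV Y γ) Z =
      pair (prV Y w) (prV Z T) + pair w (prV Y (prV Z T)) - pair w (prV (prV Y Z) T) := by
    intro Y Z
    have := integ_evolS (h1 Z) Y
    rw [integ_sum_evolS_mul, integ_sum_evolS_mul, h1] at this
    rw [← this, add_sub_cancel_right]
  -- Antisymmetrized in `Y` and `Z`, the second derivatives of `T` reduce to the commutator of the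
  -- fields, which cancels the last terms of `h2`.
  have h3 : prV Y (prV Z T) = prV Z (prV Y T) + (prV (prV Y Z) T - prV (prV Z Y) T) := by
    rw [← prV_sub_left]
    exact funext fun i => evolS_bracket Y Z (T i)
  rw [dForm, h2, h2, h3, pair_add, pair_sub]
  abel

/-- The variational derivative of the functional with density `g`. -/
def delta (g : PowerSeries A) : Fin n → PowerSeries A :=
  fun k => epsSum fun a => DOp.ev C (DOp.adj (frSym (coeff a g) k)) 1

theorem evolS_eq_epsSum (Y : Fin n → PowerSeries A) (g : PowerSeries A) :
    evolS Y g = epsSum fun a => ∑ k, DOp.ev C (frSym (coeff a g) k) (Y k) := by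
  ext D
  rw [coeff_evolS, coeff_epsSum,
    sum_antidiagonal_swap D fun a b => evol (fun i => coeff a (Y i)) (coeff b g)]
  refine Finset.sum_congr rfl fun q _ => ?_
  rw [map_sum]
  simp only [coeff_ev_C]
  exact (ev_id_frSym (fun j => coeff q.2 (Y j)) _).symm

theorem pair_delta (g : PowerSeries A) (Y : Fin n → PowerSeries A) :
    pair (delta g) Y = integ (evolS Y g) := by
  rw [evolS_eq_epsSum]
  simp only [pair, delta, mul_comm (epsSum _), mul_epsSum, ← epsSum_sum]
  refine integ_epsSum fun a => ?_
  rw [map_sum, map_sum]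
  refine Finset.sum_congr rfl fun k _ => ?_
  have := integ_ev C_d (frSym (coeff a g) k) 1 (Y k)
  rw [one_mul] at this
  rw [this, mul_comm]

/-- This is `d² = 0`: antisymmetrizing `Y(Z g)` leaves the derivative of `g` along the commutator,
and the remaining terms subtract exactly this. -/
theorem dForm_delta (g : PowerSeries A) (Y Z : Fin n → PowerSeries A) :
    dForm (delta g) Y Z = 0 := by
  have h2 : ∀ Y Z, pair (prV Y (delta g)) Z =
      integ (evolS Y (evolS Z g)) - integ (evolS (prV Y Z) g) := by
    intro Y Z
    have := integ_evolS (pair_delta g Z) Y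
    rw [integ_sum_evolS_mul, pair_delta] at this
    rw [← this, add_sub_cancel_right]
  rw [dForm, h2, h2, evolS_bracket Y Z, evolS_sub, map_add, map_sub]
  abel

end JetRing

end Calculus

/-! ### The Poincaré lemma for functional forms -/

namespace DOp

variable {A : Type*} [CommRing A] [DRing A]

/-- The coefficient of `∂ˢ`. -/
def coef (s : ℕ) : DOp A →+ A := Finsupp.applyAddHom s

theorem coef_mono (s t : ℕ) (a : A) : coef s (mono t a) = if t = s then a else 0 :=
  Finsupp.single_apply

theorem ext_coef {p q : DOp A} (h : ∀ s, coef s p = coef s q) : p = q := Finsupp.ext h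

/-- Apply an additive map to the coefficients of an operator. -/
def mapCoef (δ : A →+ A) : DOp A →+ DOp A := lift fun s => (mono s).comp δ

theorem coef_mapCoef (δ : A →+ A) (s : ℕ) (p : DOp A) : coef s (mapCoef δ p) = δ (coef s p) := by
  refine hom_ext (F := (coef s).comp (mapCoef δ)) (G := δ.comp (coef s)) (fun t a => ?_) p
  simp only [AddMonoidHom.comp_apply, mapCoef, lift_mono, coef_mono]
  split_ifs
  · rfl
  · exact (map_zero δ).symm

/-- A derivation that commutes with `∂` differentiates only the coefficients when commuted past an
operator. -/
theorem ev_mapCoef {δ : A →+ A} (hδ : IsDer δ) (hd : ∀ f, δ (d f) = d (δ f)) (p : DOp A) (f : A) :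
    ev (RingHom.id A) (mapCoef δ p) f =
      δ (ev (RingHom.id A) p f) - ev (RingHom.id A) p (δ f) := by
  have hs : ∀ s f, δ (d^[s] f) = d^[s] (δ f) := by
    intro s
    induction s with
    | zero => exact fun f => rfl
    | succ s ih => intro f; rw [Function.iterate_succ_apply, ih, hd, ← Function.iterate_succ_apply]
  induction p using DOp.induction with
  | h0 => simp
  | hadd p q hp hq => simp only [map_add, AddMonoidHom.add_apply, hp, hq]; abel
  | hm s a =>
    simp only [mapCoef, lift_mono, AddMonoidHom.comp_apply, ev_mono, RingHom.id_apply, hδ _ _, hs]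
    ring

end DOp

section Poincare

open PowerSeries (coeff C X)
open Finset.HasAntidiagonal (antidiagonal)
open JetRing

variable {n : ℕ} {A : Type*} [CommRing A] [JetRing n A]

namespace JetRing

theorem coeff_evolS_C (y : Fin n → A) (f : PowerSeries A) (D : ℕ) :
    coeff D (evolS (fun i => C (y i)) f) = evol y (coeff D f) := by
  rw [coeff_evolS, Finset.sum_eq_single (0, D)]
  · simp
  · rintro ⟨a, b⟩ h hne
    have ha : a ≠ 0 := by
      rintro rfl
      simp only [Finset.HasAntidiagonal.mem_antidiagonal, zero_add] at h
      exact hne (by rw [h])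
    simp only [PowerSeries.coeff_C, if_neg ha]
    exact evol_zero_left _
  · simp

theorem coeff_act_C_single (M : MOp n A) (i j : Fin n) (f : A) (D : ℕ) :
    coeff D (act C M (Pi.single j (C f)) i) = DOp.ev (RingHom.id A) (coeff D M i j) f := by
  rw [coeff_act_C, Finset.sum_eq_single (D, 0)]
  · rw [Finset.sum_eq_single j]
    · simp
    · intro k _ hk; simp [hk]
    · simp
  · rintro ⟨a, b⟩ h hne
    have hb : b ≠ 0 := by
      rintro rfl
      simp only [Finset.HasAntidiagonal.mem_antidiagonal, add_zero] at h
      exact hne (by rw [h])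
    refine Finset.sum_eq_zero fun k _ => ?_
    by_cases hk : k = j
    · subst hk; simp [PowerSeries.coeff_C, hb]
    · simp [hk]
  · simp

variable {e₀ : Fin n → A}

/-- The components of the Euler field are affine coordinates. This is also why its Lie derivative on
a 1-form `θ` is `prV e θ + θ`. -/
theorem prV_euler (he : ∀ Y i, evol Y (e₀ i) = Y i) (Z : Fin n → PowerSeries A) :
    prV Z (fun i => C (e₀ i)) = Z := by
  funext i
  ext D
  rw [prV_apply, coeff_evolS, Finset.sum_eq_single (D, 0)]
  · simp [he]
  · rintro ⟨a, b⟩ h hne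
    have hb : b ≠ 0 := by
      rintro rfl
      simp only [Finset.HasAntidiagonal.mem_antidiagonal, add_zero] at h
      exact hne (by rw [h])
    simp [PowerSeries.coeff_C, hb]
  · simp

/-- The Lie derivative along the Euler field is injective on 2-forms. -/
theorem eq_zero_of_lie_eq_zero (hinj : ∀ f, evol e₀ f + 2 * f = 0 → f = 0) {M : MOp n A}
    (h : ∀ Z, prV (fun i => C (e₀ i)) (act C M Z) - act C M (prV (fun i => C (e₀ i)) Z) +
      (act C M Z + act C M Z) = 0) : M = 0 := by
  refine PowerSeries.ext fun D => Matrix.ext fun i j => ?_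
  set p : DOp A := coeff D M i j with hp
  -- On each coefficient of each entry the Lie derivative acts as `evol e₀ + 2`, the `2` coming from
  -- the two arguments of the form. Vectors with one constant entry isolate `p`.
  have key : DOp.mapCoef (evol e₀) p + (p + p) = 0 := by
    refine eq_zero_of_ev i _ fun f => ?_
    have h1 : prV (fun i => C (e₀ i)) (Pi.single j (C f)) = Pi.single j (C (evol e₀ f)) := by
      funext k
      by_cases hk : k = j
      · subst hk; simp [prV_apply, evolS_C]
      · simp [prV_apply, hk]
    have h2 := congrArg (coeff D) (congrFun (h (Pi.single j (C f))) i)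
    simp only [Pi.add_apply, Pi.sub_apply, map_add, map_sub, prV_apply, coeff_evolS_C] at h2
    rw [h1, coeff_act_C_single, coeff_act_C_single] at h2
    simp only [map_add, AddMonoidHom.add_apply]
    rw [DOp.ev_mapCoef (isDer_evol e₀) (evol_d e₀)]
    simpa using h2
  refine DOp.ext_coef fun s => ?_
  have := congrArg (DOp.coef s) key
  simp only [map_add, DOp.coef_mapCoef, map_zero] at this
  refine Eq.trans ?_ (map_zero (DOp.coef s)).symm
  exact hinj _ (by rw [two_mul]; exact this)

/-- Cartan's formula for the exterior derivative of `Lie_e θ`. -/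
theorem dForm_lie (he : ∀ Y i, evol Y (e₀ i) = Y i) {θ η : Fin n → PowerSeries A}
    (hη : prV (fun i => C (e₀ i)) θ + θ = η) (Z Y : Fin n → PowerSeries A) :
    dForm η Z Y = pair Y (prV (fun i => C (e₀ i)) (act C (dM θ) Z) -
      act C (dM θ) (prV (fun i => C (e₀ i)) Z) + (act C (dM θ) Z + act C (dM θ) Z)) := by
  set e : Fin n → PowerSeries A := fun i => C (e₀ i) with hedef
  have hpe : ∀ Z, prV Z e = Z := prV_euler he
  have hQ : ∀ Z Y, pair Y (act C (dM θ) Z) = dForm θ Z Y := fun Z Y => by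
    rw [pair_comm, pair_act_dM]
  have h1 : ∀ Z, prV Z η = prV e (prV Z θ) + prV Z θ + prV Z θ - prV (prV e Z) θ := by
    intro Z
    have hb : prV Z (prV e θ) = prV e (prV Z θ) + (prV Z θ - prV (prV e Z) θ) := by
      have : prV Z (prV e θ) = prV e (prV Z θ) + prV (prV Z e - prV e Z) θ :=
        funext fun i => evolS_bracket Z e (θ i)
      rw [this, hpe, prV_sub_left]
    rw [← hη, prV_add, hb]; abel
  -- The Leibniz rule along `e` for the functional `dθ(Z, Y)`, computed from the operator and from
  -- the definition of `dForm`.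
  have h2 : pair Y (prV e (act C (dM θ) Z)) + pair (prV e Y) (act C (dM θ) Z) =
      (pair (prV e (prV Z θ)) Y + pair (prV Z θ) (prV e Y)) -
      (pair (prV e (prV Y θ)) Z + pair (prV Y θ) (prV e Z)) := by
    have h3 : integ (∑ i, Y i * act C (dM θ) Z i) =
        integ (∑ i, prV Z θ i * Y i - ∑ i, prV Y θ i * Z i) := by
      rw [map_sub]; exact hQ Z Y
    have := integ_evolS h3 e
    rw [map_sub, map_sub, integ_sum_evolS_mul, integ_sum_evolS_mul, integ_sum_evolS_mul] at this
    rw [← this]; abel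
  rw [pair_add, pair_sub, pair_add, hQ, hQ, eq_sub_of_add_eq h2, hQ]
  simp only [dForm, h1, sub_pair, add_pair]
  abel

/-- With `α = Lie_e θ` one has `Lie_e dθ = dα = 0`, hence `dθ = 0` by injectivity. Cartan's formula
`Lie_e θ = d(i_e θ) + i_e dθ` then leaves `α = d(i_e θ)`. -/
theorem potential_of_closed_one_form (he : ∀ Y i, evol Y (e₀ i) = Y i)
    (hinj : ∀ f, evol e₀ f + 2 * f = 0 → f = 0) {θ α : Fin n → PowerSeries A}
    (hθ : prV (fun i => C (e₀ i)) θ + θ = α) (hα : ∀ Y Z, dForm α Y Z = 0) :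
    α = delta (∑ i, C (e₀ i) * θ i) := by
  have hM : dM θ = 0 := eq_zero_of_lie_eq_zero hinj fun Z => eq_zero_of_pair fun Y => by
    rw [pair_comm, ← dForm_lie he hθ, hα]
  have h0 : ∀ Y Z, dForm θ Y Z = 0 := fun Y Z => by
    rw [← pair_act_dM, hM]
    have : act C (0 : MOp n A) Y = 0 := by
      have := add_act C (0 : MOp n A) 0 Y
      rw [add_zero] at this
      exact left_eq_add.1 this
    rw [this]; simp [pair]
  refine eq_of_pair fun Z => ?_
  rw [pair_delta, integ_sum_evolS_mul, ← hθ, add_pair, add_comm]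
  have h1 := h0 (fun i => C (e₀ i)) Z
  rw [dForm, sub_eq_zero] at h1
  rw [h1, prV_euler he, pair_comm Z, pair_comm (prV Z θ)]

/-- Cartan's formula gives `Lie_e Ω = d(i_e Ω)` for closed `Ω`. The form `θ` solves `Lie_e θ = i_e
Ω`, so `Lie_e (Ω - dθ) = 0`, and `Lie_e` is injective on 2-forms. -/
theorem exact_of_closed (he : ∀ Y i, evol Y (e₀ i) = Y i)
    (hinj : ∀ f, evol e₀ f + 2 * f = 0 → f = 0) {Ω : MOp n A}
    (hskew : ∀ Y Z, pair Y (act C Ω Z) = -pair (act C Ω Y) Z)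
    (hclosed : ∀ X Y Z,
      pair Z (prV X (act C Ω Y) - act C Ω (prV X Y)) +
      pair X (prV Y (act C Ω Z) - act C Ω (prV Y Z)) +
      pair Y (prV Z (act C Ω X) - act C Ω (prV Z X)) = 0) {θ : Fin n → PowerSeries A}
    (hθ : prV (fun i => C (e₀ i)) θ + θ = act C Ω fun i => C (e₀ i)) : Ω = dM θ := by
  set e : Fin n → PowerSeries A := fun i => C (e₀ i) with hedef
  have hpe : ∀ Z, prV Z e = Z := prV_euler he
  -- Differentiating the skewness of `Ω` along `X`: the derived operator is skew as well.
  have hsk : ∀ X Y Z, pair Z (prV X (act C Ω Y) - act C Ω (prV X Y)) =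
      -pair Y (prV X (act C Ω Z) - act C Ω (prV X Z)) := by
    intro X Y Z
    have h1 : integ (∑ i, Z i * act C Ω Y i) = integ (-∑ i, act C Ω Z i * Y i) := by
      rw [map_neg]; exact hskew Z Y
    have h2 := integ_evolS h1 X
    rw [map_neg, map_neg, integ_sum_evolS_mul, integ_sum_evolS_mul] at h2
    rw [pair_sub, pair_sub, hskew Z, pair_comm Y, pair_comm Y, ← neg_eq_iff_eq_neg.2 (hskew _ Y)]
    rw [eq_sub_of_add_eq' h2]; abel
  rw [← sub_eq_zero]
  refine eq_zero_of_lie_eq_zero hinj fun Z => eq_zero_of_pair fun Y => ?_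
  have h1 := dForm_lie he hθ Z Y
  -- Cartan's formula for `Ω`. Since `prV Z e = Z`, the derivative of `i_e Ω` along `Z` is a
  -- derivative of `Ω` plus `Ω Z`; closedness trades the derivatives along `Y` and `Z` for the one
  -- along `e`.
  have h2 : dForm (act C Ω e) Z Y = pair Y (prV e (act C Ω Z) - act C Ω (prV e Z) +
      (act C Ω Z + act C Ω Z)) := by
    have h3 : ∀ Z, prV Z (act C Ω e) = (prV Z (act C Ω e) - act C Ω (prV Z e)) + act C Ω Z := by
      intro Z; rw [hpe]; abel
    rw [dForm, h3 Z, h3 Y, add_pair, add_pair, pair_comm _ Y, pair_comm _ Z, pair_comm _ Y,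
      hsk Z e Y, ← neg_eq_iff_eq_neg.2 (hskew Y Z), pair_add, pair_add,
      eq_neg_of_add_eq_zero_right (hclosed Z Y e)]
    abel
  rw [h2] at h1
  rw [pair_comm, sub_act, sub_act, prV_sub]
  rw [← sub_eq_zero, ← pair_sub] at h1
  convert h1 using 2
  abel

end JetRing

end Poincare

/-! ### Differential polynomials as a jet ring -/

section Instance

open MvPolynomial

variable {n : ℕ} {U : Opens (Coord n)}

/-- The only term of `∂ₓ` that does not commute is `u^{i,s+1} ∂/∂u^{i,s}`. The relation controls the
highest jets in a total derivative. -/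
theorem jetDeriv_succ_dx (i : Fin n) (s : ℕ) (f : DiffPoly U) :
    jetDeriv i (s + 1) (dx f) = dx (jetDeriv i (s + 1) f) + jetDeriv i s f := by
  refine der_commutator_ext (isDer_jetDer i (s + 1)) isDer_dx (isDer_jetDer i s)
    (fun c => ?_) (fun v => ?_) f
  · simp only [jetDer_apply, dx_C, jetDeriv_sum, jetDeriv_mul, jetDeriv_succ_C, jetDeriv_succ_X,
      map_zero, mul_zero, zero_add, mul_ite, mul_one, Prod.mk.injEq]
    cases s with
    | zero =>
      rw [jetDeriv_zero_C]
      simp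
    | succ s => simp [jetDeriv_succ_C]
  · simp only [jetDer_apply, dx_X, jetDeriv_succ_X]
    have h0 : dx (if v = (i, s) then (1 : DiffPoly U) else 0) = 0 := isDer_dx.map_ite _
    rw [h0]
    rw [zero_add]
    cases s with
    | zero => rw [jetDeriv_zero_X, if_neg]; simp
    | succ s =>
      rw [jetDeriv_succ_X]
      refine if_congr ?_ rfl rfl
      simp [Prod.ext_iff]

theorem jetDeriv_succ_comm (i j : Fin n) (s t : ℕ) (f : DiffPoly U) :
    jetDeriv i (s + 1) (jetDeriv j (t + 1) f) = jetDeriv j (t + 1) (jetDeriv i (s + 1) f) := by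
  have h1 : ∀ (i : Fin n) (s : ℕ) (P : Prop) [Decidable P],
      jetDeriv i (s + 1) (if P then (1 : DiffPoly U) else 0) = 0 :=
    fun i s P _ => (isDer_jetDer i (s + 1)).map_ite P
  refine (der_commutator_ext (isDer_jetDer i (s + 1)) (isDer_jetDer j (t + 1)) isDer_zero
    (fun c => ?_) (fun v => ?_) f).trans (add_zero _)
  · simp only [jetDer_apply, jetDeriv_succ_C, jetDeriv_zero_right, AddMonoidHom.zero_apply,
      add_zero]
  · simp only [jetDer_apply, jetDeriv_succ_X, h1, AddMonoidHom.zero_apply, add_zero]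

theorem two_mul_eq_zero {f : DiffPoly U} (h : f + f = 0) : f = 0 := by
  have h2 : C (algebraMap ℝ (Smooth U) (1 / 2)) * (f + f) = f := by
    rw [← two_mul, ← mul_assoc]
    have : (C (algebraMap ℝ (Smooth U) (1 / 2)) : DiffPoly U) * 2 = 1 := by
      have e : (2 : DiffPoly U) = C (algebraMap ℝ (Smooth U) 2) := by
        rw [map_ofNat, map_ofNat]
      rw [e, ← C_mul, ← map_mul, one_div, inv_mul_cancel₀ two_ne_zero, map_one, map_one]
    rw [this, one_mul]
  rw [← h2, h, mul_zero]

instance : DRing (DiffPoly U) := ⟨dx, isDer_dx⟩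

theorem d_eq_dx (f : DiffPoly U) : d f = dx f := rfl

/-- Test with `φ = u²`, where `u` is a jet variable of higher order than any in `f`. If `u²f = ∂ₓg`,
then `g` has lower order than `u`, so `∂ₓg` is affine in `u`, while the second derivative of `u²f`
in `u` is `2f`. -/
theorem eq_zero_of_integ_diffPoly (f : DiffPoly U) (h : ∀ φ, integ (φ * f) = 0) : f = 0 := by
  -- Without coordinates there is no jet variable to test with, but then `∂ₓ = 0` and the test `φ =
  -- 1` gives `f = 0`.
  rcases isEmpty_or_nonempty (Fin n) with hn | ⟨⟨i⟩⟩
  · obtain ⟨g, hg⟩ := integ_eq_zero_iff.1 (h 1)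
    rw [one_mul] at hg
    rw [← hg, d_eq_dx, dx, derOf_eq_sum _ g (N := 0) fun i => isEmptyElim i]
    exact Finset.sum_eq_zero fun i => isEmptyElim i
  obtain ⟨N, hN⟩ : ∃ N, jetBound f = N + 1 := ⟨jetBound f - 1, by unfold jetBound; omega⟩
  have hf : ∀ j s, N + 1 ≤ s → jetDeriv j s f = 0 := fun j s hs =>
    jetDeriv_eq_zero (by omega) j
  -- This is the jet of order `N + 2`, whereas `f` involves only orders up to `N`.
  set u : DiffPoly U := X (i, N + 1) with hu
  obtain ⟨g, hg⟩ := integ_eq_zero_iff.1 (h (u * u))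
  rw [d_eq_dx] at hg
  -- Descending induction on the order: if the jets of order above `s` are absent from `g`, the
  -- commutation relation equates `∂g/∂u^{j,s}` with the derivative of `u²f` in a jet of order `s +
  -- 1`, which is absent.
  have hg2 : ∀ k j s, jetBound g ≤ s + k → N + 2 ≤ s → jetDeriv j s g = 0 := by
    intro k
    induction k with
    | zero => intro j s hs _; exact jetDeriv_eq_zero hs j
    | succ k ih =>
      intro j s hs hs2
      have h1 := jetDeriv_succ_dx j s g
      rw [ih j (s + 1) (by omega) (by omega), map_zero, zero_add, hg, jetDeriv_mul, jetDeriv_mul,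
        hf j (s + 1) (by omega), hu, jetDeriv_succ_X, if_neg] at h1
      · rw [← h1]; ring
      · simp only [Prod.mk.injEq, not_and]; omega
  have hg3 : ∀ j s, N + 2 ≤ s → jetDeriv j s g = 0 := fun j s hs =>
    hg2 (jetBound g) j s (by omega) hs
  have hu1 : jetDeriv i (N + 2) u = 1 := by rw [hu, jetDeriv_succ_X]; simp
  have h1 : jetDeriv i (N + 2) (u * u * f) = jetDeriv i (N + 1) g := by
    rw [← hg, jetDeriv_succ_dx, hg3 i (N + 2) le_rfl, map_zero, zero_add]
  have h2 : jetDeriv i (N + 2) (jetDeriv i (N + 2) (u * u * f)) = 0 := by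
    rw [h1, jetDeriv_succ_comm, hg3 i (N + 2) le_rfl, jetDeriv_zero_right]
  have hf2 : jetDeriv i (N + 2) f = 0 := hf i (N + 2) (by omega)
  simp only [jetDeriv_mul, jetDeriv_add, hf2, hu1, mul_zero, zero_add, mul_one,
    add_zero] at h2
  rw [mul_add, mul_one] at h2
  exact two_mul_eq_zero h2

/-- Apply `p = ∑ aₜ∂ᵗ` to a jet variable of order beyond all the `aₜ`; the differentiated variables
are then distinct from those of the coefficients, and `aₜ` is read off as a partial derivative. The
index `i` rules out `n = 0`, where `∂` acts as zero. -/
theorem eq_zero_of_ev_diffPoly (i : Fin n) (p : DOp (DiffPoly U))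
    (h : ∀ f, DOp.ev (RingHom.id (DiffPoly U)) p f = 0) : p = 0 := by
  have hd : ∀ s v, (⇑(d : DiffPoly U →+ DiffPoly U))^[s] (X v : DiffPoly U) = X (v.1, v.2 + s) :=
    fun s v => iterate_dx_X s v
  have key : ∀ p : DOp (DiffPoly U), ∃ M : ℕ, ∀ N t, M ≤ N →
      jetDeriv i (N + t + 1) (DOp.ev (RingHom.id (DiffPoly U)) p (X (i, N))) = DOp.coef t p := by
    intro p
    induction p using DOp.induction with
    | h0 => exact ⟨0, fun N t _ => by simp [jetDeriv_zero_right]⟩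
    | hadd p q hp hq =>
      obtain ⟨M, hM⟩ := hp
      obtain ⟨M', hM'⟩ := hq
      refine ⟨max M M', fun N t hN => ?_⟩
      rw [map_add, AddMonoidHom.add_apply, jetDeriv_add, map_add,
        hM N t (le_trans (le_max_left _ _) hN), hM' N t (le_trans (le_max_right _ _) hN)]
    | hm s a =>
      refine ⟨jetBound a, fun N t hN => ?_⟩
      rw [DOp.ev_mono, hd, jetDeriv_mul, jetDeriv_eq_zero (f := (RingHom.id (DiffPoly U)) a)
        (hN.trans (by omega)), mul_zero, add_zero, jetDeriv_succ_X, DOp.coef_mono]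
      simp only [Prod.mk.injEq, true_and, add_right_inj, RingHom.id_apply, mul_ite, mul_one,
        mul_zero]
  obtain ⟨M, hM⟩ := key p
  refine DOp.ext_coef fun t => ?_
  rw [← hM M t le_rfl, h, map_zero, jetDeriv_zero_right]

instance instJetRing : JetRing n (DiffPoly U) where
  jd := jetDer
  isDer_jd := isDer_jetDer
  bound := jetBound
  jd_eq_zero h i := jetDeriv_eq_zero h i
  evol := evolField
  isDer_evol := isDer_evolField
  evol_d := evolField_dx
  evol_add := evolField_add
  evol_bracket := evolField_bracket
  evol_eq_sum Y f _ hN := evolField_eq_sum Y f hN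
  eq_zero_of_integ := eq_zero_of_integ_diffPoly
  eq_zero_of_ev := eq_zero_of_ev_diffPoly

end Instance

/-! ### Superposition operators on spaces of paths -/

section Superposition

universe u

variable {K : Type} [TopologicalSpace K] [CompactSpace K]
  {E F : Type u} [NormedAddCommGroup E] [NormedSpace ℝ E] [NormedAddCommGroup F]
  [NormedSpace ℝ F]

/-- The pointwise evaluation of a family of operators on a family of vectors. -/
def pointwiseApply : C(K, E →L[ℝ] F) →L[ℝ] C(K, E) →L[ℝ] C(K, F) :=
  LinearMap.mkContinuous₂ (LinearMap.mk₂ ℝ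
    (fun (a : C(K, E →L[ℝ] F)) (η : C(K, E)) =>
      (⟨fun x => a x (η x), a.continuous.clm_apply η.continuous⟩ : C(K, F)))
    (fun a b η => by ext x; simp) (fun r a η => by ext x; simp)
    (fun a η ζ => by ext x; simp) (fun r a η => by ext x; simp)) 1 (fun a η => by
      rw [one_mul, ContinuousMap.norm_le _ (by positivity)]
      intro x
      exact ((a x).le_opNorm _).trans (mul_le_mul (a.norm_coe_le_norm x) (η.norm_coe_le_norm x)
        (norm_nonneg (η x)) (norm_nonneg a)))

/-- The superposition operator `γ ↦ f ∘ γ`. -/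
def superpose (f : C(E, F)) (γ : C(K, E)) : C(K, F) := f.comp γ

/-- The range of `γ` is compact, so `f'` is uniformly continuous near it. The mean value inequality
then bounds the error at all points of `K` with the same `δ`. -/
theorem hasFDerivAt_superpose {f : C(E, F)} {f' : C(E, E →L[ℝ] F)}
    (hf : ∀ x, HasFDerivAt f (f' x) x) (γ : C(K, E)) :
    HasFDerivAt (superpose f) (pointwiseApply (superpose f' γ)) γ := by
  rw [hasFDerivAt_iff_isLittleO_nhds_zero, Asymptotics.isLittleO_iff]
  intro ε hε
  have hS : IsCompact (Set.range γ) := isCompact_range γ.continuous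
  have hu := hS.uniformContinuousAt_of_continuousAt f' (fun x _ => f'.continuous.continuousAt)
    (Metric.dist_mem_uniformity hε)
  obtain ⟨δ, hδ, hd⟩ := Metric.mem_uniformity_dist.1 hu
  filter_upwards [Metric.ball_mem_nhds (0 : C(K, E)) hδ] with η hη
  rw [ContinuousMap.norm_le _ (by positivity)]
  intro x
  have hx : ‖η x‖ < δ := (η.norm_coe_le_norm x).trans_lt (by simpa using hη)
  have key := (convex_ball (γ x) δ).norm_image_sub_le_of_norm_hasFDerivWithin_le' (f := f)
    (f' := f') (φ := f' (γ x)) (C := ε) (x := γ x) (y := γ x + η x)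
    (fun z hz => (hf z).hasFDerivWithinAt) (fun z hz => ?_) (Metric.mem_ball_self hδ)
    (by simpa using hx)
  · rw [add_sub_cancel_left] at key
    exact key.trans (by gcongr; exact η.norm_coe_le_norm x)
  · have := hd (a := γ x) (b := z) (by rw [dist_comm]; exact hz) ⟨x, rfl⟩
    rw [← dist_eq_norm, dist_comm]
    exact le_of_lt this

/-- The derivative of the superposition by `f` is the superposition by `fderiv ℝ f` followed by a
continuous linear map. Induction on the order of differentiability therefore works with varying
target space. -/
theorem contDiff_superpose {f : C(E, F)} (hf : ContDiff ℝ ∞ f) :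
    ContDiff ℝ ∞ (superpose f : C(K, E) → C(K, F)) := by
  rw [contDiff_infty]
  intro m
  induction m generalizing F with
  | zero =>
    rw [Nat.cast_zero, contDiff_zero]
    exact ContinuousMap.continuous_postcomp f
  | succ m ih =>
    have hd : ∀ x, HasFDerivAt f (fderiv ℝ f x) x := fun x =>
      (hf.differentiable (by simp) x).hasFDerivAt
    have hfd : ContDiff ℝ ∞ (fderiv ℝ f) := hf.fderiv_right (m := ∞) (by simp)
    set f' : C(E, E →L[ℝ] F) := ⟨fderiv ℝ f, hfd.continuous⟩ with hf'
    have hD : ∀ γ : C(K, E), HasFDerivAt (superpose f) (pointwiseApply (superpose f' γ)) γ :=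
      fun γ => hasFDerivAt_superpose hd γ
    rw [Nat.cast_succ, contDiff_succ_iff_fderiv]
    refine ⟨fun γ => (hD γ).differentiableAt, by simp, ?_⟩
    have : fderiv ℝ (superpose f : C(K, E) → C(K, F)) =
        fun γ => pointwiseApply (superpose f' γ) := funext fun γ => (hD γ).fderiv
    rw [this]
    exact (ContinuousLinearMap.contDiff _).comp (ih (f := f') hfd)

end Superposition

/-! ### Integrals along rays -/

section Rays

open Set

/-- Integration over the unit interval. -/
def integralCLM (E : Type*) [NormedAddCommGroup E] [NormedSpace ℝ E] [CompleteSpace E] :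
    C(unitInterval, E) →L[ℝ] E :=
  LinearMap.mkContinuous
    { toFun := fun γ => ∫ t in (0 : ℝ)..1, γ (projIcc 0 1 zero_le_one t)
      map_add' := fun γ η => by
        simp only [ContinuousMap.add_apply]
        exact intervalIntegral.integral_add
          ((γ.continuous.comp continuous_projIcc).intervalIntegrable _ _)
          ((η.continuous.comp continuous_projIcc).intervalIntegrable _ _)
      map_smul' := fun r γ => by
        simp only [ContinuousMap.smul_apply, RingHom.id_apply, intervalIntegral.integral_smul] }
    1 (fun γ => by
      have := intervalIntegral.norm_integral_le_of_norm_le_const (a := 0) (b := 1) (C := ‖γ‖)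
        (f := fun t => γ (projIcc 0 1 zero_le_one t)) (fun t _ => γ.norm_coe_le_norm _)
      simpa using this)

theorem integralCLM_apply {E : Type*} [NormedAddCommGroup E] [NormedSpace ℝ E] [CompleteSpace E]
    (γ : C(unitInterval, E)) :
    integralCLM E γ = ∫ t in (0 : ℝ)..1, γ (projIcc 0 1 zero_le_one t) := rfl

/-- The integral is a composition of an affine map into paths, a superposition operator and the
integration functional, each of them smooth. -/
theorem contDiff_integral_ray {E F : Type} [NormedAddCommGroup E] [NormedSpace ℝ E]
    [NormedAddCommGroup F] [NormedSpace ℝ F] [CompleteSpace F]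
    {f : ℝ × E → F} (hf : ContDiff ℝ ∞ f) (c : E) :
    ContDiff ℝ ∞ fun u : E => ∫ t in (0 : ℝ)..1, f (t, c + t • (u - c)) := by
  let fc : C(ℝ × E, F) := ⟨f, hf.continuous⟩
  -- The parameter `t` belongs to the fixed path `γ₀`, so the linear part has zero first component.
  let L : E →L[ℝ] C(unitInterval, ℝ × E) := LinearMap.mkContinuous
    { toFun := fun v => ⟨fun t => (0, (t : ℝ) • v), by fun_prop⟩
      map_add' := fun v w => by ext t <;> simp
      map_smul' := fun r v => ContinuousMap.ext fun t =>
        Prod.ext (mul_zero r).symm (smul_comm (t : ℝ) r v) }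
    1 (fun v => by
      rw [ContinuousMap.norm_le _ (by positivity)]
      intro t
      have : |(t : ℝ)| ≤ 1 := abs_le.2 ⟨by linarith [t.2.1], t.2.2⟩
      simp only [LinearMap.coe_mk, AddHom.coe_mk, ContinuousMap.coe_mk, Prod.norm_def, norm_zero,
        norm_smul, Real.norm_eq_abs]
      refine max_le (by positivity) ?_
      gcongr)
  let γ₀ : C(unitInterval, ℝ × E) := ⟨fun t => ((t : ℝ), c), by fun_prop⟩
  have h : (fun u : E => ∫ t in (0 : ℝ)..1, f (t, c + t • (u - c))) =
      fun u => integralCLM F (superpose fc (γ₀ + L (u - c))) := by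
    funext u
    rw [integralCLM_apply]
    refine intervalIntegral.integral_congr fun t ht => ?_
    rw [uIcc_of_le zero_le_one] at ht
    simp only [projIcc_of_mem _ ht]
    change _ = f ((t : ℝ) + 0, c + t • (u - c))
    rw [add_zero]
  rw [h]
  refine (ContinuousLinearMap.contDiff _).comp ((contDiff_superpose (f := fc) hf).comp ?_)
  exact contDiff_const.add (L.contDiff.comp (contDiff_id.sub contDiff_const))

/-- A smooth function on a ball agrees on a smaller ball with a function that is smooth
everywhere. -/
theorem exists_contDiff_eqOn_ball {E F : Type} [NormedAddCommGroup E] [NormedSpace ℝ E]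
    [HasContDiffBump E] [NormedAddCommGroup F] [NormedSpace ℝ F] {f : E → F} {c : E} {ρ R : ℝ}
    (hρ : ρ < R) (hf : ContDiffOn ℝ ∞ f (Metric.ball c R)) :
    ∃ g : E → F, ContDiff ℝ ∞ g ∧ ∀ x ∈ Metric.ball c ρ, g x = f x := by
  rcases le_or_gt ρ 0 with h0 | h0
  · exact ⟨0, contDiff_const, fun x hx => by simp [Metric.ball_eq_empty.2 h0] at hx⟩
  let χ : ContDiffBump c := ⟨ρ, (ρ + R) / 2, h0, by linarith⟩
  refine ⟨fun x => χ x • f x, ?_, fun x hx => ?_⟩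
  · rw [contDiff_iff_contDiffAt]
    intro x
    by_cases hx : x ∈ Metric.ball c R
    · exact (χ.contDiff.contDiffAt).smul (hf.contDiffAt (Metric.isOpen_ball.mem_nhds hx))
    · have hmem : (Metric.closedBall c ((ρ + R) / 2))ᶜ ∈ nhds x := by
        refine Metric.isClosed_closedBall.isOpen_compl.mem_nhds fun h => hx ?_
        exact Metric.closedBall_subset_ball (by linarith) h
      refine (contDiffAt_const (c := (0 : F))).congr_of_eventuallyEq ?_
      filter_upwards [hmem] with y hy
      rw [χ.zero_of_le_dist (le_of_lt (by simpa using hy)), zero_smul]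
  · simp only
    rw [χ.one_of_mem_closedBall (Metric.ball_subset_closedBall hx), one_smul]

end Rays

/-! ### The grading -/

section Grading

open MvPolynomial

variable {n : ℕ} {U : Opens (Coord n)}

theorem hasDeg_zero (k : ℕ) : HasDeg (0 : DiffPoly U) k := isWeightedHomogeneous_zero _ _ _

theorem hasDeg_C (c : Smooth U) : HasDeg (C c : DiffPoly U) 0 := isWeightedHomogeneous_C _ _

theorem hasDeg_X (v : Fin n × ℕ) : HasDeg (X v : DiffPoly U) (v.2 + 1) :=
  isWeightedHomogeneous_X _ _ _

theorem HasDeg.add {f g : DiffPoly U} {k : ℕ} (hf : HasDeg f k) (hg : HasDeg g k) :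
    HasDeg (f + g) k := IsWeightedHomogeneous.add hf hg

theorem HasDeg.neg {f : DiffPoly U} {k : ℕ} (hf : HasDeg f k) : HasDeg (-f) k :=
  (weightedHomogeneousSubmodule (Smooth U) (fun v : Fin n × ℕ => v.2 + 1) k).neg_mem hf

theorem HasDeg.sub {f g : DiffPoly U} {k : ℕ} (hf : HasDeg f k) (hg : HasDeg g k) :
    HasDeg (f - g) k := by
  rw [sub_eq_add_neg]; exact hf.add hg.neg

theorem HasDeg.mul {f g : DiffPoly U} {k l : ℕ} (hf : HasDeg f k) (hg : HasDeg g l) :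
    HasDeg (f * g) (k + l) := IsWeightedHomogeneous.mul hf hg

theorem HasDeg.sum {ι : Type*} {s : Finset ι} {f : ι → DiffPoly U} {k : ℕ}
    (h : ∀ a ∈ s, HasDeg (f a) k) : HasDeg (∑ a ∈ s, f a) k :=
  IsWeightedHomogeneous.sum s f k h

theorem HasDeg.of_support {f g : DiffPoly U} {k : ℕ} (hf : HasDeg f k)
    (h : ∀ m, coeff m f = 0 → coeff m g = 0) : HasDeg g k :=
  fun m hm => hf fun h0 => hm (h m h0)

theorem HasDeg.eq_C {f : DiffPoly U} (hf : HasDeg f 0) : f = C (constantCoeff f) := by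
  classical
  ext m : 1
  rw [coeff_C]
  split_ifs with h
  · rw [← h]; rfl
  · by_contra hm
    have h0 := hf hm
    rw [Finsupp.weight_apply, Finsupp.sum, Finset.sum_eq_zero_iff] at h0
    refine h (Finsupp.ext fun v => ?_)
    by_contra hv
    have := h0 v (Finsupp.mem_support_iff.2 (Ne.symm hv))
    simp only [smul_eq_mul, mul_eq_zero] at this
    rcases this with h1 | h1
    · exact hv h1.symm
    · omega

theorem HasDeg.jetDeriv {f : DiffPoly U} {k l s : ℕ} (hf : HasDeg f k) (h : l + s = k)
    (i : Fin n) : HasDeg (jetDeriv i s f) l := by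
  cases s with
  | zero =>
    obtain rfl : l = k := by simpa using h
    refine hf.of_support fun m hm => ?_
    rw [coeff_jetDeriv_zero, hm, pd_zero]
  | succ s => exact IsWeightedHomogeneous.pderiv hf h

theorem HasDeg.jetDeriv_eq_zero {f : DiffPoly U} {k s : ℕ} (hf : HasDeg f k) (h : k < s)
    (i : Fin n) : LoopSpace.jetDeriv i s f = 0 := by
  obtain ⟨s, rfl⟩ : ∃ t, s = t + 1 := ⟨s - 1, by omega⟩
  refine pderiv_eq_zero_of_notMem_vars fun hv => ?_
  obtain ⟨m, hm, hvm⟩ := (mem_vars_iff_mem_support _).1 hv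
  have h0 := hf (mem_support_iff.1 hm)
  have h2 : m (i, s) ≠ 0 := Finsupp.mem_support_iff.1 hvm
  rw [Finsupp.weight_apply, Finsupp.sum] at h0
  have h3 := Finset.single_le_sum (f := fun v : Fin n × ℕ => m v • (v.2 + 1)) (fun _ _ => Nat.zero_le _) hvm
  rw [h0] at h3
  simp only [smul_eq_mul] at h3
  have : 1 * (s + 1) ≤ m (i, s) * (s + 1) := Nat.mul_le_mul_right _ (Nat.one_le_iff_ne_zero.2 h2)
  omega

theorem HasDeg.derOf {Y : Fin n → ℕ → DiffPoly U} {f : DiffPoly U} {k l : ℕ}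
    (hY : ∀ i s, HasDeg (Y i s) (k + s)) (hf : HasDeg f l) : HasDeg (derOf Y f) (k + l) := by
  rw [derOf_eq_sum Y f (N := l + 1) fun i s hs => hf.jetDeriv_eq_zero hs i]
  refine HasDeg.sum fun i _ => HasDeg.sum fun s hs => ?_
  have hs' : s ≤ l := by simpa [Nat.lt_succ_iff] using hs
  have := (hY i s).mul (hf.jetDeriv (l := l - s) (s := s) (by omega) i)
  rwa [show k + s + (l - s) = k + l by omega] at this

theorem HasDeg.dx {f : DiffPoly U} {k : ℕ} (hf : HasDeg f k) : HasDeg (dx f) (k + 1) := by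
  rw [add_comm]
  exact HasDeg.derOf (fun i s => by rw [add_comm]; exact hasDeg_X (i, s)) hf

theorem HasDeg.iterate_dx {f : DiffPoly U} {k : ℕ} (hf : HasDeg f k) (s : ℕ) :
    HasDeg (LoopSpace.dx^[s] f) (k + s) := by
  induction s with
  | zero => exact hf
  | succ s ih => rw [Function.iterate_succ_apply']; exact ih.dx

/-- Differential operators of degree `k`, where `∂` has degree one. -/
def opDeg (U : Opens (Coord n)) (k : ℕ) : AddSubgroup (DOp (DiffPoly U)) :=
  AddSubgroup.closure {p | ∃ s a e, HasDeg a e ∧ e + s = k ∧ DOp.mono s a = p}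

theorem mono_mem_opDeg {a : DiffPoly U} {e s k : ℕ} (ha : HasDeg a e) (h : e + s = k) :
    DOp.mono s a ∈ opDeg U k := AddSubgroup.subset_closure ⟨s, a, e, ha, h, rfl⟩

theorem nabla_mem_opDeg {p : DOp (DiffPoly U)} {k : ℕ} (hp : p ∈ opDeg U k) :
    DOp.nabla p ∈ opDeg U (k + 1) := by
  induction hp using AddSubgroup.closure_induction with
  | mem p hp =>
    obtain ⟨t, a, e', ha, h', rfl⟩ := hp
    rw [DOp.nabla_mono]
    exact add_mem (mono_mem_opDeg ha.dx (by omega)) (mono_mem_opDeg ha (by omega))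
  | zero => rw [map_zero]; exact zero_mem _
  | add p q _ _ hp hq => rw [map_add]; exact add_mem hp hq
  | neg p _ hp => rw [map_neg]; exact neg_mem hp

theorem iterate_nabla_mem_opDeg {p : DOp (DiffPoly U)} {k : ℕ} (hp : p ∈ opDeg U k) (s : ℕ) :
    DOp.nabla^[s] p ∈ opDeg U (k + s) := by
  induction s with
  | zero => exact hp
  | succ s ih => rw [Function.iterate_succ_apply']; exact nabla_mem_opDeg ih

theorem smul_mem_opDeg {a : DiffPoly U} {p : DOp (DiffPoly U)} {e k : ℕ} (ha : HasDeg a e)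
    (hp : p ∈ opDeg U k) : a • p ∈ opDeg U (e + k) := by
  induction hp using AddSubgroup.closure_induction with
  | mem p hp =>
    obtain ⟨t, b, e', hb, h', rfl⟩ := hp
    rw [DOp.smul_mono]
    exact mono_mem_opDeg (ha.mul hb) (by omega)
  | zero => rw [smul_zero]; exact zero_mem _
  | add p q _ _ hp hq => rw [smul_add]; exact add_mem hp hq
  | neg p _ hp => rw [smul_neg]; exact neg_mem hp

theorem mul_mem_opDeg {p q : DOp (DiffPoly U)} {k l : ℕ} (hp : p ∈ opDeg U k)
    (hq : q ∈ opDeg U l) : p * q ∈ opDeg U (k + l) := by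
  induction hp using AddSubgroup.closure_induction with
  | mem p hp =>
    obtain ⟨t, b, e', hb, h', rfl⟩ := hp
    rw [DOp.mono_mul]
    have := smul_mem_opDeg hb (iterate_nabla_mem_opDeg hq t)
    rwa [show e' + (l + t) = k + l by omega] at this
  | zero => rw [zero_mul]; exact zero_mem _
  | add p q _ _ hp hq => rw [add_mul]; exact add_mem hp hq
  | neg p _ hp => rw [neg_mul]; exact neg_mem hp

theorem adj_mem_opDeg {p : DOp (DiffPoly U)} {k : ℕ} (hp : p ∈ opDeg U k) :
    DOp.adj p ∈ opDeg U k := by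
  induction hp using AddSubgroup.closure_induction with
  | mem p hp =>
    obtain ⟨t, b, e', hb, rfl, rfl⟩ := hp
    simp only [DOp.adj, DOp.lift_mono, AddMonoidHom.mk'_apply]
    exact zsmul_mem (iterate_nabla_mem_opDeg (mono_mem_opDeg hb (add_zero _)) t) _
  | zero => rw [map_zero]; exact zero_mem _
  | add p q _ _ hp hq => rw [map_add]; exact add_mem hp hq
  | neg p _ hp => rw [map_neg]; exact neg_mem hp

theorem HasDeg.ev {p : DOp (DiffPoly U)} {k l : ℕ} (hp : p ∈ opDeg U k) {f : DiffPoly U}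
    (hf : HasDeg f l) : HasDeg (DOp.ev (RingHom.id (DiffPoly U)) p f) (k + l) := by
  induction hp using AddSubgroup.closure_induction with
  | mem p hp =>
    obtain ⟨t, b, e', hb, rfl, rfl⟩ := hp
    rw [DOp.ev_mono]
    have := hb.mul (hf.iterate_dx t)
    rwa [show e' + (l + t) = e' + t + l by omega] at this
  | zero => rw [map_zero]; exact hasDeg_zero _
  | add p q _ _ hp hq => rw [map_add]; exact hp.add hq
  | neg p _ hp => rw [map_neg]; exact hp.neg

theorem frSym_mem_opDeg {f : DiffPoly U} {k : ℕ} (hf : HasDeg f k) (i : Fin n) :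
    JetRing.frSym f i ∈ opDeg U k := by
  rw [JetRing.frSym_eq (N := k + 1) f i fun j s hs => hf.jetDeriv_eq_zero hs j]
  refine sum_mem fun s hs => ?_
  have hs' : s ≤ k := by simpa [Nat.lt_succ_iff] using hs
  exact mono_mem_opDeg (hf.jetDeriv (l := k - s) (by omega) i) (by omega)

/-- Series whose coefficient of `εᵏ` has degree `k`. -/
def Graded (f : PowerSeries (DiffPoly U)) : Prop := ∀ k, HasDeg (PowerSeries.coeff k f) k

/-- Matrix operators whose coefficient of `εᵏ` has degree `k`. -/
def GradedOp (M : JetRing.MOp n (DiffPoly U)) : Prop :=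
  ∀ k i j, PowerSeries.coeff k M i j ∈ opDeg U k

theorem Graded.mul {f g : PowerSeries (DiffPoly U)} (hf : Graded f) (hg : Graded g) :
    Graded (f * g) := fun k => by
  rw [PowerSeries.coeff_mul]
  refine HasDeg.sum fun q hq => ?_
  have := (hf q.1).mul (hg q.2)
  rwa [Finset.HasAntidiagonal.mem_antidiagonal.1 hq] at this

theorem Graded.sum {ι : Type*} {s : Finset ι} {f : ι → PowerSeries (DiffPoly U)}
    (h : ∀ a ∈ s, Graded (f a)) : Graded (∑ a ∈ s, f a) := fun k => by
  rw [map_sum]; exact HasDeg.sum fun a ha => h a ha k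

theorem graded_C (c : Smooth U) : Graded (PowerSeries.C (C c : DiffPoly U)) := fun k => by
  rw [PowerSeries.coeff_C]
  split_ifs with h
  · rw [h]; exact hasDeg_C c
  · exact hasDeg_zero _

theorem GradedOp.act {M : JetRing.MOp n (DiffPoly U)} (hM : GradedOp M)
    {f : Fin n → PowerSeries (DiffPoly U)} (hf : ∀ i, Graded (f i)) (i : Fin n) :
    Graded (JetRing.act PowerSeries.C M f i) := fun k => by
  rw [JetRing.coeff_act_C]
  refine HasDeg.sum fun q hq => HasDeg.sum fun j _ => ?_
  have := HasDeg.ev (hM q.1 i j) (hf j q.2)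
  rwa [Finset.HasAntidiagonal.mem_antidiagonal.1 hq] at this

theorem GradedOp.adjM {M : JetRing.MOp n (DiffPoly U)} (hM : GradedOp M) :
    GradedOp (JetRing.adjM M) := fun k i j => by
  rw [JetRing.adjM, PowerSeries.coeff_mk]
  exact adj_mem_opDeg (hM k j i)

theorem gradedOp_fr {T : Fin n → PowerSeries (DiffPoly U)} (hT : ∀ i, Graded (T i)) :
    GradedOp (JetRing.fr T) := fun k i j => by
  rw [JetRing.fr, PowerSeries.coeff_mk]
  exact frSym_mem_opDeg (hT i k) j

end Grading

/-! ### The Euler vector field on a ball -/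

section Euler

open MvPolynomial

variable {n : ℕ} {U : Opens (Coord n)}

/-- The coordinates centred at `c`, which are the components of the Euler vector field. -/
def euler (c : Coord n) (i : Fin n) : DiffPoly U :=
  C (coordFn i - algebraMap ℝ (Smooth U) (c i))

theorem pd_coordFn_sub (c : Coord n) (i j : Fin n) :
    pd j (coordFn i - algebraMap ℝ (Smooth U) (c i)) = if i = j then 1 else 0 := by
  rw [← pd_coordFn i j]
  refine (map_sub (pdDer j) _ _).trans ?_
  rw [pdDer_apply, pdDer_apply, pd_algebraMap, sub_zero]

theorem evolField_euler (c : Coord n) (Y : Fin n → DiffPoly U) (i : Fin n) :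
    evolField Y (euler c i) = Y i := by
  rw [euler, evolField_C, Finset.sum_eq_single i]
  · rw [pd_coordFn_sub, if_pos rfl, C_1, mul_one]
  · intro j _ hj
    rw [pd_coordFn_sub, if_neg hj.symm, C_0, mul_zero]
  · exact fun h => absurd (Finset.mem_univ i) h

theorem iterate_dx_euler (c : Coord n) (i : Fin n) (s : ℕ) :
    dx^[s + 1] (euler c i : DiffPoly U) = X (i, s) := by
  rw [Function.iterate_succ_apply, euler, dx_C, Finset.sum_eq_single i]
  · rw [pd_coordFn_sub, if_pos rfl, C_1, mul_one, iterate_dx_X, zero_add]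
  · intro j _ hj
    rw [pd_coordFn_sub, if_neg hj.symm, C_0, mul_zero]
  · exact fun h => absurd (Finset.mem_univ i) h

/-- The radial derivative with respect to the centre `c`. -/
def radial (c : Coord n) (g : Smooth U) : Smooth U :=
  ∑ i, (coordFn i - algebraMap ℝ (Smooth U) (c i)) * pd i g

theorem radial_apply (c : Coord n) (g : Smooth U) (u : U) :
    (radial c g).1 u = fderiv ℝ (zeroExt g.1) u (u - c) := by
  rw [fderiv_zeroExt_apply]
  have : (radial c g).1 u = ∑ i, ((coordFn i : Smooth U).1 u - c i) * (pd i g).1 u := by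
    simp [radial]
  rw [this]
  rfl

theorem radial_add (c : Coord n) (f g : Smooth U) : radial c (f + g) = radial c f + radial c g := by
  simp only [radial, pd_add, mul_add, Finset.sum_add_distrib]

theorem radial_zero (c : Coord n) : radial c (0 : Smooth U) = 0 := by
  simp only [radial, pd_zero, mul_zero, Finset.sum_const_zero]

theorem evolField_euler_C (c : Coord n) (g : Smooth U) :
    evolField (euler c) (C g : DiffPoly U) = C (radial c g) := by
  rw [evolField_C, radial, map_sum]
  simp only [euler, C_mul]

/-- The Euler field maps each jet variable to itself and acts radially on coefficients, so it
preserves monomials. Here `m.degree` counts jet factors; it is not the differential degree. -/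
theorem coeff_evolField_euler (c : Coord n) (f : DiffPoly U) (m : Fin n × ℕ →₀ ℕ) :
    coeff m (evolField (euler c) f) = radial c (coeff m f) + (m.degree : Smooth U) * coeff m f := by
  classical
  induction f using MvPolynomial.induction_on generalizing m with
  | C g =>
    rw [evolField_euler_C, coeff_C, coeff_C]
    split_ifs with h
    · rw [← h]; simp
    · rw [radial_zero]; simp
  | add f g hf hg => rw [map_add, coeff_add, hf, hg, coeff_add, radial_add]; ring
  | mul_X f v hf =>
    rw [isDer_evolField, evolField_X, iterate_dx_euler, coeff_add, mul_comm (X v), coeff_mul_X',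
      coeff_mul_X']
    split_ifs with hv
    · rw [hf]
      have h1 : m = (m - Finsupp.single v 1) + Finsupp.single v 1 := by
        refine (tsub_add_cancel_of_le ?_).symm
        rw [Finsupp.single_le_iff]
        exact Nat.one_le_iff_ne_zero.2 (Finsupp.mem_support_iff.1 hv)
      have h2 : m.degree = (m - Finsupp.single v 1).degree + 1 := by
        conv_lhs => rw [h1]
        rw [map_add, Finsupp.degree_single]
      rw [h2]
      push_cast
      ring
    · rw [radial_zero, mul_zero]

/-- With `S` the ray integral, `t^{k+1} S(c + tv) = ∫₀ᵗ sᵏ g(c + sv) ds` by rescaling. The identity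
is the derivative of this at `t = 1`. -/
theorem integral_ray_radial {E : Type} [NormedAddCommGroup E] [NormedSpace ℝ E] {g : E → ℝ}
    (hg : ContDiff ℝ ∞ g) (c : E) (k : ℕ) (u : E) :
    fderiv ℝ (fun x => ∫ t in (0 : ℝ)..1, t ^ k * g (c + t • (x - c))) u (u - c) +
      (k + 1) * ∫ t in (0 : ℝ)..1, t ^ k * g (c + t • (u - c)) = g u := by
  set S : E → ℝ := fun x => ∫ t in (0 : ℝ)..1, t ^ k * g (c + t • (x - c)) with hS
  have hSd : ContDiff ℝ ∞ S :=
    contDiff_integral_ray (f := fun p : ℝ × E => p.1 ^ k * g p.2)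
      ((contDiff_fst.pow k).mul (hg.comp contDiff_snd)) c
  set v := u - c with hv
  have hline : HasDerivAt (fun t : ℝ => c + t • v) v 1 := by
    simpa using ((hasDerivAt_id (1 : ℝ)).smul_const v).const_add c
  have hu : c + (1 : ℝ) • v = u := by simp [hv]
  have h1 : HasDerivAt (fun t : ℝ => t ^ (k + 1) * S (c + t • v))
      ((k + 1) * S u + fderiv ℝ S u v) 1 := by
    have hSu : HasFDerivAt S (fderiv ℝ S u) (c + (1 : ℝ) • v) := by
      rw [hu]; exact (hSd.differentiable (by simp) u).hasFDerivAt
    have := (hasDerivAt_pow (k + 1) (1 : ℝ)).mul (hSu.comp_hasDerivAt 1 hline)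
    exact HasDerivAt.congr_deriv this (by rw [Function.comp_apply, hu]; simp)
  set F : ℝ → ℝ := fun t => t ^ k * g (c + t • v) with hF
  have hFc : Continuous F := by
    have := hg.continuous
    fun_prop
  have h2 : (fun t : ℝ => t ^ (k + 1) * S (c + t • v)) = fun t => ∫ s in (0 : ℝ)..t, F s := by
    funext t
    have := intervalIntegral.smul_integral_comp_mul_left F t (a := 0) (b := 1)
    rw [mul_zero, mul_one] at this
    rw [← this, smul_eq_mul, pow_succ', mul_assoc, hS]
    simp only
    rw [← intervalIntegral.integral_const_mul]
    congr 1
    refine intervalIntegral.integral_congr fun s _ => ?_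
    simp only [hF, add_sub_cancel_left, smul_smul]
    rw [mul_pow, mul_comm s t]
    ring
  have h3 : HasDerivAt (fun t => ∫ s in (0 : ℝ)..t, F s) (F 1) 1 :=
    intervalIntegral.integral_hasDerivAt_right (hFc.intervalIntegrable _ _)
      hFc.aestronglyMeasurable.stronglyMeasurableAtFilter hFc.continuousAt
  rw [h2] at h1
  have := h1.unique h3
  simp only [hF, one_pow, one_mul, hu] at this
  rw [← this]; ring

variable {c : Coord n} {R : ℝ}

/-- The function `u ↦ ∫₀¹ tᵏ g(c + t(u - c)) dt` for an arbitrary extension of `g`. -/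
def rayFun (c : Coord n) (k : ℕ) (g : Coord n → ℝ) (x : Coord n) : ℝ :=
  ∫ t in (0 : ℝ)..1, t ^ k * g (c + t • (x - c))

theorem rayFun_congr {ρ : ℝ} {f g : Coord n → ℝ} (h : ∀ x ∈ Metric.ball c ρ, g x = f x) (k : ℕ)
    {x : Coord n} (hx : x ∈ Metric.ball c ρ) : rayFun c k g x = rayFun c k f x := by
  refine intervalIntegral.integral_congr fun t ht => ?_
  rw [Set.uIcc_of_le zero_le_one] at ht
  have : c + t • (x - c) ∈ Metric.ball c ρ := by
    rw [mem_ball_iff_norm, add_sub_cancel_left, norm_smul, Real.norm_eq_abs, abs_of_nonneg ht.1]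
    refine lt_of_le_of_lt ?_ (mem_ball_iff_norm.1 hx)
    exact mul_le_of_le_one_left (norm_nonneg _) ht.2
  simp only [h _ this]

/-- The ray integral at `u` sees `g` only on the segment from `c` to `u`, inside a smaller
concentric ball. There `g` may be replaced by a function smooth everywhere, to which the results on
ray integrals apply. -/
theorem exists_extension_near (g : Smooth (openBall c R)) (u : openBall c R) :
    ∃ (ρ : ℝ) (g' : Coord n → ℝ), ContDiff ℝ ∞ g' ∧ (u : Coord n) ∈ Metric.ball c ρ ∧
      ρ < R ∧ ∀ x ∈ Metric.ball c ρ, g' x = zeroExt g.1 x := by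
  have hu : dist (u : Coord n) c < R := u.2
  obtain ⟨ρ, h1, h2⟩ := exists_between hu
  obtain ⟨g', hg', h⟩ := exists_contDiff_eqOn_ball (c := c) h2 (f := zeroExt g.1) g.2
  exact ⟨ρ, g', hg', h1, h2, h⟩

theorem contDiff_rayFun {g : Coord n → ℝ} (hg : ContDiff ℝ ∞ g) (k : ℕ) :
    ContDiff ℝ ∞ (rayFun c k g) :=
  contDiff_integral_ray (f := fun p : ℝ × Coord n => p.1 ^ k * g p.2)
    ((contDiff_fst.pow k).mul (hg.comp contDiff_snd)) c

theorem rayFun_eventuallyEq {ρ : ℝ} {f g : Coord n → ℝ} (h : ∀ x ∈ Metric.ball c ρ, g x = f x)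
    (k : ℕ) {x : Coord n} (hx : x ∈ Metric.ball c ρ) : rayFun c k f =ᶠ[nhds x] rayFun c k g := by
  filter_upwards [Metric.isOpen_ball.mem_nhds hx] with y hy
  exact (rayFun_congr h k hy).symm

/-- The smooth function `u ↦ ∫₀¹ tᵏ g(c + t(u - c)) dt` on a ball centred at `c`. -/
def raySmooth (k : ℕ) (g : Smooth (openBall c R)) : Smooth (openBall c R) :=
  Smooth.ofFun (rayFun c k (zeroExt g.1)) fun u hu => by
    obtain ⟨ρ, g', hg', hu', -, h⟩ := exists_extension_near g ⟨u, hu⟩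
    exact ((contDiff_rayFun hg' k).contDiffAt.congr_of_eventuallyEq
      (rayFun_eventuallyEq h k hu')).contDiffWithinAt

theorem raySmooth_zero (k : ℕ) : raySmooth k (0 : Smooth (openBall c R)) = 0 := by
  refine Smooth.ext fun u => ?_
  change rayFun c k (zeroExt 0) u = 0
  have : zeroExt (0 : openBall c R → ℝ) = 0 := by
    funext x
    by_cases hx : x ∈ openBall c R
    · exact zeroExt_apply (0 : openBall c R → ℝ) ⟨x, hx⟩
    · exact Function.extend_apply' _ _ _ (by rintro ⟨y, rfl⟩; exact hx y.2)
  rw [this, rayFun]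
  simp

theorem radial_raySmooth (k : ℕ) (g : Smooth (openBall c R)) :
    radial c (raySmooth k g) + ((k + 1 : ℕ) : Smooth (openBall c R)) * raySmooth k g = g := by
  refine Smooth.ext fun u => ?_
  obtain ⟨ρ, g', hg', hu', -, h⟩ := exists_extension_near g u
  have h1 : (radial c (raySmooth k g)).1 u = fderiv ℝ (rayFun c k g') u (u - c) := by
    rw [radial_apply]
    congr 1
    refine Filter.EventuallyEq.fderiv_eq ?_
    exact (zeroExt_eventuallyEq (fun u => rfl) u).trans (rayFun_eventuallyEq h k hu')
  have h2 : (raySmooth k g).1 u = rayFun c k g' u := (rayFun_congr h k hu').symm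
  have h3 := integral_ray_radial hg' c k u
  change (radial c (raySmooth k g)).1 u + (((k + 1 : ℕ) : Smooth (openBall c R)).1 u) *
    (raySmooth k g).1 u = _
  have h4 : ((k + 1 : ℕ) : Smooth (openBall c R)).1 u = k + 1 := by
    have : ((k + 1 : ℕ) : Smooth (openBall c R)).1 = ((k + 1 : ℕ) : openBall c R → ℝ) := rfl
    rw [this]; simp
  rw [h1, h2, h4]
  refine h3.trans ?_
  rw [h _ hu', zeroExt_apply]

/-- Along the ray through `u` the function `t^{k+1} g(c + tv)` has zero derivative and vanishes at
`t = 0`, hence also at `t = 1`. -/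
theorem eq_zero_of_radial (k : ℕ) {g : Smooth (openBall c R)}
    (h : radial c g + ((k + 1 : ℕ) : Smooth (openBall c R)) * g = 0) : g = 0 := by
  refine Smooth.ext fun u => ?_
  set v : Coord n := u - c with hv
  have hmem : ∀ t ∈ Set.Icc (0 : ℝ) 1, c + t • v ∈ openBall c R := by
    intro t ht
    change _ ∈ Metric.ball c R
    rw [mem_ball_iff_norm, add_sub_cancel_left, norm_smul, Real.norm_eq_abs, abs_of_nonneg ht.1]
    refine lt_of_le_of_lt ?_ (mem_ball_iff_norm.1 u.2)
    exact mul_le_of_le_one_left (norm_nonneg _) ht.2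
  have hd : ∀ t ∈ Set.Icc (0 : ℝ) 1,
      HasDerivAt (fun t : ℝ => t ^ (k + 1) * zeroExt g.1 (c + t • v)) 0 t := by
    intro t ht
    have hline : HasDerivAt (fun t : ℝ => c + t • v) v t := by
      simpa using ((hasDerivAt_id t).smul_const v).const_add c
    have h1 := (hasDerivAt_pow (k + 1) t).mul
      ((Smooth.differentiableAt g ⟨_, hmem t ht⟩).hasFDerivAt.comp_hasDerivAt t hline)
    refine HasDerivAt.congr_deriv h1 ?_
    have h2 : (radial c g).1 ⟨_, hmem t ht⟩ + (k + 1) * g.1 ⟨_, hmem t ht⟩ = 0 := by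
      have h4 : ((k + 1 : ℕ) : Smooth (openBall c R)).1 ⟨_, hmem t ht⟩ = k + 1 := by
        have : ((k + 1 : ℕ) : Smooth (openBall c R)).1 = ((k + 1 : ℕ) : openBall c R → ℝ) := rfl
        rw [this]; simp
      rw [← h4]
      exact congrFun (congrArg Subtype.val h) ⟨_, hmem t ht⟩
    rw [radial_apply] at h2
    simp only [add_sub_cancel_left, map_smul, smul_eq_mul] at h2
    have h3 : zeroExt g.1 (c + t • v) = g.1 ⟨_, hmem t ht⟩ :=
      zeroExt_apply g.1 ⟨_, hmem t ht⟩
    simp only [Function.comp_apply, h3, add_tsub_cancel_right]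
    push_cast
    linear_combination t ^ k * h2
  have := constant_of_has_deriv_right_zero
    (f := fun t : ℝ => t ^ (k + 1) * zeroExt g.1 (c + t • v)) (a := 0) (b := 1)
    (fun t ht => (hd t ht).continuousAt.continuousWithinAt)
    (fun t ht => (hd t ⟨ht.1, ht.2.le⟩).hasDerivWithinAt) 1 ⟨zero_le_one, le_rfl⟩
  simp only [one_pow, one_smul, one_mul, hv, add_sub_cancel, ne_eq, Nat.add_eq_zero_iff, one_ne_zero,
    and_false, not_false_eq_true, zero_pow, zero_mul] at this
  rw [← zeroExt_apply g.1 u]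
  exact this

/-- Coefficientwise this inverts the radial derivative plus `m.degree + 1`, which the ray integral
with exponent `m.degree` does. No new monomials appear, so degrees are preserved. -/
theorem exists_evolField_euler (f : DiffPoly (openBall c R)) :
    ∃ g : DiffPoly (openBall c R), evolField (euler c) g + g = f ∧
      ∀ m, coeff m f = 0 → coeff m g = 0 := by
  classical
  let g : DiffPoly (openBall c R) :=
    ∑ m ∈ f.support, monomial m (raySmooth m.degree (coeff m f))
  have hg : ∀ m, coeff m g = raySmooth m.degree (coeff m f) := by
    intro m
    simp only [g, coeff_sum, coeff_monomial, Finset.sum_ite_eq']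
    split_ifs with h
    · rfl
    · rw [notMem_support_iff.1 h, raySmooth_zero]
  refine ⟨g, ?_, fun m hm => by rw [hg, hm, raySmooth_zero]⟩
  ext m : 1
  rw [coeff_add, coeff_evolField_euler, hg]
  conv_rhs => rw [← radial_raySmooth m.degree (coeff m f)]
  push_cast
  ring

theorem eq_zero_of_evolField_euler {f : DiffPoly (openBall c R)}
    (h : evolField (euler c) f + 2 * f = 0) : f = 0 := by
  ext m : 1
  rw [coeff_zero]
  refine eq_zero_of_radial (m.degree + 1) ?_
  have h1 := congrArg (coeff m) h
  rw [two_mul, coeff_add, coeff_add, coeff_evolField_euler, coeff_zero] at h1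
  rw [← h1]
  push_cast
  ring

theorem exists_prV_euler {η : Fin n → PowerSeries (DiffPoly (openBall c R))}
    (hη : ∀ i, Graded (η i)) :
    ∃ θ : Fin n → PowerSeries (DiffPoly (openBall c R)),
      JetRing.prV (fun i => PowerSeries.C (euler c i)) θ + θ = η ∧ (∀ i, Graded (θ i)) ∧
      ∀ i k, PowerSeries.coeff k (η i) = 0 → PowerSeries.coeff k (θ i) = 0 := by
  choose g h1 h2 using exists_evolField_euler (c := c) (R := R)
  refine ⟨fun i => PowerSeries.mk fun k => g (PowerSeries.coeff k (η i)), ?_, fun i k => ?_,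
    fun i k h => ?_⟩
  · funext i
    ext k : 1
    rw [Pi.add_apply, map_add, JetRing.prV_apply, JetRing.coeff_evolS_C, PowerSeries.coeff_mk]
    exact h1 _
  · rw [PowerSeries.coeff_mk]
    exact (hη i k).of_support (h2 _)
  · rw [PowerSeries.coeff_mk, h]
    ext m : 1
    exact h2 0 m (coeff_zero _)

end Euler

/-! ### The Schouten bracket and closed 2-forms -/

section Schouten

open PowerSeries (coeff C X)
open Finset.HasAntidiagonal (antidiagonal)
open JetRing

variable {n : ℕ} {A : Type*} [CommRing A] [JetRing n A]

theorem EpsLin.integ_eq_zero {ι : Type*} {Φ : (ι → PowerSeries A) → PowerSeries A}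
    (hΦ : EpsLin A Φ) (h : ∀ a : ι → A, integ (Φ fun i => C (a i)) = 0) (v : ι → PowerSeries A) :
    integ (Φ v) = 0 := by
  rw [integ_series_eq_zero_iff]
  intro k
  induction k generalizing v with
  | zero =>
    obtain ⟨w, hw⟩ := exists_eq_C_add_X_smul v
    rw [hw, hΦ.map_add, _root_.map_add, _root_.map_add, integ_series_eq_zero_iff.1 (h _), hΦ.map_X, zero_add,
      smul_eq_mul, PowerSeries.coeff_zero_X_mul, map_zero]
  | succ k ih =>
    obtain ⟨w, hw⟩ := exists_eq_C_add_X_smul v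
    rw [hw, hΦ.map_add, _root_.map_add, _root_.map_add, integ_series_eq_zero_iff.1 (h _), hΦ.map_X, zero_add,
      smul_eq_mul, PowerSeries.coeff_succ_X_mul, ih]

theorem EpsLin.add {ι : Type*} {Φ Ψ : (ι → PowerSeries A) → PowerSeries A} (hΦ : EpsLin A Φ)
    (hΨ : EpsLin A Ψ) : EpsLin A fun v => Φ v + Ψ v :=
  ⟨fun v w => by rw [hΦ.map_add, hΨ.map_add]; abel,
    fun v => by rw [hΦ.map_X, hΨ.map_X, smul_add]⟩

namespace JetRing

theorem act_X (M : MOp n A) (f : Fin n → PowerSeries A) :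
    act C M ((X : PowerSeries A) • f) = (X : PowerSeries A) • act C M f := by
  have hd : ∀ (s : ℕ) (g : PowerSeries A), d^[s] (X * g) = X * d^[s] g := by
    intro s g
    induction s with
    | zero => rfl
    | succ s ih => rw [Function.iterate_succ_apply', ih, d_X_mul, ← Function.iterate_succ_apply' d]
  have h : ∀ (p : DOp A) (g : PowerSeries A), DOp.ev C p (X * g) = X * DOp.ev C p g := by
    intro p g
    induction p using DOp.induction with
    | h0 => simp
    | hadd p q hp hq => simp only [map_add, AddMonoidHom.add_apply, hp, hq, mul_add]
    | hm s a => rw [DOp.ev_mono, DOp.ev_mono, hd, mul_left_comm]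
  funext i
  simp only [act_apply, Pi.smul_apply, smul_eq_mul, h, mul_epsSum, Finset.mul_sum]

theorem prV_X (Y Z : Fin n → PowerSeries A) :
    prV Y ((X : PowerSeries A) • Z) = (X : PowerSeries A) • prV Y Z :=
  funext fun _ => evolS_X _ _

theorem prV_X_left (Y Z : Fin n → PowerSeries A) :
    prV ((X : PowerSeries A) • Y) Z = (X : PowerSeries A) • prV Y Z :=
  funext fun _ => evolS_X_left _ _

theorem neg_act (M : MOp n A) (f : Fin n → PowerSeries A) : act C (-M) f = -act C M f := by
  have := sub_act C 0 M f
  rw [zero_sub] at this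
  rw [this]
  have h0 := add_act C (0 : MOp n A) 0 f
  rw [add_zero] at h0
  rw [left_eq_add.1 h0, zero_sub]

theorem act_neg (M : MOp n A) (f : Fin n → PowerSeries A) : act C M (-f) = -act C M f := by
  have := act_sub C M 0 f
  rw [zero_sub, act_zero, zero_sub] at this
  exact this

/-- The derivative `(∂_Y M) f` of a matrix operator along a vector field. -/
def derOp (Y : Fin n → PowerSeries A) (M : MOp n A) (f : Fin n → PowerSeries A) :
    Fin n → PowerSeries A :=
  prV Y (act C M f) - act C M (prV Y f)

/-- The density of the trilinear form `∫ φ (∂_{Nχ} M) ψ`. -/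
def triple (M N : MOp n A) (φ ψ χ : Fin n → PowerSeries A) : PowerSeries A :=
  ∑ i, φ i * derOp (act C N χ) M ψ i

theorem integ_triple (M N : MOp n A) (φ ψ χ : Fin n → PowerSeries A) :
    integ (triple M N φ ψ χ) = pair φ (derOp (act C N χ) M ψ) := rfl

theorem derOp_add_left (Y Z : Fin n → PowerSeries A) (M : MOp n A) (f : Fin n → PowerSeries A) :
    derOp (Y + Z) M f = derOp Y M f + derOp Z M f := by
  simp only [derOp, prV_add_left, act_add]; abel

theorem derOp_add (Y : Fin n → PowerSeries A) (M : MOp n A) (f g : Fin n → PowerSeries A) :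
    derOp Y M (f + g) = derOp Y M f + derOp Y M g := by
  simp only [derOp, prV_add, act_add]; abel

theorem derOp_X_left (Y : Fin n → PowerSeries A) (M : MOp n A) (f : Fin n → PowerSeries A) :
    derOp ((X : PowerSeries A) • Y) M f = (X : PowerSeries A) • derOp Y M f := by
  simp only [derOp, prV_X_left, act_X, smul_sub]

theorem derOp_X (Y : Fin n → PowerSeries A) (M : MOp n A) (f : Fin n → PowerSeries A) :
    derOp Y M ((X : PowerSeries A) • f) = (X : PowerSeries A) • derOp Y M f := by
  simp only [derOp, prV_X, act_X, smul_sub]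

theorem epsLin_triple_fst (M N : MOp n A) (ψ χ : Fin n → PowerSeries A) :
    EpsLin A fun φ => triple M N φ ψ χ :=
  ⟨fun φ φ' => by simp only [triple, Pi.add_apply, add_mul, Finset.sum_add_distrib],
    fun φ => by simp only [triple, Pi.smul_apply, smul_eq_mul, Finset.mul_sum, mul_assoc]⟩

theorem epsLin_triple_snd (M N : MOp n A) (φ χ : Fin n → PowerSeries A) :
    EpsLin A fun ψ => triple M N φ ψ χ :=
  ⟨fun ψ ψ' => by
    simp only [triple, derOp_add, Pi.add_apply, mul_add, Finset.sum_add_distrib],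
    fun ψ => by
    simp only [triple, derOp_X, Pi.smul_apply, smul_eq_mul, Finset.mul_sum, mul_left_comm]⟩

theorem epsLin_triple_thd (M N : MOp n A) (φ ψ : Fin n → PowerSeries A) :
    EpsLin A fun χ => triple M N φ ψ χ :=
  ⟨fun χ χ' => by
    simp only [triple, act_add, derOp_add_left, Pi.add_apply, mul_add, Finset.sum_add_distrib],
    fun χ => by
    simp only [triple, act_X, derOp_X_left, Pi.smul_apply, smul_eq_mul, Finset.mul_sum,
      mul_left_comm]⟩

/-- The density of the Schouten bracket of two operators. -/
def schoutenD (M N : MOp n A) (φ ψ χ : Fin n → PowerSeries A) : PowerSeries A :=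
  (triple M N φ ψ χ + triple N M φ ψ χ) + (triple M N χ φ ψ + triple N M χ φ ψ) +
    (triple M N ψ χ φ + triple N M ψ χ φ)

/-- The bracket is assumed to vanish on `ε`-independent 1-forms, but closedness of the inverse needs
1-forms `Ω Y` depending on `ε`. Trilinearity and compatibility with `ε` provide the extension. -/
theorem integ_schoutenD {M N : MOp n A} (h : ∀ φ ψ χ : Fin n → A,
    integ (schoutenD M N (fun i => C (φ i)) (fun i => C (ψ i)) fun i => C (χ i)) = 0)
    (φ ψ χ : Fin n → PowerSeries A) : integ (schoutenD M N φ ψ χ) = 0 := by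
  refine EpsLin.integ_eq_zero (Φ := fun φ => schoutenD M N φ ψ χ) ?_ (fun φ => ?_) φ
  · exact ((EpsLin.add (EpsLin.add (epsLin_triple_fst _ _ _ _) (epsLin_triple_fst _ _ _ _))
      (EpsLin.add (epsLin_triple_snd _ _ _ _) (epsLin_triple_snd _ _ _ _))).add
      (EpsLin.add (epsLin_triple_thd _ _ _ _) (epsLin_triple_thd _ _ _ _)))
  refine EpsLin.integ_eq_zero (Φ := fun ψ => schoutenD M N (fun i => C (φ i)) ψ χ) ?_
    (fun ψ => ?_) ψ
  · exact ((EpsLin.add (EpsLin.add (epsLin_triple_snd _ _ _ _) (epsLin_triple_snd _ _ _ _))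
      (EpsLin.add (epsLin_triple_thd _ _ _ _) (epsLin_triple_thd _ _ _ _))).add
      (EpsLin.add (epsLin_triple_fst _ _ _ _) (epsLin_triple_fst _ _ _ _)))
  refine EpsLin.integ_eq_zero
    (Φ := fun χ => schoutenD M N (fun i => C (φ i)) (fun i => C (ψ i)) χ) ?_ (fun χ => h φ ψ χ) χ
  exact ((EpsLin.add (EpsLin.add (epsLin_triple_thd _ _ _ _) (epsLin_triple_thd _ _ _ _))
      (EpsLin.add (epsLin_triple_fst _ _ _ _) (epsLin_triple_fst _ _ _ _))).add
      (EpsLin.add (epsLin_triple_snd _ _ _ _) (epsLin_triple_snd _ _ _ _)))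

/-- An operator that is antisymmetric for the pairing. -/
def Skew (M : MOp n A) : Prop := ∀ Y Z, pair Y (act C M Z) = -pair (act C M Y) Z

theorem skew_of_adjM {M : MOp n A} (h : adjM M = -M) : Skew M := fun Y Z => by
  rw [pair_act C_d, h, neg_act, neg_pair]

theorem Skew.inverse {M N : MOp n A} (hM : Skew M) (h : M * N = 1) : Skew N := by
  intro Y Z
  have h1 : ∀ f, act C M (act C N f) = f := fun f => by rw [← mul_act C_d, h, one_act]
  have := hM (act C N Y) (act C N Z)
  rw [h1, h1] at this
  rw [this, neg_neg]

/-- A closed 2-form, given by its operator. -/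
def Closed (Ω : MOp n A) : Prop := ∀ Y Z W,
  pair W (derOp Y Ω Z) + pair Y (derOp Z Ω W) + pair Z (derOp W Ω Y) = 0

/-- Differentiating `M Ω = 1` gives `∂Ω = -Ω(∂M)Ω`, so `∂Ω` evaluated on fields `Mφ`, `Mψ` is `∂M`
evaluated on `φ`, `ψ`. The cyclic sum for `Ω` thus becomes the Schouten bracket, which contains each
term twice. -/
theorem closed_of_poisson {M Ω : MOp n A} (hM : Skew M) (h1 : M * Ω = 1) (h2 : Ω * M = 1)
    (htwo : ∀ x : Fctl (PowerSeries A), x + x = 0 → x = 0)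
    (h : ∀ φ ψ χ, integ (schoutenD M M φ ψ χ) = 0) : Closed Ω := by
  have hΩ : Skew Ω := hM.inverse h1
  have h1' : ∀ f, act C M (act C Ω f) = f := fun f => by rw [← mul_act C_d, h1, one_act]
  have h2' : ∀ f, act C Ω (act C M f) = f := fun f => by rw [← mul_act C_d, h2, one_act]
  have key : ∀ φ ψ χ, pair (act C M φ) (derOp (act C M χ) Ω (act C M ψ)) =
      integ (triple M M φ ψ χ) := by
    intro φ ψ χ
    rw [integ_triple, derOp, derOp, h2']
    have : prV (act C M χ) ψ - act C Ω (prV (act C M χ) (act C M ψ)) =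
        -act C Ω (prV (act C M χ) (act C M ψ) - act C M (prV (act C M χ) ψ)) := by
      rw [act_sub, h2']; abel
    rw [this, pair_neg, hΩ, h2', neg_neg]
  intro Y Z W
  have h3 := h (act C Ω W) (act C Ω Z) (act C Ω Y)
  rw [schoutenD] at h3
  simp only [map_add, ← key, h1'] at h3
  refine htwo _ ?_
  rw [← h3]
  abel

/-- An operator with constant coefficients. -/
def ConstOp (H : MOp n A) : Prop := ∀ Y Z, prV Y (act C H Z) = act C H (prV Y Z)

theorem ConstOp.derOp {H : MOp n A} (hH : ConstOp H) (Y Z : Fin n → PowerSeries A) :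
    derOp Y H Z = 0 := by rw [JetRing.derOp, hH, sub_self]

theorem ConstOp.inverse {H G : MOp n A} (hH : ConstOp H) (h1 : H * G = 1) (h2 : G * H = 1) :
    ConstOp G := by
  have h1' : ∀ f, act C H (act C G f) = f := fun f => by rw [← mul_act C_d, h1, one_act]
  have h2' : ∀ f, act C G (act C H f) = f := fun f => by rw [← mul_act C_d, h2, one_act]
  intro Y Z
  rw [← h2' (prV Y (act C G Z)), ← hH, h1']

/-- As `H` is constant, only derivatives of `M` along fields `Hχ` survive in `[H, M]`. As `G` is
constant too, `∂(GMG) = G(∂M)G`, and the cyclic sum for `GMG` is the bracket up to sign. -/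
theorem closed_of_cocycle {H G M : MOp n A} (hH : ConstOp H) (hs : Skew H) (h1 : H * G = 1)
    (h2 : G * H = 1) (h : ∀ φ ψ χ, integ (schoutenD H M φ ψ χ) = 0) : Closed (G * M * G) := by
  have hG : ConstOp G := hH.inverse h1 h2
  have hGs : Skew G := hs.inverse h1
  have h1' : ∀ f, act C H (act C G f) = f := fun f => by rw [← mul_act C_d, h1, one_act]
  have h2' : ∀ f, act C G (act C H f) = f := fun f => by rw [← mul_act C_d, h2, one_act]
  have h0 : ∀ φ ψ χ, integ (triple H M φ ψ χ) = 0 := fun φ ψ χ => by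
    rw [integ_triple, hH.derOp]; simp [pair]
  have key : ∀ φ ψ χ, pair (act C H φ) (derOp (act C H χ) (G * M * G) (act C H ψ)) =
      -integ (triple M H φ ψ χ) := by
    intro φ ψ χ
    rw [integ_triple, derOp, derOp, mul_act C_d, mul_act C_d, mul_act C_d, mul_act C_d, h2', hG,
      hH, h2', ← act_sub, hGs, h2']
  intro Y Z W
  have h3 := h (act C G W) (act C G Z) (act C G Y)
  rw [schoutenD] at h3
  simp only [map_add, h0, zero_add] at h3
  have h4 := fun φ ψ χ => neg_eq_iff_eq_neg.2 (key φ ψ χ)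
  simp only [← h4, h1'] at h3
  rw [← neg_eq_zero, ← h3]
  abel

theorem skew_conj {G M : MOp n A} (hG : Skew G) (hM : Skew M) : Skew (G * M * G) := by
  intro Y Z
  simp only [mul_act C_d]
  rw [hG, hM, hG, neg_neg]

/-- `Lie_a` of a constant 2-vector, up to sign. -/
theorem act_fr_of_const {H : MOp n A} (hH : ConstOp H) (θ Y : Fin n → PowerSeries A) :
    act C (fr (act C H θ)) Y = act C H (act C (fr θ) Y) := by
  rw [act_fr, act_fr, hH]

theorem act_adjM_fr_of_const {H : MOp n A} (hH : ConstOp H) (hs : Skew H)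
    (θ Y : Fin n → PowerSeries A) :
    act C (adjM (fr (act C H θ))) Y = -act C (adjM (fr θ)) (act C H Y) := by
  refine eq_of_pair fun g => ?_
  rw [← pair_act C_d, act_fr_of_const hH, hs, neg_pair, ← pair_act C_d]

/-- The hypothesis is `D_a H + H D_a† = 0` for the Fréchet derivative `D_a`. Multiplying by `G` on
both sides makes `G D_a`, the Fréchet derivative of `G a`, self-adjoint, which is closedness of `G
a`. -/
theorem dForm_of_lie_eq_zero {H G : MOp n A} (hH : ConstOp H) (hs : Skew H) (h1 : H * G = 1)
    (h2 : G * H = 1) {a : Fin n → PowerSeries A}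
    (h : ∀ f, act C (fr a) (act C H f) + act C H (act C (adjM (fr a)) f) = 0)
    (Y Z : Fin n → PowerSeries A) : dForm (act C G a) Y Z = 0 := by
  have hG : ConstOp G := hH.inverse h1 h2
  have h1' : ∀ f, act C H (act C G f) = f := fun f => by rw [← mul_act C_d, h1, one_act]
  have h2' : ∀ f, act C G (act C H f) = f := fun f => by rw [← mul_act C_d, h2, one_act]
  have hGs : Skew G := hs.inverse h1
  have h3 : prV Y a = -act C H (act C (adjM (fr a)) (act C G Y)) := by
    have := h (act C G Y)
    rw [h1', act_fr] at this
    exact eq_neg_of_add_eq_zero_left this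
  rw [dForm, hG, hG, h3, act_neg, h2', neg_pair, ← pair_act C_d, act_fr,
    pair_comm _ Y, hGs Y]
  abel

theorem coeff_delta (g : PowerSeries A) (j : Fin n) (k : ℕ) :
    coeff k (delta g j) = DOp.ev (RingHom.id A) (DOp.adj (frSym (coeff k g) j)) 1 := by
  rw [delta, coeff_epsSum, Finset.sum_eq_single (k, 0)]
  · rw [coeff_ev_C, PowerSeries.coeff_zero_one]
  · rintro ⟨a, b⟩ h hne
    have hb : b ≠ 0 := by
      rintro rfl
      simp only [Finset.HasAntidiagonal.mem_antidiagonal, add_zero] at h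
      exact hne (by rw [h])
    simp only [coeff_ev_C, PowerSeries.coeff_one, if_neg hb, map_zero]
  · simp

/-- A matrix as a differential operator of order zero. -/
def matOp : Matrix (Fin n) (Fin n) A →+* MOp n A :=
  (C : Matrix (Fin n) (Fin n) (DOp A) →+* MOp n A).comp DOp.const.mapMatrix

theorem coeff_zero_matOp (H : Matrix (Fin n) (Fin n) A) (i j : Fin n) :
    coeff 0 (matOp H) i j = DOp.mono 0 (H i j) := by
  simp [matOp]; rfl

theorem act_matOp (H : Matrix (Fin n) (Fin n) A) (f : Fin n → PowerSeries A) (i : Fin n) :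
    act C (matOp H) f i = ∑ j, C (H i j) * f j := by
  rw [act_apply]
  refine Eq.trans (congrArg epsSum ?_) (epsSum_single _)
  funext a
  split_ifs with h
  · subst h
    simp only [coeff_zero_matOp, DOp.ev_mono, Function.iterate_zero_apply]
  · have : coeff a (matOp H) = 0 := by simp [matOp, PowerSeries.coeff_C, h]
    rw [this]
    simp

theorem constOp_matOp {H : Matrix (Fin n) (Fin n) A} (hH : ∀ i j Y, evol Y (H i j) = 0) :
    ConstOp (matOp H) := by
  intro Y Z
  funext i
  rw [prV_apply, act_matOp, act_matOp, map_sum]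
  refine Finset.sum_congr rfl fun j _ => ?_
  have : evolS Y (C (H i j)) = 0 := by
    ext D
    rw [coeff_evolS, map_zero]
    refine Finset.sum_eq_zero fun q _ => ?_
    rw [PowerSeries.coeff_C]
    split_ifs
    · exact hH i j _
    · exact map_zero _
  rw [evolS_mul, this, mul_zero, add_zero]
  rfl

theorem skew_matOp {H : Matrix (Fin n) (Fin n) A} (hH : H.transpose = -H) : Skew (matOp H) := by
  intro Y Z
  simp only [pair, act_matOp]
  rw [← map_neg]
  congr 1
  simp only [Finset.mul_sum, Finset.sum_mul]
  rw [Finset.sum_comm, ← Finset.sum_neg_distrib]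
  refine Finset.sum_congr rfl fun j _ => ?_
  rw [← Finset.sum_neg_distrib]
  refine Finset.sum_congr rfl fun i _ => ?_
  have : H i j = -H j i := by rw [← Matrix.transpose_apply H, hH]; rfl
  rw [this, map_neg]; ring

end JetRing

end Schouten

/-! ### Local bivectors as matrix differential operators -/

section OpOf

open PowerSeries (coeff)
open Finset.HasAntidiagonal (antidiagonal)
open JetRing

namespace DOp

variable {A : Type*} [CommRing A] [DRing A]

theorem coef_zero_nabla (p : DOp A) : coef 0 (nabla p) = d (coef 0 p) := by
  refine hom_ext (F := (coef 0).comp nabla) (G := d.comp (coef 0)) (fun t a => ?_) p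
  simp only [AddMonoidHom.comp_apply, nabla_mono, map_add, coef_mono]
  split_ifs <;> simp_all

theorem coef_succ_nabla (r : ℕ) (p : DOp A) :
    coef (r + 1) (nabla p) = d (coef (r + 1) p) + coef r p := by
  refine hom_ext (F := (coef (r + 1)).comp nabla) (G := d.comp (coef (r + 1)) + coef r)
    (fun t a => ?_) p
  simp only [AddMonoidHom.comp_apply, AddMonoidHom.add_apply, nabla_mono, map_add, coef_mono]
  split_ifs <;> simp_all

/-- The Leibniz expansion of `∂ᵗ ∘ a`, by Pascal's rule. -/
theorem coef_iterate_nabla (t r : ℕ) (a : A) :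
    coef r (nabla^[t] (mono 0 a)) = (t.choose r : A) * d^[t - r] a := by
  induction t generalizing r with
  | zero =>
    rw [Function.iterate_zero_apply, coef_mono]
    cases r with
    | zero => simp
    | succ r => simp
  | succ t ih =>
    rw [Function.iterate_succ_apply']
    cases r with
    | zero =>
      rw [coef_zero_nabla, ih]
      simp [Function.iterate_succ_apply']
    | succ r =>
      rw [coef_succ_nabla, ih, ih, isDer_d, isDer_d.map_natCast, mul_zero, add_zero,
        ← Function.iterate_succ_apply' d, Nat.choose_succ_succ]
      -- For `r < t` the truncated differences behave as in `ℤ`; for `t ≤ r` the binomial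
      -- coefficient `t choose (r + 1)` vanishes and the exponent in that term is immaterial.
      rcases lt_or_ge r t with h | h
      · rw [show (t - (r + 1)).succ = t - r by omega, show t + 1 - (r + 1) = t - r by omega]
        push_cast; ring
      · rw [Nat.choose_eq_zero_of_lt (show t < r + 1 by omega)]
        rw [show t + 1 - (r + 1) = t - r by omega]
        push_cast; ring

theorem coef_adj_mono (t r : ℕ) (a : A) :
    coef r (adj (mono t a)) = (-1) ^ t * (t.choose r : A) * d^[t - r] a := by
  simp only [adj, lift_mono, AddMonoidHom.mk'_apply]
  rw [map_zsmul, coef_iterate_nabla, zsmul_eq_mul]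
  push_cast
  ring

end DOp

theorem sum_antidiagonal_shift {M : Type*} [AddCommMonoid M] (r s : ℕ) (f : ℕ → ℕ → M)
    (hf : ∀ a b, a < r → f a b = 0) :
    ∑ q ∈ antidiagonal (r + s), f q.1 q.2 = ∑ q ∈ antidiagonal s, f (r + q.1) q.2 := by
  symm
  rw [← Finset.sum_subset (Finset.filter_subset (fun q : ℕ × ℕ => r ≤ q.1) (antidiagonal (r + s)))
    fun q hq hq' => hf _ _ (not_le.1 fun h => hq' (Finset.mem_filter.2 ⟨hq, h⟩))]
  refine Finset.sum_nbij' (fun q : ℕ × ℕ => (r + q.1, q.2)) (fun q : ℕ × ℕ => (q.1 - r, q.2))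
    ?_ ?_ ?_ ?_ fun _ _ => rfl
  · intro q hq
    simp only [Finset.HasAntidiagonal.mem_antidiagonal, Finset.mem_filter] at hq ⊢
    omega
  · intro q hq
    simp only [Finset.HasAntidiagonal.mem_antidiagonal, Finset.mem_filter] at hq ⊢
    omega
  · intro q hq
    simp
  · intro q hq
    simp only [Finset.mem_filter] at hq
    ext
    · simp only; omega
    · rfl

namespace JetRing

variable {n : ℕ} {A : Type*} [CommRing A] [JetRing n A]

theorem coeff_act_C_const (M : MOp n A) (g : Fin n → A) (i : Fin n) (D : ℕ) :
    coeff D (act PowerSeries.C M (fun j => PowerSeries.C (g j)) i) =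
      ∑ j, DOp.ev (RingHom.id A) (coeff D M i j) (g j) := by
  rw [coeff_act_C, Finset.sum_eq_single (D, 0)]
  · simp
  · rintro ⟨a, b⟩ h hne
    have hb : b ≠ 0 := by
      rintro rfl
      simp only [Finset.HasAntidiagonal.mem_antidiagonal, add_zero] at h
      exact hne (by rw [h])
    refine Finset.sum_eq_zero fun k _ => ?_
    simp [PowerSeries.coeff_C, hb]
  · simp

theorem MOp.ext_single {M N : MOp n A} (h : ∀ i j f D,
    coeff D (act PowerSeries.C M (Pi.single j (PowerSeries.C f)) i) =
      coeff D (act PowerSeries.C N (Pi.single j (PowerSeries.C f)) i)) : M = N := by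
  refine PowerSeries.ext fun D => Matrix.ext fun i j => ?_
  rw [← sub_eq_zero]
  refine eq_zero_of_ev i _ fun f => ?_
  rw [map_sub, AddMonoidHom.sub_apply, ← coeff_act_C_single, ← coeff_act_C_single, h, sub_self]

theorem coeff_derOp_const (Y : Fin n → PowerSeries A) (M : MOp n A) (ψ : Fin n → A) (i : Fin n)
    (D : ℕ) : coeff D (derOp Y M (fun j => PowerSeries.C (ψ j)) i) =
      ∑ q ∈ antidiagonal D, ∑ j, DOp.ev (RingHom.id A)
        (DOp.mapCoef (evol fun k => coeff q.2 (Y k)) (coeff q.1 M i j)) (ψ j) := by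
  rw [derOp, Pi.sub_apply, map_sub, prV_apply, coeff_evolS, coeff_act_C,
    sum_antidiagonal_swap D fun a b => evol (fun k => coeff a (Y k))
      (coeff b (act PowerSeries.C M (fun j => PowerSeries.C (ψ j)) i)), ← Finset.sum_sub_distrib]
  refine Finset.sum_congr rfl fun q _ => ?_
  rw [coeff_act_C_const, map_sum, ← Finset.sum_sub_distrib]
  refine Finset.sum_congr rfl fun j _ => ?_
  rw [DOp.ev_mapCoef (isDer_evol _) (evol_d _), prV_apply, coeff_evolS, Finset.sum_eq_single (q.2, 0)]
  · simp
  · rintro ⟨a, b⟩ h hne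
    have hb : b ≠ 0 := by
      rintro rfl
      simp only [Finset.HasAntidiagonal.mem_antidiagonal, add_zero] at h
      exact hne (by rw [h])
    simp [PowerSeries.coeff_C, hb]
  · simp

end JetRing

variable {n : ℕ} {U : Opens (Coord n)}

/-- The matrix differential operator of a series of local bivector type. -/
def opOf (A : BivectorData U) : MOp n (DiffPoly U) :=
  PowerSeries.mk fun D => Matrix.of fun i j => ∑ q ∈ antidiagonal D, DOp.mono q.1 (A q.1 q.2 i j)

theorem coeff_opOf (A : BivectorData U) (D : ℕ) (i j : Fin n) :
    coeff D (opOf A) i j = ∑ q ∈ antidiagonal D, DOp.mono q.1 (A q.1 q.2 i j) := by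
  rw [opOf, PowerSeries.coeff_mk]; rfl

theorem ev_coeff_opOf (A : BivectorData U) (D : ℕ) (i j : Fin n) (f : DiffPoly U) :
    DOp.ev (RingHom.id (DiffPoly U)) (coeff D (opOf A) i j) f =
      ∑ q ∈ antidiagonal D, A q.1 q.2 i j * dx^[q.1] f := by
  rw [coeff_opOf, map_sum, AddMonoidHom.finsetSum_apply]
  refine Finset.sum_congr rfl fun q _ => ?_
  rw [DOp.ev_mono]; rfl

/-- The antisymmetry clause of a local bivector is the coefficient of `∂ʳ` in `A† = -A`, at
`ε^{r+s}`. Terms `∂ᵗ` with `t < r` do not contribute to it. -/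
theorem adjM_opOf {A : BivectorData U} (hA : IsLocalBivector A) : adjM (opOf A) = -opOf A := by
  refine PowerSeries.ext fun D => Matrix.ext fun i j => DOp.ext_coef fun r => ?_
  have h1 : coeff D (adjM (opOf A)) i j = DOp.adj (coeff D (opOf A) j i) := by
    rw [adjM, PowerSeries.coeff_mk]; rfl
  rw [h1, map_neg, Matrix.neg_apply, map_neg, coeff_opOf, coeff_opOf, map_sum, map_sum, map_sum]
  simp only [DOp.coef_adj_mono, DOp.coef_mono]
  rcases le_or_gt r D with h | h
  · obtain ⟨s, rfl⟩ := Nat.exists_eq_add_of_le h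
    rw [Finset.sum_eq_single (r, s) (f := fun q : ℕ × ℕ => if q.1 = r then A q.1 q.2 i j else 0),
      if_pos rfl, hA.antisymm r s j i, sum_antidiagonal_shift r s fun a b =>
      (-1) ^ a * (a.choose r : DiffPoly U) * d^[a - r] (A a b j i), ← Finset.sum_neg_distrib]
    · refine Finset.sum_congr rfl fun q _ => ?_
      rw [add_tsub_cancel_left, Dx_eq_coe_dx, pow_succ]
      change _ * d^[q.1] _ = -(_ * d^[q.1] _)
      ring
    · intro a b hab
      rw [Nat.choose_eq_zero_of_lt hab]; simp
    · rintro ⟨a, b⟩ hq hne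
      refine if_neg fun ha => hne ?_
      simp only [Finset.HasAntidiagonal.mem_antidiagonal] at hq ha
      ext <;> simp <;> omega
    · intro hq; simp at hq
  · rw [Finset.sum_eq_zero, Finset.sum_eq_zero, neg_zero]
    · intro q hq
      simp only [Finset.HasAntidiagonal.mem_antidiagonal] at hq
      exact if_neg (by omega)
    · intro q hq
      simp only [Finset.HasAntidiagonal.mem_antidiagonal] at hq
      rw [Nat.choose_eq_zero_of_lt (by omega)]; simp

theorem integralZero_iff {f : DiffPoly U} : IntegralZero f ↔ integ f = 0 := by
  rw [integ_eq_zero_iff, IntegralZero]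
  simp only [Dx_eq_dx]; rfl

theorem sum_rotate {M ι κ μ : Type*} [AddCommMonoid M] (S : Finset ι) (I : Finset κ) (J : Finset μ)
    (F : ι → κ → κ → κ → κ → μ → M) :
    ∑ b ∈ S, ∑ i ∈ I, ∑ j ∈ I, ∑ k ∈ I, ∑ l ∈ I, ∑ s ∈ J, F b i j k l s =
      ∑ i ∈ I, ∑ j ∈ I, ∑ l ∈ I, ∑ s ∈ J, ∑ k ∈ I, ∑ b ∈ S, F b i j k l s := by
  rw [Finset.sum_comm]
  refine Finset.sum_congr rfl fun i _ => ?_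
  rw [Finset.sum_comm]
  refine Finset.sum_congr rfl fun j _ => ?_
  have : ∀ b, ∑ k ∈ I, ∑ l ∈ I, ∑ s ∈ J, F b i j k l s =
      ∑ l ∈ I, ∑ s ∈ J, ∑ k ∈ I, F b i j k l s := fun b => by
    rw [Finset.sum_comm]
    exact Finset.sum_congr rfl fun l _ => Finset.sum_comm
  simp only [this]
  rw [Finset.sum_comm]
  refine Finset.sum_congr rfl fun l _ => ?_
  rw [Finset.sum_comm]
  exact Finset.sum_congr rfl fun s _ => Finset.sum_comm

/-- The sum over `l` and `s` in `schoutenTerm` is the evolutionary derivative of the coefficients of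
`A` along the field `Bχ`; the degree of a coefficient bounds the jets in it and so the range of `s`.
-/
theorem coeff_triple_opOf {A B : BivectorData U} (hA : ∀ r s i j, HasDeg (A r s i j) s)
    (φ ψ χ : Fin n → DiffPoly U) (D : ℕ) :
    coeff D (triple (opOf A) (opOf B) (fun i => PowerSeries.C (φ i)) (fun i => PowerSeries.C (ψ i))
      fun i => PowerSeries.C (χ i)) = schoutenTerm A B φ ψ χ D := by
  have hX : ∀ p l, coeff p (act PowerSeries.C (opOf B) (fun i => PowerSeries.C (χ i)) l) =
      ∑ k, ∑ b ∈ antidiagonal p, B b.1 b.2 l k * dx^[b.1] (χ k) := by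
    intro p l
    rw [coeff_act_C_const]
    simp only [ev_coeff_opOf]
  rw [triple, map_sum]
  simp only [PowerSeries.coeff_C_mul, coeff_derOp_const, Finset.mul_sum]
  rw [Finset.sum_comm, schoutenTerm]
  refine Finset.sum_congr rfl fun q _ => ?_
  simp only [sum_rotate]
  have h1 : ∀ i j, DOp.ev (RingHom.id (DiffPoly U)) (DOp.mapCoef (evol fun k => coeff q.2
      (act PowerSeries.C (opOf B) (fun i => PowerSeries.C (χ i)) k)) (coeff q.1 (opOf A) i j))
      (ψ j) = ∑ a ∈ antidiagonal q.1, (∑ l, ∑ s ∈ Finset.range (a.2 + 1),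
        dx^[s] (∑ k, ∑ b ∈ antidiagonal q.2, B b.1 b.2 l k * dx^[b.1] (χ k)) *
          jetDeriv l s (A a.1 a.2 i j)) * dx^[a.1] (ψ j) := by
    intro i j
    rw [coeff_opOf, map_sum, map_sum, AddMonoidHom.finsetSum_apply]
    refine Finset.sum_congr rfl fun a _ => ?_
    rw [DOp.mapCoef, DOp.lift_mono, AddMonoidHom.comp_apply, DOp.ev_mono, RingHom.id_apply]
    simp only [hX]
    refine congrArg₂ _ ?_ rfl
    exact evolField_eq_sum _ _ fun i s hs => (hA _ _ _ _).jetDeriv_eq_zero hs i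
  simp only [h1, Finset.mul_sum, Finset.sum_mul, iterate_map_sum', Dx_eq_coe_dx]
  refine (Finset.sum_congr rfl fun i _ => Finset.sum_comm).trans (Finset.sum_comm.trans ?_)
  refine Finset.sum_congr rfl fun a _ => Finset.sum_congr rfl fun i _ =>
    Finset.sum_congr rfl fun j _ => Finset.sum_congr rfl fun l _ => Finset.sum_congr rfl fun s _ =>
    Finset.sum_congr rfl fun k _ => Finset.sum_congr rfl fun b _ => ?_
  ring

theorem integ_schoutenD_opOf {A B : BivectorData U} (hA : ∀ r s i j, HasDeg (A r s i j) s)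
    (hB : ∀ r s i j, HasDeg (B r s i j) s) (h : SchoutenZero A B)
    (φ ψ χ : Fin n → PowerSeries (DiffPoly U)) :
    integ (schoutenD (opOf A) (opOf B) φ ψ χ) = 0 := by
  refine integ_schoutenD (fun φ ψ χ => ?_) φ ψ χ
  rw [integ_series_eq_zero_iff]
  intro D
  have := integralZero_iff.1 (h φ ψ χ D)
  rw [schoutenD]
  simp only [map_add, coeff_triple_opOf hA, coeff_triple_opOf hB]
  simpa only [schouten, map_add] using this

theorem fctl_two {x : Fctl (PowerSeries (DiffPoly U))} (h : x + x = 0) : x = 0 := by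
  obtain ⟨f, rfl⟩ := QuotientAddGroup.mk'_surjective _ x
  change integ f + integ f = 0 at h
  change integ f = 0
  rw [← map_add, integ_series_eq_zero_iff] at h
  rw [integ_series_eq_zero_iff]
  intro k
  obtain ⟨g, hg⟩ := integ_eq_zero_iff.1 (h k)
  refine integ_eq_zero_iff.2 ⟨MvPolynomial.C (algebraMap ℝ (Smooth U) (1 / 2)) * g, ?_⟩
  have h0 : d (MvPolynomial.C (algebraMap ℝ (Smooth U) (1 / 2)) : DiffPoly U) = 0 := by
    rw [d_eq_dx, dx_C]
    refine Finset.sum_eq_zero fun i _ => ?_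
    rw [pd_algebraMap, MvPolynomial.C_0, mul_zero]
  rw [isDer_d, h0, mul_zero, add_zero, hg, map_add]
  rw [← sub_eq_zero]
  refine two_mul_eq_zero ?_
  have e : (MvPolynomial.C (algebraMap ℝ (Smooth U) (1 / 2)) : DiffPoly U) +
      MvPolynomial.C (algebraMap ℝ (Smooth U) (1 / 2)) = 1 := by
    rw [← MvPolynomial.C_add, ← map_add]; norm_num
  linear_combination (coeff k f + coeff k f) * e

end OpOf

/-! ### Potentials of nondegenerate Poisson brackets -/

section Potential

open PowerSeries (coeff)
open Finset.HasAntidiagonal (antidiagonal)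
open JetRing

variable {n : ℕ} {U : Opens (Coord n)}

theorem coeff_zero_mul {S : Type*} [Semiring S] (f g : PowerSeries S) :
    coeff 0 (f * g) = coeff 0 f * coeff 0 g := by
  simp

theorem gradedOp_opOf {A : BivectorData U} (hA : ∀ r s i j, HasDeg (A r s i j) s) :
    GradedOp (opOf A) := fun D i j => by
  rw [coeff_opOf]
  refine sum_mem fun q hq => mono_mem_opDeg (hA q.1 q.2 i j) ?_
  rw [add_comm]; exact Finset.HasAntidiagonal.mem_antidiagonal.1 hq

/-- The matrix `hⁱʲ` of smooth functions. -/
def leading (A : BivectorData U) : Matrix (Fin n) (Fin n) (Smooth U) :=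
  Matrix.of fun i j => MvPolynomial.constantCoeff (A 0 0 i j)

/-- A matrix of smooth functions as an operator. -/
def smoothOp : Matrix (Fin n) (Fin n) (Smooth U) →+* MOp n (DiffPoly U) :=
  matOp.comp (MvPolynomial.C : Smooth U →+* DiffPoly U).mapMatrix

theorem coeff_zero_smoothOp (H : Matrix (Fin n) (Fin n) (Smooth U)) (i j : Fin n) :
    coeff 0 (smoothOp H) i j = DOp.mono 0 (MvPolynomial.C (H i j)) := coeff_zero_matOp _ i j

theorem coeff_zero_opOf {A : BivectorData U} (hA : ∀ r s i j, HasDeg (A r s i j) s) :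
    coeff 0 (opOf A) = coeff 0 (smoothOp (leading A)) := by
  refine Matrix.ext fun i j => ?_
  rw [coeff_opOf, coeff_zero_smoothOp, leading, Matrix.of_apply, ← (hA 0 0 i j).eq_C]
  simp

theorem isUnit_leading {A : BivectorData U} (h : ∀ u, (hMatrix A u).det ≠ 0) :
    IsUnit (leading A) := Smooth.isUnit_matrix h

/-- A power series is invertible when its constant term is. Here that term is a matrix of functions
without `∂`, by homogeneity. -/
theorem isUnit_opOf {A : BivectorData U} (hA : ∀ r s i j, HasDeg (A r s i j) s)
    (h : ∀ u, (hMatrix A u).det ≠ 0) : IsUnit (opOf A) := by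
  rw [PowerSeries.isUnit_iff_constantCoeff, ← PowerSeries.coeff_zero_eq_constantCoeff_apply,
    coeff_zero_opOf hA, PowerSeries.coeff_zero_eq_constantCoeff_apply]
  exact ((isUnit_leading h).map smoothOp).map _

/-- The constant term of `N` is the inverse matrix of functions, of degree zero, and the higher
coefficients are given recursively by products of homogeneous operators. -/
theorem GradedOp.inverse {M N : MOp n (DiffPoly U)} (hM : GradedOp M) (hNM : N * M = 1)
    (hMN : M * N = 1) {H : Matrix (Fin n) (Fin n) (Smooth U)} (hH : IsUnit H)
    (h0 : coeff 0 M = coeff 0 (smoothOp H)) : GradedOp N := by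
  obtain ⟨G, hG1, hG2⟩ := isUnit_iff_exists.1 hH
  have e0 : coeff 0 N * coeff 0 M = 1 := by
    have := congrArg (coeff 0) hNM
    rwa [coeff_zero_mul, PowerSeries.coeff_zero_one] at this
  have e1 : coeff 0 M * coeff 0 (smoothOp G) = 1 := by
    rw [h0, ← coeff_zero_mul, ← map_mul, hG1, map_one, PowerSeries.coeff_zero_one]
  have e2 : coeff 0 N = coeff 0 (smoothOp G) := by
    rw [← mul_one (coeff 0 N), ← e1, ← mul_assoc, e0, one_mul]
  have hN0 : ∀ i j, coeff 0 N i j ∈ opDeg U 0 := fun i j => by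
    rw [e2, coeff_zero_smoothOp]
    exact mono_mem_opDeg (hasDeg_C _) rfl
  intro k
  induction k using Nat.strong_induction_on with
  | _ k ih =>
    rcases Nat.eq_zero_or_pos k with rfl | hk
    · exact hN0
    -- The coefficient of `εᵏ` in `M N = 1`, solved for the term containing `coeff k N`.
    have h1 : coeff k N = -(coeff 0 N *
        ∑ q ∈ (antidiagonal k).erase (0, k), coeff q.1 M * coeff q.2 N) := by
      have h2 := congrArg (coeff k) hMN
      rw [PowerSeries.coeff_mul, PowerSeries.coeff_one, if_neg hk.ne',
        ← Finset.add_sum_erase _ _ (show ((0, k) : ℕ × ℕ) ∈ antidiagonal k by simp)] at h2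
      have h3 := congrArg (fun P => coeff 0 N * P) h2
      simp only [mul_add, mul_zero] at h3
      rw [← mul_assoc, e0, one_mul] at h3
      exact eq_neg_of_add_eq_zero_left h3
    intro i j
    rw [h1, Matrix.neg_apply]
    refine neg_mem ?_
    rw [Matrix.mul_apply]
    refine sum_mem fun l _ => ?_
    have := mul_mem_opDeg (hN0 i l) (k := 0) (l := k)
      (q := (∑ q ∈ (antidiagonal k).erase (0, k), coeff q.1 M * coeff q.2 N) l j) ?_
    · rwa [zero_add] at this
    rw [Matrix.sum_apply]
    refine sum_mem fun q hq => ?_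
    rw [Matrix.mul_apply]
    refine sum_mem fun m _ => ?_
    have hq1 : q.1 + q.2 = k := Finset.HasAntidiagonal.mem_antidiagonal.1 (Finset.mem_of_mem_erase hq)
    have hq2 : q ≠ (0, k) := Finset.ne_of_mem_erase hq
    have hlt : q.2 < k := by
      rcases Nat.eq_zero_or_pos q.1 with h | h
      · exact absurd (Prod.ext h (by omega)) hq2
      · omega
    have := mul_mem_opDeg (hM q.1 l m) (ih q.2 hlt m j)
    rwa [hq1] at this

variable {c : Coord n} {R : ℝ}

/-- The last clause is needed in degree-two cohomology, where the vector field must have no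
component of degree zero. -/
theorem exists_form {Ω : MOp n (DiffPoly (openBall c R))} (hΩ : GradedOp Ω) (hs : Skew Ω)
    (hcl : Closed Ω) : ∃ Θ : Fin n → PowerSeries (DiffPoly (openBall c R)),
      (∀ i, Graded (Θ i)) ∧ Ω = dM Θ ∧
      ((∀ i j, coeff 0 Ω i j = 0) → ∀ i, coeff 0 (Θ i) = 0) := by
  have he : ∀ i, Graded (PowerSeries.C (euler c i : DiffPoly (openBall c R))) :=
    fun i => graded_C _
  obtain ⟨θ, h1, h2, h3⟩ := exists_prV_euler (c := c) (R := R) (fun i => hΩ.act he i)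
  refine ⟨θ, h2, exact_of_closed (evolField_euler c) (fun f => eq_zero_of_evolField_euler) hs hcl h1,
    fun h0 i => h3 i 0 ?_⟩
  rw [coeff_act_C_const]
  refine Finset.sum_eq_zero fun j _ => ?_
  rw [h0]; simp

theorem exists_potential {A : BivectorData (openBall c R)} (hA : IsPoisson A)
    (h : ∀ u, (hMatrix A u).det ≠ 0) :
    ∃ Θ : Fin n → PowerSeries (DiffPoly (openBall c R)), (∀ i, Graded (Θ i)) ∧
      opOf A * dM Θ = 1 ∧ dM Θ * opOf A = 1 := by
  have hd := hA.bivector.hasDeg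
  obtain ⟨Ω, h1, h2⟩ := isUnit_iff_exists.1 (isUnit_opOf hd h)
  have hs : Skew (opOf A) := skew_of_adjM (adjM_opOf hA.bivector)
  obtain ⟨Θ, hΘ, rfl, -⟩ := exists_form
    ((gradedOp_opOf hd).inverse h2 h1 (isUnit_leading h) (coeff_zero_opOf hd))
    (hs.inverse h1) (closed_of_poisson hs h1 h2 (fun x => fctl_two)
      (integ_schoutenD_opOf hd hd hA.jacobi))
  exact ⟨Θ, hΘ, h1, h2⟩

end Potential

/-! ### Vanishing of the cohomology of the ultralocal bracket -/

section Cohomology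

open PowerSeries (coeff)
open Finset.HasAntidiagonal (antidiagonal)
open JetRing

variable {n : ℕ} {U : Opens (Coord n)}

/-- A real matrix as an operator with constant coefficients. -/
def constMat : Matrix (Fin n) (Fin n) ℝ →+* MOp n (DiffPoly U) :=
  smoothOp.comp (algebraMap ℝ (Smooth U)).mapMatrix

theorem hasDeg_ultralocal (h : Matrix (Fin n) (Fin n) ℝ) (r s : ℕ) (i j : Fin n) :
    HasDeg (ultralocal U h r s i j) s := by
  rw [ultralocal]
  split_ifs with hrs
  · rw [hrs.2]; exact hasDeg_C _
  · exact hasDeg_zero _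

theorem opOf_ultralocal (h : Matrix (Fin n) (Fin n) ℝ) : opOf (ultralocal U h) = constMat h := by
  refine PowerSeries.ext fun D => Matrix.ext fun i j => ?_
  rw [coeff_opOf]
  rcases Nat.eq_zero_or_pos D with rfl | hD
  · rw [constMat, RingHom.comp_apply, coeff_zero_smoothOp]
    simp [ultralocal]
  · have : coeff D (constMat h : MOp n (DiffPoly U)) = 0 := by
      simp only [constMat, smoothOp, matOp, RingHom.comp_apply]
      rw [PowerSeries.coeff_C, if_neg hD.ne']
    rw [this]
    refine Finset.sum_eq_zero fun q hq => ?_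
    rw [ultralocal, if_neg, map_zero]
    have := Finset.HasAntidiagonal.mem_antidiagonal.1 hq
    omega

theorem act_constMat (h : Matrix (Fin n) (Fin n) ℝ) (f : Fin n → PowerSeries (DiffPoly U))
    (i : Fin n) : act PowerSeries.C (constMat h) f i =
      ∑ j, PowerSeries.C (MvPolynomial.C (algebraMap ℝ (Smooth U) (h i j))) * f j :=
  act_matOp _ f i

theorem constOp_constMat (h : Matrix (Fin n) (Fin n) ℝ) :
    ConstOp (constMat h : MOp n (DiffPoly U)) := by
  refine constOp_matOp fun i j Y => ?_
  refine (evolField_C Y _).trans (Finset.sum_eq_zero fun k _ => ?_)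
  have : pd k (((algebraMap ℝ (Smooth U)).mapMatrix h) i j) = 0 := pd_algebraMap k (h i j)
  rw [this, MvPolynomial.C_0, mul_zero]

theorem skew_constMat {h : Matrix (Fin n) (Fin n) ℝ} (hh : h.transpose = -h) :
    Skew (constMat h : MOp n (DiffPoly U)) := by
  refine skew_matOp (Matrix.ext fun i j => ?_)
  have : h j i = -h i j := by rw [← Matrix.transpose_apply h, hh]; rfl
  change MvPolynomial.C (algebraMap ℝ (Smooth U) (h j i)) =
    -MvPolynomial.C (algebraMap ℝ (Smooth U) (h i j))
  rw [this, map_neg, MvPolynomial.C_neg]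

theorem gradedOp_constMat (h : Matrix (Fin n) (Fin n) ℝ) :
    GradedOp (constMat h : MOp n (DiffPoly U)) := by
  rw [← opOf_ultralocal]
  exact gradedOp_opOf (hasDeg_ultralocal h)

theorem coeff_act_constMat (h : Matrix (Fin n) (Fin n) ℝ) (f : Fin n → PowerSeries (DiffPoly U))
    (i : Fin n) (k : ℕ) : coeff k (act PowerSeries.C (constMat h) f i) =
      ∑ j, ultralocal U h 0 0 i j * coeff k (f j) := by
  rw [act_constMat, map_sum]
  simp only [PowerSeries.coeff_C_mul, ultralocal, and_self, if_true]

theorem coeff_delta_eq_varDeriv {g : PowerSeries (DiffPoly U)} (hg : Graded g) (j : Fin n)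
    (k : ℕ) : coeff k (delta g j) = varDeriv k (coeff k g) j := by
  rw [coeff_delta, frSym_eq (N := k + 1) _ j fun i s hs => (hg k).jetDeriv_eq_zero hs i, map_sum,
    map_sum, AddMonoidHom.finsetSum_apply, varDeriv]
  refine Finset.sum_congr rfl fun s _ => ?_
  rw [DOp.ev_adj_mono (fun _ => rfl), RingHom.id_apply, mul_one, Dx_eq_coe_dx]
  rfl

/-- Only the coefficient at `ε⁻¹ δ` of the constant bracket is present and its derivatives vanish,
so two of the three sums remain: `-(D_a h + h D_a†)`. -/
theorem lieDeriv_ultralocal {a : Fin n → PowerSeries (DiffPoly U)} (ha : ∀ i, Graded (a i))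
    (h : Matrix (Fin n) (Fin n) ℝ) (i j : Fin n) (f : DiffPoly U) (D : ℕ) :
    lieDeriv (fun k i => coeff k (a i)) (ultralocal U h) i j f D =
      -coeff D (act PowerSeries.C (fr a) (act PowerSeries.C (constMat h)
          (Pi.single j (PowerSeries.C f))) i +
        act PowerSeries.C (constMat h) (act PowerSeries.C (adjM (fr a))
          (Pi.single j (PowerSeries.C f))) i) := by
  have hz : ∀ (b : ℕ × ℕ) (i j : Fin n), b ≠ (0, 0) → ultralocal U h b.1 b.2 i j = 0 :=
    fun b i j hb => if_neg fun h => hb (Prod.ext h.1 h.2)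
  have hjet : ∀ (l : Fin n) (t : ℕ) (i j : Fin n), jetDeriv l t (ultralocal U h 0 0 i j) = 0 := by
    intro l t i j
    rw [ultralocal, if_pos ⟨rfl, rfl⟩]
    cases t with
    | zero => rw [jetDeriv_zero_C, pd_algebraMap, MvPolynomial.C_0]
    | succ t => exact jetDeriv_succ_C l t _
  have hd0 : ∀ s, (⇑(dx (U := U)))^[s] 0 = 0 := fun s => iterate_map_zero _ s
  rw [lieDeriv, Finset.sum_eq_single (D, 0)]
  · simp only [Finset.Nat.antidiagonal_zero, Finset.sum_singleton, Function.iterate_zero_apply, hjet,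
      mul_zero, zero_mul, Finset.sum_const_zero, zero_sub, Dx_eq_coe_dx]
    have h1 : act PowerSeries.C (constMat h) (Pi.single j (PowerSeries.C f)) =
        fun l => PowerSeries.C (ultralocal U h 0 0 l j * f) := by
      funext l
      rw [act_constMat, Finset.sum_eq_single j]
      · rw [Pi.single_eq_same, ← map_mul]
        simp [ultralocal]
      · intro k _ hk; rw [Pi.single_eq_of_ne hk, mul_zero]
      · exact fun hj => absurd (Finset.mem_univ j) hj
    rw [h1, map_add, coeff_act_C_const, coeff_act_constMat, ← Finset.sum_add_distrib,
      ← Finset.sum_neg_distrib]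
    refine Finset.sum_congr rfl fun l _ => ?_
    have hb : ∀ i, ∀ i' s, D + 1 ≤ s → jd i' s (coeff D (a i)) = 0 :=
      fun i i' s hs => (ha i D).jetDeriv_eq_zero hs i'
    rw [coeff_act_C_single, adjM, PowerSeries.coeff_mk, Matrix.of_apply, fr, PowerSeries.coeff_mk,
      Matrix.of_apply, Matrix.of_apply, ev_frSym _ _ _ _ (hb i),
      frSym_eq _ _ (hb j), map_sum, map_sum, AddMonoidHom.finsetSum_apply, Finset.mul_sum, neg_add]
    rw [sub_eq_add_neg]
    refine congrArg₂ _ rfl (congrArg _ (Finset.sum_congr rfl fun s _ => ?_))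
    rw [DOp.ev_adj_mono (fun _ => rfl)]
    rfl
  · intro q hq hne
    have hq2 : q.2 ≠ 0 := fun h0 => hne (Prod.ext (by
      have := Finset.HasAntidiagonal.mem_antidiagonal.1 hq
      simp only; omega) h0)
    refine Finset.sum_eq_zero fun b hb => Finset.sum_eq_zero fun l _ => ?_
    have hb0 : b ≠ (0, 0) := by
      rintro rfl
      have := Finset.HasAntidiagonal.mem_antidiagonal.1 hb
      simp only at this; omega
    simp only [hz b _ _ hb0, jetDeriv_zero_right, zero_mul, mul_zero, Dx_eq_coe_dx, hd0,
      Finset.sum_const_zero, sub_zero]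
  · intro hq; simp at hq

variable {c : Coord n} {R : ℝ} {h : Matrix (Fin n) (Fin n) ℝ}

/-- The 1-form `h⁻¹a` is closed, hence equal to some `δg`, and `a = h δg`. -/
theorem vanishingH1 (hh : h.transpose = -h) (hdet : h.det ≠ 0) :
    VanishingH1 (openBall c R) h := by
  intro a ha ha0 hlie
  have h1 : (constMat h : MOp n (DiffPoly (openBall c R))) * constMat h⁻¹ = 1 := by
    rw [← map_mul, Matrix.mul_nonsing_inv _ (isUnit_iff_ne_zero.2 hdet), map_one]
  have h2 : (constMat h⁻¹ : MOp n (DiffPoly (openBall c R))) * constMat h = 1 := by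
    rw [← map_mul, Matrix.nonsing_inv_mul _ (isUnit_iff_ne_zero.2 hdet), map_one]
  set s : Fin n → PowerSeries (DiffPoly (openBall c R)) := fun i => PowerSeries.mk fun k => a k i
    with hs
  have hsc : (fun k i => coeff k (s i)) = a := by funext k i; rw [hs, PowerSeries.coeff_mk]
  have hsg : ∀ i, Graded (s i) := fun i k => by rw [hs, PowerSeries.coeff_mk]; exact ha k i
  have hop : fr s * constMat h + constMat h * adjM (fr s) = 0 := by
    refine MOp.ext_single fun i j f D => ?_
    have := hlie i j f D
    rw [← hsc, lieDeriv_ultralocal hsg, neg_eq_zero] at this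
    rw [add_act, mul_act C_d, mul_act C_d, Pi.add_apply, this]
    have h0 := add_act PowerSeries.C (0 : MOp n (DiffPoly (openBall c R))) 0
      (Pi.single j (PowerSeries.C f))
    rw [add_zero] at h0
    rw [left_eq_add.1 h0]
    simp
  have hcl := dForm_of_lie_eq_zero (constOp_constMat h) (skew_constMat hh) h1 h2 (a := s)
    (fun f => by
      rw [← mul_act C_d, ← mul_act C_d, ← add_act, hop]
      have h0 := add_act PowerSeries.C (0 : MOp n (DiffPoly (openBall c R))) 0 f
      rw [add_zero] at h0
      exact left_eq_add.1 h0)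
  have hgr : ∀ i, Graded (act PowerSeries.C (constMat h⁻¹) s i) :=
    (gradedOp_constMat h⁻¹).act hsg
  obtain ⟨θ, hθ, hθg, hθ0⟩ := exists_prV_euler hgr
  have key := potential_of_closed_one_form (evolField_euler c)
    (fun f => eq_zero_of_evolField_euler) hθ hcl
  set g : PowerSeries (DiffPoly (openBall c R)) := ∑ i, PowerSeries.C (euler c i) * θ i with hgdef
  have hgg : Graded g := Graded.sum fun i _ => (graded_C _).mul (hθg i)
  refine ⟨fun k => coeff k g, hgg, ?_, fun k i => ?_⟩
  · simp only [hgdef, map_sum, PowerSeries.coeff_C_mul]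
    refine Finset.sum_eq_zero fun i _ => ?_
    rw [hθ0 i 0, mul_zero]
    rw [coeff_act_constMat]
    refine Finset.sum_eq_zero fun j _ => ?_
    rw [hs, PowerSeries.coeff_mk, ha0, mul_zero]
  · have h3 : s = act PowerSeries.C (constMat h) (delta g) := by
      rw [← key, ← mul_act C_d, h1, one_act]
    have h4 := congrArg (coeff k) (congrFun h3 i)
    rw [coeff_act_constMat] at h4
    simp only [coeff_delta_eq_varDeriv hgg] at h4
    rw [← h4, hs, PowerSeries.coeff_mk]

theorem coeff_act_opOf_single (α : BivectorData U) (i j : Fin n) (f : DiffPoly U) (D : ℕ) :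
    coeff D (act PowerSeries.C (opOf α) (Pi.single j (PowerSeries.C f)) i) =
      bivectorOp α i j f D := by
  rw [coeff_act_C_single, ev_coeff_opOf, bivectorOp, Dx_eq_coe_dx]

/-- The closed 2-form `h⁻¹αh⁻¹` is `dθ = D_θ - D_θ†`. For `a = -hθ` skewness of `h` gives `-(D_a h +
h D_a†) = h(D_θ - D_θ†)h = α`. -/
theorem vanishingH2 (hh : h.transpose = -h) (hdet : h.det ≠ 0) :
    VanishingH2 (openBall c R) h := by
  intro α hα hα0 hsch
  have h1 : (constMat h : MOp n (DiffPoly (openBall c R))) * constMat h⁻¹ = 1 := by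
    rw [← map_mul, Matrix.mul_nonsing_inv _ (isUnit_iff_ne_zero.2 hdet), map_one]
  have h2 : (constMat h⁻¹ : MOp n (DiffPoly (openBall c R))) * constMat h = 1 := by
    rw [← map_mul, Matrix.nonsing_inv_mul _ (isUnit_iff_ne_zero.2 hdet), map_one]
  have hH := constOp_constMat (U := openBall c R) h
  have hsk := skew_constMat (U := openBall c R) hh
  have hαs : Skew (opOf α) := skew_of_adjM (adjM_opOf hα)
  set Ω : MOp n (DiffPoly (openBall c R)) := constMat h⁻¹ * opOf α * constMat h⁻¹ with hΩ
  have hαΩ : opOf α = constMat h * Ω * constMat h := by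
    have : constMat h * Ω * constMat h = (constMat h * constMat h⁻¹) * opOf α *
        (constMat h⁻¹ * constMat h) := by rw [hΩ]; simp only [mul_assoc]
    rw [this, h1, h2, one_mul, mul_one]
  have hcl : Closed Ω := closed_of_cocycle hH hsk h1 h2 (by
    rw [← opOf_ultralocal]
    exact integ_schoutenD_opOf (hasDeg_ultralocal h) hα.hasDeg hsch)
  have hΩg : GradedOp Ω := by
    have hmul : ∀ M N : MOp n (DiffPoly (openBall c R)), GradedOp M → GradedOp N →
        GradedOp (M * N) := by
      intro M N hM hN k i j
      rw [PowerSeries.coeff_mul, Matrix.sum_apply]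
      refine sum_mem fun q hq => ?_
      rw [Matrix.mul_apply]
      refine sum_mem fun l _ => ?_
      have := mul_mem_opDeg (hM q.1 i l) (hN q.2 l j)
      rwa [Finset.HasAntidiagonal.mem_antidiagonal.1 hq] at this
    exact hmul _ _ (hmul _ _ (gradedOp_constMat _) (gradedOp_opOf hα.hasDeg)) (gradedOp_constMat _)
  have hΩ0 : ∀ i j, coeff 0 Ω i j = 0 := by
    have h0 : coeff 0 (opOf α) = 0 := by
      refine Matrix.ext fun i j => (coeff_opOf α 0 i j).trans ?_
      rw [Finset.Nat.antidiagonal_zero, Finset.sum_singleton, hα0, map_zero]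
      rfl
    intro i j
    rw [hΩ, coeff_zero_mul, coeff_zero_mul, h0, mul_zero, zero_mul]
    rfl
  obtain ⟨θ, hθg, hθ, hθ0⟩ := exists_form hΩg
    (skew_conj (hsk.inverse h1) hαs) hcl
  set a : Fin n → PowerSeries (DiffPoly (openBall c R)) := act PowerSeries.C (constMat (-h)) θ
    with ha
  have hag : ∀ i, Graded (a i) := (gradedOp_constMat _).act hθg
  have ha' : a = act PowerSeries.C (constMat h) (-θ) := by
    rw [ha, act_neg, map_neg, neg_act]
  refine ⟨fun k i => coeff k (a i), fun k i => hag i k, fun i => ?_, fun i j f D => ?_⟩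
  · simp only
    rw [ha, coeff_act_constMat]
    exact Finset.sum_eq_zero fun j _ => by rw [hθ0 hΩ0, mul_zero]
  · rw [lieDeriv_ultralocal hag, ← coeff_act_opOf_single, ← map_neg, hαΩ, hθ]
    congr 1
    rw [ha', act_fr_of_const hH, act_adjM_fr_of_const hH hsk, mul_act C_d, mul_act C_d, dM, sub_act,
      act_sub]
    have hfr : ∀ Y, act PowerSeries.C (fr (-θ)) Y = -act PowerSeries.C (fr θ) Y := fun Y => by
      rw [act_fr, act_fr]; exact funext fun i => map_neg _ _
    have hfr2 : ∀ Y, act PowerSeries.C (adjM (fr (-θ))) Y = -act PowerSeries.C (adjM (fr θ)) Y :=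
      fun Y => eq_of_pair fun g => by
        rw [← pair_act C_d, hfr, neg_pair, ← pair_act C_d, pair_neg]
    rw [hfr, hfr2, neg_neg, act_neg]
    simp only [Pi.neg_apply, Pi.sub_apply]
    ring

end Cohomology

/-! ### Taylor substitution -/

section Taylor

open PowerSeries (coeff X)
open Finset.HasAntidiagonal (antidiagonal)

variable {n : ℕ} {R A : Type*} [CommRing R] [CommRing A] [DRing A]

theorem epsSum_mul_epsSum (x y : ℕ → PowerSeries A) :
    epsSum x * epsSum y = epsSum fun D => ∑ r ∈ antidiagonal D, x r.1 * y r.2 := by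
  rw [mul_comm, ← epsSum_epsSum fun a b => x a * y b, mul_epsSum]
  congr 1
  funext a
  rw [mul_comm, mul_epsSum]

theorem epsSum_succ (x : ℕ → PowerSeries A) :
    epsSum x = x 0 + X * epsSum fun a => x (a + 1) := by
  rw [← X_mul_epsSum (fun a => x (a + 1)) (x 0)]
  congr 1
  funext a
  cases a <;> rfl

/-- No continuity of `E` is assumed: compatibility with `ε` allows splitting off one term at a time,
and the coefficient of `εᵏ` involves finitely many terms. -/
theorem map_epsSum (E : PowerSeries A →+ PowerSeries A) (hE : ∀ f, E (X * f) = X * E f)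
    (x : ℕ → PowerSeries A) : E (epsSum x) = epsSum fun a => E (x a) := by
  ext k
  induction k generalizing x with
  | zero =>
    rw [epsSum_succ x, epsSum_succ fun a => E (x a), map_add, hE]
    simp
  | succ k ih =>
    rw [epsSum_succ x, epsSum_succ fun a => E (x a), map_add, hE, map_add, map_add,
      PowerSeries.coeff_succ_X_mul, PowerSeries.coeff_succ_X_mul, ih]

/-- The derivatives of order `m` of `c` contracted with `z`. -/
def taylorPow (δ : Fin n → R →+ R) (ρ : R →+* PowerSeries A) (z : Fin n → PowerSeries A) :
    ℕ → R → PowerSeries A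
  | 0, c => ρ c
  | m + 1, c => ∑ i, z i * taylorPow δ ρ z m (δ i c)

/-- The term of order `m` of the Taylor expansion. -/
def taylorTerm (δ : Fin n → R →+ R) (ρ : R →+* PowerSeries A) (κ : ℝ →+* PowerSeries A)
    (z : Fin n → PowerSeries A) (m : ℕ) (c : R) : PowerSeries A :=
  κ (m.factorial : ℝ)⁻¹ * taylorPow δ ρ z m c

variable {δ : Fin n → R →+ R} {ρ : R →+* PowerSeries A} {κ : ℝ →+* PowerSeries A}
  {z : Fin n → PowerSeries A}

theorem taylorPow_add (m : ℕ) (c c' : R) :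
    taylorPow δ ρ z m (c + c') = taylorPow δ ρ z m c + taylorPow δ ρ z m c' := by
  induction m generalizing c c' with
  | zero => exact map_add ρ c c'
  | succ m ih => simp only [taylorPow, map_add, ih, mul_add, Finset.sum_add_distrib]

/-- With `z` held fixed, this is the binomial rule for powers of the directional derivative along
`z`. Division by the factorials then makes Taylor substitution multiplicative. -/
theorem taylorPow_mul (hδ : ∀ i, IsDer (δ i)) (m : ℕ) (c c' : R) :
    taylorPow δ ρ z m (c * c') = ∑ q ∈ antidiagonal m,
      (m.choose q.1 : PowerSeries A) * (taylorPow δ ρ z q.1 c * taylorPow δ ρ z q.2 c') := by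
  induction m generalizing c c' with
  | zero => simp [taylorPow]
  | succ m ih =>
    rw [Finset.sum_antidiagonal_choose_succ_mul
      (fun i j => taylorPow δ ρ z i c * taylorPow δ ρ z j c') m, taylorPow]
    simp only [hδ _ _ _, taylorPow_add, ih, mul_add, Finset.sum_add_distrib, taylorPow,
      Finset.mul_sum, Finset.sum_mul]
    congr 1
    · rw [Finset.sum_comm]
      refine Finset.sum_congr rfl fun q _ => Finset.sum_congr rfl fun i _ => ?_
      ring
    · rw [Finset.sum_comm, sum_antidiagonal_swap m fun a b => ∑ i, z i * ((m.choose a : PowerSeries A) *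
        (taylorPow δ ρ z a c' * taylorPow δ ρ z b (δ i c)))]
      refine Finset.sum_congr rfl fun q _ => Finset.sum_congr rfl fun i _ => ?_
      ring

theorem kappa_natCast (k : ℕ) : κ (k : ℝ) = (k : PowerSeries A) := map_natCast κ k

theorem taylorTerm_mul (hδ : ∀ i, IsDer (δ i)) (m : ℕ) (c c' : R) :
    taylorTerm δ ρ κ z m (c * c') = ∑ q ∈ antidiagonal m,
      taylorTerm δ ρ κ z q.1 c * taylorTerm δ ρ κ z q.2 c' := by
  rw [taylorTerm, taylorPow_mul hδ, Finset.mul_sum]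
  refine Finset.sum_congr rfl fun q hq => ?_
  have hm := Finset.HasAntidiagonal.mem_antidiagonal.1 hq
  have h1 : (m.factorial : ℝ)⁻¹ * (m.choose q.1 : ℝ) =
      (q.1.factorial : ℝ)⁻¹ * (q.2.factorial : ℝ)⁻¹ := by
    rw [← hm, Nat.cast_add_choose]
    field_simp
  have h2 := congrArg κ h1
  rw [map_mul, map_mul, kappa_natCast] at h2
  simp only [taylorTerm]
  linear_combination (taylorPow δ ρ z q.1 c * taylorPow δ ρ z q.2 c') * h2

theorem taylorTerm_zero (c : R) : taylorTerm δ ρ κ z 0 c = ρ c := by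
  simp [taylorTerm, taylorPow]

theorem taylorPow_map_one (hδ : ∀ i, IsDer (δ i)) (m : ℕ) : taylorPow δ ρ z (m + 1) 1 = 0 := by
  have h0 : ∀ m, taylorPow δ ρ z m (0 : R) = 0 := fun m => by
    have := taylorPow_add (δ := δ) (ρ := ρ) (z := z) m 0 0
    rw [add_zero] at this
    exact left_eq_add.1 this
  simp only [taylorPow, (hδ _).map_one, h0, mul_zero, Finset.sum_const_zero]

/-- The substitution of `f₀ + εz` in `c`, by Taylor expansion. -/
def taylorHom (δ : Fin n → R →+ R) (hδ : ∀ i, IsDer (δ i)) (ρ : R →+* PowerSeries A)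
    (κ : ℝ →+* PowerSeries A) (z : Fin n → PowerSeries A) : R →+* PowerSeries A where
  toFun c := epsSum fun m => taylorTerm δ ρ κ z m c
  map_one' := by
    rw [epsSum_succ, taylorTerm_zero, map_one]
    simp only [taylorTerm, taylorPow_map_one hδ, mul_zero]
    have : epsSum (fun _ => (0 : PowerSeries A)) = 0 := by ext; simp [coeff_epsSum]
    rw [this, mul_zero, add_zero]
  map_zero' := by
    ext k
    simp only [coeff_epsSum, taylorTerm]
    refine Finset.sum_eq_zero fun q _ => ?_
    have := taylorPow_add (δ := δ) (ρ := ρ) (z := z) q.1 0 0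
    rw [add_zero] at this
    rw [left_eq_add.1 this, mul_zero, map_zero]
  map_add' c c' := by
    rw [← epsSum_add]
    simp only [taylorTerm, taylorPow_add, mul_add]
  map_mul' c c' := by
    rw [epsSum_mul_epsSum]
    simp only [taylorTerm_mul hδ]

theorem taylorHom_apply (hδ : ∀ i, IsDer (δ i)) (c : R) :
    taylorHom δ hδ ρ κ z c = epsSum fun m => taylorTerm δ ρ κ z m c := rfl

/-- `E` hits either the function or one of the `m` factors `z`; as partial derivatives commute,
these factors contribute equally. For `m = 0` the value of `m - 1` does not matter, the term having
the factor `m`. -/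
theorem der_taylorPow {E : PowerSeries A →+ PowerSeries A} (hE : IsDer E)
    (hcomm : ∀ i j c, δ i (δ j c) = δ j (δ i c)) {e : Fin n → PowerSeries A}
    (he : ∀ c, E (ρ c) = ∑ j, e j * ρ (δ j c)) (m : ℕ) (c : R) :
    E (taylorPow δ ρ z m c) = ∑ j, e j * taylorPow δ ρ z m (δ j c) +
      (m : PowerSeries A) * ∑ j, E (z j) * taylorPow δ ρ z (m - 1) (δ j c) := by
  induction m generalizing c with
  | zero => simp [taylorPow, he]
  | succ m ih =>
    have h1 : ∀ j, ∑ i, z i * taylorPow δ ρ z m (δ j (δ i c)) = taylorPow δ ρ z (m + 1) (δ j c) :=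
      fun j => by simp only [taylorPow, hcomm j]
    have h2 : (m : PowerSeries A) * ∑ j, E (z j) * ∑ i, z i * taylorPow δ ρ z (m - 1) (δ j (δ i c)) =
        (m : PowerSeries A) * ∑ j, E (z j) * taylorPow δ ρ z m (δ j c) := by
      cases m with
      | zero => simp
      | succ m => simp only [taylorPow, Nat.add_sub_cancel, hcomm]
    rw [taylorPow, map_sum]
    simp only [hE _ _, ih, Finset.sum_add_distrib, mul_add]
    have h3 : ∑ i, z i * ∑ j, e j * taylorPow δ ρ z m (δ j (δ i c)) =
        ∑ j, e j * taylorPow δ ρ z (m + 1) (δ j c) := by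
      simp only [← h1, Finset.mul_sum]
      rw [Finset.sum_comm]
      exact Finset.sum_congr rfl fun i _ => Finset.sum_congr rfl fun j _ => by ring
    have h4 : ∑ i, z i * ((m : PowerSeries A) * ∑ j, E (z j) *
        taylorPow δ ρ z (m - 1) (δ j (δ i c))) =
        (m : PowerSeries A) * ∑ j, E (z j) * taylorPow δ ρ z m (δ j c) := by
      rw [← h2]
      simp only [Finset.mul_sum]
      rw [Finset.sum_comm]
      exact Finset.sum_congr rfl fun i _ => Finset.sum_congr rfl fun j _ => by ring
    rw [h3, h4, Nat.add_sub_cancel]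
    push_cast
    simp only [mul_comm (taylorPow δ ρ z m _)]
    ring

/-- The chain rule for Taylor substitution. -/
theorem der_taylorHom (hδ : ∀ i, IsDer (δ i)) {E : PowerSeries A →+ PowerSeries A} (hE : IsDer E)
    (hX : ∀ f, E (X * f) = X * E f) (hκ : ∀ r, E (κ r) = 0)
    (hcomm : ∀ i j c, δ i (δ j c) = δ j (δ i c)) {e : Fin n → PowerSeries A}
    (he : ∀ c, E (ρ c) = ∑ j, e j * ρ (δ j c)) (c : R) :
    E (taylorHom δ hδ ρ κ z c) =
      ∑ j, (e j + X * E (z j)) * taylorHom δ hδ ρ κ z (δ j c) := by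
  -- Since `(m + 1)/(m + 1)! = 1/m!`, differentiating a factor `z` in the term of order `m + 1`
  -- gives a Taylor term of order `m`.
  have h1 : ∀ m, E (taylorTerm δ ρ κ z (m + 1) c) =
      ∑ j, e j * taylorTerm δ ρ κ z (m + 1) (δ j c) +
        ∑ j, E (z j) * taylorTerm δ ρ κ z m (δ j c) := by
    intro m
    have hf : κ ((m + 1).factorial : ℝ)⁻¹ * ((m + 1 : ℕ) : PowerSeries A) =
        κ (m.factorial : ℝ)⁻¹ := by
      rw [← kappa_natCast (κ := κ), ← map_mul, Nat.factorial_succ]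
      congr 1
      push_cast
      field_simp
    simp only [taylorTerm, hE _ _, hκ, mul_zero, add_zero,
      der_taylorPow hE hcomm he, mul_add, Nat.add_sub_cancel, Finset.mul_sum]
    congr 1
    · exact Finset.sum_congr rfl fun j _ => by ring
    · refine Finset.sum_congr rfl fun j _ => ?_
      rw [← hf]; ring
  rw [taylorHom_apply, map_epsSum E hX, epsSum_succ]
  simp only [h1, taylorTerm_zero, he, epsSum_add, add_mul, Finset.sum_add_distrib, mul_add,
    epsSum_sum, ← mul_epsSum]
  rw [← add_assoc]
  congr 1
  · simp only [taylorHom_apply]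
    rw [Finset.mul_sum, ← Finset.sum_add_distrib]
    refine Finset.sum_congr rfl fun j _ => ?_
    rw [epsSum_succ fun m => taylorTerm δ ρ κ z m (δ j c), taylorTerm_zero]; ring
  · rw [Finset.mul_sum]
    exact Finset.sum_congr rfl fun j _ => by rw [taylorHom_apply]; ring

theorem dvd_epsSum {p : PowerSeries A} {x : ℕ → PowerSeries A} (h : ∀ a, p ∣ x a) :
    p ∣ epsSum x := by
  choose y hy using h
  exact ⟨epsSum y, by rw [mul_epsSum]; exact congrArg epsSum (funext hy)⟩

theorem dvd_taylorPow_sub {z' : Fin n → PowerSeries A} {p : PowerSeries A}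
    (h : ∀ i, p ∣ z i - z' i) (m : ℕ) (c : R) :
    p ∣ taylorPow δ ρ z m c - taylorPow δ ρ z' m c := by
  induction m generalizing c with
  | zero => simp [taylorPow]
  | succ m ih =>
    simp only [taylorPow, ← Finset.sum_sub_distrib]
    refine Finset.dvd_sum fun i _ => ?_
    have : z i * taylorPow δ ρ z m (δ i c) - z' i * taylorPow δ ρ z' m (δ i c) =
        (z i - z' i) * taylorPow δ ρ z m (δ i c) +
          z' i * (taylorPow δ ρ z m (δ i c) - taylorPow δ ρ z' m (δ i c)) := by ring
    rw [this]
    exact dvd_add ((h i).mul_right _) ((ih _).mul_left _)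

/-- The first order dependence of Taylor substitution on `z`. -/
theorem taylorHom_perturb (hδ : ∀ i, IsDer (δ i)) {z' y : Fin n → PowerSeries A} {K : ℕ}
    (h : ∀ i, z i = z' i + X ^ K * y i) (c : R) :
    X ^ (K + 2) ∣ taylorHom δ hδ ρ κ z c - taylorHom δ hδ ρ κ z' c -
      X ^ (K + 1) * ∑ j, y j * ρ (δ j c) := by
  have hd : ∀ m, X ^ K ∣ taylorTerm δ ρ κ z m c - taylorTerm δ ρ κ z' m c := fun m => by
    rw [taylorTerm, taylorTerm, ← mul_sub]
    exact (dvd_taylorPow_sub (fun i => ⟨y i, by rw [h]; ring⟩) m c).mul_left _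
  have h1 : taylorTerm δ ρ κ z 1 c - taylorTerm δ ρ κ z' 1 c = X ^ K * ∑ j, y j * ρ (δ j c) := by
    simp only [taylorTerm, taylorPow, Nat.factorial_one, Nat.cast_one, inv_one, map_one, one_mul,
      ← Finset.sum_sub_distrib, Finset.mul_sum]
    refine Finset.sum_congr rfl fun j _ => ?_
    rw [h]; ring
  -- Orders zero and one of the expansion give nothing and the main term. From order two on there is
  -- a factor `ε²`, besides the `εᴷ` dividing each difference.
  have h2 : taylorHom δ hδ ρ κ z c - taylorHom δ hδ ρ κ z' c -
      X ^ (K + 1) * ∑ j, y j * ρ (δ j c) = X ^ 2 * epsSum fun m =>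
        taylorTerm δ ρ κ z (m + 2) c - taylorTerm δ ρ κ z' (m + 2) c := by
    rw [taylorHom_apply, taylorHom_apply, ← epsSum_sub, epsSum_succ, epsSum_succ, taylorTerm_zero,
      taylorTerm_zero, sub_self, zero_add, zero_add, h1]
    simp only [show ∀ a, a + 1 + 1 = a + 2 from fun a => rfl]
    ring
  rw [h2, pow_add, mul_comm]
  exact mul_dvd_mul dvd_rfl (dvd_epsSum fun m => hd _)

end Taylor

/-! ### Substitution of a series in differential polynomials -/

section Substitution

open PowerSeries (coeff)
open Finset.HasAntidiagonal (antidiagonal)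
open JetRing

namespace JetRing

theorem ev_frSym_mul {n : ℕ} {A S : Type*} [CommRing A] [JetRing n A] [CommRing S] [DRing S]
    (π : A →+* S) (f g : A) (k : Fin n) (y : S) :
    DOp.ev π (frSym (f * g) k) y =
      π f * DOp.ev π (frSym g k) y + π g * DOp.ev π (frSym f k) y := by
  have hf : ∀ i s, max (bound f) (bound g) ≤ s → jd (n := n) i s f = 0 := fun i s hs =>
    jd_eq_zero ((le_max_left _ _).trans hs) i
  have hg : ∀ i s, max (bound f) (bound g) ≤ s → jd (n := n) i s g = 0 := fun i s hs =>
    jd_eq_zero ((le_max_right _ _).trans hs) i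
  have hfg : ∀ i s, max (bound f) (bound g) ≤ s → jd (n := n) i s (f * g) = 0 := fun i s hs => by
    rw [isDer_jd, hf i s hs, hg i s hs, mul_zero, mul_zero, add_zero]
  rw [ev_frSym π _ k y hf, ev_frSym π _ k y hg, ev_frSym π _ k y hfg, Finset.mul_sum,
    Finset.mul_sum, ← Finset.sum_add_distrib]
  refine Finset.sum_congr rfl fun s _ => ?_
  rw [isDer_jd, map_add, map_mul, map_mul]
  ring

end JetRing

variable {n : ℕ} {U V : Opens (Coord n)}

/-- The partial derivative of smooth functions as an additive map. -/
def pdHom (i : Fin n) : Smooth V →+ Smooth V := AddMonoidHom.mk' (pd i) (pd_add i)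

theorem isDer_pdHom (i : Fin n) : IsDer (pdHom (V := V) i) := pd_mul i

/-- Smooth functions as constant series. -/
def smoothC : Smooth U →+* PowerSeries (DiffPoly U) := PowerSeries.C.comp MvPolynomial.C

/-- Real numbers as constant series. -/
def realC : ℝ →+* PowerSeries (DiffPoly U) := smoothC.comp (algebraMap ℝ (Smooth U))

theorem frSym_C {S : Type*} [CommRing S] [DRing S] (π : DiffPoly V →+* S) (c : Smooth V)
    (j : Fin n) (y : S) :
    DOp.ev π (frSym (MvPolynomial.C c : DiffPoly V) j) y = π (MvPolynomial.C (pd j c)) * y := by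
  rw [ev_frSym π _ j y (N := 1) fun i s hs => (hasDeg_C c).jetDeriv_eq_zero hs i,
    Finset.sum_range_one, Function.iterate_zero_apply]
  exact congrArg (fun a => π a * y) (jetDeriv_zero_C j c)

theorem frSym_X {S : Type*} [CommRing S] [DRing S] (π : DiffPoly V →+* S) (v : Fin n × ℕ)
    (y : Fin n → S) :
    ∑ j, DOp.ev π (frSym (MvPolynomial.X v : DiffPoly V) j) (y j) = d^[v.2 + 1] (y v.1) := by
  have h : ∀ j, DOp.ev π (frSym (MvPolynomial.X v : DiffPoly V) j) (y j) =
      if j = v.1 then d^[v.2 + 1] (y j) else 0 := by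
    intro j
    rw [ev_frSym π _ j (y j) (N := v.2 + 2) fun i s hs => (hasDeg_X v).jetDeriv_eq_zero hs i,
      Finset.sum_range_succ']
    have h0 : jd j 0 (MvPolynomial.X v : DiffPoly V) = 0 := jetDeriv_zero_X j v
    have h1 : ∀ s, jd j (s + 1) (MvPolynomial.X v : DiffPoly V) = if v = (j, s) then 1 else 0 :=
      fun s => jetDeriv_succ_X j s v
    rw [h0, map_zero, zero_mul, add_zero]
    simp only [h1]
    split_ifs with hj
    · subst hj
      rw [Finset.sum_eq_single v.2]
      · rw [if_pos rfl, map_one, one_mul]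
      · intro s _ hs
        rw [if_neg fun h => hs (by rw [h]), map_zero, zero_mul]
      · simp
    · refine Finset.sum_eq_zero fun s _ => ?_
      rw [if_neg fun h => hj (by rw [h]), map_zero, zero_mul]
  simp only [h, Finset.sum_ite_eq', Finset.mem_univ, if_true]

variable (φ : Fin n → Smooth U) (hφ : ∀ u, toMap φ u ∈ V) (z : Fin n → PowerSeries (DiffPoly U))

/-- The series `φ + εz`. -/
def ser (i : Fin n) : PowerSeries (DiffPoly U) := smoothC (φ i) + PowerSeries.X * z i

/-- The substitution of `φ + εz` in smooth functions. -/
def smoothPull : Smooth V →+* PowerSeries (DiffPoly U) :=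
  taylorHom pdHom isDer_pdHom (smoothC.comp (compSmoothHom φ hφ)) realC z

/-- The substitution of `φ + εz` in differential polynomials. -/
def pullHom : DiffPoly V →+* PowerSeries (DiffPoly U) :=
  MvPolynomial.eval₂Hom (smoothPull φ hφ z) fun v => d^[v.2 + 1] (ser φ z v.1)

theorem pullHom_C (c : Smooth V) : pullHom φ hφ z (MvPolynomial.C c) = smoothPull φ hφ z c :=
  MvPolynomial.eval₂Hom_C _ _ _

theorem pullHom_X (v : Fin n × ℕ) :
    pullHom φ hφ z (MvPolynomial.X v) = d^[v.2 + 1] (ser φ z v.1) :=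
  MvPolynomial.eval₂Hom_X' _ _ _

variable {φ z}

/-- The chain rule. -/
theorem der_pullHom {E : PowerSeries (DiffPoly U) →+ PowerSeries (DiffPoly U)} (hE : IsDer E)
    (hX : ∀ f, E (PowerSeries.X * f) = PowerSeries.X * E f) (hd : ∀ f, E (d f) = d (E f))
    {y : Fin n → PowerSeries (DiffPoly U)}
    (hy : ∀ c, E (smoothC c) = ∑ k, y k * smoothC (pd k c)) (g : DiffPoly V) :
    E (pullHom φ hφ z g) = ∑ j, DOp.ev (pullHom φ hφ z) (frSym g j) (E (ser φ z j)) := by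
  have hκ : ∀ r, E (realC r) = 0 := fun r => by
    rw [realC, RingHom.comp_apply, hy]
    refine Finset.sum_eq_zero fun k _ => ?_
    rw [pd_algebraMap, map_zero, mul_zero]
  have hρ : ∀ c : Smooth V, E ((smoothC.comp (compSmoothHom φ hφ)) c) =
      ∑ j, E (smoothC (φ j)) * (smoothC.comp (compSmoothHom φ hφ)) (pdHom j c) := by
    intro c
    simp only [RingHom.comp_apply, hy, compSmoothHom_apply, pd_compSmooth, map_sum, map_mul,
      Finset.mul_sum, Finset.sum_mul]
    rw [Finset.sum_comm]
    refine Finset.sum_congr rfl fun j _ => Finset.sum_congr rfl fun k _ => ?_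
    rw [mul_assoc]
    rfl
  have hds : ∀ s f, E (d^[s] f) = d^[s] (E f) := by
    intro s
    induction s with
    | zero => exact fun f => rfl
    | succ s ih => intro f; rw [Function.iterate_succ_apply, ih, hd, ← Function.iterate_succ_apply]
  induction g using MvPolynomial.induction_on with
  | C c =>
    rw [pullHom_C, smoothPull, der_taylorHom isDer_pdHom hE hX hκ (fun i j c => pd_comm i j c) hρ]
    refine Finset.sum_congr rfl fun j _ => ?_
    rw [frSym_C, pullHom_C, ser, map_add, hX, mul_comm]
    rfl
  | add f g hf hg =>
    rw [map_add, map_add, hf, hg, ← Finset.sum_add_distrib]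
    refine Finset.sum_congr rfl fun j _ => ?_
    rw [frSym_add, map_add, AddMonoidHom.add_apply]
  | mul_X f v hf =>
    rw [map_mul, hE, hf, pullHom_X, hds]
    simp only [ev_frSym_mul, Finset.sum_add_distrib, ← Finset.mul_sum]
    rw [frSym_X (pullHom φ hφ z) v fun j => E (ser φ z j), pullHom_X]

/-- The chain rule for the derivation `∂ₓ` itself. It makes substitution a morphism of differential
rings, so that operators with substituted coefficients compose and have adjoints. -/
theorem pullHom_d (g : DiffPoly V) : pullHom φ hφ z (d g) = d (pullHom φ hφ z g) := by
  rw [der_pullHom hφ (E := d) isDer_d d_X_mul (fun f => rfl)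
    (y := fun k => PowerSeries.C (MvPolynomial.X (k, 0))) fun c => ?_]
  · have hb : ∀ i s, jetBound g ≤ s → jetDeriv i s g = 0 := fun i s hs => jetDeriv_eq_zero hs i
    have h1 : d g = ∑ i, ∑ s ∈ Finset.range (jetBound g), MvPolynomial.X (i, s) * jetDeriv i s g := by
      rw [d_eq_dx, dx, derOf_eq_sum _ g hb]
    refine (congrArg (pullHom φ hφ z) h1).trans ?_
    rw [map_sum]
    refine Finset.sum_congr rfl fun j _ => ?_
    rw [ev_frSym (pullHom φ hφ z) g j _ (N := jetBound g) hb, map_sum]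
    refine Finset.sum_congr rfl fun s _ => ?_
    rw [map_mul, pullHom_X, mul_comm, ← Function.iterate_succ_apply]
    rfl
  · rw [smoothC, RingHom.comp_apply, d_C, d_eq_dx, dx_C, map_sum]
    simp only [map_mul, RingHom.comp_apply]

theorem evolS_smoothC (Y : Fin n → PowerSeries (DiffPoly U)) (c : Smooth U) :
    evolS Y (smoothC c) = ∑ k, Y k * smoothC (pd k c) := by
  ext D : 1
  rw [coeff_evolS, Finset.sum_eq_single (D, 0), map_sum]
  · simp only [smoothC, RingHom.comp_apply, PowerSeries.coeff_mul_C, PowerSeries.coeff_zero_C]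
    exact evolField_C _ c
  · rintro ⟨a, b⟩ h hne
    have hb : b ≠ 0 := by
      rintro rfl
      simp only [Finset.HasAntidiagonal.mem_antidiagonal, add_zero] at h
      exact hne (by rw [h])
    rw [smoothC, RingHom.comp_apply, PowerSeries.coeff_C, if_neg hb, map_zero]
  · intro h; simp at h

theorem evolS_pullHom (Y : Fin n → PowerSeries (DiffPoly U)) (g : DiffPoly V) :
    evolS Y (pullHom φ hφ z g) =
      ∑ j, DOp.ev (pullHom φ hφ z) (frSym g j) (prV Y (ser φ z) j) :=
  der_pullHom hφ (evolS_mul Y) (evolS_X Y) (evolS_d Y) (evolS_smoothC Y) g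

/-- The substitution of `φ + εz` in a vector of series. -/
def pullS (Θ : Fin n → PowerSeries (DiffPoly V)) (i : Fin n) : PowerSeries (DiffPoly U) :=
  epsSum fun a => pullHom φ hφ z (coeff a (Θ i))

theorem prV_pullS (Θ : Fin n → PowerSeries (DiffPoly V)) (Y : Fin n → PowerSeries (DiffPoly U)) :
    prV Y (pullS (z := z) hφ Θ) = act (pullHom φ hφ z) (fr Θ) (prV Y (ser φ z)) := by
  funext i
  rw [prV_apply, pullS, map_epsSum _ (evolS_X Y), act_apply]
  congr 1
  funext a
  rw [evolS_pullHom, fr, PowerSeries.coeff_mk]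
  rfl

/-- The pull-back of a 1-form along the substitution of `φ + εz`. -/
def pullForm (z : Fin n → PowerSeries (DiffPoly U)) (Θ : Fin n → PowerSeries (DiffPoly V)) :
    Fin n → PowerSeries (DiffPoly U) :=
  act PowerSeries.C (adjM (fr (ser φ z))) (pullS (z := z) hφ Θ)

/-- Exterior differentiation commutes with pull-back: for the substitution `T` the operator of the
result is `D_T† (dΘ ∘ T) D_T`. -/
theorem dForm_pullForm (Θ : Fin n → PowerSeries (DiffPoly V))
    (Y Z : Fin n → PowerSeries (DiffPoly U)) :
    dForm (pullForm hφ z Θ) Y Z = pair (act PowerSeries.C (adjM (fr (ser φ z)))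
      (act (pullHom φ hφ z) (dM Θ) (act PowerSeries.C (fr (ser φ z)) Y))) Z := by
  rw [pullForm, dForm_pullback rfl, prV_pullS, prV_pullS, ← pair_act C_d, act_fr, act_fr, dM, sub_act,
    sub_pair, ← pair_act (pullHom_d hφ), pair_comm (prV Y (ser φ z))]

theorem act_eq_of_pullForm {Θ : Fin n → PowerSeries (DiffPoly V)}
    {ΘA : Fin n → PowerSeries (DiffPoly U)}
    (h : ∀ Y Z, dForm (pullForm hφ z Θ) Y Z = dForm ΘA Y Z) (Y : Fin n → PowerSeries (DiffPoly U)) :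
    act PowerSeries.C (dM ΘA) Y = act PowerSeries.C (adjM (fr (ser φ z)))
      (act (pullHom φ hφ z) (dM Θ) (act PowerSeries.C (fr (ser φ z)) Y)) :=
  eq_of_pair fun Z => by rw [pair_act_dM, ← h, dForm_pullForm]

theorem coeff_zero_ser (i : Fin n) : coeff 0 (ser φ z i) = MvPolynomial.C (φ i) := by
  simp [ser, smoothC]

theorem coeff_zero_fr_ser : coeff 0 (fr (ser φ z)) =
    coeff 0 (smoothOp (Matrix.of fun i k => pd k (φ i))) := by
  refine Matrix.ext fun i k => ?_
  rw [coeff_zero_smoothOp, fr, PowerSeries.coeff_mk, Matrix.of_apply, coeff_zero_ser,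
    frSym_eq (N := 1) _ k fun i s hs => (hasDeg_C _).jetDeriv_eq_zero hs i, Finset.sum_range_one,
    Matrix.of_apply]
  exact congrArg _ (jetDeriv_zero_C k (φ i))

theorem isUnit_fr_ser
    (hdet : ∀ u, (Matrix.of fun i k => (pd k (φ i)).1 u).det ≠ 0) : IsUnit (fr (ser φ z)) := by
  rw [PowerSeries.isUnit_iff_constantCoeff, ← PowerSeries.coeff_zero_eq_constantCoeff_apply,
    coeff_zero_fr_ser, PowerSeries.coeff_zero_eq_constantCoeff_apply]
  exact ((Smooth.isUnit_matrix (M := Matrix.of fun i k => pd k (φ i)) hdet).map smoothOp).map _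

/-- Inverting `dΘ_A = D_T† (dΘ ∘ T) D_T` yields `B ∘ T = D_T A D_T†`, the transformation law under a
Miura transformation. `D_T` is invertible because its constant term is the Jacobian of `φ`. -/
theorem act_conj {Θ : Fin n → PowerSeries (DiffPoly V)} {ΘA : Fin n → PowerSeries (DiffPoly U)}
    {A : MOp n (DiffPoly U)} {B : MOp n (DiffPoly V)}
    (hdet : ∀ u, (Matrix.of fun i k => (pd k (φ i)).1 u).det ≠ 0)
    (h : ∀ Y Z, dForm (pullForm hφ z Θ) Y Z = dForm ΘA Y Z)
    (hA : ∀ f, act PowerSeries.C A (act PowerSeries.C (dM ΘA) f) = f) (hB : dM Θ * B = 1)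
    (f : Fin n → PowerSeries (DiffPoly U)) :
    act (pullHom φ hφ z) B f = act PowerSeries.C (fr (ser φ z)) (act PowerSeries.C A
      (act PowerSeries.C (adjM (fr (ser φ z))) f)) := by
  obtain ⟨N, hN, -⟩ := isUnit_iff_exists.1 (isUnit_fr_ser (z := z) hdet)
  set g := act (pullHom φ hφ z) B f with hg
  have h1 : act (pullHom φ hφ z) (dM Θ) g = f := by
    rw [hg, ← mul_act (pullHom_d hφ), hB, one_act]
  have h2 : act PowerSeries.C (fr (ser φ z)) (act PowerSeries.C N g) = g := by
    rw [← mul_act C_d, hN, one_act]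
  have h3 := act_eq_of_pullForm hφ h (act PowerSeries.C N g)
  rw [h2, h1] at h3
  rw [← h3, hA, h2]

end Substitution

/-! ### Degrees of substituted series -/

section PullDegree

open PowerSeries (coeff)
open Finset.HasAntidiagonal (antidiagonal)
open JetRing

variable {n : ℕ} {U V : Opens (Coord n)}

/-- Series whose coefficient of `εᵏ` has degree `k + e`. -/
def GradedBy (e : ℕ) (f : PowerSeries (DiffPoly U)) : Prop :=
  ∀ k, HasDeg (coeff k f) (k + e)

theorem GradedBy.mul {e e' : ℕ} {f g : PowerSeries (DiffPoly U)} (hf : GradedBy e f)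
    (hg : GradedBy e' g) : GradedBy (e + e') (f * g) := fun k => by
  rw [PowerSeries.coeff_mul]
  refine HasDeg.sum fun q hq => ?_
  have := (hf q.1).mul (hg q.2)
  have hk := Finset.HasAntidiagonal.mem_antidiagonal.1 hq
  rwa [show q.1 + e + (q.2 + e') = k + (e + e') by omega] at this

theorem GradedBy.sum {ι : Type*} {s : Finset ι} {e : ℕ} {f : ι → PowerSeries (DiffPoly U)}
    (h : ∀ a ∈ s, GradedBy e (f a)) : GradedBy e (∑ a ∈ s, f a) := fun k => by
  rw [map_sum]; exact HasDeg.sum fun a ha => h a ha k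

theorem gradedBy_smoothC (c : Smooth U) : GradedBy 0 (smoothC c) := graded_C c

theorem gradedBy_one : GradedBy 0 (1 : PowerSeries (DiffPoly U)) := by
  have := gradedBy_smoothC (1 : Smooth U)
  rwa [map_one] at this

theorem GradedBy.pow {e : ℕ} {f : PowerSeries (DiffPoly U)} (hf : GradedBy e f) (m : ℕ) :
    GradedBy (m * e) (f ^ m) := by
  induction m with
  | zero => rw [zero_mul, pow_zero]; exact gradedBy_one
  | succ m ih =>
    rw [pow_succ, Nat.succ_mul]
    exact ih.mul hf

theorem GradedBy.prod {ι : Type*} {s : Finset ι} {e : ι → ℕ} {f : ι → PowerSeries (DiffPoly U)}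
    (h : ∀ a ∈ s, GradedBy (e a) (f a)) : GradedBy (∑ a ∈ s, e a) (∏ a ∈ s, f a) := by
  classical
  induction s using Finset.induction_on with
  | empty => simpa using gradedBy_one
  | insert a s ha ih =>
    rw [Finset.prod_insert ha, Finset.sum_insert ha]
    exact (h a (Finset.mem_insert_self _ _)).mul
      (ih fun b hb => h b (Finset.mem_insert_of_mem hb))

theorem GradedBy.iterate_d {e : ℕ} {f : PowerSeries (DiffPoly U)} (hf : GradedBy e f) (s : ℕ) :
    GradedBy (e + s) (d^[s] f) := fun k => by
  rw [coeff_iterate_d, ← add_assoc]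
  exact (hf k).iterate_dx s

theorem GradedBy.epsSum {e : ℕ} {x : ℕ → PowerSeries (DiffPoly U)}
    (h : ∀ a, GradedBy (a + e) (x a)) : GradedBy e (epsSum x) := fun k => by
  rw [coeff_epsSum]
  refine HasDeg.sum fun q hq => ?_
  have hk := Finset.HasAntidiagonal.mem_antidiagonal.1 hq
  have := h q.1 q.2
  rwa [show q.2 + (q.1 + e) = k + e by omega] at this

variable {φ : Fin n → Smooth U} (hφ : ∀ u, toMap φ u ∈ V) {z : Fin n → PowerSeries (DiffPoly U)}

theorem gradedBy_taylorPow (hz : ∀ i, GradedBy 1 (z i)) (m : ℕ) (c : Smooth V) :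
    GradedBy m (taylorPow pdHom (smoothC.comp (compSmoothHom φ hφ)) z m c) := by
  induction m generalizing c with
  | zero => exact gradedBy_smoothC _
  | succ m ih =>
    rw [taylorPow, add_comm]
    exact GradedBy.sum fun i _ => (hz i).mul (ih _)

theorem gradedBy_smoothPull (hz : ∀ i, GradedBy 1 (z i)) (c : Smooth V) :
    GradedBy 0 (smoothPull φ hφ z c) := by
  rw [smoothPull, taylorHom_apply]
  refine GradedBy.epsSum fun m => ?_
  have h := (gradedBy_smoothC (U := U) (algebraMap ℝ _ (m.factorial : ℝ)⁻¹)).mul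
    (gradedBy_taylorPow hφ hz m c)
  rwa [zero_add] at h

theorem gradedBy_ser (hz : ∀ i, GradedBy 1 (z i)) (i : Fin n) : GradedBy 0 (ser φ z i) := by
  intro k
  rw [ser, map_add]
  refine HasDeg.add (gradedBy_smoothC (φ i) k) ?_
  cases k with
  | zero => rw [PowerSeries.coeff_zero_X_mul]; exact hasDeg_zero _
  | succ k => rw [PowerSeries.coeff_succ_X_mul]; exact hz i k

theorem gradedBy_pullHom (hz : ∀ i, GradedBy 1 (z i)) {g : DiffPoly V} {e : ℕ}
    (hg : HasDeg g e) : GradedBy e (pullHom φ hφ z g) := by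
  rw [pullHom, MvPolynomial.coe_eval₂Hom, MvPolynomial.eval₂_eq]
  refine GradedBy.sum fun m hm => ?_
  have h1 := hg (MvPolynomial.mem_support_iff.1 hm)
  rw [Finsupp.weight_apply, Finsupp.sum] at h1
  have h2 := (gradedBy_smoothPull hφ hz (g.coeff m)).mul (GradedBy.prod (s := m.support)
    (e := fun v => m v * (0 + (v.2 + 1))) (f := fun v => (d^[v.2 + 1] (ser φ z v.1)) ^ m v)
    fun v _ => ((gradedBy_ser hz v.1).iterate_d (v.2 + 1)).pow (m v))
  simp only [zero_add, ← smul_eq_mul] at h2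
  rwa [h1] at h2

theorem graded_pullS (hz : ∀ i, GradedBy 1 (z i)) {Θ : Fin n → PowerSeries (DiffPoly V)}
    (hΘ : ∀ i, Graded (Θ i)) (i : Fin n) : Graded (pullS (z := z) hφ Θ i) :=
  GradedBy.epsSum (e := 0) fun a => gradedBy_pullHom hφ hz (hΘ i a)

theorem graded_pullForm (hz : ∀ i, GradedBy 1 (z i)) {Θ : Fin n → PowerSeries (DiffPoly V)}
    (hΘ : ∀ i, Graded (Θ i)) (i : Fin n) : Graded (pullForm hφ z Θ i) :=
  (gradedOp_fr (gradedBy_ser hz)).adjM.act (graded_pullS hφ hz hΘ) i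

end PullDegree

/-! ### First order perturbation of the pulled back form -/

section Perturbation

open PowerSeries (coeff X)
open Finset.HasAntidiagonal (antidiagonal)
open JetRing

namespace JetRing

variable {n : ℕ} {A : Type*} [CommRing A] [JetRing n A]

/-- The pull-back `(fr T)† w` of the 1-form `w` along `T`. -/
def coForm (T w : Fin n → PowerSeries A) : Fin n → PowerSeries A :=
  act PowerSeries.C (adjM (fr T)) w

theorem pair_coForm (T w g : Fin n → PowerSeries A) :
    pair (coForm T w) g = pair w (prV g T) := by
  rw [coForm, ← pair_act C_d, act_fr]

theorem coForm_add_left (T T' w : Fin n → PowerSeries A) :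
    coForm (T + T') w = coForm T w + coForm T' w :=
  eq_of_pair fun g => by rw [add_pair, pair_coForm, pair_coForm, pair_coForm, prV_add, pair_add]

theorem coForm_add (T w w' : Fin n → PowerSeries A) :
    coForm T (w + w') = coForm T w + coForm T w' := act_add _ _ _ _

theorem pair_smul (p : PowerSeries A) (f g : Fin n → PowerSeries A) :
    pair (p • f) g = pair f (p • g) := by
  simp only [pair, Pi.smul_apply, smul_eq_mul, mul_left_comm, mul_assoc]

theorem coForm_X (T w : Fin n → PowerSeries A) :
    coForm T ((X : PowerSeries A) • w) = (X : PowerSeries A) • coForm T w := act_X _ _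

theorem coForm_X_left (T w : Fin n → PowerSeries A) :
    coForm ((X : PowerSeries A) • T) w = (X : PowerSeries A) • coForm T w :=
  eq_of_pair fun g => by
    rw [pair_coForm, prV_X, ← pair_smul, pair_smul, pair_smul, pair_coForm, prV_X_left]

theorem coForm_X_pow (N : ℕ) (T w : Fin n → PowerSeries A) :
    coForm T ((X : PowerSeries A) ^ N • w) = (X : PowerSeries A) ^ N • coForm T w := by
  induction N with
  | zero => simp
  | succ N ih => rw [pow_succ', mul_smul, coForm_X, ih, mul_smul]

theorem coForm_X_pow_left (N : ℕ) (T w : Fin n → PowerSeries A) :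
    coForm ((X : PowerSeries A) ^ N • T) w = (X : PowerSeries A) ^ N • coForm T w := by
  induction N with
  | zero => simp
  | succ N ih => rw [pow_succ', mul_smul, coForm_X_left, ih, mul_smul]

end JetRing

variable {n : ℕ} {U V : Opens (Coord n)} {φ : Fin n → Smooth U} (hφ : ∀ u, toMap φ u ∈ V)
  {z z' y : Fin n → PowerSeries (DiffPoly U)}

/-- Both substitutions are ring homomorphisms, so the congruence modulo `ε^{K+1}` is checked on
coefficients and on jet variables. -/
theorem X_pow_dvd_pullHom {K : ℕ} (h : ∀ i, z i = z' i + X ^ K * y i) (g : DiffPoly V) :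
    X ^ (K + 1) ∣ pullHom φ hφ z g - pullHom φ hφ z' g := by
  set I := Ideal.span {(X : PowerSeries (DiffPoly U)) ^ (K + 1)} with hI
  rw [← Ideal.mem_span_singleton, ← Ideal.Quotient.mk_eq_mk_iff_sub_mem]
  have : (Ideal.Quotient.mk I).comp (pullHom φ hφ z) =
      (Ideal.Quotient.mk I).comp (pullHom φ hφ z') := by
    refine MvPolynomial.ringHom_ext (fun c => ?_) (fun v => ?_)
    · simp only [RingHom.comp_apply, pullHom_C]
      rw [Ideal.Quotient.mk_eq_mk_iff_sub_mem, hI, Ideal.mem_span_singleton]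
      have h1 := taylorHom_perturb (κ := realC) (ρ := smoothC.comp (compSmoothHom φ hφ))
        isDer_pdHom h c
      have h2 : (X : PowerSeries (DiffPoly U)) ^ (K + 1) ∣ X ^ (K + 2) := pow_dvd_pow _ (by omega)
      exact (dvd_sub_left (dvd_mul_right _ _)).1 (h2.trans h1)
    · simp only [RingHom.comp_apply, pullHom_X]
      rw [Ideal.Quotient.mk_eq_mk_iff_sub_mem, hI, Ideal.mem_span_singleton, ← iterate_map_sub]
      have h1 : ser φ z v.1 - ser φ z' v.1 = X ^ (K + 1) * y v.1 := by
        rw [ser, ser, h]; ring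
      have h2 : ∀ (N s : ℕ) (f : PowerSeries (DiffPoly U)), d^[s] (X ^ N * f) = X ^ N * d^[s] f := by
        intro N s f
        induction s generalizing f with
        | zero => rfl
        | succ s ih =>
          have h3 : d ((X : PowerSeries (DiffPoly U)) ^ N * f) = X ^ N * d f := by
            clear ih
            induction N with
            | zero => simp
            | succ N ih => rw [pow_succ', mul_assoc, d_X_mul, ih, mul_assoc]
          rw [Function.iterate_succ_apply, h3, ih, Function.iterate_succ_apply]
      rw [h1, h2]
      exact dvd_mul_right _ _
  exact RingHom.congr_fun this g

/-- To this order only the `ε⁰` coefficient of `Θ` matters; the other coefficients bring a further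
factor `ε`. -/
theorem X_pow_dvd_pullS {K : ℕ} (h : ∀ i, z i = z' i + X ^ K * y i)
    {Θ : Fin n → PowerSeries (DiffPoly V)} {θ : Fin n → Smooth V}
    (hθ : ∀ i, coeff 0 (Θ i) = MvPolynomial.C (θ i)) (i : Fin n) :
    X ^ (K + 2) ∣ pullS (z := z) hφ Θ i - pullS (z := z') hφ Θ i -
      X ^ (K + 1) * ∑ j, y j * smoothC (compSmooth φ hφ (pd j (θ i))) := by
  have h1 := taylorHom_perturb (κ := realC) (ρ := smoothC.comp (compSmoothHom φ hφ))
    isDer_pdHom h (θ i)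
  have h2 : pullS (z := z) hφ Θ i - pullS (z := z') hφ Θ i =
      (smoothPull φ hφ z (θ i) - smoothPull φ hφ z' (θ i)) +
        X * epsSum fun a => pullHom φ hφ z (coeff (a + 1) (Θ i)) -
          pullHom φ hφ z' (coeff (a + 1) (Θ i)) := by
    rw [pullS, pullS, ← epsSum_sub, epsSum_succ, hθ, pullHom_C, pullHom_C]
  rw [h2, add_sub_right_comm]
  refine dvd_add h1 ?_
  rw [show K + 2 = 1 + (K + 1) by omega, pow_add, pow_one]
  exact mul_dvd_mul dvd_rfl (dvd_epsSum fun a => X_pow_dvd_pullHom hφ h _)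

theorem exists_pullS_eq {Θ : Fin n → PowerSeries (DiffPoly V)} {θ : Fin n → Smooth V}
    (hθ : ∀ i, coeff 0 (Θ i) = MvPolynomial.C (θ i)) :
    ∃ r : Fin n → PowerSeries (DiffPoly U), pullS (z := z) hφ Θ =
      (fun i => smoothC (compSmooth φ hφ (θ i))) + (X : PowerSeries (DiffPoly U)) • r := by
  refine ⟨fun i => (epsSum fun a => taylorTerm pdHom (smoothC.comp (compSmoothHom φ hφ)) realC z
    (a + 1) (θ i)) + epsSum fun a => pullHom φ hφ z (coeff (a + 1) (Θ i)), funext fun i => ?_⟩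
  rw [pullS, epsSum_succ, hθ, pullHom_C, smoothPull, taylorHom_apply, epsSum_succ, taylorTerm_zero]
  simp only [Pi.add_apply, Pi.smul_apply, smul_eq_mul]
  rw [mul_add, add_assoc]
  rfl

theorem sum_mul_sum_swap {S : Type*} [CommRing S] (w g : Fin n → S) (a : Fin n → Fin n → S) :
    ∑ i, w i * ∑ k, g k * a k i = ∑ k, (∑ i, a k i * w i) * g k := by
  simp only [Finset.mul_sum, Finset.sum_mul]
  rw [Finset.sum_comm]
  exact Finset.sum_congr rfl fun i _ => Finset.sum_congr rfl fun k _ => by ring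

theorem sum_sum_mul_swap {S : Type*} [CommRing S] (g : Fin n → S) (b : Fin n → S)
    (a : Fin n → Fin n → S) :
    ∑ j, (∑ i, b i * a j i) * g j = ∑ i, b i * ∑ j, g j * a j i := by
  simp only [Finset.mul_sum, Finset.sum_mul]
  rw [Finset.sum_comm]
  exact Finset.sum_congr rfl fun i _ => Finset.sum_congr rfl fun k _ => by ring

theorem pair_prV_smooth (g w : Fin n → PowerSeries (DiffPoly U)) (f : Fin n → Smooth U) :
    pair w (prV g fun i => smoothC (f i)) =
      pair (fun k => ∑ i, smoothC (pd k (f i)) * w i) g := by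
  have h : ∀ i, prV g (fun i => smoothC (f i)) i = ∑ k, g k * smoothC (pd k (f i)) :=
    fun i => evolS_smoothC g (f i)
  unfold pair
  refine congrArg _ ?_
  rw [← sum_mul_sum_swap w g fun k i => smoothC (pd k (f i))]
  exact Finset.sum_congr rfl fun i _ => congrArg (w i * ·) (h i)

theorem coForm_smooth (w : Fin n → PowerSeries (DiffPoly U)) :
    coForm (fun i => smoothC (φ i)) w = fun k => ∑ i, smoothC (pd k (φ i)) * w i :=
  eq_of_pair fun g => (pair_coForm _ _ _).trans (pair_prV_smooth g w φ)

/-- The product rule for the functional `∫ w·y`: its variational derivative is `D_y† w` plus a term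
without derivatives of `y`. This separates the exact part of the first variation. -/
theorem coForm_smooth_right (y : Fin n → PowerSeries (DiffPoly U)) (w : Fin n → Smooth U) :
    coForm y (fun i => smoothC (w i)) = delta (∑ i, smoothC (w i) * y i) -
      fun k => ∑ i, smoothC (pd k (w i)) * y i := by
  refine eq_of_pair fun g => ?_
  rw [sub_pair, pair_delta, integ_sum_evolS_mul (φ := fun i => smoothC (w i)), pair_coForm,
    pair_comm (prV g fun i => smoothC (w i)) y, pair_prV_smooth, add_sub_cancel_left]

/-- The matrix that governs the dependence of the pulled back form on the perturbation. -/
def perturbMatrix (φ : Fin n → Smooth U) (hφ : ∀ u, toMap φ u ∈ V) (θ : Fin n → Smooth V) :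
    Matrix (Fin n) (Fin n) (Smooth U) :=
  (Matrix.of fun k i => pd k (φ i)) *
    (compSmoothHom φ hφ).mapMatrix (Matrix.of fun i j => pd j (θ i) - pd i (θ j))

theorem perturbMatrix_apply (θ : Fin n → Smooth V) (k j : Fin n) :
    perturbMatrix φ hφ θ k j = ∑ i, pd k (φ i) * compSmooth φ hφ (pd j (θ i)) -
      pd k (compSmooth φ hφ (θ j)) := by
  rw [pd_compSmooth, ← Finset.sum_sub_distrib, perturbMatrix, Matrix.mul_apply]
  refine Finset.sum_congr rfl fun i _ => ?_
  rw [← mul_sub]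
  rfl

/-- This is Cartan's formula for the first variation of a pulled back 1-form: an exact term `δ∫θ·y`
plus the contraction of `dθ` with `y`. At leading order `dθ` is a matrix of functions, so the second
term is algebraic in `y`. -/
theorem pullForm_perturb {K : ℕ} (h : ∀ i, z i = z' i + X ^ K * y i)
    {Θ : Fin n → PowerSeries (DiffPoly V)} {θ : Fin n → Smooth V}
    (hθ : ∀ i, coeff 0 (Θ i) = MvPolynomial.C (θ i)) (k : Fin n) :
    X ^ (K + 2) ∣ pullForm hφ z Θ k - pullForm hφ z' Θ k - X ^ (K + 1) *
      (delta (∑ i, smoothC (compSmooth φ hφ (θ i)) * y i) k +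
        ∑ j, smoothC (perturbMatrix φ hφ θ k j) * y j) := by
  set N := K + 1 with hN
  choose r₁ hr₁ using X_pow_dvd_pullS hφ h hθ
  obtain ⟨w₁, hw₁⟩ := exists_pullS_eq (z := z) hφ hθ
  set v : Fin n → PowerSeries (DiffPoly U) :=
    fun i => ∑ j, y j * smoothC (compSmooth φ hφ (pd j (θ i))) with hv
  set ŝ : Fin n → PowerSeries (DiffPoly U) := fun i => smoothC (φ i) with hŝ
  set p : PowerSeries (DiffPoly U) := X with hp
  have hw : pullS (z := z) hφ Θ = pullS (z := z') hφ Θ + p ^ N • (v + p • r₁) := by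
    funext i
    simp only [Pi.add_apply, Pi.smul_apply, smul_eq_mul]
    have := hr₁ i
    rw [sub_eq_iff_eq_add, sub_eq_iff_eq_add] at this
    rw [this, hv, hN]
    ring
  have hT : ser φ z = ser φ z' + p ^ N • y := by
    funext i
    simp only [Pi.add_apply, Pi.smul_apply, smul_eq_mul, ser]
    rw [h, hN]; ring
  have hT' : ser φ z' = ŝ + p • z' := rfl
  -- Bilinear expansion of the pull-back in the map and in the substituted form; every term beyond
  -- the two leading ones acquires one more factor `ε`.
  have key : pullForm hφ z Θ = pullForm hφ z' Θ + p ^ N • (coForm ŝ v + coForm y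
      (fun i => smoothC (compSmooth φ hφ (θ i)))) +
      p ^ N • p • (coForm z' v + coForm (ser φ z') r₁ + coForm y w₁) := by
    have h1 : pullForm hφ z Θ = coForm (ser φ z') (pullS (z := z') hφ Θ) +
        p ^ N • coForm (ser φ z') (v + p • r₁) + p ^ N • coForm y (pullS (z := z) hφ Θ) := by
      change coForm (ser φ z) (pullS (z := z) hφ Θ) = _
      conv_lhs => rw [hT, coForm_add_left, coForm_X_pow_left]
      rw [hw, coForm_add (ser φ z'), coForm_X_pow]
    rw [h1, coForm_add (ser φ z'), coForm_X, hw₁, coForm_add y, coForm_X]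
    conv_lhs =>
      enter [1, 2]
      rw [hT', coForm_add_left ŝ, coForm_X_left]
    simp only [smul_add]
    change coForm (ser φ z') (pullS (z := z') hφ Θ) + _ + _ = coForm (ser φ z') (pullS (z := z') hφ Θ) + _ + _
    rw [hT']
    abel
  have hk := congrFun key k
  rw [coForm_smooth, coForm_smooth_right] at hk
  have hM : ∑ j, smoothC (perturbMatrix φ hφ θ k j) * y j =
      ∑ i, smoothC (pd k (φ i)) * v i - ∑ i, smoothC (pd k (compSmooth φ hφ (θ i))) * y i := by
    rw [← sum_sum_mul_swap, ← Finset.sum_sub_distrib]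
    refine Finset.sum_congr rfl fun j _ => ?_
    rw [perturbMatrix_apply, map_sub, map_sum, sub_mul]
    simp only [map_mul]
  refine ⟨(coForm z' v + coForm (ser φ z') r₁ + coForm y w₁) k, ?_⟩
  rw [hk, hM]
  simp only [Pi.add_apply, Pi.sub_apply, Pi.smul_apply, smul_eq_mul, hp, hN]
  ring

end Perturbation

/-! ### Successive approximation of a series -/

section Recursion

open PowerSeries (coeff X)
open JetRing

section Approx

variable {ι R : Type*} [CommRing R] (next : ℕ → (ι → PowerSeries R) → ι → R)

/-- Partial sums of the series whose coefficients are determined recursively by `next`. -/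
def approx : ℕ → ι → PowerSeries R
  | 0 => 0
  | K + 1 => fun i => approx K i + X ^ K * PowerSeries.C (next K (approx K) i)

/-- The series whose coefficients are determined recursively by `next`. -/
def approxLim (i : ι) : PowerSeries R := PowerSeries.mk fun k => coeff k (approx next (k + 1) i)

theorem coeff_approx_succ (k K : ℕ) (i : ι) : coeff k (approx next (K + 1) i) =
    coeff k (approx next K i) + if k = K then next K (approx next K) i else 0 := by
  rw [approx, map_add, PowerSeries.coeff_X_pow_mul']
  by_cases h : k = K
  · subst h; simp
  · rw [if_neg h]
    split_ifs with h'
    · rw [PowerSeries.coeff_C, if_neg (by omega)]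
    · rfl

theorem coeff_approx_of_lt {k K : ℕ} (h : k < K) (i : ι) :
    coeff k (approx next K i) = coeff k (approx next (k + 1) i) := by
  induction K, h using Nat.le_induction with
  | base => rfl
  | succ m hm ih => rw [coeff_approx_succ, ih, if_neg (by omega), add_zero]

theorem exists_approxLim_eq (K : ℕ) : ∃ y : ι → PowerSeries R,
    (∀ i, approxLim next i = approx next K i + X ^ K * y i) ∧
      ∀ i, coeff 0 (y i) = next K (approx next K) i := by
  have h : ∀ i, X ^ K ∣ approxLim next i - approx next K i := fun i => by
    rw [PowerSeries.X_pow_dvd_iff]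
    intro m hm
    rw [map_sub, approxLim, PowerSeries.coeff_mk, coeff_approx_of_lt next hm, sub_self]
  choose y hy using h
  refine ⟨y, fun i => by rw [← hy i]; ring, fun i => ?_⟩
  have h1 := congrArg (coeff K) (hy i)
  rw [map_sub, approxLim, PowerSeries.coeff_mk, coeff_approx_succ, if_pos rfl,
    add_sub_cancel_left, PowerSeries.coeff_X_pow_mul', if_pos le_rfl, Nat.sub_self] at h1
  exact h1.symm

end Approx

variable {n : ℕ} {U V : Opens (Coord n)} {φ : Fin n → Smooth U} (hφ : ∀ u, toMap φ u ∈ V)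

theorem frSym_zero {A : Type*} [CommRing A] [JetRing n A] (k : Fin n) : frSym (0 : A) k = 0 := by
  have h := frSym_add (0 : A) 0 k
  rwa [add_zero, left_eq_add] at h

theorem coeff_zero_X_smul (f : Fin n → PowerSeries (DiffPoly U)) (k : Fin n) :
    coeff 0 (((X : PowerSeries (DiffPoly U)) • f) k) = 0 := by
  rw [Pi.smul_apply, smul_eq_mul, PowerSeries.coeff_zero_X_mul]

theorem coeff_zero_pullForm {Θ : Fin n → PowerSeries (DiffPoly V)} {θ : Fin n → Smooth V}
    (hθ : ∀ i, coeff 0 (Θ i) = MvPolynomial.C (θ i)) (z : Fin n → PowerSeries (DiffPoly U))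
    (k : Fin n) : coeff 0 (pullForm hφ z Θ k) =
      MvPolynomial.C (∑ i, pd k (φ i) * compSmooth φ hφ (θ i)) := by
  obtain ⟨r, hr⟩ := exists_pullS_eq (z := z) hφ hθ
  have hT : ser φ z = (fun i => smoothC (φ i)) + (X : PowerSeries (DiffPoly U)) • z := rfl
  have h1 : pullForm hφ z Θ = coForm (ser φ z) (pullS (z := z) hφ Θ) := rfl
  rw [h1, hr, coForm_add, coForm_X, hT, coForm_add_left, coForm_X_left, coForm_smooth,
    Pi.add_apply, Pi.add_apply, map_add, map_add, coeff_zero_X_smul, coeff_zero_X_smul, add_zero,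
    add_zero, map_sum, map_sum]
  refine Finset.sum_congr rfl fun i _ => ?_
  rw [← map_mul, smoothC, RingHom.comp_apply, PowerSeries.coeff_zero_C]

theorem coeff_pullForm_succ {Θ : Fin n → PowerSeries (DiffPoly V)} {θ : Fin n → Smooth V}
    (hθ : ∀ i, coeff 0 (Θ i) = MvPolynomial.C (θ i)) {K : ℕ}
    {z z' y : Fin n → PowerSeries (DiffPoly U)} (h : ∀ i, z i = z' i + X ^ K * y i) (k : Fin n) :
    coeff (K + 1) (pullForm hφ z Θ k) = coeff (K + 1) (pullForm hφ z' Θ k) +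
      (DOp.ev (RingHom.id _) (DOp.adj (frSym (∑ i, MvPolynomial.C (compSmooth φ hφ (θ i)) *
        coeff 0 (y i)) k)) 1 +
      ∑ j, MvPolynomial.C (perturbMatrix φ hφ θ k j) * coeff 0 (y j)) := by
  obtain ⟨r, hr⟩ := pullForm_perturb hφ h hθ k
  have h0 : ∀ (c : Fin n → Smooth U), coeff 0 (∑ i, smoothC (c i) * y i) =
      ∑ i, MvPolynomial.C (c i) * coeff 0 (y i) := fun c => by
    rw [map_sum]
    refine Finset.sum_congr rfl fun i _ => ?_
    rw [coeff_zero_mul, smoothC, RingHom.comp_apply, PowerSeries.coeff_zero_C]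
  have h1 := congrArg (coeff (K + 1)) hr
  rw [map_sub, map_sub, PowerSeries.coeff_X_pow_mul', if_pos le_rfl, Nat.sub_self,
    PowerSeries.coeff_X_pow_mul', if_neg (by omega), map_add, coeff_delta, h0, h0,
    sub_eq_zero, sub_eq_iff_eq_add'] at h1
  exact h1

theorem dForm_smoothC_eq_zero {κ : Fin n → Smooth U} (h : ∀ k l, pd l (κ k) = pd k (κ l))
    (Y Z : Fin n → PowerSeries (DiffPoly U)) : dForm (fun k => smoothC (κ k)) Y Z = 0 := by
  rw [dForm, sub_eq_zero, pair_comm _ Z, pair_prV_smooth]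
  refine congrArg (fun f => pair f Y) (funext fun k => ?_)
  refine ((evolS_smoothC Z (κ k)).trans (Finset.sum_congr rfl fun i _ => ?_)).symm
  rw [h, mul_comm]

/-- A potential of a symplectic form on the source can be matched, up to closed forms, by the
pull-back of a potential on the target along a series with prescribed leading term, as soon as the
leading terms of the two symplectic forms match. -/
theorem exists_series {ΘB : Fin n → PowerSeries (DiffPoly V)}
    {ΘA : Fin n → PowerSeries (DiffPoly U)} (hB : ∀ i, Graded (ΘB i)) (hA : ∀ i, Graded (ΘA i))
    {θB : Fin n → Smooth V} {θA : Fin n → Smooth U}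
    (hθB : ∀ i, coeff 0 (ΘB i) = MvPolynomial.C (θB i))
    (hθA : ∀ i, coeff 0 (ΘA i) = MvPolynomial.C (θA i))
    (hM : IsUnit (perturbMatrix φ hφ θB)) {κ : Fin n → Smooth U}
    (hκ : ∀ k, ∑ i, pd k (φ i) * compSmooth φ hφ (θB i) = θA k + κ k)
    (hcl : ∀ k l, pd l (κ k) = pd k (κ l)) :
    ∃ z : Fin n → PowerSeries (DiffPoly U), (∀ i, GradedBy 1 (z i)) ∧
      ∀ Y Z, dForm (pullForm hφ z ΘB) Y Z = dForm ΘA Y Z := by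
  obtain ⟨N, hN, -⟩ := isUnit_iff_exists.1 hM
  -- The correction solves `perturbMatrix · y =` defect at `ε^{K+1}`, disregarding the variational
  -- derivative it creates.
  set next : ℕ → (Fin n → PowerSeries (DiffPoly U)) → Fin n → DiffPoly U := fun K z i =>
    ∑ j, MvPolynomial.C (N i j) * (coeff (K + 1) (ΘA j) - coeff (K + 1) (pullForm hφ z ΘB j))
    with hnext
  have hgr : ∀ K i, GradedBy 1 (approx next K i) := by
    intro K
    induction K with
    | zero => exact fun i k => by rw [approx, Pi.zero_apply, map_zero]; exact hasDeg_zero _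
    | succ K ih =>
      intro i k
      rw [coeff_approx_succ]
      refine (ih i k).add ?_
      split_ifs with hk
      · subst hk
        refine HasDeg.sum fun j _ => ?_
        have := (hasDeg_C (N i j)).mul
          ((hA j (k + 1)).sub (graded_pullForm hφ ih hB j (k + 1)))
        rwa [zero_add] at this
      · exact hasDeg_zero _
  choose y hy hy0 using exists_approxLim_eq next
  refine ⟨approxLim next, fun i k => by
    rw [approxLim, PowerSeries.coeff_mk]; exact hgr (k + 1) i k, fun Y Z => ?_⟩
  -- The functional collecting the disregarded exact terms of all orders; correction `K` enters at
  -- `ε^{K+1}`, whence the factor `X`.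
  set G : PowerSeries (DiffPoly U) := X * PowerSeries.mk fun K =>
    ∑ i, MvPolynomial.C (compSmooth φ hφ (θB i)) * coeff 0 (y K i) with hG
  have hNs : ∀ (k : Fin n) (v : Fin n → DiffPoly U), ∑ j, MvPolynomial.C (perturbMatrix φ hφ θB k j) *
      ∑ l, MvPolynomial.C (N j l) * v l = v k := by
    intro k v
    simp only [Finset.mul_sum, ← mul_assoc, ← map_mul]
    rw [Finset.sum_comm]
    simp only [← Finset.sum_mul, ← map_sum]
    have h1 : ∀ l, ∑ j, perturbMatrix φ hφ θB k j * N j l = if k = l then 1 else 0 := fun l => by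
      rw [← Matrix.mul_apply, hN, Matrix.one_apply]
    rw [Finset.sum_eq_single k]
    · rw [h1, if_pos rfl, map_one, one_mul]
    · intro l _ hl
      rw [h1, if_neg (Ne.symm hl), map_zero, zero_mul]
    · exact fun h => absurd (Finset.mem_univ k) h
  have key : pullForm hφ (approxLim next) ΘB = ΘA + (fun k => smoothC (κ k)) + delta G := by
    funext k
    refine PowerSeries.ext fun D => ?_
    rw [Pi.add_apply, Pi.add_apply, map_add, map_add, coeff_delta]
    cases D with
    | zero =>
      rw [coeff_zero_pullForm hφ hθB, hκ, hθA, hG, PowerSeries.coeff_zero_X_mul, frSym_zero,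
        map_zero, map_zero, smoothC, RingHom.comp_apply, PowerSeries.coeff_zero_C, map_add,
        AddMonoidHom.zero_apply, add_zero]
    | succ K =>
      rw [coeff_pullForm_succ hφ hθB (hy K), hG, PowerSeries.coeff_succ_X_mul, PowerSeries.coeff_mk,
        smoothC, RingHom.comp_apply, PowerSeries.coeff_C, if_neg K.succ_ne_zero, add_zero]
      simp only [hy0, hnext]
      rw [hNs]
      abel
  rw [key, dForm_add, dForm_add, dForm_delta, dForm_smoothC_eq_zero hcl, add_zero, add_zero]

end Recursion

/-! ### Miura transformations with given leading term -/

section MiuraBridge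

open PowerSeries (coeff X)
open Finset.HasAntidiagonal (antidiagonal)
open JetRing

theorem taylorPow_eq_sum {n : ℕ} {R A : Type*} [CommRing R] [CommRing A]
    (δ : Fin n → R →+ R) (ρ : R →+* PowerSeries A) (z : Fin n → PowerSeries A) (m : ℕ) (c : R) :
    taylorPow δ ρ z m c = ∑ ι : Fin m → Fin n,
      ρ ((List.ofFn ι).foldr (fun i => δ i) c) * ∏ a, z (ι a) := by
  induction m generalizing c with
  | zero => simp [taylorPow]
  | succ m ih =>
    -- The recursion applies `δ i` to `c` before the other derivatives, and a right fold applies the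
    -- last list entry first; the new index is therefore appended at the end.
    rw [taylorPow, ← (Fin.snocEquiv fun _ => Fin n).sum_comp, Fintype.sum_prod_type]
    refine Finset.sum_congr rfl fun i _ => ?_
    rw [ih, Finset.mul_sum]
    refine Finset.sum_congr rfl fun ι _ => ?_
    have h1 : List.ofFn (Fin.snocEquiv (fun _ => Fin n) (i, ι)) = List.ofFn ι ++ [i] := by
      rw [List.ofFn_succ', List.concat_eq_append]
      simp [Fin.snocEquiv]
    rw [h1, List.foldr_append, Fin.prod_univ_castSucc]
    simp only [Fin.snocEquiv, Equiv.coe_fn_mk, Fin.snoc_castSucc, Fin.snoc_last, List.foldr_cons,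
      List.foldr_nil]
    ring

variable {n : ℕ} {U V : Opens (Coord n)}

theorem DxSeries_eq (f : PowerSeries (DiffPoly U)) : DxSeries f = d f := by
  refine PowerSeries.ext fun k => ?_
  rw [DxSeries, PowerSeries.coeff_mk, Dx_eq_coe_dx, coeff_d, d_eq_dx]

theorem iterate_DxSeries (s : ℕ) (f : PowerSeries (DiffPoly U)) : DxSeries^[s] f = d^[s] f :=
  congrFun (congrArg (·^[s]) (funext DxSeries_eq)) f

theorem act_opOf_apply {π : DiffPoly V →+* PowerSeries (DiffPoly U)} (B : BivectorData V)
    (f : Fin n → PowerSeries (DiffPoly U)) (i : Fin n) :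
    act π (opOf B) f i = ∑ j, diffOp (fun r s => π (B r s i j)) (f j) := by
  refine PowerSeries.ext fun D => ?_
  rw [act_apply, coeff_epsSum, map_sum]
  simp only [map_sum]
  rw [Finset.sum_comm]
  refine Finset.sum_congr rfl fun j _ => ?_
  rw [diffOp, PowerSeries.coeff_mk]
  refine Finset.sum_congr rfl fun q _ => ?_
  rw [coeff_opOf, map_sum, AddMonoidHom.finsetSum_apply, map_sum]
  refine Finset.sum_congr rfl fun a _ => ?_
  rw [DOp.ev_mono, iterate_DxSeries]

variable {φ : Fin n → Smooth U} {z : Fin n → PowerSeries (DiffPoly U)}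

theorem constantCoeff_ser (φ : Fin n → Smooth U) (z : Fin n → PowerSeries (DiffPoly U)) :
    (fun i => MvPolynomial.constantCoeff (coeff 0 (ser φ z i))) = φ :=
  funext fun i => by rw [coeff_zero_ser, MvPolynomial.constantCoeff_C]

/-- The Miura transformation `φ + εz`. -/
def miuraOf (hφ : ∀ u, toMap φ u ∈ V) (hinj : Function.Injective (toMap φ))
    (hdet : ∀ u, (Matrix.of fun i k => (pd k (φ i)).1 u).det ≠ 0)
    (hz : ∀ i, GradedBy 1 (z i)) : Miura U V where
  F k i := coeff k (ser φ z i)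
  hasDeg k i := gradedBy_ser hz i k
  mapsTo u := by rw [constantCoeff_ser φ z]; exact hφ u
  injective := by rw [constantCoeff_ser φ z]; exact hinj
  det_ne_zero u := by
    have h : ∀ i, MvPolynomial.constantCoeff (coeff 0 (ser φ z i)) = φ i :=
      congrFun (constantCoeff_ser φ z)
    simp only [h]
    exact hdet u

variable (hφ : ∀ u, toMap φ u ∈ V) (hinj : Function.Injective (toMap φ))
    (hdet : ∀ u, (Matrix.of fun i k => (pd k (φ i)).1 u).det ≠ 0)
    (hz : ∀ i, GradedBy 1 (z i))

theorem base_miuraOf (u : U) : ((miuraOf hφ hinj hdet hz).base u : Coord n) = toMap φ u :=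
  congrArg (fun ψ => toMap ψ u) (constantCoeff_ser φ z)

theorem series_miuraOf (i : Fin n) : (miuraOf hφ hinj hdet hz).series i = ser φ z i :=
  PowerSeries.ext fun _ => PowerSeries.coeff_mk _ _

theorem compSmooth_congr {ψ : Fin n → Smooth U} (h : ψ = φ) (hψ : ∀ u, toMap ψ u ∈ V)
    (c : Smooth V) : compSmooth ψ hψ c = compSmooth φ hφ c := by
  subst h; rfl

theorem C_inv_smul_mul {S : Type*} [CommRing S] (κ : Smooth U →+* S) (r : ℝ) (c : Smooth U) (p : S) :
    κ (r • c) * p = κ (algebraMap ℝ _ r) * (κ c * p) := by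
  rw [Algebra.smul_def, map_mul, mul_assoc]

theorem pullSmooth_miuraOf (c : Smooth V) :
    (miuraOf hφ hinj hdet hz).pullSmooth c = smoothPull φ hφ z c := by
  refine PowerSeries.ext fun D => ?_
  have h0 : ∀ i, (miuraOf hφ hinj hdet hz).series i -
      PowerSeries.C ((miuraOf hφ hinj hdet hz).F 0 i) = X * z i := fun i => by
    have h1 : (miuraOf hφ hinj hdet hz).F 0 i = MvPolynomial.C (φ i) := coeff_zero_ser i
    rw [series_miuraOf, h1, ser, smoothC, RingHom.comp_apply, add_sub_cancel_left]
  have hψ : (fun i => MvPolynomial.constantCoeff ((miuraOf hφ hinj hdet hz).F 0 i)) = φ :=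
    constantCoeff_ser φ z
  rw [smoothPull, taylorHom_apply, coeff_epsSum,
    Finset.Nat.sum_antidiagonal_eq_sum_range_succ_mk, Miura.pullSmooth, PowerSeries.coeff_mk]
  refine Finset.sum_congr rfl fun m hm => ?_
  have hm' : m ≤ D := Nat.lt_succ_iff.1 (Finset.mem_range.1 hm)
  rw [taylorTerm, taylorPow_eq_sum, Finset.mul_sum, map_sum]
  refine Finset.sum_congr rfl fun ι _ => ?_
  simp only [h0]
  rw [Finset.prod_mul_distrib, Finset.prod_const, Finset.card_univ, Fintype.card_fin,
    PowerSeries.coeff_X_pow_mul', if_pos hm', compSmooth_congr hφ hψ,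
    C_inv_smul_mul, realC, smoothC]
  simp only [RingHom.comp_apply, PowerSeries.coeff_C_mul]
  rfl

theorem pull_miuraOf (g : DiffPoly V) :
    (miuraOf hφ hinj hdet hz).pull g = pullHom φ hφ z g := by
  rw [pullHom, MvPolynomial.coe_eval₂Hom, MvPolynomial.eval₂_eq, Miura.pull]
  refine Finset.sum_congr rfl fun m _ => ?_
  rw [pullSmooth_miuraOf]
  refine congrArg _ (Finset.prod_congr rfl fun v _ => ?_)
  change (DxSeries^[v.2 + 1] _) ^ m v = _
  rw [iterate_DxSeries, series_miuraOf]

theorem Lstar_miuraOf (i k : Fin n) (f : PowerSeries (DiffPoly U)) :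
    (miuraOf hφ hinj hdet hz).Lstar i k f =
      epsSum fun a => DOp.ev PowerSeries.C (frSym (coeff a (ser φ z i)) k) f := by
  refine PowerSeries.ext fun D => ?_
  rw [coeff_epsSum, Miura.Lstar, PowerSeries.coeff_mk]
  refine Finset.sum_congr rfl fun q _ => ?_
  rw [coeff_ev_C, ev_frSym (N := q.1 + 1) _ _ _ _ fun i' s hs =>
    (gradedBy_ser hz i q.1).jetDeriv_eq_zero hs i', Dx_eq_coe_dx]
  rfl

theorem sum_Lstar_miuraOf (i : Fin n) (f : Fin n → PowerSeries (DiffPoly U)) :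
    ∑ k, (miuraOf hφ hinj hdet hz).Lstar i k (f k) =
      act PowerSeries.C (fr (ser φ z)) f i := by
  simp only [Lstar_miuraOf]
  rw [← epsSum_sum, act_apply]
  refine congrArg _ (funext fun a => ?_)
  rw [fr, PowerSeries.coeff_mk]
  rfl

theorem Lstar_miuraOf_sum (i k : Fin n) (f : Fin n → PowerSeries (DiffPoly U)) :
    (miuraOf hφ hinj hdet hz).Lstar i k (∑ l, f l) =
      ∑ l, (miuraOf hφ hinj hdet hz).Lstar i k (f l) := by
  simp only [Lstar_miuraOf]
  rw [← epsSum_sum]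
  refine congrArg _ (funext fun a => ?_)
  rw [map_sum]

theorem L_miuraOf (j l : Fin n) (f : PowerSeries (DiffPoly U)) :
    (miuraOf hφ hinj hdet hz).L j l f =
      act PowerSeries.C (adjM (fr (ser φ z))) (Pi.single j f) l := by
  refine PowerSeries.ext fun D => ?_
  rw [coeff_act_C, Miura.L, PowerSeries.coeff_mk]
  refine Finset.sum_congr rfl fun q _ => ?_
  rw [Finset.sum_eq_single j]
  · rw [Pi.single_eq_same, adjM, PowerSeries.coeff_mk, Matrix.of_apply, fr, PowerSeries.coeff_mk,
      Matrix.of_apply, frSym_eq (N := q.1 + 1) _ _ fun i' s hs =>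
      (gradedBy_ser hz j q.1).jetDeriv_eq_zero hs i', map_sum, map_sum,
      AddMonoidHom.finsetSum_apply, Dx_eq_coe_dx]
    refine Finset.sum_congr rfl fun s _ => ?_
    rw [DOp.ev_adj_mono (fun _ => rfl)]
    rfl
  · intro k _ hk
    rw [Pi.single_eq_of_ne hk, map_zero, map_zero]
  · exact fun h => absurd (Finset.mem_univ j) h

theorem carries_miuraOf {A : BivectorData U} {B : BivectorData V}
    (h : ∀ f, act (pullHom φ hφ z) (opOf B) f = act PowerSeries.C (fr (ser φ z))
      (act PowerSeries.C (opOf A) (act PowerSeries.C (adjM (fr (ser φ z))) f))) :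
    (miuraOf hφ hinj hdet hz).Carries A B := by
  intro i j f
  have h1 := congrFun (h (Pi.single j f)) i
  rw [act_opOf_apply, Finset.sum_eq_single j] at h1
  · rw [Pi.single_eq_same] at h1
    simp only [pull_miuraOf]
    rw [h1, ← sum_Lstar_miuraOf hφ hinj hdet hz]
    refine Finset.sum_congr rfl fun k _ => ?_
    rw [act_opOf_apply, Lstar_miuraOf_sum]
    refine Finset.sum_congr rfl fun l _ => ?_
    rw [L_miuraOf]
  · intro k _ hk
    rw [Pi.single_eq_of_ne hk, diffOp]
    refine PowerSeries.ext fun D => ?_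
    rw [PowerSeries.coeff_mk]
    refine Finset.sum_eq_zero fun q _ => Finset.sum_eq_zero fun a _ => ?_
    rw [iterate_DxSeries, iterate_map_zero, mul_zero, map_zero]
  · exact fun h => absurd (Finset.mem_univ j) h

end MiuraBridge

/-! ### Miura transformations with a symplectic leading term -/

section Transport

open PowerSeries (coeff X)
open Finset.HasAntidiagonal (antidiagonal)
open JetRing

variable {n : ℕ} {U V : Opens (Coord n)}

/-- The matrix of the exterior derivative of a 1-form. -/
def curl (θ : Fin n → Smooth U) : Matrix (Fin n) (Fin n) (Smooth U) :=
  Matrix.of fun i j => pd j (θ i) - pd i (θ j)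

theorem coeff_zero_fr {Θ : Fin n → PowerSeries (DiffPoly U)} {θ : Fin n → Smooth U}
    (hθ : ∀ i, coeff 0 (Θ i) = MvPolynomial.C (θ i)) (i k : Fin n) :
    coeff 0 (fr Θ) i k = DOp.mono 0 (MvPolynomial.C (pd k (θ i))) := by
  rw [fr, PowerSeries.coeff_mk, Matrix.of_apply, hθ,
    frSym_eq (N := 1) _ k fun i s hs => (hasDeg_C _).jetDeriv_eq_zero hs i, Finset.sum_range_one]
  exact congrArg _ (jetDeriv_zero_C k (θ i))

theorem adj_mono_zero {A : Type*} [CommRing A] [DRing A] (a : A) :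
    DOp.adj (DOp.mono 0 a) = DOp.mono 0 a := by
  refine DOp.ext_coef fun r => ?_
  rw [DOp.coef_adj_mono, DOp.coef_mono]
  rcases Nat.eq_zero_or_pos r with rfl | hr
  · simp
  · rw [if_neg (by omega), Nat.choose_eq_zero_of_lt hr]
    simp

theorem coeff_zero_dM {Θ : Fin n → PowerSeries (DiffPoly U)} {θ : Fin n → Smooth U}
    (hθ : ∀ i, coeff 0 (Θ i) = MvPolynomial.C (θ i)) :
    coeff 0 (dM Θ) = coeff 0 (smoothOp (curl θ)) := by
  refine Matrix.ext fun i j => ?_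
  rw [coeff_zero_smoothOp, dM, map_sub, Matrix.sub_apply, coeff_zero_fr hθ, adjM,
    PowerSeries.coeff_mk, Matrix.of_apply, coeff_zero_fr hθ, adj_mono_zero, ← map_sub, ← map_sub]
  rfl

theorem smoothOp_injective_coeff_zero {H H' : Matrix (Fin n) (Fin n) (Smooth U)}
    (h : coeff 0 (smoothOp H) = coeff 0 (smoothOp H')) : H = H' := by
  refine Matrix.ext fun i j => ?_
  have h1 := congrFun (congrFun h i) j
  rw [coeff_zero_smoothOp, coeff_zero_smoothOp] at h1
  have h2 := congrArg (DOp.coef 0) h1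
  rw [DOp.coef_mono, DOp.coef_mono, if_pos rfl, if_pos rfl] at h2
  exact MvPolynomial.C_injective _ _ h2

theorem curl_mul_leading {Θ : Fin n → PowerSeries (DiffPoly U)} {θ : Fin n → Smooth U}
    (hθ : ∀ i, coeff 0 (Θ i) = MvPolynomial.C (θ i)) {A : BivectorData U}
    (hA : ∀ r s i j, HasDeg (A r s i j) s) (h : dM Θ * opOf A = 1) :
    curl θ * leading A = 1 := by
  have h1 := congrArg (coeff 0) h
  rw [coeff_zero_mul, coeff_zero_dM hθ, coeff_zero_opOf hA, ← coeff_zero_mul, ← map_mul,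
    ← map_one smoothOp] at h1
  exact smoothOp_injective_coeff_zero h1

theorem pd_sub (i : Fin n) (f g : Smooth U) : pd i (f - g) = pd i f - pd i g :=
  map_sub (pdHom i) f g

/-- The hypothesis says that `φ` pulls `dθ_B` back to `dθ_A`, so `φ*θ_B - θ_A` is closed. The second
derivatives of `φ` drop out by symmetry. -/
theorem closed_of_perturbMatrix {φ : Fin n → Smooth U} {hφ : ∀ u, toMap φ u ∈ V}
    {θB : Fin n → Smooth V} {θA : Fin n → Smooth U}
    (h : perturbMatrix φ hφ θB * (Matrix.of fun i k => pd k (φ i)) = curl θA) (k l : Fin n) :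
    pd l (∑ i, pd k (φ i) * compSmooth φ hφ (θB i) - θA k) =
      pd k (∑ i, pd l (φ i) * compSmooth φ hφ (θB i) - θA l) := by
  have h1 : ∑ i, pd k (φ i) * pd l (compSmooth φ hφ (θB i)) -
      ∑ i, pd l (φ i) * pd k (compSmooth φ hφ (θB i)) = pd l (θA k) - pd k (θA l) := by
    have := congrFun (congrFun h k) l
    rw [Matrix.mul_apply, curl, Matrix.of_apply] at this
    rw [← this]
    simp only [perturbMatrix_apply, sub_mul, Finset.sum_sub_distrib, Matrix.of_apply]
    refine congrArg₂ _ ?_ (Finset.sum_congr rfl fun i _ => mul_comm _ _)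
    simp only [pd_compSmooth _ _ _ l]
    rw [← sum_sum_mul_swap]
  have h2 : ∀ k l, pd l (∑ i, pd k (φ i) * compSmooth φ hφ (θB i) - θA k) =
      (∑ i, pd k (φ i) * pd l (compSmooth φ hφ (θB i)) +
        ∑ i, compSmooth φ hφ (θB i) * pd l (pd k (φ i))) - pd l (θA k) := fun k l => by
    rw [pd_sub, pd_sum, ← Finset.sum_add_distrib]
    exact congrArg₂ _ (Finset.sum_congr rfl fun i _ => pd_mul l _ _) rfl
  rw [h2, h2]
  simp only [pd_comm l k]
  linear_combination h1

/-- The matrix in the order-by-order recursion is the Jacobian times the leading symplectic form of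
`B`, both invertible, and the leading 1-forms differ by a closed form. This is what `exists_series`
requires. -/
theorem exists_miura {A : BivectorData U} {B : BivectorData V}
    {ΘA : Fin n → PowerSeries (DiffPoly U)} {ΘB : Fin n → PowerSeries (DiffPoly V)}
    (hA : ∀ i, Graded (ΘA i)) (hB : ∀ i, Graded (ΘB i))
    {θB : Fin n → Smooth V} {θA : Fin n → Smooth U}
    (hθA : ∀ i, coeff 0 (ΘA i) = MvPolynomial.C (θA i))
    (hθB : ∀ i, coeff 0 (ΘB i) = MvPolynomial.C (θB i))
    (hAΘ : ∀ f, act PowerSeries.C (opOf A) (act PowerSeries.C (dM ΘA) f) = f)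
    (hBd : ∀ r s i j, HasDeg (B r s i j) s)
    (hBΘ : dM ΘB * opOf B = 1) {φ : Fin n → Smooth U} (hφ : ∀ u, toMap φ u ∈ V)
    (hinj : Function.Injective (toMap φ))
    (hdet : ∀ u, (Matrix.of fun i k => (pd k (φ i)).1 u).det ≠ 0)
    (h : perturbMatrix φ hφ θB * (Matrix.of fun i k => pd k (φ i)) = curl θA) :
    ∃ T : Miura U V, (∀ u, (T.base u : Coord n) = toMap φ u) ∧ T.Carries A B := by
  have hu : IsUnit (perturbMatrix φ hφ θB) := by
    refine IsUnit.mul ?_ ?_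
    · refine Smooth.isUnit_matrix fun u => ?_
      rw [← Matrix.det_transpose]
      exact hdet u
    · refine RingHom.isUnit_map _ ?_
      have h1 := curl_mul_leading hθB hBd hBΘ
      exact isUnit_iff_exists.2 ⟨_, h1, mul_eq_one_comm.1 h1⟩
  obtain ⟨z, hz, hform⟩ := exists_series hφ hB hA hθB hθA hu
    (κ := fun k => ∑ i, pd k (φ i) * compSmooth φ hφ (θB i) - θA k)
    (fun k => (add_sub_cancel _ _).symm) (fun k l => closed_of_perturbMatrix h k l)
  exact ⟨miuraOf hφ hinj hdet hz, base_miuraOf hφ hinj hdet hz,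
    carries_miuraOf hφ hinj hdet hz (act_conj hφ hdet hform hAΘ hBΘ)⟩

end Transport

/-! ### Restriction to a smaller open set -/

section Restriction

open PowerSeries (coeff X)
open Finset.HasAntidiagonal (antidiagonal)
open JetRing

variable {n : ℕ} {U V : Opens (Coord n)} (h : U ≤ V)

/-- The restriction of differential polynomials. -/
def restrictPoly : DiffPoly V →+* DiffPoly U := MvPolynomial.map (restrictSmooth h)

theorem jetDeriv_restrictPoly (i : Fin n) (s : ℕ) (f : DiffPoly V) :
    jetDeriv i s (restrictPoly h f) = restrictPoly h (jetDeriv i s f) := by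
  cases s with
  | zero =>
    refine MvPolynomial.ext _ _ fun m => ?_
    rw [coeff_jetDeriv_zero, restrictPoly, MvPolynomial.coeff_map, MvPolynomial.coeff_map,
      coeff_jetDeriv_zero, pd_restrictSmooth]
  | succ s => exact MvPolynomial.pderiv_map

theorem d_restrictPoly (f : DiffPoly V) : restrictPoly h (d f) = d (restrictPoly h f) := by
  have hb : ∀ i s, jetBound f ≤ s → jetDeriv i s f = 0 := fun i s hs => jetDeriv_eq_zero hs i
  have hb' : ∀ i s, jetBound f ≤ s → jetDeriv i s (restrictPoly h f) = 0 := fun i s hs => by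
    rw [jetDeriv_restrictPoly, hb i s hs, map_zero]
  rw [d_eq_dx, d_eq_dx, dx, dx, derOf_eq_sum _ f hb, derOf_eq_sum _ _ hb', map_sum]
  refine Finset.sum_congr rfl fun i _ => ?_
  rw [map_sum]
  refine Finset.sum_congr rfl fun s _ => ?_
  rw [map_mul, jetDeriv_restrictPoly, restrictPoly, MvPolynomial.map_X]

theorem HasDeg.restrictPoly {f : DiffPoly V} {e : ℕ} (hf : HasDeg f e) :
    HasDeg (restrictPoly h f) e := fun m hm => hf fun h0 => hm (by
  rw [LoopSpace.restrictPoly, MvPolynomial.coeff_map, h0, map_zero])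

/-- Restriction, with values in series. -/
def restrictHom : DiffPoly V →+* PowerSeries (DiffPoly U) := PowerSeries.C.comp (restrictPoly h)

theorem restrictHom_d (f : DiffPoly V) : restrictHom h (d f) = d (restrictHom h f) := by
  rw [restrictHom, RingHom.comp_apply, RingHom.comp_apply, d_restrictPoly, C_d]

/-- The restriction of series of differential polynomials. -/
def restrictSeries (f : PowerSeries (DiffPoly V)) : PowerSeries (DiffPoly U) :=
  PowerSeries.mk fun k => restrictPoly h (coeff k f)

theorem coeff_restrictSeries (k : ℕ) (f : PowerSeries (DiffPoly V)) :
    coeff k (restrictSeries h f) = restrictPoly h (coeff k f) := PowerSeries.coeff_mk _ _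

theorem act_opOf_restrict (A : BivectorData V) (f : Fin n → PowerSeries (DiffPoly U)) :
    act PowerSeries.C (opOf (restrictBivector h A)) f = act (restrictHom h) (opOf A) f :=
  funext fun i => by rw [act_opOf_apply, act_opOf_apply]; rfl

theorem act_fr_restrict (Θ : Fin n → PowerSeries (DiffPoly V))
    (f : Fin n → PowerSeries (DiffPoly U)) :
    act PowerSeries.C (fr fun i => restrictSeries h (Θ i)) f = act (restrictHom h) (fr Θ) f := by
  funext i
  rw [act_apply, act_apply]
  refine congrArg _ (funext fun a => Finset.sum_congr rfl fun j _ => ?_)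
  rw [fr, fr, PowerSeries.coeff_mk, PowerSeries.coeff_mk, Matrix.of_apply, Matrix.of_apply,
    coeff_restrictSeries]
  set g := coeff a (Θ i) with hg
  have hb : ∀ i s, jetBound g ≤ s → jetDeriv i s g = 0 := fun i s hs => jetDeriv_eq_zero hs i
  have hb' : ∀ i s, jetBound g ≤ s → jetDeriv i s (restrictPoly h g) = 0 := fun i s hs => by
    rw [jetDeriv_restrictPoly, hb i s hs, map_zero]
  rw [ev_frSym _ g j _ (N := jetBound g) hb, ev_frSym _ (restrictPoly h g) j _ (N := jetBound g) hb']
  refine Finset.sum_congr rfl fun s _ => ?_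
  refine congrArg (fun a => PowerSeries.C a * d^[s] (f j)) (jetDeriv_restrictPoly h j s g)

theorem act_dM_restrict (Θ : Fin n → PowerSeries (DiffPoly V))
    (f : Fin n → PowerSeries (DiffPoly U)) :
    act PowerSeries.C (dM fun i => restrictSeries h (Θ i)) f = act (restrictHom h) (dM Θ) f := by
  rw [dM, dM, sub_act, sub_act, act_fr_restrict]
  refine congrArg _ (eq_of_pair fun g => ?_)
  rw [← pair_act C_d, ← pair_act (restrictHom_d h), act_fr_restrict]

theorem act_opOf_dM_restrict {A : BivectorData V} {Θ : Fin n → PowerSeries (DiffPoly V)}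
    (hA : opOf A * dM Θ = 1) (f : Fin n → PowerSeries (DiffPoly U)) :
    act PowerSeries.C (opOf (restrictBivector h A))
      (act PowerSeries.C (dM fun i => restrictSeries h (Θ i)) f) = f := by
  rw [act_dM_restrict, act_opOf_restrict, ← mul_act (restrictHom_d h), hA, one_act]

end Restriction

/-! ### Brackets with constant leading coefficient -/

section ConstantLeading

open PowerSeries (coeff X)
open JetRing

variable {n : ℕ} {U : Opens (Coord n)}

theorem IsPQBracket.det_ne_zero {A : BivectorData U} (hA : IsPQBracket A n 0) (u : U) :
    (hMatrix A u).det ≠ 0 := by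
  have h1 : LinearIndependent ℝ (hMatrix A u).row := by
    exact linearIndependent_iff_card_eq_finrank_span.2 (by
      rw [Fintype.card_fin, Set.finrank, ← Matrix.rank_eq_finrank_span_row, hA.rank_eq u])
  exact (Matrix.isUnit_iff_isUnit_det _).1 (Matrix.linearIndependent_rows_iff_isUnit.1 h1) |>.ne_zero

theorem sign_mul_zero {S : Type*} [CommRing S] (x : S) :
    (-1) ^ (0 + 0 + 1) * ((0 + 0).choose 0 : S) * x = -x := by simp

theorem transpose_hMatrix {A : BivectorData U} (hA : IsLocalBivector A) (u : U) :
    (hMatrix A u).transpose = -hMatrix A u := by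
  refine Matrix.ext fun i j => ?_
  have h := hA.antisymm 0 0 i j
  rw [Finset.Nat.antidiagonal_zero, Finset.sum_singleton] at h
  replace h := h.trans (sign_mul_zero (A 0 0 i j))
  rw [Matrix.transpose_apply, Matrix.neg_apply, hMatrix, Matrix.of_apply, Matrix.of_apply, h, map_neg]
  rfl

theorem ultralocal_of_ne {h : Matrix (Fin n) (Fin n) ℝ} {r s : ℕ} (hrs : ¬(r = 0 ∧ s = 0))
    (i j : Fin n) : ultralocal U h r s i j = 0 := if_neg hrs

theorem jetDeriv_ultralocal (h : Matrix (Fin n) (Fin n) ℝ) (l : Fin n) (t r s : ℕ) (i j : Fin n) :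
    jetDeriv l t (ultralocal U h r s i j) = 0 := by
  rw [ultralocal]
  split_ifs
  · cases t with
    | zero => rw [jetDeriv_zero_C, pd_algebraMap, map_zero]
    | succ t => exact jetDeriv_succ_C _ _ _
  · exact jetDeriv_zero_right _ _

theorem isLocalBivector_ultralocal {h : Matrix (Fin n) (Fin n) ℝ} (hh : h.transpose = -h) :
    IsLocalBivector (ultralocal U h) where
  hasDeg := hasDeg_ultralocal h
  antisymm r s i j := by
    rw [Finset.sum_eq_single (0, s)]
    · by_cases hrs : r = 0 ∧ s = 0
      · obtain ⟨rfl, rfl⟩ := hrs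
        have : h j i = -h i j := by rw [← Matrix.transpose_apply h, hh]; rfl
        refine Eq.trans ?_ (sign_mul_zero (ultralocal U h 0 0 i j)).symm
        rw [ultralocal, ultralocal, if_pos ⟨rfl, rfl⟩, if_pos ⟨rfl, rfl⟩, this, map_neg, map_neg]
      · simp only [add_zero, Function.iterate_zero_apply]
        rw [ultralocal_of_ne hrs, ultralocal_of_ne hrs, mul_zero]
    · rintro ⟨a, b⟩ hq hne
      have ha : a ≠ 0 := by
        rintro rfl
        have := Finset.HasAntidiagonal.mem_antidiagonal.1 hq
        simp only [zero_add] at this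
        exact hne (by rw [this])
      rw [ultralocal_of_ne (by simp only; omega), Dx_eq_coe_dx, iterate_map_zero, mul_zero]
    · intro h; simp at h

theorem isPoisson_ultralocal {h : Matrix (Fin n) (Fin n) ℝ} (hh : h.transpose = -h) :
    IsPoisson (ultralocal U h) where
  bivector := isLocalBivector_ultralocal hh
  jacobi φ ψ χ D := by
    have h0 : ∀ φ ψ χ, schoutenTerm (ultralocal U h) (ultralocal U h) φ ψ χ D = 0 := by
      intro φ ψ χ
      simp only [schoutenTerm, jetDeriv_ultralocal, mul_zero, zero_mul, Finset.sum_const_zero]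
    refine ⟨0, ?_⟩
    rw [schouten, h0, h0, h0, Dx_eq_coe_dx, map_zero]
    simp only [add_zero]

theorem hMatrix_ultralocal (h : Matrix (Fin n) (Fin n) ℝ) (u : U) :
    hMatrix (ultralocal U h) u = h := by
  refine Matrix.ext fun i j => ?_
  rw [hMatrix, Matrix.of_apply, ultralocal, if_pos ⟨rfl, rfl⟩, MvPolynomial.constantCoeff_C]
  rfl

theorem leading_eq_of_hMatrix {A B : BivectorData U} (h : ∀ u, hMatrix A u = hMatrix B u) :
    leading A = leading B :=
  Matrix.ext fun i j => Smooth.ext fun u => congrFun (congrFun (h u) i) j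

theorem toMap_coordFn (u : U) : toMap (fun i => coordFn i) u = u := by
  refine PiLp.ext fun i => ?_
  rfl

theorem coeff_zero_eq_C {Θ : Fin n → PowerSeries (DiffPoly U)} (hΘ : ∀ i, Graded (Θ i)) :
    ∀ i, coeff 0 (Θ i) = MvPolynomial.C (MvPolynomial.constantCoeff (coeff 0 (Θ i))) :=
  fun i => (hΘ i 0).eq_C

/-- A bracket with constant nondegenerate leading coefficient is equivalent to an ultralocal one. -/
theorem exists_miura_ultralocal {c : Coord n} {R : ℝ} {A : BivectorData (openBall c R)}
    (hR : 0 < R) {h : Matrix (Fin n) (Fin n) ℝ} (hA : IsPQBracket A n 0) (hh : ∀ u, hMatrix A u = h) :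
    ∃ T : Miura (openBall c R) (openBall c R),
      (∀ u, T.base u = u) ∧ T.Carries A (ultralocal (openBall c R) h) := by
  have hskew : h.transpose = -h := by
    rw [← hh ⟨c, Metric.mem_ball_self hR⟩]; exact transpose_hMatrix hA.poisson.bivector _
  have hB : IsPoisson (ultralocal (openBall c R) h) := isPoisson_ultralocal hskew
  have hdetB : ∀ u, (hMatrix (ultralocal (openBall c R) h) u).det ≠ 0 := fun u => by
    rw [hMatrix_ultralocal, ← hh u]; exact hA.det_ne_zero u
  obtain ⟨ΘA, hgA, hA1, hA2⟩ := exists_potential hA.poisson hA.det_ne_zero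
  obtain ⟨ΘB, hgB, hB1, hB2⟩ := exists_potential hB hdetB
  have hφ : ∀ u : openBall c R, toMap (fun i => coordFn i) u ∈ openBall c R := fun u => by
    rw [toMap_coordFn]; exact u.2
  have hJ : (Matrix.of fun i k => pd k (coordFn i : Smooth (openBall c R))) = 1 :=
    Matrix.ext fun i k => by rw [Matrix.of_apply, pd_coordFn, Matrix.one_apply]
  have hJ' : (Matrix.of fun k i => pd k (coordFn i : Smooth (openBall c R))) = 1 :=
    Matrix.ext fun k i => by
      rw [Matrix.of_apply, pd_coordFn, Matrix.one_apply]; simp only [eq_comm]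
  have hcurl := curl_mul_leading (coeff_zero_eq_C hgA) hA.poisson.bivector.hasDeg hA2
  have hcurl' := curl_mul_leading (coeff_zero_eq_C hgB) hB.bivector.hasDeg hB2
  have hlead : leading A = leading (ultralocal (openBall c R) h) :=
    leading_eq_of_hMatrix fun u => by rw [hh, hMatrix_ultralocal]
  rw [hlead] at hcurl
  -- Both leading 2-forms invert the same constant matrix, so they coincide and the identity is
  -- symplectic on the whole ball.
  have hcc := left_inv_eq_right_inv hcurl (mul_eq_one_comm.1 hcurl')
  obtain ⟨T, hT, hTC⟩ := exists_miura hgA hgB (coeff_zero_eq_C hgA) (coeff_zero_eq_C hgB)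
    (fun f => by rw [← mul_act C_d, hA1, one_act]) hB.bivector.hasDeg hB2 hφ
    (fun u v huv => Subtype.ext (by rwa [toMap_coordFn, toMap_coordFn] at huv))
    (fun u => by
      have : (Matrix.of fun i k => (pd k (coordFn i : Smooth (openBall c R))).1 u) = 1 := by
        refine Matrix.ext fun i k => ?_
        have := congrFun (congrFun hJ i) k
        rw [Matrix.of_apply] at this
        rw [Matrix.of_apply, this, Matrix.one_apply, Matrix.one_apply]
        split_ifs <;> rfl
      rw [this, Matrix.det_one]
      exact one_ne_zero)
    (by
      rw [hJ, mul_one, perturbMatrix, hJ', one_mul, hcc]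
      refine Matrix.ext fun i j => Smooth.ext fun u => ?_
      exact congrArg (curl (fun i => MvPolynomial.constantCoeff (coeff 0 (ΘB i))) i j).1
        (Subtype.ext (toMap_coordFn u)))
  exact ⟨T, fun u => Subtype.ext (by rw [hT, toMap_coordFn]), hTC⟩

end ConstantLeading

/-! ### Smooth flows near a degenerate zero of a vector field -/

section Flow

open Set

/-- The primitive, vanishing at `0`, of a path. -/
def primitiveCLM (E : Type*) [NormedAddCommGroup E] [NormedSpace ℝ E] [CompleteSpace E] :
    C(unitInterval, E) →L[ℝ] C(unitInterval, E) :=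
  LinearMap.mkContinuous
    { toFun := fun γ => ⟨fun t => ∫ s in (0 : ℝ)..t, γ (projIcc 0 1 zero_le_one s),
        (intervalIntegral.continuous_primitive (fun a b =>
          (γ.continuous.comp continuous_projIcc).intervalIntegrable a b) 0).comp
          continuous_subtype_val⟩
      map_add' := fun γ η => by
        ext t
        simp only [ContinuousMap.add_apply, ContinuousMap.coe_mk]
        exact intervalIntegral.integral_add
          ((γ.continuous.comp continuous_projIcc).intervalIntegrable _ _)
          ((η.continuous.comp continuous_projIcc).intervalIntegrable _ _)
      map_smul' := fun r γ => by
        ext t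
        simp only [ContinuousMap.smul_apply, RingHom.id_apply, intervalIntegral.integral_smul,
          ContinuousMap.coe_mk] }
    1 (fun γ => by
      rw [ContinuousMap.norm_le _ (by positivity)]
      intro t
      have := intervalIntegral.norm_integral_le_of_norm_le_const (a := 0) (b := (t : ℝ)) (C := ‖γ‖)
        (f := fun t => γ (projIcc 0 1 zero_le_one t)) (fun t _ => γ.norm_coe_le_norm _)
      refine this.trans ?_
      rw [mul_comm, sub_zero, abs_of_nonneg t.2.1]
      gcongr
      exact t.2.2)

theorem primitiveCLM_apply {E : Type*} [NormedAddCommGroup E] [NormedSpace ℝ E] [CompleteSpace E]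
    (γ : C(unitInterval, E)) (t : unitInterval) :
    primitiveCLM E γ t = ∫ s in (0 : ℝ)..t, γ (projIcc 0 1 zero_le_one s) := rfl

/-- A path given as a primitive is differentiable from the right. -/
theorem hasDerivWithinAt_of_primitive {E : Type*} [NormedAddCommGroup E] [NormedSpace ℝ E]
    [CompleteSpace E] {γ η : C(unitInterval, E)} {x : E}
    (h : ∀ t, γ t = x + primitiveCLM E η t) {t : ℝ} (ht : t ∈ Ico (0 : ℝ) 1) :
    HasDerivWithinAt (fun s => γ (projIcc 0 1 zero_le_one s)) (η (projIcc 0 1 zero_le_one t))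
      (Ici t) t := by
  have h1 : HasDerivAt (fun u => x + ∫ s in (0 : ℝ)..u, η (projIcc 0 1 zero_le_one s))
      (η (projIcc 0 1 zero_le_one t)) t := by
    refine HasDerivAt.const_add x ?_
    exact intervalIntegral.integral_hasDerivAt_right
      ((η.continuous.comp continuous_projIcc).intervalIntegrable _ _)
      ((η.continuous.comp continuous_projIcc).stronglyMeasurableAtFilter _ _)
      (η.continuous.comp continuous_projIcc).continuousAt
  refine h1.hasDerivWithinAt.congr_of_eventuallyEq ?_ ?_
  · filter_upwards [Icc_mem_nhdsGE_of_mem ht] with s hs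
    rw [h, primitiveCLM_apply, projIcc_of_mem _ hs]
  · rw [h, primitiveCLM_apply, projIcc_of_mem _ (Ico_subset_Icc_self ht)]

variable {E : Type} [NormedAddCommGroup E] [NormedSpace ℝ E] [CompleteSpace E]

/-- The graph of a path in the extended phase space. -/
def graphPath (γ : C(unitInterval, E)) : C(unitInterval, ℝ × E) :=
  ⟨fun t => ((t : ℝ), γ t), by fun_prop⟩

/-- The linear part of `graphPath`. -/
def inrPath : C(unitInterval, E) →L[ℝ] C(unitInterval, ℝ × E) :=
  (ContinuousLinearMap.inr ℝ ℝ E).compLeftContinuous ℝ unitInterval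

theorem graphPath_eq (γ : C(unitInterval, E)) : graphPath γ = graphPath 0 + inrPath γ := by
  ext t <;> simp [graphPath, inrPath]

theorem hasFDerivAt_graphPath (γ : C(unitInterval, E)) :
    HasFDerivAt graphPath (inrPath (E := E)) γ := by
  have : (graphPath : C(unitInterval, E) → _) = fun γ => graphPath 0 + inrPath γ :=
    funext graphPath_eq
  rw [this]
  exact ((inrPath (E := E)).hasFDerivAt (x := γ)).const_add _

theorem contDiff_graphPath : ContDiff ℝ ∞ (graphPath : C(unitInterval, E) → _) := by
  have : (graphPath : C(unitInterval, E) → _) = fun γ => graphPath 0 + inrPath γ :=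
    funext graphPath_eq
  rw [this]
  exact contDiff_const.add (inrPath (E := E)).contDiff

/-- Near a zero of second order of a time dependent vector field, the integral curves over the unit
interval depend smoothly on the initial value. -/
theorem exists_smooth_flow {X : ℝ × E → E} (hX : ContDiff ℝ ∞ X) {p : E} (h0 : ∀ t, X (t, p) = 0)
    (h1 : ∀ t v, fderiv ℝ X (t, p) (0, v) = 0) :
    ∃ r > 0, ∃ Ψ : E → C(unitInterval, E), ContDiffOn ℝ ∞ Ψ (Metric.ball p r) ∧
      Ψ p = ContinuousMap.const _ p ∧ ∀ x ∈ Metric.ball p r, Ψ x = ContinuousMap.const _ x +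
        primitiveCLM E (superpose ⟨X, hX.continuous⟩ (graphPath (Ψ x))) := by
  set Xc : C(ℝ × E, E) := ⟨X, hX.continuous⟩ with hXc
  -- The integral curve starting at `x` is the solution of `G γ = const x`.
  set G : C(unitInterval, E) → C(unitInterval, E) :=
    fun γ => γ - primitiveCLM E (superpose Xc (graphPath γ)) with hG
  set γ₀ : C(unitInterval, E) := ContinuousMap.const _ p with hγ₀
  have hGs : ContDiff ℝ ∞ G := contDiff_id.sub ((primitiveCLM E).contDiff.comp
    ((contDiff_superpose (f := Xc) hX).comp contDiff_graphPath))
  have hXd : ContDiff ℝ ∞ (fderiv ℝ X) := hX.fderiv_right (m := ∞) (by simp)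
  -- At the constant path `p` the linearized field vanishes by `h1`, so the derivative of `G` there
  -- is the identity and the inverse function theorem applies on all of the unit interval at once.
  have hG' : HasFDerivAt G
      ((ContinuousLinearEquiv.refl ℝ C(unitInterval, E) : C(unitInterval, E) →L[ℝ] _)) γ₀ := by
    have hs := (hasFDerivAt_superpose (f := Xc) (f' := ⟨fderiv ℝ X, hXd.continuous⟩)
      (fun x => (hX.differentiable (by simp) x).hasFDerivAt) (graphPath γ₀)).comp γ₀
      (hasFDerivAt_graphPath γ₀)
    have hp := ((primitiveCLM E).hasFDerivAt (x := superpose Xc (graphPath γ₀))).comp γ₀ hs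
    refine ((hasFDerivAt_id γ₀).sub hp).congr_fderiv ?_
    have hz : (pointwiseApply (superpose ⟨fderiv ℝ X, hXd.continuous⟩ (graphPath γ₀))).comp
        (inrPath (E := E)) = 0 := by
      ext η t
      exact h1 t (η t)
    rw [hz, ContinuousLinearMap.comp_zero, sub_zero]
    rfl
  have hG0 : G γ₀ = γ₀ := by
    have : superpose Xc (graphPath γ₀) = 0 := by
      ext t
      exact h0 t
    rw [hG]
    simp only
    rw [this, map_zero, sub_zero]
  set e := hGs.contDiffAt.toOpenPartialHomeomorph G hG' (by simp) with he
  have hmem : γ₀ ∈ e.target := by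
    rw [← hG0]; exact ContDiffAt.image_mem_toOpenPartialHomeomorph_target _ _ _
  have hsrc : γ₀ ∈ e.source := ContDiffAt.mem_toOpenPartialHomeomorph_source _ _ _
  have hsymm : e.symm γ₀ = γ₀ := by
    have h2 := e.left_inv hsrc
    have h3 : e γ₀ = γ₀ := hG0
    rwa [h3] at h2
  -- Smoothness of the local inverse at points other than `γ₀` needs the derivative of `G` to be
  -- invertible there; invertibility is an open condition.
  have hW : ∀ᶠ γ in nhds γ₀, ∃ L : C(unitInterval, E) ≃L[ℝ] C(unitInterval, E),
      (L : C(unitInterval, E) →L[ℝ] C(unitInterval, E)) = fderiv ℝ G γ := by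
    have hc := (hGs.continuous_fderiv (by simp)).tendsto γ₀
    rw [hG'.fderiv] at hc
    exact hc (ContinuousLinearEquiv.nhds _)
  have hcst : ContDiff ℝ ∞ (ContinuousMap.const unitInterval : E → C(unitInterval, E)) :=
    (ContinuousLinearMap.const ℝ unitInterval (M := E)).contDiff
  have hev : ∀ᶠ x in nhds p, ContinuousMap.const unitInterval x ∈ e.target ∧
      ∃ L : C(unitInterval, E) ≃L[ℝ] C(unitInterval, E),
      (L : C(unitInterval, E) →L[ℝ] C(unitInterval, E)) =
        fderiv ℝ G (e.symm (ContinuousMap.const unitInterval x)) := by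
    have hcp : Filter.Tendsto (fun x : E => (ContinuousMap.const unitInterval x)) (nhds p)
        (nhds γ₀) := hcst.continuous.tendsto p
    refine (hcp.eventually (e.open_target.mem_nhds hmem)).and ?_
    have h2 := (e.continuousAt_symm hmem).tendsto
    rw [hsymm] at h2
    exact hcp.eventually (h2.eventually hW)
  obtain ⟨r, hr, hball⟩ := Metric.eventually_nhds_iff_ball.1 hev
  refine ⟨r, hr, fun x => e.symm (ContinuousMap.const unitInterval x), ?_, hsymm, ?_⟩
  · intro x hx
    obtain ⟨hxt, L, hL⟩ := hball x hx
    have h2 : ContDiffAt ℝ ∞ e.symm (ContinuousMap.const unitInterval x) := by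
      refine e.contDiffAt_symm (f₀' := L) hxt ?_ hGs.contDiffAt
      rw [hL]
      exact (hGs.differentiable (by simp) _).hasFDerivAt
    exact (h2.comp x hcst.contDiffAt).contDiffWithinAt
  · intro x hx
    obtain ⟨hxt, -⟩ := hball x hx
    have h2 : G (e.symm (ContinuousMap.const unitInterval x)) = ContinuousMap.const unitInterval x :=
      e.right_inv hxt
    exact sub_eq_iff_eq_add.1 h2

end Flow

/-! ### Moser's argument -/

section Moser

open Set

variable {E : Type} [NormedAddCommGroup E] [NormedSpace ℝ E]

/-- The transposition of bilinear forms. -/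
def flipCLM : (E →L[ℝ] E →L[ℝ] ℝ) →L[ℝ] (E →L[ℝ] E →L[ℝ] ℝ) :=
  (ContinuousLinearMap.flipₗᵢ ℝ E E ℝ).toContinuousLinearEquiv.toContinuousLinearMap

/-- The exterior derivative of a 1-form. -/
def extDer (α : E → E →L[ℝ] ℝ) (x : E) : E →L[ℝ] E →L[ℝ] ℝ :=
  fderiv ℝ α x - (fderiv ℝ α x).flip

theorem extDer_apply (α : E → E →L[ℝ] ℝ) (x v w : E) :
    extDer α x v w = fderiv ℝ α x v w - fderiv ℝ α x w v := rfl

theorem extDer_skew (α : E → E →L[ℝ] ℝ) (x v w : E) : extDer α x v w = -extDer α x w v := by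
  rw [extDer_apply, extDer_apply, neg_sub]

theorem contDiff_extDer {α : E → E →L[ℝ] ℝ} (hα : ContDiff ℝ ∞ α) : ContDiff ℝ ∞ (extDer α) := by
  have h := hα.fderiv_right (m := ∞) (by simp)
  have hf : ContDiff ℝ ∞ (flipCLM : (E →L[ℝ] E →L[ℝ] ℝ) → (E →L[ℝ] E →L[ℝ] ℝ)) :=
    ContinuousLinearMap.contDiff _
  exact h.sub (hf.comp h)

theorem extDer_add {α β : E → E →L[ℝ] ℝ} (hα : ContDiff ℝ ∞ α) (hβ : ContDiff ℝ ∞ β) (x : E) :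
    extDer (α + β) x = extDer α x + extDer β x := by
  have h : fderiv ℝ (α + β) x = fderiv ℝ α x + fderiv ℝ β x :=
    fderiv_add (hα.differentiable (by simp) x) (hβ.differentiable (by simp) x)
  ext v w
  simp only [extDer_apply, h, add_apply]
  ring

theorem fderiv_extDer {α : E → E →L[ℝ] ℝ} (hα : ContDiff ℝ ∞ α) (x a b c : E) :
    fderiv ℝ (extDer α) x a b c =
      fderiv ℝ (fderiv ℝ α) x a b c - fderiv ℝ (fderiv ℝ α) x a c b := by
  have hd : ContDiff ℝ ∞ (fderiv ℝ α) := hα.fderiv_right (m := ∞) (by simp)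
  have hev : ∀ {β : E → E →L[ℝ] E →L[ℝ] ℝ}, ContDiff ℝ ∞ β → ∀ b c,
      ∃ L : E →L[ℝ] ℝ, HasFDerivAt (fun y => β y b c) L x ∧ L a = fderiv ℝ β x a b c := by
    intro β hβ b c
    refine ⟨_, (((hβ.differentiable (by simp) x).hasFDerivAt.clm_apply
      (hasFDerivAt_const b x)).clm_apply (hasFDerivAt_const c x)), by simp⟩
  obtain ⟨L, hL, hLa⟩ := hev (contDiff_extDer hα) b c
  obtain ⟨L₁, hL₁, hLa₁⟩ := hev hd b c
  obtain ⟨L₂, hL₂, hLa₂⟩ := hev hd c b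
  rw [← hLa, ← hLa₁, ← hLa₂, hL.unique (hL₁.sub hL₂)]
  rfl

theorem fderiv_extDer_skew {α : E → E →L[ℝ] ℝ} (hα : ContDiff ℝ ∞ α) (x a b c : E) :
    fderiv ℝ (extDer α) x a b c = -fderiv ℝ (extDer α) x a c b := by
  rw [fderiv_extDer hα, fderiv_extDer hα, neg_sub]

/-- Exterior derivatives are closed. -/
theorem fderiv_extDer_cyclic {α : E → E →L[ℝ] ℝ} (hα : ContDiff ℝ ∞ α) (x a b c : E) :
    fderiv ℝ (extDer α) x a b c + fderiv ℝ (extDer α) x b c a + fderiv ℝ (extDer α) x c a b = 0 := by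
  have hs : ∀ a b, fderiv ℝ (fderiv ℝ α) x a b = fderiv ℝ (fderiv ℝ α) x b a := fun a b =>
    (hα.contDiffAt.isSymmSndFDerivAt (by
      rw [minSmoothness_of_isRCLikeNormedField]; exact WithTop.coe_le_coe.2 le_top)).eq a b
  simp only [fderiv_extDer hα]
  rw [hs a b, hs b c, hs c a]
  ring

/-- The infinitesimal form of Moser's argument. -/
theorem moser_identity {α σ : E → E →L[ℝ] ℝ} (hα : ContDiff ℝ ∞ α) (hσ : ContDiff ℝ ∞ σ)
    {X : ℝ × E → E} {t : ℝ} {y : E} (hX : DifferentiableAt ℝ X (t, y))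
    (h : ∀ᶠ y' in nhds y, (extDer α y' + t • extDer σ y') (X (t, y')) = -σ y') (a b : E) :
    fderiv ℝ (extDer α) y (X (t, y)) a b + t * fderiv ℝ (extDer σ) y (X (t, y)) a b +
      extDer σ y a b +
      (extDer α y + t • extDer σ y) (fderiv ℝ X (t, y) (0, a)) b +
      (extDer α y + t • extDer σ y) a (fderiv ℝ X (t, y) (0, b)) = 0 := by
  set Z := X (t, y) with hZ
  set X' : E → E := fun a => fderiv ℝ X (t, y) (0, a) with hX'
  have hdX : HasFDerivAt (fun y' => X (t, y')) ((fderiv ℝ X (t, y)).comp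
      (ContinuousLinearMap.inr ℝ ℝ E)) y := by
    refine HasFDerivAt.comp y hX.hasFDerivAt ?_
    exact (hasFDerivAt_const t y).prodMk (hasFDerivAt_id y)
  have hα' := ((contDiff_extDer hα).differentiable (by simp) y).hasFDerivAt
  have hσ' := ((contDiff_extDer hσ).differentiable (by simp) y).hasFDerivAt
  -- The derivative in direction `a` of the defining equation `i_X ω_t = -σ`, with `ω_t = dα + t
  -- dσ`. Antisymmetrizing in `a`, `b` and using `dω_t = 0` gives the claim.
  have key : ∀ a b, fderiv ℝ (extDer α) y a Z b + t * fderiv ℝ (extDer σ) y a Z b +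
      (extDer α y + t • extDer σ y) (X' a) b = -fderiv ℝ σ y a b := by
    intro a b
    have h2 := (((hα'.add (hσ'.const_smul t)).clm_apply hdX).clm_apply (hasFDerivAt_const b y))
    have h3 := ((hσ.differentiable (by simp) y).hasFDerivAt.neg).clm_apply (hasFDerivAt_const b y)
    have h4 := h2.unique (h3.congr_of_eventuallyEq (h.mono fun y' hy' => by
      exact congrArg (fun L => L b) hy'))
    have h5 := congrArg (fun L => L a) h4
    simp at h5
    simp only [add_apply, smul_apply, smul_eq_mul]
    linarith
  have hsk : (extDer α y + t • extDer σ y) a (X' b) =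
      -(extDer α y + t • extDer σ y) (X' b) a := by
    simp only [add_apply, smul_apply, smul_eq_mul]
    rw [extDer_skew α, extDer_skew σ]
    ring
  have k1 := key a b
  have k2 := key b a
  have c1 := fderiv_extDer_cyclic hα y Z a b
  have c2 := fderiv_extDer_cyclic hσ y Z a b
  have s1 := fderiv_extDer_skew hα y a Z b
  have s2 := fderiv_extDer_skew hσ y a Z b
  have e1 := extDer_apply σ y a b
  rw [hsk]
  linear_combination k1 - k2 + c1 + t * c2 - s1 - t * s2 + e1

variable [CompleteSpace E]

/-- The variational equation. -/
theorem fderiv_flow {X : ℝ × E → E} (hX : ContDiff ℝ ∞ X) {p : E} {r : ℝ}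
    {Ψ : E → C(unitInterval, E)} (hΨ : ContDiffOn ℝ ∞ Ψ (Metric.ball p r))
    (h : ∀ x ∈ Metric.ball p r, Ψ x = ContinuousMap.const _ x +
        primitiveCLM E (superpose ⟨X, hX.continuous⟩ (graphPath (Ψ x))))
    {x : E} (hx : x ∈ Metric.ball p r) (v : E) :
    fderiv ℝ Ψ x v = ContinuousMap.const _ v + primitiveCLM E (pointwiseApply
      (superpose ⟨fderiv ℝ X, (hX.fderiv_right (m := ∞) (by simp)).continuous⟩ (graphPath (Ψ x)))
        (inrPath (fderiv ℝ Ψ x v))) := by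
  have hnb := Metric.isOpen_ball.mem_nhds hx
  have hd : HasFDerivAt Ψ (fderiv ℝ Ψ x) x :=
    ((hΨ.contDiffAt hnb).differentiableAt (by simp)).hasFDerivAt
  have hs := ((hasFDerivAt_superpose (f := ⟨X, hX.continuous⟩)
    (f' := ⟨fderiv ℝ X, (hX.fderiv_right (m := ∞) (by simp)).continuous⟩)
    (fun x => (hX.differentiable (by simp) x).hasFDerivAt) (graphPath (Ψ x))).comp (Ψ x)
    (hasFDerivAt_graphPath (Ψ x))).comp x hd
  have hp := ((primitiveCLM E).hasFDerivAt
    (x := superpose ⟨X, hX.continuous⟩ (graphPath (Ψ x)))).comp x hs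
  have hc := ((ContinuousLinearMap.const ℝ unitInterval (M := E)).hasFDerivAt (x := x)).add hp
  have h2 := hd.unique (hc.congr_of_eventuallyEq (Filter.mem_of_superset hnb fun y hy => h y hy))
  conv_lhs => rw [h2]
  rfl

end Moser

/-! ### Moser's vector field and the isomorphism of symplectic forms defined by its flow -/

section MoserFlow

open Set

variable {E : Type} [NormedAddCommGroup E] [NormedSpace ℝ E]

theorem contDiff_add_smul {G F : Type*} [NormedAddCommGroup G] [NormedSpace ℝ G]
    [NormedAddCommGroup F] [NormedSpace ℝ F] {a b : G → F} {T : G → ℝ} (ha : ContDiff ℝ ∞ a)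
    (hb : ContDiff ℝ ∞ b) (hT : ContDiff ℝ ∞ T) : ContDiff ℝ ∞ fun q => a q + T q • b q :=
  ha.add (hT.smul hb)

theorem hasDerivWithinAt_add_smul {F : Type*} [NormedAddCommGroup F] [NormedSpace ℝ F]
    {a b : ℝ → F} {a' b' : F} {s : Set ℝ} {t : ℝ} (ha : HasDerivWithinAt a a' s t)
    (hb : HasDerivWithinAt b b' s t) :
    HasDerivWithinAt (fun t => a t + t • b t) (a' + (t • b' + b t)) s t := by
  have := ha.add ((hasDerivWithinAt_id t s).smul hb)
  rwa [one_smul] at this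

/-- As `W₁` vanishes at `p`, the whole family stays near the invertible `W₀ p`. The bound `2` on the
parameter is that of the clamp in `exists_smooth_clamp`, and it explains `ε / 4`. -/
theorem exists_isInvertible_near [CompleteSpace E] {F : Type*} [NormedAddCommGroup F]
    [NormedSpace ℝ F] {W₀ W₁ : E → E →L[ℝ] F} {p : E}
    (h₀ : ContinuousAt W₀ p)
    (h₁ : ContinuousAt W₁ p) (hz : W₁ p = 0) (hinv : (W₀ p).IsInvertible) :
    ∃ δ > 0, ∀ t : ℝ, |t| ≤ 2 → ∀ y ∈ Metric.ball p δ, (W₀ y + t • W₁ y).IsInvertible := by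
  obtain ⟨e, he⟩ := hinv
  have hn := ContinuousLinearEquiv.nhds e
  rw [he] at hn
  obtain ⟨ε, hε, hball⟩ := Metric.mem_nhds_iff.1 hn
  have e₀ := Metric.continuousAt_iff'.1 h₀ (ε / 2) (by positivity)
  have e₁ := Metric.continuousAt_iff'.1 h₁ (ε / 4) (by positivity)
  obtain ⟨δ, hδ, hb⟩ := Metric.eventually_nhds_iff_ball.1 (e₀.and e₁)
  refine ⟨δ, hδ, fun t ht y hy => hball ?_⟩
  obtain ⟨b₀, b₁⟩ := hb y hy
  rw [dist_eq_norm] at b₀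
  rw [hz, dist_zero_right] at b₁
  rw [Metric.mem_ball, dist_eq_norm, add_sub_right_comm]
  refine (norm_add_le _ _).trans_lt ?_
  rw [norm_smul, Real.norm_eq_abs]
  have : |t| * ‖W₁ y‖ ≤ 2 * (ε / 4) := mul_le_mul ht b₁.le (norm_nonneg _) (by norm_num)
  linarith

/-- A smooth map into a given ball that is the identity near its centre. -/
theorem exists_smooth_retraction [HasContDiffBump E] (p : E) {δ : ℝ} (hδ : 0 < δ) :
    ∃ Y : E → E, ContDiff ℝ ∞ Y ∧ (∀ x, Y x ∈ Metric.ball p δ) ∧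
      ∀ x ∈ Metric.ball p (δ / 2), Y x = x := by
  let χ : ContDiffBump p := ⟨δ / 2, δ, by positivity, by linarith⟩
  refine ⟨fun x => p + χ x • (x - p),
    contDiff_const.add (χ.contDiff.smul (contDiff_id.sub contDiff_const)), fun x => ?_,
    fun x hx => ?_⟩
  · rw [Metric.mem_ball, dist_eq_norm, add_sub_cancel_left, norm_smul, Real.norm_eq_abs,
      abs_of_nonneg χ.nonneg]
    by_cases hx : x ∈ Metric.ball p δ
    · rw [Metric.mem_ball, dist_eq_norm] at hx
      exact (mul_le_of_le_one_left (norm_nonneg _) χ.le_one).trans_lt hx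
    · rw [χ.zero_of_le_dist (by simpa using hx), zero_mul]
      exact hδ
  · simp only
    rw [χ.one_of_mem_closedBall (Metric.ball_subset_closedBall hx), one_smul, add_sub_cancel]

/-- Clamping `t`, together with the retraction onto a ball, makes Moser's field smooth on all of `ℝ
× E` without changing it for `t ∈ [0, 1]` near `p`. -/
theorem exists_smooth_clamp : ∃ T : ℝ → ℝ, ContDiff ℝ ∞ T ∧ (∀ t, |T t| ≤ 2) ∧
    ∀ t ∈ Icc (0 : ℝ) 1, T t = t := by
  let χ : ContDiffBump (0 : ℝ) := ⟨1, 2, by norm_num, by norm_num⟩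
  refine ⟨fun t => χ t * t, χ.contDiff.mul contDiff_id, fun t => ?_, fun t ht => ?_⟩
  · rw [abs_mul, abs_of_nonneg χ.nonneg]
    by_cases hx : |t| ≤ 2
    · exact (mul_le_of_le_one_left (abs_nonneg _) χ.le_one).trans hx
    · rw [χ.zero_of_le_dist (by rw [Real.dist_eq, sub_zero]; exact (not_le.1 hx).le), zero_mul]
      norm_num
  · simp only
    rw [χ.one_of_mem_closedBall (by
      rw [Metric.mem_closedBall, Real.dist_eq, sub_zero, abs_of_nonneg ht.1]; exact ht.2), one_mul]

/-- The vector field of Moser's argument. -/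
theorem exists_moser_field [CompleteSpace E] [HasContDiffBump E] {α σ : E → E →L[ℝ] ℝ}
    (hα : ContDiff ℝ ∞ α) (hσ : ContDiff ℝ ∞ σ) {p : E} (h0 : σ p = 0) (h1 : fderiv ℝ σ p = 0)
    (hinv : (extDer α p).IsInvertible) :
    ∃ (X : ℝ × E → E) (ε : ℝ), 0 < ε ∧ ContDiff ℝ ∞ X ∧ (∀ t, X (t, p) = 0) ∧
      (∀ t v, fderiv ℝ X (t, p) (0, v) = 0) ∧ ∀ t ∈ Icc (0 : ℝ) 1, ∀ y ∈ Metric.ball p ε,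
        (extDer α y + t • extDer σ y) (X (t, y)) = -σ y := by
  have hα' := contDiff_extDer hα
  have hσ' := contDiff_extDer hσ
  obtain ⟨δ, hδ, hI⟩ := exists_isInvertible_near (W₀ := extDer α) (W₁ := extDer σ) (p := p)
    hα'.continuous.continuousAt hσ'.continuous.continuousAt
    (by ext v w; simp [extDer_apply, h1]) hinv
  obtain ⟨Y, hY, hYb, hYe⟩ := exists_smooth_retraction p hδ
  obtain ⟨T, hT, hTb, hTe⟩ := exists_smooth_clamp
  set W : ℝ × E → E →L[ℝ] E →L[ℝ] ℝ := fun q => extDer α (Y q.2) + T q.1 • extDer σ (Y q.2) with hW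
  have hWs : ContDiff ℝ ∞ W := contDiff_add_smul (hα'.comp (hY.comp contDiff_snd))
    (hσ'.comp (hY.comp contDiff_snd)) (hT.comp contDiff_fst)
  have hWi : ∀ q, (W q).IsInvertible := fun q => hI _ (hTb _) _ (hYb _)
  set A : ℝ × E → (E →L[ℝ] ℝ) →L[ℝ] E := fun q => (W q).inverse with hA
  have hAs : ContDiff ℝ ∞ A := contDiff_iff_contDiffAt.2 fun q =>
    (hWi q).contDiffAt_map_inverse.comp q hWs.contDiffAt
  refine ⟨fun q => -A q (σ q.2), δ / 2, by positivity,
    (hAs.clm_apply (hσ.comp contDiff_snd)).neg, fun t => ?_, fun t v => ?_, fun t ht y hy => ?_⟩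
  · simp only [h0, map_zero, neg_zero]
  -- By the product rule the derivative of `-A σ` at `p` involves only `σ p` and the derivative of
  -- `σ` at `p`, both zero.
  · have hs : HasFDerivAt (fun q : ℝ × E => σ q.2)
        ((fderiv ℝ σ p).comp (ContinuousLinearMap.snd ℝ ℝ E)) (t, p) :=
      HasFDerivAt.comp (t, p) (hσ.differentiable (by simp) p).hasFDerivAt hasFDerivAt_snd
    have hd := (((hAs.differentiable (by simp) (t, p)).hasFDerivAt).clm_apply hs).neg
    have hd' : fderiv ℝ (fun q => -A q (σ q.2)) (t, p) = _ := hd.fderiv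
    rw [hd']
    simp [h0, h1]
  · have hWe : W (t, y) = extDer α y + t • extDer σ y := by
      simp only [hW, hYe y hy, hTe t ht]
    rw [← hWe, map_neg, hA]
    simp only
    rw [(hWi _).self_apply_inverse]

/-- A 2-form that is moved along its Moser field is constant. -/
theorem hasDerivWithinAt_moser {α σ : E → E →L[ℝ] ℝ} (hα : ContDiff ℝ ∞ α) (hσ : ContDiff ℝ ∞ σ)
    {X : ℝ × E → E} {t : ℝ} {γ η ζ : ℝ → E} (hX : DifferentiableAt ℝ X (t, γ t))
    (h : ∀ᶠ y' in nhds (γ t), (extDer α y' + t • extDer σ y') (X (t, y')) = -σ y') {s : Set ℝ}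
    (hγ : HasDerivWithinAt γ (X (t, γ t)) s t)
    (hη : HasDerivWithinAt η (fderiv ℝ X (t, γ t) (0, η t)) s t)
    (hζ : HasDerivWithinAt ζ (fderiv ℝ X (t, γ t) (0, ζ t)) s t) :
    HasDerivWithinAt (fun t => (extDer α (γ t) + t • extDer σ (γ t)) (η t) (ζ t)) 0 s t := by
  have hα' := ((contDiff_extDer hα).differentiable (by simp) (γ t)).hasFDerivAt
  have hσ' := ((contDiff_extDer hσ).differentiable (by simp) (γ t)).hasFDerivAt
  have h1 := hasDerivWithinAt_add_smul (hα'.comp_hasDerivWithinAt t hγ)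
    (hσ'.comp_hasDerivWithinAt t hγ)
  refine ((h1.clm_apply hη).clm_apply hζ).congr_deriv ?_
  have key := moser_identity hα hσ hX h (η t) (ζ t)
  simp only [add_apply, smul_apply, smul_eq_mul, Function.comp_apply] at key ⊢
  linarith

/-- Two symplectic forms with the same value at a point and potentials that agree to first
order are locally isomorphic. -/
theorem exists_moser [CompleteSpace E] [HasContDiffBump E] {α σ : E → E →L[ℝ] ℝ}
    (hα : ContDiff ℝ ∞ α) (hσ : ContDiff ℝ ∞ σ) {p : E} (h0 : σ p = 0) (h1 : fderiv ℝ σ p = 0)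
    (hinv : (extDer α p).IsInvertible) :
    ∃ r > 0, ∃ ψ : E → E, ContDiffOn ℝ ∞ ψ (Metric.ball p r) ∧ ψ p = p ∧
      ∀ x ∈ Metric.ball p r, ∀ v w, extDer (α + σ) (ψ x) (fderiv ℝ ψ x v) (fderiv ℝ ψ x w) =
        extDer α x v w := by
  obtain ⟨X, ε, hε, hX, hX0, hX1, hXσ⟩ := exists_moser_field hα hσ h0 h1 hinv
  obtain ⟨r₀, hr₀, Ψ, hΨ, hΨp, hΨe⟩ := exists_smooth_flow hX hX0 hX1
  have hcont : ContinuousAt Ψ p :=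
    hΨ.continuousOn.continuousAt (Metric.isOpen_ball.mem_nhds (Metric.mem_ball_self hr₀))
  have hev := Metric.continuousAt_iff'.1 hcont ε hε
  obtain ⟨r₁, hr₁, hb⟩ := Metric.eventually_nhds_iff_ball.1 hev
  have hev1 : ∀ γ : C(unitInterval, E), γ 1 = ContinuousMap.evalCLM ℝ (1 : unitInterval) γ :=
    fun γ => rfl
  refine ⟨min r₀ r₁, lt_min hr₀ hr₁, fun x => Ψ x 1, ?_, by simp [hΨp], ?_⟩
  · simp only [hev1]
    exact (ContinuousLinearMap.contDiff _).comp_contDiffOn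
      (hΨ.mono (Metric.ball_subset_ball (min_le_left _ _)))
  intro x hx v w
  have hx0 : x ∈ Metric.ball p r₀ := Metric.ball_subset_ball (min_le_left _ _) hx
  have hx1 : x ∈ Metric.ball p r₁ := Metric.ball_subset_ball (min_le_right _ _) hx
  have hd : HasFDerivAt Ψ (fderiv ℝ Ψ x) x :=
    ((hΨ.contDiffAt (Metric.isOpen_ball.mem_nhds hx0)).differentiableAt (by simp)).hasFDerivAt
  have hψ : ∀ v, fderiv ℝ (fun x => Ψ x 1) x v = fderiv ℝ Ψ x v 1 := by
    intro v
    have h2 := ((ContinuousMap.evalCLM ℝ (1 : unitInterval)).hasFDerivAt (x := Ψ x)).comp x hd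
    have h3 : fderiv ℝ (fun x => Ψ x 1) x =
      (ContinuousMap.evalCLM ℝ (1 : unitInterval)).comp (fderiv ℝ Ψ x) := h2.fderiv
    rw [h3]
    rfl
  have hball : ∀ t, Ψ x t ∈ Metric.ball p ε := fun t => by
    have h2 := hb x hx1
    rw [hΨp] at h2
    exact (ContinuousMap.dist_apply_le_dist t).trans_lt h2
  set γ := Ψ x with hγ
  set η := fderiv ℝ Ψ x v with hη
  set ζ := fderiv ℝ Ψ x w with hζ
  have hη' := fderiv_flow hX hΨ hΨe hx0 v
  have hζ' := fderiv_flow hX hΨ hΨe hx0 w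
  have hγ' := hΨe x hx0
  rw [← hη] at hη'
  rw [← hζ] at hζ'
  rw [← hγ] at hγ' hη' hζ'
  set P : ℝ → unitInterval := projIcc 0 1 zero_le_one with hP
  have hPc : Continuous P := continuous_projIcc
  -- The form `dα + t dσ`, evaluated along the curve on two solutions of the variational equation,
  -- is constant in `t`. The values at `0` and `1` are the two sides of the claim.
  have hconst := constant_of_has_deriv_right_zero (a := (0 : ℝ)) (b := 1)
    (f := fun t => (extDer α (γ (P t)) + t • extDer σ (γ (P t))) (η (P t)) (ζ (P t))) ?_ ?_ 1
    (right_mem_Icc.2 zero_le_one)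
  · have hP1 : P 1 = 1 := projIcc_right _
    have hP0 : P 0 = 0 := projIcc_left _
    simp only [hP1, hP0, add_apply, smul_apply, one_smul, zero_smul, add_zero] at hconst
    have hγ0 : γ 0 = x := by
      rw [hγ', ContinuousMap.add_apply, primitiveCLM_apply]; simp
    have hη0 : η 0 = v := by
      rw [hη', ContinuousMap.add_apply, primitiveCLM_apply]; simp
    have hζ0 : ζ 0 = w := by
      rw [hζ', ContinuousMap.add_apply, primitiveCLM_apply]; simp
    rw [hγ0, hη0, hζ0] at hconst
    rw [hψ, hψ, extDer_add hα hσ, add_apply, add_apply]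
    exact hconst
  · have c1 := (contDiff_extDer hα).continuous
    have c2 := (contDiff_extDer hσ).continuous
    have c3 := γ.continuous.comp hPc
    have c4 : ∀ {β : E → E →L[ℝ] E →L[ℝ] ℝ}, Continuous β →
        Continuous fun t => β (γ (P t)) (η (P t)) (ζ (P t)) := fun hβ =>
      ((hβ.comp c3).clm_apply (η.continuous.comp hPc)).clm_apply (ζ.continuous.comp hPc)
    simp only [add_apply, smul_apply]
    exact ((c4 c1).add (continuous_id.smul (c4 c2))).continuousOn
  · intro t ht
    have hPt : (P t : ℝ) = t := by
      rw [hP, projIcc_of_mem _ (Ico_subset_Icc_self ht)]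
    refine hasDerivWithinAt_moser (X := X) (γ := fun t => γ (P t)) (η := fun t => η (P t))
      (ζ := fun t => ζ (P t)) hα hσ (hX.differentiable (by simp) _) ?_ ?_ ?_ ?_
    · filter_upwards [Metric.isOpen_ball.mem_nhds (hball (P t))] with y hy
      exact hXσ t (Ico_subset_Icc_self ht) y hy
    · have h2 := hasDerivWithinAt_of_primitive (fun t => congrArg (fun γ => γ t) hγ') ht
      refine h2.congr_deriv ?_
      change X ((P t : ℝ), γ (P t)) = X (t, γ (P t))
      rw [hPt]
    · have h2 := hasDerivWithinAt_of_primitive (fun t => congrArg (fun γ => γ t) hη') ht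
      refine h2.congr_deriv ?_
      change fderiv ℝ X ((P t : ℝ), γ (P t)) (0, η (P t)) = fderiv ℝ X (t, γ (P t)) (0, η (P t))
      rw [hPt]
    · have h2 := hasDerivWithinAt_of_primitive (fun t => congrArg (fun γ => γ t) hζ') ht
      refine h2.congr_deriv ?_
      change fderiv ℝ X ((P t : ℝ), γ (P t)) (0, ζ (P t)) = fderiv ℝ X (t, γ (P t)) (0, ζ (P t))
      rw [hPt]

end MoserFlow

/-! ### Linear symplectic equivalence -/

section LinearSymplectic

/-- A nondegenerate alternating form splits off a hyperbolic plane. -/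
theorem exists_hyperbolic_splitting {V : Type} [AddCommGroup V] [Module ℝ V]
    (B : V →ₗ[ℝ] V →ₗ[ℝ] ℝ) (halt : ∀ v, B v v = 0) (hnd : ∀ v, (∀ w, B v w = 0) → v = 0)
    [Nontrivial V] :
    ∃ (K : Submodule ℝ V) (e : ((ℝ × ℝ) × K) ≃ₗ[ℝ] V),
      (∀ a b, B (e a) (e b) = a.1.1 * b.1.2 - a.1.2 * b.1.1 + B a.2 b.2) ∧
      ∀ k : K, (∀ k' : K, B k k' = 0) → k = 0 := by
  have hsk : ∀ x y, B x y = -B y x := fun x y => by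
    have := halt (x + y)
    rw [map_add, map_add, LinearMap.add_apply, LinearMap.add_apply, halt, halt] at this
    linarith
  obtain ⟨v, hv⟩ := exists_ne (0 : V)
  obtain ⟨w₀, hw₀⟩ : ∃ w, B v w ≠ 0 := by
    by_contra! h
    exact hv (hnd v h)
  set w := (B v w₀)⁻¹ • w₀ with hw
  have hvw : B v w = 1 := by rw [hw, map_smul, smul_eq_mul, inv_mul_cancel₀ hw₀]
  have hwv : B w v = -1 := by rw [hsk, hvw]
  -- The orthogonal complement of the hyperbolic plane spanned by `v` and `w`. Nondegeneracy is
  -- inherited because `K` is orthogonal to the plane.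
  set K : Submodule ℝ V := LinearMap.ker (B v) ⊓ LinearMap.ker (B w) with hK
  have hKv : ∀ k : K, B v k = 0 := fun k => k.2.1
  have hKw : ∀ k : K, B w k = 0 := fun k => k.2.2
  have hKv' : ∀ k : K, B k v = 0 := fun k => by rw [hsk, hKv, neg_zero]
  have hKw' : ∀ k : K, B k w = 0 := fun k => by rw [hsk, hKw, neg_zero]
  have hmem : ∀ x, x - B x w • v - B v x • w ∈ K := fun x => by
    refine ⟨?_, ?_⟩ <;>
    simp only [LinearMap.mem_ker, map_sub, map_smul, smul_eq_mul, halt, hvw, hwv, SetLike.mem_coe]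
    · ring
    · rw [hsk w x]; ring
  let e : ((ℝ × ℝ) × K) ≃ₗ[ℝ] V :=
    { toFun := fun a => a.1.1 • v + a.1.2 • w + a.2
      map_add' := fun a b => by
        simp only [Prod.fst_add, Prod.snd_add, add_smul, Submodule.coe_add]; abel
      map_smul' := fun r a => by
        simp only [Prod.smul_fst, Prod.smul_snd, smul_eq_mul, mul_smul, Submodule.coe_smul,
          smul_add, RingHom.id_apply]
      invFun := fun x => ((B x w, B v x), ⟨x - B x w • v - B v x • w, hmem x⟩)
      left_inv := fun a => by
        have h1 : B (a.1.1 • v + a.1.2 • w + a.2) w = a.1.1 := by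
          simp only [map_add, map_smul, LinearMap.add_apply, LinearMap.smul_apply, hvw, halt, hKw',
            smul_eq_mul]; ring
        have h2 : B v (a.1.1 • v + a.1.2 • w + a.2) = a.1.2 := by
          simp only [map_add, map_smul, hvw, halt, hKv, smul_eq_mul]; ring
        refine Prod.ext (Prod.ext h1 h2) (Subtype.ext ?_)
        simp only [h1, h2]
        abel
      right_inv := fun x => by simp only; abel }
  refine ⟨K, e, fun a b => ?_, fun k hk => Subtype.ext (hnd _ fun x => ?_)⟩
  · change B (a.1.1 • v + a.1.2 • w + a.2) (b.1.1 • v + b.1.2 • w + b.2) = _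
    simp only [map_add, map_smul, LinearMap.add_apply, LinearMap.smul_apply, hvw, hwv, halt, hKw', hKv', hKv, hKw,
      smul_eq_mul]
    ring
  · have h1 := hk ⟨_, hmem x⟩
    simp only [map_sub, map_smul, hKv', hKw', smul_zero, sub_zero] at h1
    exact h1

/-- Nondegenerate alternating forms on spaces of the same dimension are equivalent. -/
theorem exists_equiv_of_alternating (m : ℕ) : ∀ (V W : Type) [AddCommGroup V] [Module ℝ V]
    [AddCommGroup W] [Module ℝ W] [FiniteDimensional ℝ V] [FiniteDimensional ℝ W]
    (B : V →ₗ[ℝ] V →ₗ[ℝ] ℝ) (B' : W →ₗ[ℝ] W →ₗ[ℝ] ℝ),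
    Module.finrank ℝ V = m → Module.finrank ℝ W = m → (∀ v, B v v = 0) → (∀ v, B' v v = 0) →
    (∀ v, (∀ w, B v w = 0) → v = 0) → (∀ v, (∀ w, B' v w = 0) → v = 0) →
    ∃ L : V ≃ₗ[ℝ] W, ∀ x y, B' (L x) (L y) = B x y := by
  induction m using Nat.strong_induction_on with
  | _ m ih =>
    intro V W _ _ _ _ _ _ B B' hV hW ha ha' hn hn'
    rcases Nat.eq_zero_or_pos m with rfl | hm
    · have := Module.finrank_zero_iff.1 hV
      have := Module.finrank_zero_iff.1 hW
      exact ⟨LinearEquiv.ofFinrankEq V W (hV.trans hW.symm), fun x y => by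
        rw [Subsingleton.elim x 0]; simp⟩
    · have : Nontrivial V := Module.nontrivial_of_finrank_pos (R := ℝ) (by omega)
      have : Nontrivial W := Module.nontrivial_of_finrank_pos (R := ℝ) (by omega)
      obtain ⟨K, e, he, hK⟩ := exists_hyperbolic_splitting B ha hn
      obtain ⟨K', e', he', hK'⟩ := exists_hyperbolic_splitting B' ha' hn'
      have hf := e.finrank_eq
      have hf' := e'.finrank_eq
      rw [Module.finrank_prod, Module.finrank_prod, Module.finrank_self] at hf hf'
      obtain ⟨L, hL⟩ := ih (Module.finrank ℝ K) (by omega) K K' (B.domRestrict₁₂ K K)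
        (B'.domRestrict₁₂ K' K') rfl (by omega) (fun v => ha v) (fun v => ha' v) hK hK'
      refine ⟨e.symm.trans (((LinearEquiv.refl ℝ (ℝ × ℝ)).prodCongr L).trans e'), fun x y => ?_⟩
      have hx : B x y = B (e (e.symm x)) (e (e.symm y)) := by
        rw [e.apply_symm_apply, e.apply_symm_apply]
      rw [hx, he]
      simp only [LinearEquiv.trans_apply]
      rw [he']
      exact congrArg _ (hL (e.symm x).2 (e.symm y).2)

end LinearSymplectic

/-! ### Darboux's theorem -/

section Darboux

variable {E : Type} [NormedAddCommGroup E] [NormedSpace ℝ E]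

theorem isInvertible_of_nondegenerate [FiniteDimensional ℝ E] {T : E →L[ℝ] E →L[ℝ] ℝ}
    (h : ∀ v, (∀ w, T v w = 0) → v = 0) : T.IsInvertible := by
  have hinj : Function.Injective (T : E →ₗ[ℝ] E →L[ℝ] ℝ) :=
    (injective_iff_map_eq_zero _).2 fun v hv => h v fun w =>
      congrArg (fun L : E →L[ℝ] ℝ => L w) hv
  have hfin : Module.finrank ℝ E = Module.finrank ℝ (E →L[ℝ] ℝ) := by
    rw [← (LinearMap.toContinuousLinearMap (𝕜 := ℝ) (E := E) (F' := ℝ)).finrank_eq]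
    exact (Subspace.dual_finrank_eq (K := ℝ) (V := E)).symm
  refine ⟨(LinearEquiv.ofInjectiveOfFinrankEq (T : E →ₗ[ℝ] E →L[ℝ] ℝ) hinj
    hfin).toContinuousLinearEquiv, ?_⟩
  ext v w
  rfl

/-- A bilinear form in terms of linear maps. -/
def toBilin (T : E →L[ℝ] E →L[ℝ] ℝ) : E →ₗ[ℝ] E →ₗ[ℝ] ℝ :=
  LinearMap.mk₂ ℝ (fun v w => T v w) (by simp) (by simp) (by simp) (by simp)

theorem exists_linear_symplectic [FiniteDimensional ℝ E] {α β : E → E →L[ℝ] ℝ} {p q : E}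
    (hα : ∀ v, (∀ w, extDer α p v w = 0) → v = 0) (hβ : ∀ v, (∀ w, extDer β q v w = 0) → v = 0) :
    ∃ L : E →L[ℝ] E, ∀ v w, extDer β q (L v) (L w) = extDer α p v w := by
  obtain ⟨L, hL⟩ := exists_equiv_of_alternating (Module.finrank ℝ E) E E (toBilin (extDer α p))
    (toBilin (extDer β q)) rfl rfl (fun v => sub_self _) (fun v => sub_self _) hα hβ
  exact ⟨(L : E →ₗ[ℝ] E).toContinuousLinearMap, hL⟩

theorem extDer_eq {α : E → E →L[ℝ] ℝ} {α' : E →L[ℝ] E →L[ℝ] ℝ} {x : E} (h : HasFDerivAt α α' x)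
    (v w : E) : extDer α x v w = α' v w - α' w v := by
  rw [extDer_apply, h.fderiv]

/-- Symplectic forms of the same dimension are locally isomorphic. -/
theorem exists_darboux [FiniteDimensional ℝ E] [HasContDiffBump E] {α β : E → E →L[ℝ] ℝ}
    (hα : ContDiff ℝ ∞ α) (hβ : ContDiff ℝ ∞ β) {p q : E}
    (hαp : ∀ v, (∀ w, extDer α p v w = 0) → v = 0) (hβq : ∀ v, (∀ w, extDer β q v w = 0) → v = 0) :
    ∃ r > 0, ∃ f : E → E, ContDiffOn ℝ ∞ f (Metric.ball p r) ∧ f p = q ∧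
      Set.InjOn f (Metric.ball p r) ∧
      ∀ x ∈ Metric.ball p r, ∀ v w, extDer β (f x) (fderiv ℝ f x v) (fderiv ℝ f x w) =
        extDer α x v w := by
  have : CompleteSpace E := FiniteDimensional.complete ℝ E
  obtain ⟨L, hL⟩ := exists_linear_symplectic hαp hβq
  set a : E → E := fun x => q + L (x - p) with ha
  have had : ∀ x, HasFDerivAt a L x := fun x =>
    (L.hasFDerivAt.comp x ((hasFDerivAt_id x).sub_const p)).const_add q
  have has : ContDiff ℝ ∞ a :=
    contDiff_const.add (L.contDiff.comp (contDiff_id.sub contDiff_const))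
  have hap : a p = q := by simp [ha]
  set Lt : (E →L[ℝ] ℝ) →L[ℝ] (E →L[ℝ] ℝ) := (ContinuousLinearMap.compL ℝ E E ℝ).flip L with hLt
  -- The pull-back of `β` along the affine map `a`; its exterior derivative agrees with that of `α`
  -- at `p`.
  set β' : E → E →L[ℝ] ℝ := fun x => Lt (β (a x)) with hβ'
  have hβs : ContDiff ℝ ∞ β' := Lt.contDiff.comp (hβ.comp has)
  have hβd : ∀ x, HasFDerivAt β' (Lt.comp ((fderiv ℝ β (a x)).comp L)) x := fun x =>
    Lt.hasFDerivAt.comp x ((hβ.differentiable (by simp) (a x)).hasFDerivAt.comp x (had x))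
  have hβe : ∀ x v w, extDer β' x v w = extDer β (a x) (L v) (L w) := fun x v w =>
    extDer_eq (hβd x) v w
  set ρ : E → E →L[ℝ] ℝ := fun x => β' x - α x with hρ
  have hρs : ContDiff ℝ ∞ ρ := hβs.sub hα
  have hρd : ∀ x, HasFDerivAt ρ (fderiv ℝ β' x - fderiv ℝ α x) x := fun x =>
    (hβs.differentiable (by simp) x).hasFDerivAt.sub (hα.differentiable (by simp) x).hasFDerivAt
  set D : E →L[ℝ] E →L[ℝ] ℝ := fderiv ℝ β' p - fderiv ℝ α p with hD
  -- Subtract from `β' - α` its first-order Taylor polynomial at `p`. That polynomial is closed,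
  -- because its linear part `D` is symmetric (`hDs`). So `α + σ` still has exterior derivative
  -- `dβ'`, while `σ` vanishes to second order, as Moser's argument requires.
  set σ : E → E →L[ℝ] ℝ := fun x => ρ x - ρ p - D (x - p) with hσ
  have hσs : ContDiff ℝ ∞ σ := (hρs.sub contDiff_const).sub
    (D.contDiff.comp (contDiff_id.sub contDiff_const))
  have hσd : ∀ x, HasFDerivAt σ (fderiv ℝ β' x - fderiv ℝ α x - D) x := fun x =>
    ((hρd x).sub_const (ρ p)).sub (D.hasFDerivAt.comp x ((hasFDerivAt_id x).sub_const p))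
  have hDs : ∀ v w, D v w - D w v = 0 := fun v w => by
    have h1 := hβe p v w
    rw [hap, hL, extDer_apply, extDer_apply] at h1
    simp only [hD, sub_apply]
    linarith
  have hsum : ∀ x v w, extDer (α + σ) x v w = extDer β (a x) (L v) (L w) := fun x v w => by
    rw [extDer_eq ((hα.differentiable (by simp) x).hasFDerivAt.add (hσd x)), ← hβe, extDer_apply]
    have h1 := hDs v w
    simp only [add_apply, sub_apply] at h1 ⊢
    linarith
  obtain ⟨r, hr, ψ, hψ, hψp, hψe⟩ := exists_moser hα hσs (p := p) (by simp [hσ])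
    (by rw [(hσd p).fderiv]; ext v w; simp [hD]) (isInvertible_of_nondegenerate hαp)
  have hψd : ∀ x ∈ Metric.ball p r, HasFDerivAt ψ (fderiv ℝ ψ x) x := fun x hx =>
    ((hψ.contDiffAt (Metric.isOpen_ball.mem_nhds hx)).differentiableAt (by simp)).hasFDerivAt
  have hfs : ContDiffOn ℝ ∞ (a ∘ ψ) (Metric.ball p r) := has.comp_contDiffOn hψ
  have hfe : ∀ x ∈ Metric.ball p r, ∀ v w,
      extDer β ((a ∘ ψ) x) (fderiv ℝ (a ∘ ψ) x v) (fderiv ℝ (a ∘ ψ) x w) = extDer α x v w := by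
    intro x hx v w
    rw [((had (ψ x)).comp x (hψd x hx)).fderiv, ← hψe x hx v w, hsum]
    rfl
  have hpr := Metric.mem_ball_self (x := p) hr
  have hstrict : HasStrictFDerivAt (a ∘ ψ) (fderiv ℝ (a ∘ ψ) p) p :=
    (hfs.contDiffAt (Metric.isOpen_ball.mem_nhds hpr)).hasStrictFDerivAt (by simp)
  -- A linear map that pulls some form back to a nondegenerate form is injective. The inverse
  -- function theorem then gives injectivity of the map near `p`.
  have hinj : Function.Injective (fderiv ℝ (a ∘ ψ) p : E →ₗ[ℝ] E) :=
    (injective_iff_map_eq_zero _).2 fun v hv => hαp v fun w => by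
      have hv' : fderiv ℝ (a ∘ ψ) p v = 0 := hv
      rw [← hfe p hpr, hv', map_zero]
      rfl
  set e : E ≃L[ℝ] E := (LinearEquiv.ofInjectiveEndo _ hinj).toContinuousLinearEquiv with he
  have hee : (e : E →L[ℝ] E) = fderiv ℝ (a ∘ ψ) p := by ext v; rfl
  rw [← hee] at hstrict
  have hnh := (hstrict.toOpenPartialHomeomorph (a ∘ ψ)).open_source.mem_nhds
    hstrict.mem_toOpenPartialHomeomorph_source
  obtain ⟨r', hr', hb⟩ := Metric.mem_nhds_iff.1 hnh
  refine ⟨min r r', lt_min hr hr', a ∘ ψ,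
    hfs.mono (Metric.ball_subset_ball (min_le_left _ _)), by simp [hψp, hap], ?_,
    fun x hx => hfe x (Metric.ball_subset_ball (min_le_left _ _) hx)⟩
  exact (hstrict.toOpenPartialHomeomorph (a ∘ ψ)).injOn.mono
    ((Metric.ball_subset_ball (min_le_right _ _)).trans hb)

end Darboux

/-! ### Local equivalence of nondegenerate brackets -/

section LocalEquivalence

open PowerSeries (coeff)
open JetRing

variable {n : ℕ} {U V : Opens (Coord n)}

theorem hasFDerivAt_sum_smul {E F ι : Type*} [Fintype ι] [NormedAddCommGroup E] [NormedSpace ℝ E]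
    [NormedAddCommGroup F] [NormedSpace ℝ F] {g : ι → E → ℝ} {c : ι → F} {x : E}
    (hg : ∀ i, DifferentiableAt ℝ (g i) x) :
    HasFDerivAt (fun x => ∑ i, g i x • c i) (∑ i, (fderiv ℝ (g i) x).smulRight (c i)) x :=
  HasFDerivAt.fun_sum fun i _ => (hg i).hasFDerivAt.smul_const (c i)

theorem fderiv_form_apply (θ : Fin n → Smooth U) (u : U) (v w : Coord n) :
    fderiv ℝ (fun x => ∑ i, zeroExt (θ i).1 x • (EuclideanSpace.proj i : Coord n →L[ℝ] ℝ)) u v w =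
      ∑ l, ∑ k, v k * w l * (pd k (θ l)).1 u := by
  have h : HasFDerivAt
      (fun x => ∑ i, zeroExt (θ i).1 x • (EuclideanSpace.proj i : Coord n →L[ℝ] ℝ))
      (∑ i, (fderiv ℝ (zeroExt (θ i).1) u).smulRight
        (EuclideanSpace.proj i : Coord n →L[ℝ] ℝ)) u :=
    hasFDerivAt_sum_smul fun i => Smooth.differentiableAt (θ i) u
  rw [h.fderiv, sum_apply, sum_apply]
  refine Finset.sum_congr rfl fun l _ => ?_
  rw [ContinuousLinearMap.smulRight_apply, smul_apply, fderiv_zeroExt_apply, smul_eq_mul,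
    Finset.sum_mul]
  refine Finset.sum_congr rfl fun k _ => ?_
  rw [PiLp.proj_apply]
  ring

theorem curl_apply_val (θ : Fin n → Smooth U) (i j : Fin n) (u : U) :
    (curl θ i j).1 u = (pd j (θ i)).1 u - (pd i (θ j)).1 u := rfl

/-- A 1-form on an open set agrees near a given point with a form that is smooth everywhere. -/
theorem exists_form_near (θ : Fin n → Smooth U) (p : U) :
    ∃ ρ > 0, ∃ hρ : openBall (p : Coord n) ρ ≤ U, ∃ α : Coord n → Coord n →L[ℝ] ℝ, ContDiff ℝ ∞ α ∧
      ∀ (x : openBall (p : Coord n) ρ) v w,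
        extDer α x v w = ∑ l, ∑ k, v k * w l * (curl θ l k).1 ⟨x, hρ x.2⟩ := by
  obtain ⟨R, hR, hRU⟩ := Metric.isOpen_iff.1 U.isOpen p p.2
  set α₀ : Coord n → Coord n →L[ℝ] ℝ :=
    fun x => ∑ i, zeroExt (θ i).1 x • (EuclideanSpace.proj i : Coord n →L[ℝ] ℝ) with hα₀
  have hs : ContDiffOn ℝ ∞ α₀ (Metric.ball (p : Coord n) R) :=
    ContDiffOn.sum fun i _ => ((θ i).2.mono hRU).smul contDiffOn_const
  obtain ⟨α, hα, he⟩ := exists_contDiff_eqOn_ball (half_lt_self hR) hs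
  have hρ : openBall (p : Coord n) (R / 2) ≤ U :=
    fun x hx => hRU (Metric.ball_subset_ball (half_le_self hR.le) hx)
  refine ⟨R / 2, by positivity, hρ, α, hα, fun x v w => ?_⟩
  have hev : α =ᶠ[nhds (x : Coord n)] α₀ :=
    Filter.mem_of_superset (Metric.isOpen_ball.mem_nhds x.2) he
  have h1 := fun v w => fderiv_form_apply θ ⟨x, hρ x.2⟩ v w
  rw [extDer_apply, hev.fderiv_eq, h1, h1, Finset.sum_comm (f := fun l k => w k * v l * _),
    ← Finset.sum_sub_distrib]
  refine Finset.sum_congr rfl fun l _ => ?_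
  rw [← Finset.sum_sub_distrib]
  refine Finset.sum_congr rfl fun k _ => ?_
  rw [curl_apply_val]
  ring

/-- The value at a point, as a ring homomorphism. -/
def evalHom (u : U) : Smooth U →+* ℝ := (Pi.evalRingHom (fun _ => ℝ) u).comp (Smooth U).val.toRingHom

/-- Testing with basis vectors shows that the matrix of the form at `u` annihilates `v`, and this
matrix has the value of `H` as an inverse. -/
theorem nondegenerate_of_curl {θ : Fin n → Smooth U} {H : Matrix (Fin n) (Fin n) (Smooth U)}
    (h : curl θ * H = 1) (u : U) (v : Coord n)
    (hv : ∀ w : Coord n, ∑ l, ∑ k, v k * w l * (curl θ l k).1 u = 0) : v = 0 := by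
  have h1 : (evalHom u).mapMatrix H * (evalHom u).mapMatrix (curl θ) = 1 := by
    rw [← map_mul, mul_eq_one_comm.1 h, map_one]
  have h2 : ((evalHom u).mapMatrix (curl θ)).mulVec v.ofLp = 0 := by
    funext l
    have h3 := hv (EuclideanSpace.single l 1)
    rw [Finset.sum_eq_single l] at h3
    · rw [Pi.zero_apply, ← h3, Matrix.mulVec, dotProduct]
      refine Finset.sum_congr rfl fun k _ => ?_
      rw [PiLp.single_apply, if_pos rfl, mul_one, mul_comm]
      rfl
    · intro l' _ hl'
      refine Finset.sum_eq_zero fun k _ => ?_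
      rw [PiLp.single_apply, if_neg hl', mul_zero, zero_mul]
    · exact fun h => absurd (Finset.mem_univ l) h
  have h3 := congrArg ((evalHom u).mapMatrix H).mulVec h2
  rw [Matrix.mulVec_mulVec, h1, Matrix.one_mulVec, Matrix.mulVec_zero] at h3
  exact PiLp.ext fun i => congrFun h3 i

theorem det_ne_zero_of_isUnit {M : Matrix (Fin n) (Fin n) (Smooth U)} (h : IsUnit M) (u : U) :
    (Matrix.of fun i k => (M i k).1 u).det ≠ 0 :=
  ((Matrix.isUnit_iff_isUnit_det _).1 (h.map (evalHom u).mapMatrix)).ne_zero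

/-- Two symplectic forms on open sets are related near given points by a map. -/
theorem exists_leading_term {θA : Fin n → Smooth U} {θB : Fin n → Smooth V}
    {HA : Matrix (Fin n) (Fin n) (Smooth U)} {HB : Matrix (Fin n) (Fin n) (Smooth V)}
    (hA : curl θA * HA = 1) (hB : curl θB * HB = 1) (p : U) (q : V) :
    ∃ (r : ℝ) (hr : 0 < r) (hsub : openBall (p : Coord n) r ≤ U)
      (φ : Fin n → Smooth (openBall (p : Coord n) r)) (hφ : ∀ u, toMap φ u ∈ V),
      toMap φ ⟨p, Metric.mem_ball_self hr⟩ = q ∧ Function.Injective (toMap φ) ∧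
      perturbMatrix φ hφ θB * (Matrix.of fun i k => pd k (φ i)) =
        curl fun i => restrictSmooth hsub (θA i) := by
  obtain ⟨ρA, hρA, hsA, α, hα, hαe⟩ := exists_form_near θA p
  obtain ⟨ρB, hρB, hsB, β, hβ, hβe⟩ := exists_form_near θB q
  obtain ⟨r₀, hr₀, f, hf, hfp, hinj, hfe⟩ := exists_darboux hα hβ (p := (p : Coord n))
    (q := (q : Coord n))
    (fun v hv => nondegenerate_of_curl hA p v fun w => by
      rw [← hv w]; exact (hαe ⟨p, Metric.mem_ball_self hρA⟩ v w).symm)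
    (fun v hv => nondegenerate_of_curl hB q v fun w => by
      rw [← hv w]; exact (hβe ⟨q, Metric.mem_ball_self hρB⟩ v w).symm)
  have hcont : ContinuousAt f p :=
    hf.continuousOn.continuousAt (Metric.isOpen_ball.mem_nhds (Metric.mem_ball_self hr₀))
  obtain ⟨r₁, hr₁, hb⟩ := Metric.eventually_nhds_iff_ball.1 (Metric.continuousAt_iff'.1 hcont ρB hρB)
  set r := min r₀ (min r₁ ρA) with hrdef
  have hr : 0 < r := lt_min hr₀ (lt_min hr₁ hρA)
  have hr0 : Metric.ball (p : Coord n) r ⊆ Metric.ball p r₀ :=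
    Metric.ball_subset_ball (min_le_left _ _)
  have hr1 : Metric.ball (p : Coord n) r ⊆ Metric.ball p r₁ :=
    Metric.ball_subset_ball ((min_le_right _ _).trans (min_le_left _ _))
  have hrA : Metric.ball (p : Coord n) r ⊆ Metric.ball p ρA :=
    Metric.ball_subset_ball ((min_le_right _ _).trans (min_le_right _ _))
  have hfr : ContDiffOn ℝ ∞ f (Metric.ball (p : Coord n) r) := hf.mono hr0
  set φ : Fin n → Smooth (openBall (p : Coord n) r) := fun i => Smooth.ofFun (fun x => f x i)
    (contDiffOn_euclidean.1 hfr i) with hφdef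
  have hφf : ∀ u, toMap φ u = f u := fun u => PiLp.ext fun i => rfl
  have hfB : ∀ u : openBall (p : Coord n) r, f u ∈ openBall (q : Coord n) ρB := fun u => by
    have := hb u (hr1 u.2)
    rwa [hfp] at this
  have hφ : ∀ u, toMap φ u ∈ V := fun u => by rw [hφf]; exact hsB (hfB u)
  have hpd : ∀ k i (u : openBall (p : Coord n) r),
      (pd k (φ i)).1 u = fderiv ℝ f u (EuclideanSpace.single k 1) i := by
    intro k i u
    rw [pd_apply_eq (g := fun x => f x i) (fun u => rfl)]
    have hd : HasFDerivAt f (fderiv ℝ f u) u := ((hfr.contDiffAt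
      (Metric.isOpen_ball.mem_nhds u.2)).differentiableAt (by simp)).hasFDerivAt
    have h2 := ((EuclideanSpace.proj i : Coord n →L[ℝ] ℝ).hasFDerivAt (x := f u)).comp (u : Coord n) hd
    have h3 : fderiv ℝ (fun x => f x i) u = _ := h2.fderiv
    rw [h3]
    rfl
  refine ⟨r, hr, fun x hx => hsA (hrA hx), φ, hφ, by rw [hφf]; exact hfp, fun u v huv => ?_, ?_⟩
  · rw [hφf, hφf] at huv
    exact Subtype.ext (hinj (hr0 u.2) (hr0 v.2) huv)
  · refine Matrix.ext fun k l => Smooth.ext fun u => ?_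
    -- In `curl θ l k` the second index belongs to the first argument of the 2-form, so the entry
    -- `(k, l)` is the value on the basis vectors `l`, `k` in this order.
    have h1 := hfe u (hr0 u.2) (EuclideanSpace.single l 1) (EuclideanSpace.single k 1)
    have h2 := hαe ⟨u, hrA u.2⟩ (EuclideanSpace.single l 1) (EuclideanSpace.single k 1)
    have h3 := hβe ⟨f u, hfB u⟩ (fderiv ℝ f u (EuclideanSpace.single l 1))
      (fderiv ℝ f u (EuclideanSpace.single k 1))
    have hL : ((perturbMatrix φ hφ θB * (Matrix.of fun i k => pd k (φ i))) k l).1 u =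
        ∑ i, ∑ j, (pd l (φ j)).1 u * (pd k (φ i)).1 u *
          (curl θB i j).1 ⟨toMap φ u, hφ u⟩ := by
      have h4 : ((perturbMatrix φ hφ θB * (Matrix.of fun i k => pd k (φ i))) k l) =
          ∑ i, ∑ j, pd l (φ j) * pd k (φ i) * compSmooth φ hφ (curl θB i j) := by
        rw [Matrix.mul_apply, Finset.sum_comm]
        refine Finset.sum_congr rfl fun j _ => ?_
        rw [perturbMatrix, Matrix.mul_apply, Finset.sum_mul]
        refine Finset.sum_congr rfl fun i _ => ?_
        rw [Matrix.of_apply, Matrix.of_apply, mul_right_comm, mul_comm (pd k (φ i))]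
        rfl
      have h5 := congrArg (evalHom u) h4
      simp only [map_sum, map_mul] at h5
      exact h5
    have hR : (curl (fun i => restrictSmooth (fun x hx => hsA (hrA hx)) (θA i)) k l).1 u =
        (curl θA k l).1 ⟨u, hsA (hrA u.2)⟩ := by
      rw [curl_apply_val, curl_apply_val, pd_restrictSmooth, pd_restrictSmooth]
      rfl
    rw [hL, hR]
    have h6 : ∑ l', ∑ k', (EuclideanSpace.single l (1 : ℝ) : Coord n) k' *
        (EuclideanSpace.single k (1 : ℝ) : Coord n) l' *
          (curl θA l' k').1 ⟨u, hsA (hrA u.2)⟩ = (curl θA k l).1 ⟨u, hsA (hrA u.2)⟩ := by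
      simp
    rw [← h6, ← h2, ← h1, h3]
    refine Finset.sum_congr rfl fun i _ => Finset.sum_congr rfl fun j _ => ?_
    rw [hpd, hpd]
    exact congrArg (fun x => _ * (curl θB i j).1 x) (Subtype.ext (hφf u))

/-- Any two nondegenerate brackets are locally equivalent. -/
theorem exists_miura_local {c : Coord n} {R : ℝ} {A B : BivectorData (openBall c R)}
    (hA : IsPQBracket A n 0) (hB : IsPQBracket B n 0) (p q : openBall c R) :
    ∃ (r : ℝ) (hr : 0 < r) (hsub : openBall (p : Coord n) r ≤ openBall c R)
      (T : Miura (openBall (p : Coord n) r) (openBall c R)),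
      T.base ⟨p, Metric.mem_ball_self hr⟩ = q ∧ T.Carries (restrictBivector hsub A) B := by
  obtain ⟨ΘA, hgA, hA1, hA2⟩ := exists_potential hA.poisson hA.det_ne_zero
  obtain ⟨ΘB, hgB, hB1, hB2⟩ := exists_potential hB.poisson hB.det_ne_zero
  have hcA := curl_mul_leading (coeff_zero_eq_C hgA) hA.poisson.bivector.hasDeg hA2
  have hcB := curl_mul_leading (coeff_zero_eq_C hgB) hB.poisson.bivector.hasDeg hB2
  obtain ⟨r, hr, hsub, φ, hφ, hφp, hinj, hsymp⟩ := exists_leading_term hcA hcB p q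
  have hunit : IsUnit (curl fun i => restrictSmooth hsub
      (MvPolynomial.constantCoeff (coeff 0 (ΘA i)))) := by
    have h1 : (curl fun i => restrictSmooth hsub (MvPolynomial.constantCoeff (coeff 0 (ΘA i)))) =
        (restrictSmooth hsub).mapMatrix
          (curl fun i => MvPolynomial.constantCoeff (coeff 0 (ΘA i))) := by
      refine Matrix.ext fun i j => ?_
      simp only [curl, Matrix.of_apply, pd_restrictSmooth, RingHom.mapMatrix_apply, Matrix.map_apply,
        map_sub]
    rw [h1]
    exact RingHom.isUnit_map _ (isUnit_iff_exists.2 ⟨_, hcA, mul_eq_one_comm.1 hcA⟩)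
  -- The Jacobian is a factor of the invertible matrix of the pulled back symplectic form.
  have hJ : IsUnit (Matrix.of fun i k => pd k (φ i)) := by
    rw [← hsymp, Matrix.isUnit_iff_isUnit_det, Matrix.det_mul] at hunit
    exact (Matrix.isUnit_iff_isUnit_det _).2 (isUnit_of_mul_isUnit_right hunit)
  obtain ⟨T, hT, hTC⟩ := exists_miura (A := restrictBivector hsub A)
    (ΘA := fun i => restrictSeries hsub (ΘA i))
    (θA := fun i => restrictSmooth hsub (MvPolynomial.constantCoeff (coeff 0 (ΘA i))))
    (fun i k => by rw [coeff_restrictSeries]; exact (hgA i k).restrictPoly hsub) hgB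
    (fun i => by
      rw [coeff_restrictSeries, coeff_zero_eq_C hgA i, restrictPoly, MvPolynomial.map_C,
        MvPolynomial.constantCoeff_C])
    (coeff_zero_eq_C hgB) (act_opOf_dM_restrict hsub hA1) hB.poisson.bivector.hasDeg hB2 hφ hinj
    (det_ne_zero_of_isUnit hJ) hsymp
  exact ⟨r, hr, hsub, T, Subtype.ext ((hT _).trans hφp), hTC⟩

end LocalEquivalence

end LoopSpace

end

/-! ### The classification theorem -/

theorem mainTheorem8 (n : ℕ) (c : LoopSpace.Coord n) (R : ℝ) (hR : 0 < R) :
    (∀ A B : LoopSpace.BivectorData (LoopSpace.openBall c R),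
      LoopSpace.IsPQBracket A n 0 → LoopSpace.IsPQBracket B n 0 →
      ∀ p q : LoopSpace.openBall c R,
        ∃ (r : ℝ) (hr : 0 < r)
          (hsub : LoopSpace.openBall (p : LoopSpace.Coord n) r ≤ LoopSpace.openBall c R)
          (T : LoopSpace.Miura (LoopSpace.openBall (p : LoopSpace.Coord n) r)
            (LoopSpace.openBall c R)),
          T.base ⟨p, Metric.mem_ball_self hr⟩ = q ∧
          T.Carries (LoopSpace.restrictBivector hsub A) B) ∧
    (∀ (A : LoopSpace.BivectorData (LoopSpace.openBall c R)) (h : Matrix (Fin n) (Fin n) ℝ),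
      LoopSpace.IsPQBracket A n 0 → (∀ u, LoopSpace.hMatrix A u = h) →
      ∃ T : LoopSpace.Miura (LoopSpace.openBall c R) (LoopSpace.openBall c R),
        (∀ u, T.base u = u) ∧
        T.Carries A (LoopSpace.ultralocal (LoopSpace.openBall c R) h)) ∧
    (∀ h : Matrix (Fin n) (Fin n) ℝ, h.transpose = -h → h.det ≠ 0 →
      LoopSpace.VanishingH1 (LoopSpace.openBall c R) h ∧
      LoopSpace.VanishingH2 (LoopSpace.openBall c R) h) := by
  refine ⟨fun A B hA hB p q => LoopSpace.exists_miura_local hA hB p q,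
    fun A h hA hh => LoopSpace.exists_miura_ultralocal hR hA hh,
    fun h hh hdet => ⟨LoopSpace.vanishingH1 hh hdet, LoopSpace.vanishingH2 hh hdet⟩⟩
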